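/- **Discrete process.** Let $\lambda\in(0,1)$ and $\pi\ge 1$. Let $N^S(i),N^M(i),N^P(i)$, $i\in\mathbb Z$, be independent Poisson processes of rates $1,\lambda,\pi$. A $(\lambda,\pi)$-forest fire process (FFP) is a process $(\eta_t(i))_{t\ge0,i\in\mathbb Z}$ with values in $\{0,1,2\}$ (vacant, occupied, burning) such that a.s. every $t\mapsto\eta_t(i)$ is càdlàg and, for all $i\in\mathbb Z$ and $t\ge0$, $$\eta_t(i)=\int_0^t\mathbf 1_{\{\eta_{s-}(i)=0\}}dN^S_s(i)+\int_0^t\mathbf 1_{\{\eta_{s-}(i)=1\}}dN^M_s(i)+\sum_{j=i\pm1}\int_0^t\mathbf 1_{\{\eta_{s-}(j)=2,\ \eta_{s-}(i)=1\}}dN^P_s(j)-2\int_0^t\mathbf 1_{\{\eta_{s-}(i)=2\}}dN^P_s(i).$$ For a configuration $\xi$, let $C(\xi,i)=\emptyset$ if $\xi(i)\ne1$, and otherwise let $C(\xi,i)$ be the integer interval of consecutive occupied sites around $i$. Put $\mathbf a_\lambda=\log(1/\lambda)$ and $\mathbf n_\lambda=\lfloor 1/(\lambda\mathbf a_\lambda)\rfloor$.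 The rescaled cluster of $x\in\mathbb R$ at time $t\ge 0$ is $$D^{\lambda,\pi}_t(x)=\tfrac1{\mathbf n_\lambda}C\big(\eta_{\mathbf a_\lambda t},\lfloor\mathbf n_\lambda x\rfloor\big),$$ where $\frac1n\{l,\dots,r\}$ means the real interval $[l/n,r/n]$. **Limit process.** Let $z_0\in[0,1]$ and let $\pi_M$ be a Poisson measure on $\mathbb R\times[0,\infty)$ with intensity $dx\,dt$. An LFFP$(\infty,z_0)$ is a process $(Y_t(x))_{t\ge0,x\in\mathbb R}$ with values in $\mathbb R_+$ such that a.s., for every $x$, $t\mapsto Y_t(x)$ is càdlàg, for all $t\ge0$ $$Y_t(x)=\int_0^{t\wedge z_0}s\,\pi_M(\{x\}\times ds)-\int_0^t\mathbf 1_{\{Y_s(x)\in(0,1)\}}ds+\mathbf 1_{\{t\ge z_0\}}\pi_M(\{x\}\times[z_0,t]),$$ and $Y_s(x)=1$ for all $s\ge t$ whenever $\pi_M$ has a mark at $(x,t)$ with $t>z_0$. Its cluster at $x$ is $D_t(x)=\{x\}$ if $t<1$ and, if $t\ge1$, $$D_t(x)=\big[\sup\{y\le x:Y_t(y)>0\},\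 \inf\{y\ge x:Y_t(y)>0\}\big].$$ **Distances.** On compact intervals put $\boldsymbol\delta([a,b],[c,d])=|a-c|+|b-d|$. The values of a cluster of $x$ are compared by $\boldsymbol\delta$ with $\emptyset$ identified with $\{x\}$; in particular $\boldsymbol\delta([a,b],\emptyset)=|b-a|$ whenever $x\in[a,b]$. For càdlàg functions $I,J$ on $[0,T]$ with such values, $\boldsymbol\delta_T(I,J)=\int_0^T\boldsymbol\delta(I_t,J_t)\,dt$. A $q$-tuple is given the sum of the distances of its components. **Theorem.** Let $z_0\in[0,1]$. For each $\lambda\in(0,1)$ and $\pi\ge1$ let $D^{\lambda,\pi}$ be associated with a $(\lambda,\pi)$-FFP, and let $D$ be associated with an LFFP$(\infty,z_0)$ $Y$. Let $\lambda\to0$ and $\pi\to\infty$ in the slow regime $\mathcal R(\infty,z_0)$, that is, along the parameters $\lambda\in(0,1)$, $\pi\ge1$ with $$\lambda\to0,\qquad \frac{\mathbf n_\lambda}{\mathbf a_\lambda\pi}\to\infty,\qquad \frac{\log\pi}{\log(1/\lambda)}\to z_0 .$$ 1. For all $T>0$ and $x_1,\dots,x_q\in\mathbb R$, the paths $t\mapsto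 D^{\lambda,\pi}_t(x_i)$ and $t\mapsto D_t(x_i)$ are a.s. càdlàg on $[0,T]$, and $(D^{\lambda,\pi}_t(x_i))_{t\in[0,T],\,i\le q}$ converges in law to $(D_t(x_i))_{t\in[0,T],\,i\le q}$ in the space of $q$-tuples of càdlàg paths endowed with $\boldsymbol\delta_T$. 2. For all $(x_1,t_1),\dots,(x_q,t_q)\in\mathbb R\times[0,\infty)$, $(D^{\lambda,\pi}_{t_i}(x_i))_{i\le q}$ converges in law to $(D_{t_i}(x_i))_{i\le q}$ for the distance $\boldsymbol\delta$. 3. In the limit, fires have only a local effect: a.s., for every mark $(x,s)$ of $\pi_M$ and every $t\ge0$, if $s<z_0$ then $Y_t(x)>0$ if and only if $s\le t<2s$, and if $s>z_0$ then $Y_t(x)>0$ if and only if $t\ge s$. -/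

import Mathlib

open MeasureTheory ProbabilityTheory Filter Topology Set
open scoped NNReal ENNReal

noncomputable section

namespace ForestFire

/-! ### Càdlàg functions -/

/-- Right-continuity and existence of left limits at every point. -/
def IsCadlag {α E : Type*} [LinearOrder α] [TopologicalSpace α] [TopologicalSpace E]
    (f : α → E) : Prop :=
  ∀ t, ContinuousWithinAt f (Ici t) t ∧ ∃ l, Tendsto f (𝓝[<] t) (𝓝 l)

lemma IsCadlag.comp {α E F : Type*} [LinearOrder α] [TopologicalSpace α] [TopologicalSpace E]
    [TopologicalSpace F] {f : α → E} (hf : IsCadlag f) {g : E → F} (hg : Continuous g) :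
    IsCadlag (fun t => g (f t)) := fun t =>
  ⟨hg.continuousAt.comp_continuousWithinAt (hf t).1,
    (hf t).2.imp' g fun _ hl => (hg.tendsto _).comp hl⟩

lemma IsCadlag.bounded {T : ℝ} {f : Icc (0 : ℝ) T → ℝ} (hf : IsCadlag f) :
    ∃ C, ∀ t, |f t| ≤ C := by
  have key : ∃ C, ∀ t ∈ (univ : Set (Icc (0 : ℝ) T)), |f t| ≤ C := by
    refine isCompact_univ.induction_on (p := fun s => ∃ C, ∀ t ∈ s, |f t| ≤ C)
      ⟨0, by simp⟩ (fun s u hsu ⟨C, hC⟩ => ⟨C, fun t ht => hC t (hsu ht)⟩) ?_ ?_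
    · rintro s u ⟨C, hC⟩ ⟨D, hD⟩
      refine ⟨max C D, fun t ht => ?_⟩
      rcases ht with h | h
      · exact (hC t h).trans (le_max_left _ _)
      · exact (hD t h).trans (le_max_right _ _)
    · intro t _
      obtain ⟨hr, l, hl⟩ := hf t
      have h1 : ∀ᶠ s in 𝓝[≥] t, |f s| < |f t| + 1 :=
        hr.abs.eventually (gt_mem_nhds (by simp))
      have h2 : ∀ᶠ s in 𝓝[<] t, |f s| < |l| + 1 :=
        hl.abs.eventually (gt_mem_nhds (by simp))
      have h3 : ∀ᶠ s in 𝓝 t, |f s| ≤ max (|f t| + 1) (|l| + 1) := by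
        rw [← nhdsLT_sup_nhdsGE t]
        refine Filter.eventually_sup.2 ⟨?_, ?_⟩
        · filter_upwards [h2] with s hs using hs.le.trans (le_max_right _ _)
        · filter_upwards [h1] with s hs using hs.le.trans (le_max_left _ _)
      exact ⟨{s | |f s| ≤ max (|f t| + 1) (|l| + 1)}, by
        rw [nhdsWithin_univ]; exact h3, _, fun s hs => hs⟩
  obtain ⟨C, hC⟩ := key
  exact ⟨C, fun t => hC t (mem_univ t)⟩

lemma IsCadlag.measurable {T : ℝ} {f : Icc (0 : ℝ) T → ℝ} (hf : IsCadlag f) :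
    Measurable f := by
  rcases le_or_gt 0 T with hT | hT
  swap
  · have : IsEmpty (Icc (0 : ℝ) T) := ⟨fun t => absurd (t.2.1.trans t.2.2) (not_le.2 hT)⟩
    exact measurable_of_empty f
  let s : ℕ → ℝ → ℝ := fun n t => ((⌊((n : ℝ) + 1) * t⌋ : ℝ) + 1) / ((n : ℝ) + 1)
  have hs1 : ∀ n t, t ≤ s n t := fun n t => by
    have hn : (0 : ℝ) < (n : ℝ) + 1 := by positivity
    rw [le_div_iff₀ hn]
    linarith [(Int.lt_floor_add_one (((n : ℝ) + 1) * t)).le]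
  have hs2 : ∀ n t, s n t ≤ t + 1 / ((n : ℝ) + 1) := fun n t => by
    have hn : (0 : ℝ) < (n : ℝ) + 1 := by positivity
    have h1 : (t + 1 / ((n : ℝ) + 1)) * ((n : ℝ) + 1) = ((n : ℝ) + 1) * t + 1 := by
      field_simp
    rw [div_le_iff₀ hn, h1]
    linarith [Int.floor_le (((n : ℝ) + 1) * t)]
  refine measurable_of_tendsto_metrizable
    (f := fun (n : ℕ) (t : Icc (0 : ℝ) T) => f (projIcc 0 T hT (s n t))) (fun n => ?_) ?_
  · have : (fun t : Icc (0 : ℝ) T => f (projIcc 0 T hT (s n t))) =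
        (fun k : ℤ => f (projIcc 0 T hT (((k : ℝ) + 1) / ((n : ℝ) + 1)))) ∘
          (fun t : Icc (0 : ℝ) T => ⌊((n : ℝ) + 1) * (t : ℝ)⌋) := rfl
    rw [this]
    exact (measurable_from_top).comp
      (Int.measurable_floor.comp (measurable_const.mul measurable_subtype_coe))
  · rw [tendsto_pi_nhds]
    intro t
    refine (hf t).1.tendsto.comp (tendsto_nhdsWithin_iff.2 ⟨?_, Eventually.of_forall fun n => ?_⟩)
    · have h : Tendsto (fun n : ℕ => s n t) atTop (𝓝 (t : ℝ)) := by
        refine tendsto_of_tendsto_of_tendsto_of_le_of_le tendsto_const_nhds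
          (h := fun n : ℕ => (t : ℝ) + 1 / ((n : ℝ) + 1)) ?_ (fun n => hs1 n t) (fun n => hs2 n t)
        simpa using (tendsto_const_nhds (x := (t : ℝ))).add
          (tendsto_one_div_add_atTop_nhds_zero_nat (𝕜 := ℝ))
      have h' := ((continuous_projIcc (h := hT)).tendsto (t : ℝ)).comp h
      rwa [projIcc_val] at h'
    · have := monotone_projIcc hT (hs1 n t)
      rwa [projIcc_val] at this

/-! ### Closed intervals, the empty set, and their distances

`Interval ℝ` is the set of all compact intervals `[a, b]`, `a ≤ b`, together with the empty
interval `⊥`. -/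

/-- The interval `[a, b]`, empty if `b < a`. -/
def mkInterval (a b : ℝ) : Interval ℝ :=
  if h : a ≤ b then ((⟨(a, b), h⟩ : NonemptyInterval ℝ) : WithBot (NonemptyInterval ℝ)) else ⊥

/-- `δ([a,b],[c,d]) = |a-c| + |b-d|`, `δ([a,b],∅) = |b-a|`, `δ(∅,∅) = 0`. This is not a
pseudometric on all intervals: the triangle inequality through `∅` fails. -/
def delta : Interval ℝ → Interval ℝ → ℝ
  | ⊥, ⊥ => 0
  | ⊥, (J : NonemptyInterval ℝ) => |J.snd - J.fst|
  | (I : NonemptyInterval ℝ), ⊥ => |I.snd - I.fst|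
  | (I : NonemptyInterval ℝ), (J : NonemptyInterval ℝ) => |I.fst - J.fst| + |I.snd - J.snd|

/-- The end points of an interval, with the end points of `∅` put at `x`. -/
def ends (x : ℝ) : Interval ℝ → ℝ × ℝ
  | ⊥ => (x, x)
  | (I : NonemptyInterval ℝ) => (I.fst, I.snd)

/-- Closed intervals and the empty set, as values of the cluster of the point `x`. They are
compared by `δ`, with `∅` identified with `{x}`. -/
def Cluster (_x : ℝ) : Type := Interval ℝ

/-- The distance of `Cluster x`. -/
def clusterDist (x : ℝ) (I J : Interval ℝ) : ℝ :=
  |(ends x I).1 - (ends x J).1| + |(ends x I).2 - (ends x J).2|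

/-- Among `∅` and the intervals that contain `x`, the distance of `Cluster x` is `δ`. -/
lemma clusterDist_eq_delta (x : ℝ) (I J : Interval ℝ)
    (hI : I = ⊥ ∨ (ends x I).1 ≤ x ∧ x ≤ (ends x I).2)
    (hJ : J = ⊥ ∨ (ends x J).1 ≤ x ∧ x ≤ (ends x J).2) :
    clusterDist x I J = delta I J := by
  have aux : ∀ a b : ℝ, a ≤ x → x ≤ b → |x - a| + |x - b| = |b - a| := fun a b h1 h2 => by
    rw [abs_of_nonneg (sub_nonneg.2 h1), abs_of_nonpos (sub_nonpos.2 h2),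
      abs_of_nonneg (sub_nonneg.2 (h1.trans h2))]
    ring
  induction I using WithBot.recBotCoe with
  | bot =>
    induction J using WithBot.recBotCoe with
    | bot => simp [clusterDist, delta]
    | coe J =>
      have h := hJ.resolve_left WithBot.coe_ne_bot
      exact aux _ _ h.1 h.2
  | coe I =>
    have h := hI.resolve_left WithBot.coe_ne_bot
    induction J using WithBot.recBotCoe with
    | bot =>
      have := aux _ _ h.1 h.2
      rw [abs_sub_comm x, abs_sub_comm x] at this
      exact this
    | coe J => rfl

lemma clusterDist_nonneg (x : ℝ) (I J : Interval ℝ) : 0 ≤ clusterDist x I J := by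
  unfold clusterDist; positivity

lemma clusterDist_self (x : ℝ) (I : Interval ℝ) : clusterDist x I I = 0 := by
  simp [clusterDist]

lemma clusterDist_comm (x : ℝ) (I J : Interval ℝ) : clusterDist x I J = clusterDist x J I := by
  unfold clusterDist; rw [abs_sub_comm, abs_sub_comm (ends x I).2]

lemma clusterDist_triangle (x : ℝ) (I J K : Interval ℝ) :
    clusterDist x I K ≤ clusterDist x I J + clusterDist x J K := by
  unfold clusterDist
  linarith [abs_sub_le (ends x I).1 (ends x J).1 (ends x K).1,
    abs_sub_le (ends x I).2 (ends x J).2 (ends x K).2]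

instance (x : ℝ) : PseudoMetricSpace (Cluster x) where
  dist I J := clusterDist x I J
  dist_self := clusterDist_self x
  dist_comm := clusterDist_comm x
  dist_triangle := clusterDist_triangle x

lemma continuous_ends_fst (x : ℝ) : Continuous (fun I : Cluster x => (ends x I).1) :=
  (LipschitzWith.of_dist_le_mul (K := 1) fun I J => by
    show |(ends x I).1 - (ends x J).1| ≤ ((1 : ℝ≥0) : ℝ) * clusterDist x I J
    rw [NNReal.coe_one, one_mul]
    exact le_add_of_nonneg_right (abs_nonneg _)).continuous

lemma continuous_ends_snd (x : ℝ) : Continuous (fun I : Cluster x => (ends x I).2) :=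
  (LipschitzWith.of_dist_le_mul (K := 1) fun I J => by
    show |(ends x I).2 - (ends x J).2| ≤ ((1 : ℝ≥0) : ℝ) * clusterDist x I J
    rw [NNReal.coe_one, one_mul]
    exact le_add_of_nonneg_left (abs_nonneg _)).continuous

/-! ### The space of `q`-tuples of clusters -/

/-- Clusters of the points `x 1, …, x q`, with the sum of the distances. -/
def ClusterTuple {q : ℕ} (x : Fin q → ℝ) : Type := ∀ i, Cluster (x i)

instance {q : ℕ} (x : Fin q → ℝ) : PseudoMetricSpace (ClusterTuple x) where
  dist f g := ∑ i, clusterDist (x i) (f i) (g i)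
  dist_self f := Finset.sum_eq_zero fun i _ => clusterDist_self (x i) (f i)
  dist_comm f g := Finset.sum_congr rfl fun i _ => clusterDist_comm (x i) (f i) (g i)
  dist_triangle f g h := by
    rw [← Finset.sum_add_distrib]
    exact Finset.sum_le_sum fun i _ => clusterDist_triangle (x i) (f i) (g i) (h i)

instance {q : ℕ} (x : Fin q → ℝ) : MeasurableSpace (ClusterTuple x) := borel _

instance {q : ℕ} (x : Fin q → ℝ) : BorelSpace (ClusterTuple x) := ⟨rfl⟩

/-! ### The space of `q`-tuples of càdlàg paths of clusters -/

/-- `δ_T(f, g) = ∫₀ᵀ δ(f t, g t) dt`. -/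
def pathDist (T x : ℝ) (f g : Icc (0 : ℝ) T → Cluster x) : ℝ :=
  ∫ t, clusterDist x (f t) (g t) ∂(volume.comap ((↑) : Icc (0 : ℝ) T → ℝ))

lemma pathDist_self (T x : ℝ) (f : Icc (0 : ℝ) T → Cluster x) : pathDist T x f f = 0 := by
  have : (fun t => clusterDist x (f t) (f t)) = fun _ => 0 :=
    funext fun t => clusterDist_self x (f t)
  unfold pathDist
  rw [this, integral_zero]

lemma pathDist_comm (T x : ℝ) (f g : Icc (0 : ℝ) T → Cluster x) :
    pathDist T x f g = pathDist T x g f := by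
  have : (fun t => clusterDist x (f t) (g t)) = fun t => clusterDist x (g t) (f t) :=
    funext fun t => clusterDist_comm x (f t) (g t)
  unfold pathDist
  rw [this]

/-- The `q`-tuples of càdlàg functions on `[0, T]` with values in the clusters of `x 1, …, x q`. -/
def PathTuple (T : ℝ) {q : ℕ} (x : Fin q → ℝ) : Type :=
  {f : ∀ i, Icc (0 : ℝ) T → Cluster (x i) // ∀ i, IsCadlag (f i)}

lemma integrable_clusterDist {T x : ℝ} {f g : Icc (0 : ℝ) T → Cluster x}
    (hf : IsCadlag f) (hg : IsCadlag g) :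
    Integrable (fun t => clusterDist x (f t) (g t))
      (volume.comap ((↑) : Icc (0 : ℝ) T → ℝ)) := by
  have : IsFiniteMeasure ((volume : Measure ℝ).comap ((↑) : Icc (0 : ℝ) T → ℝ)) := by
    refine ⟨?_⟩
    rw [comap_subtype_coe_apply measurableSet_Icc]
    exact (measure_mono (Subtype.coe_image_subset _ _)).trans_lt measure_Icc_lt_top
  have hint : ∀ h : Icc (0 : ℝ) T → ℝ, IsCadlag h →
      Integrable h (volume.comap ((↑) : Icc (0 : ℝ) T → ℝ)) := fun h hh => by
    obtain ⟨C, hC⟩ := hh.bounded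
    exact Integrable.of_bound hh.measurable.aestronglyMeasurable C (Eventually.of_forall hC)
  exact (((hint _ (hf.comp (continuous_ends_fst x))).sub
    (hint _ (hg.comp (continuous_ends_fst x)))).abs).add
    (((hint _ (hf.comp (continuous_ends_snd x))).sub
    (hint _ (hg.comp (continuous_ends_snd x)))).abs)

/-- The distance is the sum of the distances `δ_T` of the components. -/
instance {T : ℝ} {q : ℕ} (x : Fin q → ℝ) : PseudoMetricSpace (PathTuple T x) where
  dist f g := ∑ i, pathDist T (x i) (f.1 i) (g.1 i)
  dist_self f := Finset.sum_eq_zero fun i _ => pathDist_self T (x i) (f.1 i)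
  dist_comm f g := Finset.sum_congr rfl fun i _ => pathDist_comm T (x i) (f.1 i) (g.1 i)
  dist_triangle f g h := by
    rw [← Finset.sum_add_distrib]
    refine Finset.sum_le_sum fun i _ => ?_
    unfold pathDist
    rw [← integral_add (integrable_clusterDist (f.2 i) (g.2 i))
      (integrable_clusterDist (g.2 i) (h.2 i))]
    exact integral_mono (integrable_clusterDist (f.2 i) (h.2 i))
      ((integrable_clusterDist (f.2 i) (g.2 i)).add (integrable_clusterDist (g.2 i) (h.2 i)))
      fun t => clusterDist_triangle (x i) (f.1 i t) (g.1 i t) (h.1 i t)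

instance {T : ℝ} {q : ℕ} (x : Fin q → ℝ) : MeasurableSpace (PathTuple T x) := borel _

instance {T : ℝ} {q : ℕ} (x : Fin q → ℝ) : BorelSpace (PathTuple T x) := ⟨rfl⟩

open Classical in
/-- A tuple of functions as an element of the path space; tuples that are not càdlàg are sent to
the constant `∅`. -/
def toPathTuple (T : ℝ) {q : ℕ} (x : Fin q → ℝ) (f : ∀ i, Icc (0 : ℝ) T → Cluster (x i)) :
    PathTuple T x :=
  if h : ∀ i, IsCadlag (f i) then ⟨f, h⟩
  else ⟨fun _ _ => (⊥ : Interval ℝ), fun _ _ =>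
    ⟨continuousWithinAt_const, _, tendsto_const_nhds⟩⟩

/-! ### Poisson processes and Poisson measures -/

/-- `N` is a Poisson process of rate `r` under `P`. -/
structure IsPoissonProcess {Ω : Type*} [MeasurableSpace Ω] (N : ℝ≥0 → Ω → ℕ) (r : ℝ≥0)
    (P : Measure Ω) : Prop where
  measurable : ∀ t, Measurable (N t)
  path : ∀ᵐ ω ∂P, N 0 ω = 0 ∧ Monotone (fun t => N t ω) ∧ IsCadlag (fun t => N t ω)
  indep : HasIndepIncrements N P
  law : ∀ s t, s ≤ t → HasLaw (fun ω => N t ω - N s ω) (poissonMeasure (r * (t - s))) P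

/-- `M` is a Poisson random measure with intensity measure `ν` under `P`. -/
structure IsPoissonMeasure {Ω E : Type*} [MeasurableSpace Ω] [MeasurableSpace E]
    (M : Ω → Measure E) (ν : Measure E) (P : Measure Ω) : Prop where
  measurable : ∀ B, MeasurableSet B → Measurable (fun ω => M ω B)
  integer : ∀ᵐ ω ∂P, ∀ B, MeasurableSet B → ∃ n : ℕ∞, M ω B = (n : ℝ≥0∞)
  law : ∀ B, MeasurableSet B → ν B ≠ ∞ →
    HasLaw (fun ω => M ω B)
      ((poissonMeasure (ν B).toNNReal).map (fun n : ℕ => (n : ℝ≥0∞))) P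
  indep : ∀ (n : ℕ) (B : Fin n → Set E), (∀ i, MeasurableSet (B i)) →
    Pairwise (Function.onFun Disjoint B) → iIndepFun (fun i ω => M ω (B i)) P

/-! ### The discrete forest fire process

Sites are `0` (vacant), `1` (occupied) or `2` (burning). -/

/-- `∫₀ᵗ φ(s) dN_s` for a counting function `N`: the sum over the jump times in `(0, t]`. -/
def jumpIntegral (φ : ℝ≥0 → ℤ) (N : ℝ≥0 → ℕ) (t : ℝ≥0) : ℤ :=
  ∑ᶠ s ∈ Ioc (0 : ℝ≥0) t, φ s * ((N s : ℤ) - ((Function.leftLim N s : ℕ) : ℤ))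

open Classical in
/-- The indicator of a proposition. -/
def ind (p : Prop) : ℤ := if p then 1 else 0

/-- The evolution equation of the forest fire process, for given paths of the state of the sites
and of the seed, match and propagation counting processes. -/
def ForestFireEquation (ξ : ℝ≥0 → ℤ → Fin 3) (nS nM nP : ℤ → ℝ≥0 → ℕ) : Prop :=
  let pre : ℝ≥0 → ℤ → Fin 3 := fun s i => Function.leftLim (fun u => ξ u i) s
  ∀ (i : ℤ) (t : ℝ≥0), (((ξ t i : Fin 3) : ℕ) : ℤ) =
    jumpIntegral (fun s => ind (pre s i = 0)) (nS i) t
    + jumpIntegral (fun s => ind (pre s i = 1)) (nM i) t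
    + jumpIntegral (fun s => ind (pre s (i + 1) = 2 ∧ pre s i = 1)) (nP (i + 1)) t
    + jumpIntegral (fun s => ind (pre s (i - 1) = 2 ∧ pre s i = 1)) (nP (i - 1)) t
    - 2 * jumpIntegral (fun s => ind (pre s i = 2)) (nP i) t

/-- `η` is a `(lam, pi)`-forest fire process under `P`. -/
def IsForestFireProcess {Ω : Type*} [MeasurableSpace Ω] (lam pi : ℝ)
    (η : ℝ≥0 → ℤ → Ω → Fin 3) (P : Measure Ω) : Prop :=
  (∀ t i, Measurable (η t i)) ∧
  ∃ NS NM NP : ℤ → ℝ≥0 → Ω → ℕ,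
    (∀ i, IsPoissonProcess (NS i) 1 P) ∧
    (∀ i, IsPoissonProcess (NM i) lam.toNNReal P) ∧
    (∀ i, IsPoissonProcess (NP i) pi.toNNReal P) ∧
    iIndepFun (fun (k : Fin 3 × ℤ) (ω : Ω) (t : ℝ≥0) => (![NS, NM, NP] k.1) k.2 t ω) P ∧
    ∀ᵐ ω ∂P, (∀ i, IsCadlag (fun t => η t i ω)) ∧
      ForestFireEquation (fun t i => η t i ω)
        (fun i t => NS i t ω) (fun i t => NM i t ω) (fun i t => NP i t ω)

/-- The time scale `log (1 / lam)`. -/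
def aScale (lam : ℝ) : ℝ := Real.log (1 / lam)

/-- The space scale `⌊1 / (lam log (1 / lam))⌋`. -/
def nScale (lam : ℝ) : ℤ := ⌊1 / (lam * aScale lam)⌋

/-- Left end `sup {k < i : ξ k = 0 or 2} + 1` of the occupied component of the site `i`. -/
def leftEnd (ξ : ℤ → Fin 3) (i : ℤ) : ℤ := sSup {k | k < i ∧ (ξ k = 0 ∨ ξ k = 2)} + 1

/-- Right end `inf {k > i : ξ k = 0 or 2} - 1` of the occupied component of the site `i`. -/
def rightEnd (ξ : ℤ → Fin 3) (i : ℤ) : ℤ := sInf {k | i < k ∧ (ξ k = 0 ∨ ξ k = 2)} - 1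

/-- The occupied component `C(ξ, i)` of the site `i`, scaled by the factor `1 / n`. -/
def scaledComponent (n : ℤ) (ξ : ℤ → Fin 3) (i : ℤ) : Interval ℝ :=
  if ξ i = 1 then mkInterval ((leftEnd ξ i : ℝ) / n) ((rightEnd ξ i : ℝ) / n) else ⊥

/-- The rescaled cluster `D_t^{lam,pi}(x) = (1/n) C(η_{a t}, ⌊n x⌋)` of a forest fire path `ξ`. -/
def rescaledCluster (lam : ℝ) (ξ : ℝ≥0 → ℤ → Fin 3) (t x : ℝ) : Cluster x :=
  scaledComponent (nScale lam) (ξ (aScale lam * t).toNNReal) ⌊(nScale lam : ℝ) * x⌋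

/-! ### The limit process -/

/-- `Y` is a limit forest fire process `LFFP(∞, z₀)` under `P`, driven by the Poisson measure `M`
of matches `(position, time)`. A match after `z₀` makes `Y` equal to `1` for ever: the last clause
records this, since the equation alone would let `Y` leave the value `1` at an arbitrary time. -/
def IsLFFP {Ω : Type*} [MeasurableSpace Ω] (z₀ : ℝ) (M : Ω → Measure (ℝ × ℝ))
    (Y : ℝ≥0 → ℝ → Ω → ℝ) (P : Measure Ω) : Prop :=
  IsPoissonMeasure M (volume.restrict (univ ×ˢ Ici (0 : ℝ))) P ∧
  (∀ t x, Measurable (Y t x)) ∧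
  ∀ᵐ ω ∂P, ∀ x : ℝ,
    IsCadlag (fun t => Y t x ω) ∧
    (∀ t, 0 ≤ Y t x ω) ∧
    (∀ t : ℝ≥0, Y t x ω =
      (∫ p in {x} ×ˢ Icc (0 : ℝ) (min (t : ℝ) z₀), p.2 ∂(M ω))
      - (∫ s in (0 : ℝ)..t, (Ioo (0 : ℝ) 1).indicator (fun _ => (1 : ℝ)) (Y s.toNNReal x ω))
      + (if z₀ ≤ t then (M ω ({x} ×ˢ Icc z₀ (t : ℝ))).toReal else 0)) ∧
    (∀ t s : ℝ≥0, z₀ < t → t ≤ s → M ω {(x, (t : ℝ))} ≠ 0 → Y s x ω = 1)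

/-- The cluster `D_t(x) = [L_t(x), R_t(x)]` of the limit process with path `y`: `{x}` if `t < 1`,
and delimited by the sites where `y t` is positive if `t ≥ 1`. -/
def limitCluster (y : ℝ≥0 → ℝ → ℝ) (t x : ℝ) : Cluster x :=
  if t < 1 then mkInterval x x
  else mkInterval (sSup {u | u ≤ x ∧ 0 < y t.toNNReal u}) (sInf {u | x ≤ u ∧ 0 < y t.toNNReal u})

/-! ### The asymptotic regime -/

/-- The parameters: `0 < lam < 1` and `pi ≥ 1`. -/
structure Params where
  lam : ℝ
  pi : ℝ
  lam_pos : 0 < lam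
  lam_lt_one : lam < 1
  one_le_pi : 1 ≤ pi

/-- The slow regime: `lam → 0`, `n / (a pi) → ∞` and `log pi / log (1 / lam) → z₀`. -/
def slowRegime (z₀ : ℝ) : Filter Params :=
  comap (fun p => p.lam) (𝓝 0)
    ⊓ comap (fun p => (nScale p.lam : ℝ) / (aScale p.lam * p.pi)) atTop
    ⊓ comap (fun p => Real.log p.pi / Real.log (1 / p.lam)) (𝓝 z₀)

end ForestFire

end

noncomputable section

namespace ForestFire

/-! ### Convergence in law by finite approximation -/

/-! Write `a = log (1 / λ)`, so that a unit of rescaled time is a time `a`. A site receives no seed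
up to time `a u` with probability `λ ^ u`, and a bounded window contains of order `1 / (λ a)` sites.
Before rescaled time `1` there are thus unseeded sites microscopically close to any given point, and
the clusters are points; at time `1` every site of the window has been seeded, and from then on
clusters are delimited only by the traces of fires. The matches, seen at this scale, have mean
density `n a λ → 1` and become the Poisson measure.

The slow regime says that a front makes only about `a π ≪ n` steps per unit of rescaled time, so
each fire stays near its match. A match at time `s` falls on an occupied stretch of about `λ ^ (-s)`
sites, while `π` is about `λ ^ (-z₀)`. If `s < z₀`, the fire crosses the stretch in negligible time,
and the hole needs a further time `s` to be filled: the match is a barrier during `[s, 2s)`. If `s >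
z₀`, take `z₀ < γ < s`: a fully occupied stretch of `λ ^ (-γ)` sites is not crossed within any fixed
number of time units, so it always contains a burning site, and the match is a barrier for ever. The
limit process has the same barriers: almost surely at most one mark lies above each site, and the
equation can then be solved by hand (`LimitEquation.pos_iff_of_mark`, which is also the third
assertion).

The two processes are not coupled. Space and rescaled time are cut into cells of side `1 / m`, and
the set of cells that contain a mark (or a match) is recorded. This pattern is a finite variable
with independent entries in both models, and its law converges (`tendsto_real_matchPattern`). For a
good pattern (`GoodState`, likely by `exists_goodState`) the clusters of both processes are, outside
few time cells, within `20 / m` of one deterministic function of the pattern, `gridCluster`: this is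
`limit_closeToGrid` for the limit and `eventually_closeToGrid` for the forest fire. Then
`tendstoInDistribution_of_approx` concludes.

On the discrete side each time cell is divided into `K₀` steps, so short that in the window at most
one clock rings per step. The process read at these steps is a deterministic automaton,
`IsEvolution`, driven by independent rings. What a match does is then combinatorial
(`IsEvolution.exists_unoccupied`, `IsEvolution.occupied_of_brief`) once the rings are typical; that
they are is a union bound (`RingModel.real_not_typicalRings_le`), whose terms are made small by
choosing lengths `λ ^ (-γ)` with suitable exponents (`eventually_lastingBound`,
`eventually_briefBound`). -/

lemma aemeasurable_of_approx {Ω E : Type*} [MeasurableSpace Ω] {P : Measure Ω}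
    [PseudoMetricSpace E] [MeasurableSpace E] [BorelSpace E] {Z : Ω → E}
    (h : ∀ ε > 0, ∃ Y : Ω → E, AEMeasurable Y P ∧
      P {ω | ε < dist (Z ω) (Y ω)} ≤ ENNReal.ofReal ε) :
    AEMeasurable Z P := by
  have h' : ∀ ε : ℝ, ∃ Y : Ω → E, 0 < ε → AEMeasurable Y P ∧
      P {ω | ε < dist (Z ω) (Y ω)} ≤ ENNReal.ofReal ε := fun ε => by
    by_cases hε : 0 < ε
    · obtain ⟨Y, hY⟩ := h ε hε
      exact ⟨Y, fun _ => hY⟩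
    · exact ⟨Z, fun h0 => absurd h0 hε⟩
  choose Y hY using h'
  have hpos : ∀ n : ℕ, (0 : ℝ) < (1 / 2) ^ n := fun n => by positivity
  -- Borel–Cantelli with `ε = 2⁻ⁿ`: the probabilities that `Z` is further than `2⁻ⁿ` from its
  -- approximation are summable, so the approximations converge to `Z` almost surely.
  have hsum : ∑' n : ℕ, P {ω | (1 / 2 : ℝ) ^ n < dist (Z ω) (Y ((1 / 2) ^ n) ω)} ≠ ∞ := by
    refine ne_top_of_le_ne_top ?_ (ENNReal.tsum_le_tsum fun n => (hY _ (hpos n)).2)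
    rw [← ENNReal.ofReal_tsum_of_nonneg (fun n => (hpos n).le) summable_geometric_two]
    exact ENNReal.ofReal_ne_top
  refine aemeasurable_of_tendsto_metrizable_ae (u := atTop) (f := fun n : ℕ => Y ((1 / 2) ^ n))
    (fun n => (hY _ (hpos n)).1) ?_
  filter_upwards [ae_eventually_notMem hsum] with ω hω
  rw [tendsto_iff_dist_tendsto_zero]
  refine squeeze_zero' (Eventually.of_forall fun _ => dist_nonneg)
    (hω.mono fun n hn => ?_)
    (tendsto_pow_atTop_nhds_zero_of_lt_one (r := (1 / 2 : ℝ)) (by norm_num) (by norm_num))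
  rw [dist_comm]
  simpa using hn

lemma integral_comp_finite {Ω S : Type*} [MeasurableSpace Ω] {P : Measure Ω}
    [IsProbabilityMeasure P] [Fintype S] {U : Ω → S} (hU : ∀ s, MeasurableSet (U ⁻¹' {s}))
    (g : S → ℝ) : ∫ ω, g (U ω) ∂P = ∑ s, P.real (U ⁻¹' {s}) * g s := by
  classical
  have : (fun ω => g (U ω)) = fun ω => ∑ s, (U ⁻¹' {s}).indicator (fun _ => g s) ω := by
    funext ω
    rw [Finset.sum_eq_single (U ω)]
    · simp
    · intro s _ hs
      exact indicator_of_notMem (fun h => hs (by simpa using h.symm)) _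
    · simp
  rw [this, integral_finsetSum]
  · refine Finset.sum_congr rfl fun s _ => ?_
    rw [integral_indicator (hU s)]
    simp
  · exact fun s _ => (integrable_const _).indicator (hU s)

lemma aemeasurable_comp_finite {Ω S E : Type*} [MeasurableSpace Ω] {P : Measure Ω}
    [Fintype S] [MeasurableSpace E] {U : Ω → S} (hU : ∀ s, MeasurableSet (U ⁻¹' {s}))
    (H : S → E) : AEMeasurable (fun ω => H (U ω)) P := by
  refine Measurable.aemeasurable fun B _ => ?_
  have : (fun ω => H (U ω)) ⁻¹' B = ⋃ s ∈ H ⁻¹' B, U ⁻¹' {s} := by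
    ext ω; simp
  rw [this]
  exact MeasurableSet.biUnion (to_countable _) fun s _ => hU s

/-- Where the two variables are within `ε`, the Lipschitz bound costs `L * ε`; elsewhere, with
probability at most `ε`, the oscillation of `f` costs `C`. -/
lemma abs_integral_sub_le_of_approx {Ω E : Type*} [MeasurableSpace Ω] {P : Measure Ω}
    [IsProbabilityMeasure P] [PseudoMetricSpace E] [MeasurableSpace E] [OpensMeasurableSpace E]
    {X Y : Ω → E} (hX : AEMeasurable X P) (hY : AEMeasurable Y P) {f : E → ℝ} {C : ℝ} {L : ℝ≥0}
    (hC : ∀ x y, dist (f x) (f y) ≤ C) (hL : LipschitzWith L f) {ε : ℝ} (hε : 0 < ε)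
    (h : P {ω | ε < dist (X ω) (Y ω)} ≤ ENNReal.ofReal ε) :
    |∫ ω, f (X ω) ∂P - ∫ ω, f (Y ω) ∂P| ≤ (L + C) * ε := by
  have hint : ∀ {Z : Ω → E}, AEMeasurable Z P → Integrable (fun ω => f (Z ω)) P := by
    intro Z hZ
    obtain ⟨ω₀⟩ : Nonempty Ω := P.nonempty_of_neZero
    refine Integrable.of_bound
      (hL.continuous.measurable.comp_aemeasurable hZ).aestronglyMeasurable
      (C + |f (Z ω₀)|) (Eventually.of_forall fun ω => ?_)
    have h1 := hC (Z ω) (Z ω₀)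
    rw [Real.dist_eq] at h1
    rw [Real.norm_eq_abs]
    linarith [abs_sub_abs_le_abs_sub (f (Z ω)) (f (Z ω₀))]
  have hC0 : 0 ≤ C := by
    obtain ⟨ω₀⟩ : Nonempty Ω := P.nonempty_of_neZero
    exact dist_nonneg.trans (hC (X ω₀) (X ω₀))
  -- The exceptional event is not known to be measurable, so it is replaced by its measurable hull,
  -- of the same probability.
  set B := toMeasurable P {ω | ε < dist (X ω) (Y ω)} with hB
  have hBm : MeasurableSet B := measurableSet_toMeasurable _ _
  have hPB : P.real B ≤ ε := by
    rw [measureReal_def, hB, measure_toMeasurable]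
    exact ENNReal.toReal_le_of_le_ofReal hε.le h
  rw [← integral_sub (hint hX) (hint hY)]
  refine (abs_integral_le_integral_abs).trans ?_
  have hle : ∀ ω, |f (X ω) - f (Y ω)| ≤ L * ε + B.indicator (fun _ => C) ω := by
    intro ω
    by_cases hω : ω ∈ B
    · rw [indicator_of_mem hω]
      have := hC (X ω) (Y ω)
      rw [Real.dist_eq] at this
      have : (0 : ℝ) ≤ L * ε := by positivity
      linarith
    · rw [indicator_of_notMem hω, add_zero]
      have h1 : dist (X ω) (Y ω) ≤ ε := by
        by_contra hlt
        exact hω (subset_toMeasurable _ _ (not_le.1 hlt))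
      have h2 := hL.dist_le_mul (X ω) (Y ω)
      rw [Real.dist_eq] at h2
      exact h2.trans (by gcongr)
  refine (integral_mono (hint hX |>.sub (hint hY)).abs
    ((integrable_const _).add ((integrable_const C).indicator hBm)) hle).trans ?_
  have hsplit : ∫ ω, ((fun _ => (L : ℝ) * ε : Ω → ℝ) + B.indicator (fun _ => C)) ω ∂P =
      L * ε + P.real B * C := by
    rw [integral_add' (integrable_const _) ((integrable_const C).indicator hBm),
      integral_indicator hBm]
    simp
  rw [hsplit]
  nlinarith

/-- Convergence in law follows from approximation by functions of finite discrete variables which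
converge in law. -/
theorem tendstoInDistribution_of_approx {ι : Type*} {l : Filter ι} [l.IsCountablyGenerated]
    {Ω : ι → Type*} [∀ i, MeasurableSpace (Ω i)] {P : ∀ i, Measure (Ω i)}
    [∀ i, IsProbabilityMeasure (P i)] {Ω' : Type*} [MeasurableSpace Ω'] {P' : Measure Ω'}
    [IsProbabilityMeasure P'] {E : Type*} [PseudoMetricSpace E] [MeasurableSpace E]
    [BorelSpace E] {X : ∀ i, Ω i → E} {Z : Ω' → E} (hX : ∀ i, AEMeasurable (X i) (P i))
    (h : ∀ ε > 0, ∃ (S : Type) (_ : Fintype S) (U : ∀ i, Ω i → S) (V : Ω' → S) (H : S → E),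
      (∀ i s, MeasurableSet (U i ⁻¹' {s})) ∧ (∀ s, MeasurableSet (V ⁻¹' {s})) ∧
      (∀ s, Tendsto (fun i => (P i).real (U i ⁻¹' {s})) l (𝓝 (P'.real (V ⁻¹' {s})))) ∧
      (∀ᶠ i in l, P i {ω | ε < dist (X i ω) (H (U i ω))} ≤ ENNReal.ofReal ε) ∧
      P' {ω | ε < dist (Z ω) (H (V ω))} ≤ ENNReal.ofReal ε) :
    TendstoInDistribution X l Z P P' := by
  have hZ : AEMeasurable Z P' := aemeasurable_of_approx fun ε hε => by
    obtain ⟨S, _, U, V, H, _, hV, _, _, h5⟩ := h ε hε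
    exact ⟨fun ω => H (V ω), aemeasurable_comp_finite hV H, h5⟩
  refine ⟨hX, hZ, tendsto_iff_forall_lipschitz_integral_tendsto.2 ?_⟩
  rintro f ⟨C, hC⟩ ⟨L, hL⟩
  have hC0 : 0 ≤ C := by
    obtain ⟨ω₀⟩ : Nonempty Ω' := P'.nonempty_of_neZero
    exact dist_nonneg.trans (hC (Z ω₀) (Z ω₀))
  have hmap' : ∀ i, ∫ x, f x ∂((P i).map (X i)) = ∫ ω, f (X i ω) ∂(P i) := fun i =>
    integral_map (hX i) hL.continuous.measurable.stronglyMeasurable.aestronglyMeasurable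
  have hmapZ : ∫ x, f x ∂(P'.map Z) = ∫ ω, f (Z ω) ∂P' :=
    integral_map hZ hL.continuous.measurable.stronglyMeasurable.aestronglyMeasurable
  simp only [ProbabilityMeasure.coe_mk, hmap', hmapZ]
  rw [Metric.tendsto_nhds]
  intro δ hδ
  -- The error `δ` is shared between the two replacements by finite variables, each costing at most
  -- `(L + C) * ε < δ / 3`, and the convergence of the finite laws. The `+ 1` keeps the denominator
  -- positive.
  set ε := δ / (3 * (L + C + 1)) with hεdef
  have hden : (0 : ℝ) < 3 * (L + C + 1) := by positivity
  have hε : 0 < ε := div_pos hδ hden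
  have hεδ : (L + C) * ε < δ / 3 := by
    have : (L + C + 1) * ε = δ / 3 := by rw [hεdef]; field_simp
    nlinarith
  obtain ⟨S, _, U, V, H, hU, hV, hlaw, h4, h5⟩ := h ε hε
  have hlim : Tendsto (fun i => ∫ ω, f (H (U i ω)) ∂(P i)) l (𝓝 (∫ ω, f (H (V ω)) ∂P')) := by
    simp_rw [integral_comp_finite (hU _) (fun s => f (H s)),
      integral_comp_finite hV (fun s => f (H s))]
    exact tendsto_finsetSum _ fun s _ => (hlaw s).mul_const _
  filter_upwards [h4, Metric.tendsto_nhds.1 hlim (δ / 3) (by positivity)] with i hi1 hi2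
  have e1 := abs_integral_sub_le_of_approx (hX i) (aemeasurable_comp_finite (hU i) H) hC hL hε hi1
  have e2 := abs_integral_sub_le_of_approx hZ (aemeasurable_comp_finite hV H) hC hL hε h5
  rw [Real.dist_eq] at hi2 ⊢
  rw [abs_le] at e1 e2
  rw [abs_lt] at hi2 ⊢
  constructor <;> linarith

/-! ### Synchronous evolution of the forest fire on a box -/

lemma fin_three_cases (a : Fin 3) : a = 0 ∨ a = 1 ∨ a = 2 := by
  revert a; decide

/-- `z` evolves, in the box `[-N, N]` and up to step `K`, by the rules of the forest fire process
with seeds `S`, matches `M` and propagations `Q`. -/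
structure IsEvolution (N : ℤ) (K : ℕ) (z : ℕ → ℤ → Fin 3) (S M Q : ℕ → ℤ → Prop) : Prop where
  init : ∀ i, |i| ≤ N → z 0 i = 0
  vac : ∀ c i, c < K → |i| ≤ N → z c i = 0 → ¬S c i → z (c + 1) i = 0
  seed : ∀ c i, c < K → |i| ≤ N → z c i = 0 → S c i → z (c + 1) i = 1
  occ : ∀ c i, c < K → |i| ≤ N → z c i = 1 → ¬M c i → ¬(Q c (i - 1) ∧ z c (i - 1) = 2) →
    ¬(Q c (i + 1) ∧ z c (i + 1) = 2) → z (c + 1) i = 1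
  ignite : ∀ c i, c < K → |i| ≤ N → z c i = 1 →
    (M c i ∨ (Q c (i - 1) ∧ z c (i - 1) = 2) ∨ (Q c (i + 1) ∧ z c (i + 1) = 2)) →
    z (c + 1) i = 2
  burn : ∀ c i, c < K → |i| ≤ N → z c i = 2 → ¬Q c i → z (c + 1) i = 2
  ext : ∀ c i, c < K → |i| ≤ N → z c i = 2 → Q c i → z (c + 1) i = 0

namespace IsEvolution

variable {N : ℤ} {K : ℕ} {z : ℕ → ℤ → Fin 3} {S M Q : ℕ → ℤ → Prop}

lemma burning_succ (h : IsEvolution N K z S M Q) {c : ℕ} {g : ℤ} (hc : c < K) (hg : |g| ≤ N)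
    (hz : z (c + 1) g = 2) : (z c g = 2 ∧ ¬Q c g) ∨ (z c g = 1 ∧
      (M c g ∨ (Q c (g - 1) ∧ z c (g - 1) = 2) ∨ (Q c (g + 1) ∧ z c (g + 1) = 2))) := by
  rcases fin_three_cases (z c g) with h0 | h1 | h2
  · by_cases hS : S c g
    · rw [h.seed c g hc hg h0 hS] at hz; exact absurd hz (by decide)
    · rw [h.vac c g hc hg h0 hS] at hz; exact absurd hz (by decide)
  · right
    refine ⟨h1, ?_⟩
    by_contra hcon
    push Not at hcon
    rw [h.occ c g hc hg h1 hcon.1 (fun h' => hcon.2.1 h'.1 h'.2) (fun h' => hcon.2.2 h'.1 h'.2)]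
      at hz
    exact absurd hz (by decide)
  · left
    refine ⟨h2, fun hQ => ?_⟩
    rw [h.ext c g hc hg h2 hQ] at hz; exact absurd hz (by decide)

lemma one_succ (h : IsEvolution N K z S M Q) {c : ℕ} {g : ℤ} (hc : c < K) (hg : |g| ≤ N)
    (hz : z c g = 1) (hz' : z (c + 1) g ≠ 2) : z (c + 1) g = 1 := by
  by_cases hI : M c g ∨ (Q c (g - 1) ∧ z c (g - 1) = 2) ∨ (Q c (g + 1) ∧ z c (g + 1) = 2)
  · exact absurd (h.ignite c g hc hg hz hI) hz'
  · push Not at hI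
    exact h.occ c g hc hg hz hI.1 (fun h' => hI.2.1 h'.1 h'.2) (fun h' => hI.2.2 h'.1 h'.2)

lemma ne_one_succ (h : IsEvolution N K z S M Q) {c : ℕ} {g : ℤ} (hc : c < K) (hg : |g| ≤ N)
    (hz : z c g ≠ 1) (hS : ¬S c g) : z (c + 1) g ≠ 1 := by
  rcases fin_three_cases (z c g) with h0 | h1 | h2
  · rw [h.vac c g hc hg h0 hS]; decide
  · exact absurd h1 hz
  · by_cases hQ : Q c g
    · rw [h.ext c g hc hg h2 hQ]; decide
    · rw [h.burn c g hc hg h2 hQ]; decide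

lemma ne_one_of_no_seed (h : IsEvolution N K z S M Q) {g : ℤ} (hg : |g| ≤ N) {c₀ C : ℕ}
    (hC : C ≤ K) (hz : z c₀ g ≠ 1) (hS : ∀ c, c₀ ≤ c → c < C → ¬S c g) :
    ∀ c, c₀ ≤ c → c ≤ C → z c g ≠ 1 := by
  intro c hc
  induction c, hc using Nat.le_induction with
  | base => exact fun _ => hz
  | succ c hc ih =>
    exact fun hcC => h.ne_one_succ (by omega) hg (ih (by omega)) (hS c hc (by omega))

lemma vacant_of_no_seed (h : IsEvolution N K z S M Q) {g : ℤ} (hg : |g| ≤ N) {C : ℕ}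
    (hC : C ≤ K) (hS : ∀ c < C, ¬S c g) : ∀ c ≤ C, z c g = 0 := by
  intro c
  induction c with
  | zero => exact fun _ => h.init g hg
  | succ c ih =>
    exact fun hcC => h.vac c g (by omega) hg (ih (by omega)) (hS c (by omega))

/-- A site that does not burn never loses its tree, and a seed on an occupied site has no effect; so
a single seed anywhere in the interval decides the final state. -/
lemma occupied_of_seed (h : IsEvolution N K z S M Q) {g : ℤ} (hg : |g| ≤ N) {c₀ C : ℕ}
    (hC : C ≤ K) (hnb : ∀ c, c₀ ≤ c → c ≤ C → z c g ≠ 2)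
    (hS : ∃ c, c₀ ≤ c ∧ c < C ∧ S c g) : z C g = 1 := by
  obtain ⟨c, hc0, hcC, hSc⟩ := hS
  have key : ∀ c', c + 1 ≤ c' → c' ≤ C → z c' g = 1 := by
    intro c' hc'
    induction c', hc' using Nat.le_induction with
    | base =>
      intro _
      rcases fin_three_cases (z c g) with h0 | h1 | h2
      · exact h.seed c g (by omega) hg h0 hSc
      · exact h.one_succ (by omega) hg h1 (hnb _ (by omega) (by omega))
      · exact absurd h2 (hnb c hc0 hcC.le)
    | succ c' hc' ih =>
      intro hle
      exact h.one_succ (by omega) hg (ih (by omega)) (hnb _ (by omega) hle)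
  exact key C hcC le_rfl

/-- A window without matches is only entered by fires through its ends. -/
lemma window (h : IsEvolution N K z S M Q) {F G : ℕ → ℤ} {c₀ C : ℕ} (hC : C ≤ K)
    (hF : ∀ c, c₀ ≤ c → c < C → F c ≤ F (c + 1)) (hG : ∀ c, c₀ ≤ c → c < C → G (c + 1) ≤ G c)
    (hF' : ∀ c, c₀ ≤ c → c < C → z c (F c) = 2 → Q c (F c) → F c + 1 ≤ F (c + 1))
    (hG' : ∀ c, c₀ ≤ c → c < C → z c (G c) = 2 → Q c (G c) → G (c + 1) ≤ G c - 1)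
    (hbF : -N ≤ F c₀ + 1) (hbG : G c₀ ≤ N + 1)
    (hM : ∀ c, c₀ ≤ c → c < C → ∀ g, F c < g → g < G c → ¬M c g)
    (h0 : ∀ g, F c₀ < g → g < G c₀ → z c₀ g ≠ 2) :
    ∀ c, c₀ ≤ c → c ≤ C → ∀ g, F c < g → g < G c → z c g ≠ 2 := by
  have key : ∀ c, c₀ ≤ c → c ≤ C → F c₀ ≤ F c ∧ G c ≤ G c₀ ∧
      ∀ g, F c < g → g < G c → z c g ≠ 2 := by
    intro c hc
    induction c, hc using Nat.le_induction with
    | base => exact fun _ => ⟨le_rfl, le_rfl, h0⟩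
    | succ c hc ih =>
      intro hle
      obtain ⟨i1, i2, i3⟩ := ih (by omega)
      have f1 := hF c hc (by omega)
      have f2 := hG c hc (by omega)
      refine ⟨by omega, by omega, fun g hFg hgG hz => ?_⟩
      have hgN : |g| ≤ N := by rw [abs_le]; omega
      rcases h.burning_succ (by omega) hgN hz with ⟨h2, -⟩ | ⟨-, hm | ⟨hq, h2⟩ | ⟨hq, h2⟩⟩
      · exact i3 g (by omega) (by omega) h2
      · exact hM c hc (by omega) g (by omega) (by omega) hm
      -- Fire crosses the left end only when `F c` burns and propagates, and at that very step the
      -- end moves, so that `F c + 1` has left the window. The right end is symmetric.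
      · rcases eq_or_ne (g - 1) (F c) with he | he
        · rw [he] at hq h2
          have := hF' c hc (by omega) h2 hq
          omega
        · exact i3 (g - 1) (by omega) (by omega) h2
      · rcases eq_or_ne (g + 1) (G c) with he | he
        · rw [he] at hq h2
          have := hG' c hc (by omega) h2 hq
          omega
        · exact i3 (g + 1) (by omega) (by omega) h2
  exact fun c hc hcC => (key c hc hcC).2.2

/-- A fire lit at the left end of an occupied stretch burns somewhere in the stretch until it has
reached the right end. -/
lemma front_persists (h : IsEvolution N K z S M Q) {i j : ℤ} (hi : -N ≤ i) (hj : j ≤ N)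
    (hij : i ≤ j) {c₀ C : ℕ} (hC : C ≤ K) (h2 : z c₀ i = 2)
    (h1 : ∀ g, i < g → g ≤ j → z c₀ g = 1) :
    ∀ c, c₀ ≤ c → c ≤ C → (∃ f, i ≤ f ∧ f ≤ j ∧ z c f = 2 ∧ ∀ g, f < g → g ≤ j → z c g = 1) ∨
      ∃ c', c₀ ≤ c' ∧ c' ≤ c ∧ z c' j = 2 := by
  intro c hc
  induction c, hc using Nat.le_induction with
  | base => exact fun _ => Or.inl ⟨i, le_rfl, hij, h2, h1⟩
  | succ c hc ih =>
    intro hle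
    rcases ih (by omega) with ⟨f, hif, hfj, hf2, hf1⟩ | ⟨c', h3, h4, h5⟩
    swap
    · exact Or.inr ⟨c', h3, by omega, h5⟩
    rcases hfj.eq_or_lt with rfl | hlt
    · exact Or.inr ⟨c, hc, by omega, hf2⟩
    left
    have hex : ∃ g, f ≤ g ∧ g ≤ j ∧ z (c + 1) g = 2 := by
      by_cases hQ : Q c f
      · refine ⟨f + 1, by omega, by omega, h.ignite c (f + 1) (by omega)
          (by rw [abs_le]; omega) (hf1 _ (by omega) (by omega)) (Or.inr (Or.inl ?_))⟩
        rw [add_sub_cancel_right]; exact ⟨hQ, hf2⟩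
      · exact ⟨f, le_rfl, hfj, h.burn c f (by omega) (by rw [abs_le]; omega) hf2 hQ⟩
    -- The rightmost burning site is taken, so that everything beyond it up to `j` is still
    -- occupied.
    obtain ⟨f', ⟨hf'1, hf'2, hf'3⟩, hmax⟩ := Int.exists_greatest_of_bdd
      (P := fun g => f ≤ g ∧ g ≤ j ∧ z (c + 1) g = 2) ⟨j, fun g hg => hg.2.1⟩ hex
    refine ⟨f', by omega, hf'2, hf'3, fun g hg hgj => ?_⟩
    refine h.one_succ (by omega) (by rw [abs_le]; omega) (hf1 g (by omega) hgj) fun hb => ?_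
    have := hmax g ⟨by omega, hgj, hb⟩
    omega

/-- A fire between two barriers of which the fronts are not followed by seeds. -/
lemma fronts_only (h : IsEvolution N K z S M Q) {bl br i : ℤ} {F G : ℕ → ℤ} {c₁ c₂ : ℕ}
    (hC : c₂ ≤ K) (hbl : -N ≤ bl + 1) (hbr : br ≤ N + 1) (hi : bl < i) (hi' : i < br)
    (hF0 : F c₁ = i) (hG0 : G c₁ = i)
    (hF : ∀ c, c₁ ≤ c → c < c₂ → Q c (F c) → F (c + 1) = F c + 1)
    (hF' : ∀ c, c₁ ≤ c → c < c₂ → ¬Q c (F c) → F (c + 1) = F c)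
    (hG : ∀ c, c₁ ≤ c → c < c₂ → Q c (G c) → G (c + 1) = G c - 1)
    (hG' : ∀ c, c₁ ≤ c → c < c₂ → ¬Q c (G c) → G (c + 1) = G c)
    (hM : ∀ c, c₁ ≤ c → c < c₂ → ∀ g, bl < g → g < br → ¬M c g)
    (hzl : ∀ c, c₁ ≤ c → c ≤ c₂ → z c bl ≠ 2) (hzr : ∀ c, c₁ ≤ c → c ≤ c₂ → z c br ≠ 2)
    (hSF : ∀ c, c₁ ≤ c → c < c₂ → ¬S c (F c - 1)) (hSG : ∀ c, c₁ ≤ c → c < c₂ → ¬S c (G c + 1))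
    (h0 : ∀ g, bl < g → g < br → z c₁ g = 2 → g = i) :
    ∀ c, c₁ ≤ c → c ≤ c₂ → ∀ g, bl < g → g < br → z c g = 2 → g = F c ∨ g = G c := by
  -- The positions of the fires alone do not form an inductive statement. One also needs that the
  -- site just behind a burning front is not occupied: otherwise the front could light a fire
  -- backwards.
  have key : ∀ c, c₁ ≤ c → c ≤ c₂ →
      (∀ g, bl < g → g < br → z c g = 2 → g = F c ∨ g = G c) ∧
      ((F c = i ∧ G c = i) ∨ (G c < i ∧ i < F c)) ∧
      (i < F c → F c < br → z c (F c) = 2 → z c (F c - 1) ≠ 1) ∧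
      (G c < i → bl < G c → z c (G c) = 2 → z c (G c + 1) ≠ 1) := by
    intro c hc
    induction c, hc using Nat.le_induction with
    | base =>
      refine fun _ => ⟨fun g h1 h2 h3 => Or.inl ?_, Or.inl ⟨hF0, hG0⟩, fun h1 => ?_, fun h1 => ?_⟩
      · rw [hF0]; exact h0 g h1 h2 h3
      · omega
      · omega
    | succ c hc ih =>
      intro hle
      obtain ⟨iA, iB, iD, iE⟩ := ih (by omega)
      have hcK : c < K := by omega
      have hbox : ∀ g, bl < g → g < br → |g| ≤ N := fun g h1 h2 => by rw [abs_le]; omega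
      have mF := hF c hc (by omega)
      have mF' := hF' c hc (by omega)
      have mG := hG c hc (by omega)
      have mG' := hG' c hc (by omega)
      have nl := hzl c hc (by omega)
      have nr := hzr c hc (by omega)
      have sF := hSF c hc (by omega)
      have sG := hSG c hc (by omega)
      have hB : (F (c + 1) = i ∧ G (c + 1) = i) ∨ (G (c + 1) < i ∧ i < F (c + 1)) := by
        rcases iB with ⟨e1, e2⟩ | ⟨e1, e2⟩
        · by_cases hQ : Q c i
          · rw [e1] at mF; rw [e2] at mG
            have := mF hQ; have := mG hQ
            right; omega
          · rw [e1] at mF'; rw [e2] at mG'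
            have := mF' hQ; have := mG' hQ
            left; omega
        · right
          constructor
          · by_cases hQ : Q c (G c)
            · have := mG hQ; omega
            · have := mG' hQ; omega
          · by_cases hQ : Q c (F c)
            · have := mF hQ; omega
            · have := mF' hQ; omega
      have left_nb : ∀ g, bl < g → g < br → z c (g - 1) = 2 → g - 1 = F c ∨ g - 1 = G c := by
        intro g h1 h2 h3
        rcases eq_or_ne (g - 1) bl with he | he
        · rw [he] at h3; exact absurd h3 nl
        · exact iA _ (by omega) (by omega) h3
      have right_nb : ∀ g, bl < g → g < br → z c (g + 1) = 2 → g + 1 = F c ∨ g + 1 = G c := by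
        intro g h1 h2 h3
        rcases eq_or_ne (g + 1) br with he | he
        · rw [he] at h3; exact absurd h3 nr
        · exact iA _ (by omega) (by omega) h3
      refine ⟨?_, hB, ?_, ?_⟩
      · intro g h1 h2 h3
        rcases h.burning_succ hcK (hbox g h1 h2) h3 with ⟨b, nq⟩ | ⟨b, hm | ⟨hq, b'⟩ | ⟨hq, b'⟩⟩
        · rcases iA g h1 h2 b with e | e
          · rw [e] at nq; exact Or.inl (e.trans (mF' nq).symm)
          · rw [e] at nq; exact Or.inr (e.trans (mG' nq).symm)
        · exact absurd hm (hM c hc (by omega) g h1 h2)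
        · rcases left_nb g h1 h2 b' with e | e
          · rw [e] at hq; left; have := mF hq; omega
          · rcases iB with ⟨e1, e2⟩ | ⟨e1, e2⟩
            · rw [e, e2, ← e1] at hq; left; have := mF hq; omega
            · have hb := iE e1 (by
                rcases eq_or_ne (g - 1) bl with he | he
                · rw [he] at b'; exact absurd b' nl
                · omega) (by rw [← e]; exact b')
              rw [← e, sub_add_cancel] at hb
              exact absurd b hb
        · rcases right_nb g h1 h2 b' with e | e
          · rcases iB with ⟨e1, e2⟩ | ⟨e1, e2⟩
            · rw [e, e1, ← e2] at hq; right; have := mG hq; omega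
            · have hb := iD e2 (by
                rcases eq_or_ne (g + 1) br with he | he
                · rw [he] at b'; exact absurd b' nr
                · omega) (by rw [← e]; exact b')
              rw [← e, add_sub_cancel_right] at hb
              exact absurd b hb
          · rw [e] at hq; right; have := mG hq; omega
      · intro h1 h2 h3
        -- If the front moves, the site behind it is the one just extinguished. If it waits, the
        -- site behind it was not occupied and receives no seed.
        by_cases hQ : Q c (F c)
        · have hF1 := mF hQ
          rw [hF1] at h1 h2 h3 ⊢
          rw [add_sub_cancel_right]
          have hFi : i ≤ F c := by omega
          have hb : z c (F c) = 2 := by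
            rcases h.burning_succ hcK (hbox _ (by omega) h2) h3 with
              ⟨b, -⟩ | ⟨-, hm | ⟨-, b'⟩ | ⟨-, b'⟩⟩
            · rcases iA _ (by omega) h2 b with e | e <;> omega
            · exact absurd hm (hM c hc (by omega) _ (by omega) h2)
            · rwa [add_sub_cancel_right] at b'
            · rcases right_nb _ (by omega) h2 b' with e | e <;> omega
          rw [h.ext c _ hcK (hbox _ (by omega) (by omega)) hb hQ]
          decide
        · have hF1 := mF' hQ
          rw [hF1] at h1 h2 h3 ⊢
          have hb : z c (F c) = 2 := by
            rcases h.burning_succ hcK (hbox _ (by omega) h2) h3 with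
              ⟨b, -⟩ | ⟨-, hm | ⟨-, b'⟩ | ⟨-, b'⟩⟩
            · exact b
            · exact absurd hm (hM c hc (by omega) _ (by omega) h2)
            · rcases left_nb _ (by omega) h2 b' with e | e <;> omega
            · rcases right_nb _ (by omega) h2 b' with e | e <;> omega
          exact h.ne_one_succ hcK (hbox _ (by omega) (by omega)) (iD h1 h2 hb) sF
      · intro h1 h2 h3
        by_cases hQ : Q c (G c)
        · have hG1 := mG hQ
          rw [hG1] at h1 h2 h3 ⊢
          rw [sub_add_cancel]
          have hGi : G c ≤ i := by omega
          have hb : z c (G c) = 2 := by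
            rcases h.burning_succ hcK (hbox _ h2 (by omega)) h3 with
              ⟨b, -⟩ | ⟨-, hm | ⟨-, b'⟩ | ⟨-, b'⟩⟩
            · rcases iA _ h2 (by omega) b with e | e <;> omega
            · exact absurd hm (hM c hc (by omega) _ h2 (by omega))
            · rcases left_nb _ h2 (by omega) b' with e | e <;> omega
            · rwa [sub_add_cancel] at b'
          rw [h.ext c _ hcK (hbox _ (by omega) (by omega)) hb hQ]
          decide
        · have hG1 := mG' hQ
          rw [hG1] at h1 h2 h3 ⊢
          have hb : z c (G c) = 2 := by
            rcases h.burning_succ hcK (hbox _ h2 (by omega)) h3 with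
              ⟨b, -⟩ | ⟨-, hm | ⟨-, b'⟩ | ⟨-, b'⟩⟩
            · exact b
            · exact absurd hm (hM c hc (by omega) _ h2 (by omega))
            · rcases left_nb _ h2 (by omega) b' with e | e <;> omega
            · rcases right_nb _ h2 (by omega) b' with e | e <;> omega
          exact h.ne_one_succ hcK (hbox _ (by omega) (by omega)) (iE h1 h2 hb) sG
  exact fun c hc hcC => (key c hc hcC).1

end IsEvolution

open Classical in
/-- The front started from `x` at step `c` in the direction `dir`: it moves at each propagation of
its current site. -/
def front (Q : ℕ → ℤ → Prop) (dir x : ℤ) (c : ℕ) : ℕ → ℤ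
  | 0 => x
  | w + 1 => if Q (c + w) (front Q dir x c w) then front Q dir x c w + dir else front Q dir x c w

lemma front_succ_of (Q : ℕ → ℤ → Prop) (dir x : ℤ) (c w : ℕ)
    (h : Q (c + w) (front Q dir x c w)) : front Q dir x c (w + 1) = front Q dir x c w + dir := by
  simp [front, h]

lemma front_succ_of_not (Q : ℕ → ℤ → Prop) (dir x : ℤ) (c w : ℕ)
    (h : ¬Q (c + w) (front Q dir x c w)) : front Q dir x c (w + 1) = front Q dir x c w := by
  simp [front, h]

/-- No front crosses a block `[b d, (b + 1) d]` or `[(b - 1) d, b d]`. -/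
def NoCrossing (N d : ℤ) (K : ℕ) (Q : ℕ → ℤ → Prop) : Prop :=
  ∀ b : ℤ, |b * d| ≤ N → ∀ w ≤ K,
    front Q 1 (b * d) 0 w < b * d + d ∧ b * d - d < front Q (-1) (b * d) 0 w

/-- Distinct matches in the box are far from each other. -/
def MatchesIsolated (N d : ℤ) (K : ℕ) (M : ℕ → ℤ → Prop) : Prop :=
  ∀ i c i' c', |i| ≤ N → |i'| ≤ N → c < K → c' < K → M c i → M c' i' → |i - i'| ≤ 8 * d →
    i = i' ∧ c = c'

/-- The match at `(i, c)` finds the sites of `[i, i + l]` seeded, and there is always a site of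
`[i, i + l]` at which its effect is visible, up to step `C`. -/
def LastingMatch (l : ℤ) (S Q : ℕ → ℤ → Prop) (i : ℤ) (c C : ℕ) : Prop :=
  (∀ g, i ≤ g → g ≤ i + l → ∃ c' < c, S c' g) ∧
  ((∃ g, i ≤ g ∧ g ≤ i + l ∧ ∀ c', c ≤ c' → c' < C → ¬S c' g) ∨
    ∀ w, c + 1 + w ≤ C → front Q 1 i (c + 1) w < i + l)

/-- The fire of the match at `(i, c)` is extinguished within `W` steps, between two barriers at
distance at most `l`, and the sites between the barriers are seeded again before step `C`. -/
def BriefMatch (l : ℤ) (W : ℕ) (S Q : ℕ → ℤ → Prop) (i : ℤ) (c C : ℕ) : Prop :=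
  (∃ bl, i - l ≤ bl ∧ bl < i ∧ (∀ c' < c + 1 + W, ¬S c' bl) ∧
    front Q (-1) i (c + 1) W ≤ bl) ∧
  (∃ br, i < br ∧ br ≤ i + l ∧ (∀ c' < c + 1 + W, ¬S c' br) ∧ br ≤ front Q 1 i (c + 1) W) ∧
  (∀ w < W, ¬S (c + 1 + w) (front Q 1 i (c + 1) w - 1)) ∧
  (∀ w < W, ¬S (c + 1 + w) (front Q (-1) i (c + 1) w + 1)) ∧
  ∀ g, i - l ≤ g → g ≤ i + l → ∃ c', c + 1 + W ≤ c' ∧ c' < C ∧ S c' g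

namespace IsEvolution

variable {N d : ℤ} {K : ℕ} {z : ℕ → ℤ → Fin 3} {S M Q : ℕ → ℤ → Prop}

lemma front_le_succ (Q : ℕ → ℤ → Prop) (x : ℤ) (c w : ℕ) :
    front Q 1 x c w ≤ front Q 1 x c (w + 1) := by
  by_cases h : Q (c + w) (front Q 1 x c w)
  · rw [front_succ_of _ _ _ _ _ h]; omega
  · rw [front_succ_of_not _ _ _ _ _ h]

lemma front_succ_le (Q : ℕ → ℤ → Prop) (x : ℤ) (c w : ℕ) :
    front Q (-1) x c (w + 1) ≤ front Q (-1) x c w := by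
  by_cases h : Q (c + w) (front Q (-1) x c w)
  · rw [front_succ_of _ _ _ _ _ h]; omega
  · rw [front_succ_of_not _ _ _ _ _ h]

lemma le_front (Q : ℕ → ℤ → Prop) (x : ℤ) (c w : ℕ) : x ≤ front Q 1 x c w := by
  induction w with
  | zero => exact le_rfl
  | succ w ih => exact ih.trans (front_le_succ Q x c w)

lemma front_le (Q : ℕ → ℤ → Prop) (x : ℤ) (c w : ℕ) : front Q (-1) x c w ≤ x := by
  induction w with
  | zero => exact le_rfl
  | succ w ih => exact (front_succ_le Q x c w).trans ih

/-- The front started from `l` at step `0` moves at every propagation of its current site, whether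
or not that site burns. It therefore runs ahead of any real fire coming from the left of `l`, and
the two fronts bound a window in the sense of `window`. -/
lemma window_fronts (h : IsEvolution N K z S M Q) {l r : ℤ} (hl : -N ≤ l + 1) (hr : r ≤ N + 1)
    {c₀ C : ℕ} (hC : C ≤ K)
    (hM : ∀ c, c₀ ≤ c → c < C → ∀ g, l < g → g < r → ¬M c g)
    (h0 : ∀ g, front Q 1 l 0 c₀ < g → g < front Q (-1) r 0 c₀ → z c₀ g ≠ 2) :
    ∀ c, c₀ ≤ c → c ≤ C → ∀ g, front Q 1 l 0 c < g → g < front Q (-1) r 0 c → z c g ≠ 2 := by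
  refine h.window (F := fun c => front Q 1 l 0 c) (G := fun c => front Q (-1) r 0 c) hC
    (fun c _ _ => front_le_succ Q l 0 c) (fun c _ _ => front_succ_le Q r 0 c) ?_ ?_ ?_ ?_ ?_ h0
  · intro c _ _ _ hq
    exact (front_succ_of Q 1 l 0 c (by simpa using hq)).ge
  · intro c _ _ _ hq
    exact (front_succ_of Q (-1) r 0 c (by simpa using hq)).le
  · have := le_front Q l 0 c₀
    omega
  · have := front_le Q r 0 c₀
    omega
  · intro c h1 h2 g h3 h4
    have := le_front Q l 0 c
    have := front_le Q r 0 c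
    exact hM c h1 h2 g (by omega) (by omega)

/-- A site far from matches does not burn. -/
lemma not_burning_of_far (h : IsEvolution N K z S M Q) (hX : NoCrossing N d K Q) (hd : 0 < d)
    {g : ℤ} (hg : |g| + 2 * d ≤ N) {C : ℕ} (hC : C ≤ K)
    (hM : ∀ c < C, ∀ i, |i - g| < 2 * d → ¬M c i) : ∀ c ≤ C, z c g ≠ 2 := by
  have e1 := Int.emod_add_mul_ediv g d
  have e2 := Int.emod_nonneg g hd.ne'
  have e3 := Int.emod_lt_of_pos g hd
  have hgl : -|g| ≤ g := neg_abs_le g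
  have hgr : g ≤ |g| := le_abs_self g
  -- The window starts one block before the block of `g` and ends one block after it. As no front
  -- crosses a whole block, neither reaches the block of `g`, and the window stays within distance
  -- `2 * d` of `g`.
  have l1 : (g / d - 1) * d = d * (g / d) - d := by ring
  have l2 : (g / d + 2) * d = d * (g / d) + 2 * d := by ring
  have X1 := hX (g / d - 1) (by rw [l1, abs_le]; omega)
  have X2 := hX (g / d + 2) (by rw [l2, abs_le]; omega)
  intro c hc
  refine h.window_fronts (l := (g / d - 1) * d) (r := (g / d + 2) * d) (by omega) (by omega)
    (c₀ := 0) hC ?_ ?_ c (Nat.zero_le _) hc g ?_ ?_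
  · intro c _ hcC i h1 h2
    exact hM c hcC i (by rw [abs_lt]; omega)
  · intro i h1 h2
    simp only [front] at h1 h2
    rw [h.init i (by rw [abs_le]; omega)]; decide
  · have := (X1 c (by omega)).1; omega
  · have := (X2 c (by omega)).2; omega

/-- The neighbourhood of an isolated match: limits of a window, and the burning sites in it just
after the match. -/
lemma exists_window (h : IsEvolution N K z S M Q) (hX : NoCrossing N d K Q)
    (hI : MatchesIsolated N d K M) (hd : 0 < d) {i : ℤ} {c₀ : ℕ} (hi : |i| + 6 * d ≤ N)
    (hc : c₀ < K) (hm : M c₀ i) :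
    ∃ l r : ℤ, -N ≤ l + 1 ∧ r ≤ N + 1 ∧
      (∀ w ≤ K, l ≤ front Q 1 l 0 w ∧ front Q 1 l 0 w < i - 3 * d ∧
        i + 3 * d < front Q (-1) r 0 w ∧ front Q (-1) r 0 w ≤ r) ∧
      (∀ c < K, ∀ g, l < g → g < r → M c g → g = i ∧ c = c₀) ∧
      (∀ c ≤ c₀, ∀ g, front Q 1 l 0 c < g → g < front Q (-1) r 0 c → z c g ≠ 2) ∧
      (∀ g, front Q 1 l 0 (c₀ + 1) < g → g < front Q (-1) r 0 (c₀ + 1) → g ≠ i →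
        z (c₀ + 1) g ≠ 2) := by
  have e1 := Int.emod_add_mul_ediv i d
  have e2 := Int.emod_nonneg i hd.ne'
  have e3 := Int.emod_lt_of_pos i hd
  have hgl : -|i| ≤ i := neg_abs_le i
  have hgr : i ≤ |i| := le_abs_self i
  -- With these ends, the window is within `5 * d` of `i`, where isolation (up to `8 * d`) leaves a
  -- single match, and after losing at most one block on each side it still contains all sites
  -- within `3 * d` of `i`.
  have l1 : (i / d - 4) * d = d * (i / d) - 4 * d := by ring
  have l2 : (i / d + 5) * d = d * (i / d) + 5 * d := by ring
  have X1 := hX (i / d - 4) (by rw [l1, abs_le]; omega)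
  have X2 := hX (i / d + 5) (by rw [l2, abs_le]; omega)
  have hw : ∀ w ≤ K, (i / d - 4) * d ≤ front Q 1 ((i / d - 4) * d) 0 w ∧
      front Q 1 ((i / d - 4) * d) 0 w < i - 3 * d ∧
      i + 3 * d < front Q (-1) ((i / d + 5) * d) 0 w ∧
      front Q (-1) ((i / d + 5) * d) 0 w ≤ (i / d + 5) * d := by
    intro w hw
    have := (X1 w hw).1
    have := (X2 w hw).2
    exact ⟨le_front _ _ _ _, by omega, by omega, front_le _ _ _ _⟩
  have honly : ∀ c < K, ∀ g, (i / d - 4) * d < g → g < (i / d + 5) * d → M c g →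
      g = i ∧ c = c₀ := fun c hcK g h1 h2 hM =>
    hI g c i c₀ (by rw [abs_le]; omega) (by rw [abs_le]; omega) hcK hc hM hm
      (by rw [abs_le]; omega)
  have hbefore : ∀ c ≤ c₀, ∀ g, front Q 1 ((i / d - 4) * d) 0 c < g →
      g < front Q (-1) ((i / d + 5) * d) 0 c → z c g ≠ 2 := by
    intro c hcc
    refine h.window_fronts (by omega) (by omega) (c₀ := 0) (C := c₀) hc.le ?_ ?_ c
      (Nat.zero_le _) hcc
    · intro c' _ hc' g h1 h2 hM
      have := (honly c' (by omega) g h1 h2 hM).2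
      omega
    · intro g h1 h2
      simp only [front] at h1 h2
      rw [h.init g (by rw [abs_le]; omega)]; decide
  refine ⟨(i / d - 4) * d, (i / d + 5) * d, by omega, by omega, hw, honly, hbefore, ?_⟩
  intro g h1 h2 hgi hz
  have w0 := hw c₀ hc.le
  have w1 := hw (c₀ + 1) (by omega)
  rcases h.burning_succ hc (by rw [abs_le]; omega) hz with ⟨b, -⟩ | ⟨-, hm' | ⟨hq, b⟩ | ⟨hq, b⟩⟩
  · refine hbefore c₀ le_rfl g ?_ ?_ b
    · exact (front_le_succ Q _ 0 c₀).trans_lt h1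
    · exact h2.trans_le (front_succ_le Q _ 0 c₀)
  · exact hgi (honly c₀ hc g (by omega) (by omega) hm').1
  · rcases eq_or_ne (g - 1) (front Q 1 ((i / d - 4) * d) 0 c₀) with he | he
    · have := front_succ_of Q 1 ((i / d - 4) * d) 0 c₀ (by rw [← he]; simpa using hq)
      omega
    · have := front_le_succ Q ((i / d - 4) * d) 0 c₀
      have := front_succ_le Q ((i / d + 5) * d) 0 c₀
      exact hbefore c₀ le_rfl (g - 1) (by omega) (by omega) b
  · rcases eq_or_ne (g + 1) (front Q (-1) ((i / d + 5) * d) 0 c₀) with he | he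
    · have := front_succ_of Q (-1) ((i / d + 5) * d) 0 c₀ (by rw [← he]; simpa using hq)
      omega
    · have := front_le_succ Q ((i / d - 4) * d) 0 c₀
      have := front_succ_le Q ((i / d + 5) * d) 0 c₀
      exact hbefore c₀ le_rfl (g + 1) (by omega) (by omega) b

/-- A lasting match is followed by an unoccupied site near it. -/
lemma exists_unoccupied (h : IsEvolution N K z S M Q) (hX : NoCrossing N d K Q)
    (hI : MatchesIsolated N d K M) (hd : 0 < d) {i l : ℤ} {c₀ C : ℕ} (hi : |i| + 6 * d ≤ N)
    (hl : 0 ≤ l) (hld : l ≤ d) (hc : c₀ < C) (hC : C ≤ K) (hm : M c₀ i)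
    (hL : LastingMatch l S Q i c₀ C) :
    ∀ c, c₀ + 1 ≤ c → c ≤ C → ∃ f, i ≤ f ∧ f ≤ i + l ∧ z c f ≠ 1 := by
  obtain ⟨x, y, hx, hy, hw, honly, hbefore, hafter⟩ :=
    h.exists_window hX hI hd hi (by omega) hm
  obtain ⟨hseed, hlast⟩ := hL
  have hgl : -|i| ≤ i := neg_abs_le i
  have hgr : i ≤ |i| := le_abs_self i
  have hocc : ∀ g, i ≤ g → g ≤ i + l → z c₀ g = 1 := by
    intro g h1 h2
    obtain ⟨c', h3, h4⟩ := hseed g h1 h2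
    refine h.occupied_of_seed (c₀ := 0) (by rw [abs_le]; omega) (by omega) (fun c _ hcc => ?_)
      ⟨c', Nat.zero_le _, h3, h4⟩
    have := hw c (by omega)
    exact hbefore c hcc g (by omega) (by omega)
  have w1 := hw (c₀ + 1) (by omega)
  have hz2 : z (c₀ + 1) i = 2 := h.ignite c₀ i (by omega) (by rw [abs_le]; omega)
    (hocc i le_rfl (by omega)) (Or.inl hm)
  have hz1 : ∀ g, i < g → g ≤ i + l → z (c₀ + 1) g = 1 := fun g h1 h2 =>
    h.one_succ (by omega) (by rw [abs_le]; omega) (hocc g h1.le h2)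
      (hafter g (by omega) (by omega) (by omega))
  -- If `j` is never reseeded, some site of `[i, j]` burns until the fire reaches `j`, and from then
  -- on `j` itself is unoccupied. In the other case the fire never leaves `[i, i + l]`: a fire at `i
  -- + l` would lie strictly between the front of the match and the outer front, where `window`
  -- excludes fires.
  rcases hlast with ⟨j, hij, hjl, hjS⟩ | hfront
  · intro c hc1 hcC
    rcases h.front_persists (i := i) (j := j) (by omega) (by omega) hij (c₀ := c₀ + 1) (C := C) hC
      hz2 (fun g h1 h2 => hz1 g h1 (by omega)) c hc1 hcC with
      ⟨f, h1, h2, h3, -⟩ | ⟨c', h1, h2, h3⟩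
    · exact ⟨f, h1, by omega, by rw [h3]; decide⟩
    · exact ⟨j, hij, hjl, h.ne_one_of_no_seed (by rw [abs_le]; omega) (c₀ := c') (C := C) hC
        (by rw [h3]; decide) (fun c'' h4 h5 => hjS c'' (by omega) h5) c h2 hcC⟩
  · intro c hc1 hcC
    rcases h.front_persists (i := i) (j := i + l) (by omega) (by omega) (by omega) (c₀ := c₀ + 1)
      (C := C) hC hz2 hz1 c hc1 hcC with ⟨f, h1, h2, h3, -⟩ | ⟨c', h1, h2, h3⟩
    · exact ⟨f, h1, h2, by rw [h3]; decide⟩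
    · exfalso
      have hwin := h.window (F := fun c => front Q 1 i (c₀ + 1) (c - (c₀ + 1)))
        (G := fun c => front Q (-1) y 0 c) (c₀ := c₀ + 1) (C := C) hC
        (fun c h4 _ => by
          show front Q 1 i (c₀ + 1) (c - (c₀ + 1)) ≤ front Q 1 i (c₀ + 1) (c + 1 - (c₀ + 1))
          rw [Nat.sub_add_comm h4]; exact front_le_succ _ _ _ _)
        (fun c _ _ => front_succ_le Q y 0 c)
        (fun c h4 _ _ hq => by
          show front Q 1 i (c₀ + 1) (c - (c₀ + 1)) + 1 ≤ front Q 1 i (c₀ + 1) (c + 1 - (c₀ + 1))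
          rw [Nat.sub_add_comm h4]
          exact (front_succ_of _ _ _ _ _ (by rwa [Nat.add_sub_cancel' h4])).ge)
        (fun c _ _ _ hq => (front_succ_of Q (-1) y 0 c (by simpa using hq)).le)
        (by simp only [Nat.sub_self, front]; omega) (by omega)
        (fun c h4 h5 g h6 h7 hM => by
          have a1 := le_front Q i (c₀ + 1) (c - (c₀ + 1))
          have a2 := hw c (by omega)
          have a3 := (honly c (by omega) g (by omega) (by omega) hM).2
          omega)
        (fun g h4 h5 => by
          simp only [Nat.sub_self, front] at h4
          exact hafter g (by omega) h5 (by omega))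
      have a2 := hw c' (by omega)
      have a4 := hfront (c' - (c₀ + 1)) (by omega)
      exact hwin c' h1 (by omega) (i + l) (by simpa using a4) (by omega) h3

/-- A brief match has no lasting effect. -/
lemma occupied_of_brief (h : IsEvolution N K z S M Q) (hX : NoCrossing N d K Q)
    (hI : MatchesIsolated N d K M) (hd : 0 < d) {i l : ℤ} {c₀ W C₀ C : ℕ} (hi : |i| + 6 * d ≤ N)
    (hld : l ≤ d) (hc : c₀ + 1 + W ≤ C₀) (hCC : C₀ ≤ C) (hC : C ≤ K) (hm : M c₀ i)
    (hB : BriefMatch l W S Q i c₀ C₀) {g : ℤ} (hgi : |g - i| ≤ 3 * d)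
    (hg : ∃ c < C₀, S c g) : z C g = 1 := by
  obtain ⟨x, y, hx, hy, hw, honly, hbefore, hafter⟩ :=
    h.exists_window hX hI hd hi (by omega) hm
  obtain ⟨⟨bl, hbl1, hbl2, hblS, hblF⟩, ⟨br, hbr1, hbr2, hbrS, hbrF⟩, hSF, hSG, hrefill⟩ := hB
  have hgl : -|i| ≤ i := neg_abs_le i
  have hgr : i ≤ |i| := le_abs_self i
  rw [abs_le] at hgi
  set c₁ := c₀ + 1 with hc₁
  set c₂ := c₁ + W with hc₂
  have hzl : ∀ c ≤ c₂, z c bl ≠ 2 := fun c hcc => by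
    rw [h.vacant_of_no_seed (by rw [abs_le]; omega) (C := c₂) (by omega) hblS c hcc]; decide
  have hzr : ∀ c ≤ c₂, z c br ≠ 2 := fun c hcc => by
    rw [h.vacant_of_no_seed (by rw [abs_le]; omega) (C := c₂) (by omega) hbrS c hcc]; decide
  have hnoM : ∀ c, c₁ ≤ c → c < K → ∀ g, x < g → g < y → ¬M c g := fun c h1 h2 g h3 h4 hM => by
    have := (honly c h2 g h3 h4 hM).2
    omega
  have w1 := hw c₁ (by omega)
  -- The barriers `bl` and `br` stay vacant until `c₂`, so the window splits into three independent
  -- parts: no fire enters the two outer ones, and in the middle only the two fronts of the match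
  -- burn.
  have hleft : ∀ c, c₁ ≤ c → c ≤ c₂ → ∀ g, front Q 1 x 0 c < g → g < bl → z c g ≠ 2 := by
    refine h.window (F := fun c => front Q 1 x 0 c) (G := fun _ => bl) (by omega)
      (fun c _ _ => front_le_succ Q x 0 c) (fun _ _ _ => le_rfl)
      (fun c _ _ _ hq => (front_succ_of Q 1 x 0 c (by simpa using hq)).ge)
      (fun c _ h2 h3 => absurd h3 (hzl c h2.le)) (by omega) (by omega)
      (fun c h1 h2 g h3 h4 => ?_) (fun g h3 h4 => ?_)
    · have := hw c (by omega)
      exact hnoM c h1 (by omega) g (by omega) (by omega)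
    · exact hafter g h3 (by omega) (by omega)
  have hright : ∀ c, c₁ ≤ c → c ≤ c₂ → ∀ g, br < g → g < front Q (-1) y 0 c → z c g ≠ 2 := by
    refine h.window (F := fun _ => br) (G := fun c => front Q (-1) y 0 c) (by omega)
      (fun _ _ _ => le_rfl) (fun c _ _ => front_succ_le Q y 0 c)
      (fun c _ h2 h3 => absurd h3 (hzr c h2.le))
      (fun c _ _ _ hq => (front_succ_of Q (-1) y 0 c (by simpa using hq)).le)
      (by omega) (by omega)
      (fun c h1 h2 g h3 h4 => ?_) (fun g h3 h4 => ?_)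
    · have := hw c (by omega)
      exact hnoM c h1 (by omega) g (by omega) (by omega)
    · exact hafter g (by omega) h4 (by omega)
  have hmid := h.fronts_only (bl := bl) (br := br) (i := i)
    (F := fun c => front Q 1 i c₁ (c - c₁)) (G := fun c => front Q (-1) i c₁ (c - c₁))
    (c₁ := c₁) (c₂ := c₂) (by omega) (by omega) (by omega) hbl2 hbr1
    (by simp [front]) (by simp [front])
    (fun c h1 _ hq => by
      simp only [Nat.sub_add_comm h1]
      exact front_succ_of _ _ _ _ _ (by rwa [Nat.add_sub_cancel' h1]))
    (fun c h1 _ hq => by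
      simp only [Nat.sub_add_comm h1]
      exact front_succ_of_not _ _ _ _ _ (by rwa [Nat.add_sub_cancel' h1]))
    (fun c h1 _ hq => by
      simp only [Nat.sub_add_comm h1]
      exact front_succ_of _ _ _ _ _ (by rwa [Nat.add_sub_cancel' h1]))
    (fun c h1 _ hq => by
      simp only [Nat.sub_add_comm h1]
      exact front_succ_of_not _ _ _ _ _ (by rwa [Nat.add_sub_cancel' h1]))
    (fun c h1 h2 g h3 h4 => hnoM c h1 (by omega) g (by omega) (by omega))
    (fun c _ h2 => hzl c h2) (fun c _ h2 => hzr c h2)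
    (fun c h1 h2 => by
      have := hSF (c - c₁) (by omega)
      rwa [Nat.add_sub_cancel' h1] at this)
    (fun c h1 h2 => by
      have := hSG (c - c₁) (by omega)
      rwa [Nat.add_sub_cancel' h1] at this)
    (fun g h1 h2 h3 => by
      by_contra hne
      exact hafter g (by omega) (by omega) hne h3)
  -- At step `c₂` both fronts have reached or passed the barriers, hence no site between them is
  -- burning any more.
  have hdead : ∀ g, front Q 1 x 0 c₂ < g → g < front Q (-1) y 0 c₂ → z c₂ g ≠ 2 := by
    intro g h1 h2 h3
    rcases lt_trichotomy g bl with hlt | heq | hgt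
    · exact hleft c₂ (by omega) le_rfl g h1 hlt h3
    · exact hzl c₂ le_rfl (heq ▸ h3)
    rcases lt_trichotomy g br with hlt' | heq' | hgt'
    · have := hmid c₂ (by omega) le_rfl g hgt hlt' h3
      simp only [hc₂, Nat.add_sub_cancel_left] at this
      omega
    · exact hzr c₂ le_rfl (heq' ▸ h3)
    · exact hright c₂ (by omega) le_rfl g hgt' h2 h3
  have hend : ∀ c, c₂ ≤ c → c ≤ C → z c g ≠ 2 := by
    intro c h1 h2
    have := hw c (by omega)
    exact h.window_fronts hx hy hC
      (fun c h3 h4 g h5 h6 => hnoM c (by omega) (by omega) g h5 h6) hdead c h1 h2 g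
      (by omega) (by omega)
  have hgN : |g| ≤ N := by rw [abs_le]; omega
  -- Between the barriers the tree may have burnt, and a seed after `c₂` is needed. Outside them `g`
  -- has never burnt, and any earlier seed will do.
  by_cases hgb : bl ≤ g ∧ g ≤ br
  · obtain ⟨c', h1, h2, h3⟩ := hrefill g (by omega) (by omega)
    exact h.occupied_of_seed hgN hC hend ⟨c', h1, by omega, h3⟩
  · obtain ⟨c', h1, h2⟩ := hg
    refine h.occupied_of_seed (c₀ := 0) hgN hC (fun c _ hcC => ?_) ⟨c', Nat.zero_le _, by omega, h2⟩
    rcases le_or_gt c c₀ with h3 | h3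
    · have := hw c (by omega)
      exact hbefore c h3 g (by omega) (by omega)
    rcases le_or_gt c c₂ with h4 | h4
    · have := hw c (by omega)
      rcases lt_or_ge g bl with h5 | h5
      · exact hleft c (by omega) h4 g (by omega) h5
      · exact hright c (by omega) h4 g (by omega) (by omega)
    · exact hend c h4.le hcC

end IsEvolution

/-! ### Jump integrals -/

lemma leftLim_eq_of_const {E : Type*} [TopologicalSpace E] [T2Space E] {f : ℝ≥0 → E} {s u : ℝ≥0} (hsu : s < u)
    (h : ∀ v, s ≤ v → v < u → f v = f s) : Function.leftLim f u = f s := by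
  have : (𝓝[<] u).NeBot := nhdsLT_neBot_of_exists_lt ⟨s, hsu⟩
  refine leftLim_eq_of_tendsto ?_
  refine tendsto_const_nhds.congr' ?_
  filter_upwards [Ioo_mem_nhdsLT hsu] with v hv
  exact (h v hv.1.le hv.2).symm

/-- A monotone function is injective on its jump times, and its values up to `t` are at most `f t`.
Finiteness is what allows the sum to be split: `finsum` is zero by convention on an infinite
support. -/
lemma finite_jumps {f : ℝ≥0 → ℕ} (hf : Monotone f) (t : ℝ≥0) (φ : ℝ≥0 → ℤ) :
    (Ioc 0 t ∩ Function.support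
      fun s => φ s * ((f s : ℤ) - ((Function.leftLim f s : ℕ) : ℤ))).Finite := by
  refine Set.Finite.of_injOn (f := f) (t := Iic (f t)) (fun s hs => hf hs.1.2) ?_
    (Set.finite_Iic _)
  have key : ∀ a b : ℝ≥0, b ∈ Function.support
      (fun s => φ s * ((f s : ℤ) - ((Function.leftLim f s : ℕ) : ℤ))) → a < b → f a ≠ f b := by
    intro a b hb hab he
    have h1 := hf.le_leftLim hab
    have h2 := hf.leftLim_le (le_refl b)
    have : (Function.leftLim f b : ℕ) = f b := le_antisymm h2 (he ▸ h1)
    simp [this] at hb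
  intro a ha b hb hab
  rcases lt_trichotomy a b with h | h | h
  · exact absurd hab (key a b hb.2 h)
  · exact h
  · exact absurd hab.symm (key b a ha.2 h)

lemma jumpIntegral_eq_add {f : ℝ≥0 → ℕ} (hf : Monotone f) (φ : ℝ≥0 → ℤ) {s u t : ℝ≥0}
    (hsu : s < u) (hut : u ≤ t) (h1 : ∀ v, s ≤ v → v < u → f v = f s)
    (h2 : ∀ v, u ≤ v → v ≤ t → f v = f t) :
    jumpIntegral φ f t = jumpIntegral φ f s + φ u * ((f t : ℤ) - f s) := by
  have hst : s ≤ t := hsu.le.trans hut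
  have hdisj : Disjoint (Ioc (0 : ℝ≥0) s) (Ioc s t) := by
    rw [Set.disjoint_left]
    exact fun x hx hx' => absurd hx.2 (not_le.2 hx'.1)
  have hU : Ioc (0 : ℝ≥0) t = Ioc 0 s ∪ Ioc s t := (Ioc_union_Ioc_eq_Ioc zero_le hst).symm
  unfold jumpIntegral
  rw [hU, finsum_mem_union' hdisj (finite_jumps hf s φ)
    ((finite_jumps hf t φ).subset (inter_subset_inter_left _ (Ioc_subset_Ioc_left zero_le)))]
  congr 1
  have hzero : ∀ v ∈ Ioc s t, v ≠ u →
      φ v * ((f v : ℤ) - ((Function.leftLim f v : ℕ) : ℤ)) = 0 := by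
    intro v hv hvu
    have : Function.leftLim f v = f v := by
      rcases lt_or_gt_of_ne hvu with hlt | hgt
      · rw [leftLim_eq_of_const hv.1 (fun w hw hw' => h1 w hw (hw'.trans hlt)),
          h1 v hv.1.le hlt]
      · rw [leftLim_eq_of_const hgt
          (fun w hw hw' => by rw [h2 w hw (hw'.le.trans hv.2), h2 u le_rfl hut]),
          h2 v hgt.le hv.2, h2 u le_rfl hut]
    rw [this]; simp
  rw [finsum_mem_eq_sum_of_subset (t := {u}) _ ?_ ?_, Finset.sum_singleton,
    leftLim_eq_of_const hsu h1, h2 u le_rfl hut]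
  · intro v hv
    by_contra hvu
    exact hv.2 (hzero v hv.1 (by simpa using hvu))
  · simpa using ⟨hsu, hut⟩

/-- The jump time is the infimum of the times at which `f` exceeds `f s`. Right continuity makes the
jump already effective at that time, and there is no room for a second one. -/
lemma exists_jump_time {f : ℝ≥0 → ℕ} (hf : Monotone f) (hc : IsCadlag f) {s t : ℝ≥0}
    (h : f t = f s + 1) : ∃ u, s < u ∧ u ≤ t ∧ (∀ v, s ≤ v → v < u → f v = f s) ∧
      ∀ v, u ≤ v → v ≤ t → f v = f t := by
  have hst : s < t := by
    by_contra hts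
    have := hf (not_lt.1 hts)
    omega
  set A : Set ℝ≥0 := {v | f s < f v} with hA
  have htA : t ∈ A := by show f s < f t; omega
  have hAs : ∀ v ∈ A, s ≤ v := fun v hv => by
    by_contra hlt
    have := hf (not_le.1 hlt).le
    have : f s < f v := hv
    omega
  have hbdd : BddBelow A := ⟨s, hAs⟩
  set u := sInf A with hu
  have hut : u ≤ t := csInf_le hbdd htA
  have hsu : s ≤ u := le_csInf ⟨t, htA⟩ hAs
  have hlt : ∀ v, v < u → f v ≤ f s := fun v hv => by
    by_contra hcon
    exact absurd (csInf_le hbdd (show v ∈ A from not_le.1 hcon)) (not_le.2 hv)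
  have hright : ∀ v, (∀ᶠ w in 𝓝[≥] v, f w = f v) := fun v =>
    (hc v).1.eventually (p := fun y => y = f v)
      (by rw [nhds_discrete]; exact Filter.eventually_pure.2 rfl)
  have huA : f s < f u := by
    by_contra hcon
    obtain ⟨w, hw, hw'⟩ := mem_nhdsGE_iff_exists_Ico_subset' (show u < u + 1 by simp) |>.1 (hright u)
    have : w ≤ u := le_csInf ⟨t, htA⟩ fun x hx => by
      by_contra hxw
      have hux : u ≤ x := csInf_le hbdd hx
      have h1 : f x = f u := hw' ⟨hux, not_le.1 hxw⟩
      have h2 : f s < f x := hx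
      omega
    exact absurd hw (not_lt.2 this)
  have hsu' : s < u := lt_of_le_of_ne hsu fun he => by rw [he] at huA; exact lt_irrefl _ huA
  refine ⟨u, hsu', hut, fun v h1 h2 => le_antisymm (hlt v h2) (hf h1), fun v h1 h2 => ?_⟩
  have := hf h1
  have := hf h2
  omega

/-! ### The forest fire path over a short time interval -/

/-- Regular paths of a forest fire process. -/
structure IsRegularFire (ξ : ℝ≥0 → ℤ → Fin 3) (nS nM nP : ℤ → ℝ≥0 → ℕ) : Prop where
  cadlag : ∀ i, IsCadlag (fun t => ξ t i)
  eqn : ForestFireEquation ξ nS nM nP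
  monoS : ∀ i, Monotone (nS i)
  monoM : ∀ i, Monotone (nM i)
  monoP : ∀ i, Monotone (nP i)
  cadlagS : ∀ i, IsCadlag (nS i)
  cadlagM : ∀ i, IsCadlag (nM i)
  cadlagP : ∀ i, IsCadlag (nP i)

/-- On `[s, t]` the counting function `f` can only jump at `u`. -/
def OnlyJumpsAt (f : ℝ≥0 → ℕ) (s u t : ℝ≥0) : Prop :=
  (∀ v, s ≤ v → v < u → f v = f s) ∧ ∀ v, u ≤ v → v ≤ t → f v = f t

namespace IsRegularFire

variable {ξ : ℝ≥0 → ℤ → Fin 3} {nS nM nP : ℤ → ℝ≥0 → ℕ}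

lemma zero_eq (h : IsRegularFire ξ nS nM nP) (i : ℤ) : ξ 0 i = 0 := by
  have := h.eqn i 0
  simp only [jumpIntegral, Ioc_self, mem_empty_iff_false, finsum_false, finsum_zero, add_zero,
    mul_zero, sub_zero] at this
  apply Fin.ext
  simpa using this

lemma eq_add (h : IsRegularFire ξ nS nM nP) {i : ℤ} {s u t : ℝ≥0} (hsu : s < u) (hut : u ≤ t)
    (hS : OnlyJumpsAt (nS i) s u t) (hM : OnlyJumpsAt (nM i) s u t)
    (hP : ∀ j, i - 1 ≤ j → j ≤ i + 1 → OnlyJumpsAt (nP j) s u t) :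
    (((ξ t i : Fin 3) : ℕ) : ℤ) = (((ξ s i : Fin 3) : ℕ) : ℤ)
      + ind (Function.leftLim (fun v => ξ v i) u = 0) * ((nS i t : ℤ) - nS i s)
      + ind (Function.leftLim (fun v => ξ v i) u = 1) * ((nM i t : ℤ) - nM i s)
      + ind (Function.leftLim (fun v => ξ v (i + 1)) u = 2 ∧
          Function.leftLim (fun v => ξ v i) u = 1) * ((nP (i + 1) t : ℤ) - nP (i + 1) s)
      + ind (Function.leftLim (fun v => ξ v (i - 1)) u = 2 ∧
          Function.leftLim (fun v => ξ v i) u = 1) * ((nP (i - 1) t : ℤ) - nP (i - 1) s)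
      - 2 * (ind (Function.leftLim (fun v => ξ v i) u = 2) * ((nP i t : ℤ) - nP i s)) := by
  have e1 := h.eqn i s
  have e2 := h.eqn i t
  have p0 := hP i (by omega) (by omega)
  have p1 := hP (i + 1) (by omega) (by omega)
  have p2 := hP (i - 1) (by omega) (by omega)
  rw [jumpIntegral_eq_add (h.monoS i) _ hsu hut hS.1 hS.2,
    jumpIntegral_eq_add (h.monoM i) _ hsu hut hM.1 hM.2,
    jumpIntegral_eq_add (h.monoP i) _ hsu hut p0.1 p0.2,
    jumpIntegral_eq_add (h.monoP (i + 1)) _ hsu hut p1.1 p1.2,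
    jumpIntegral_eq_add (h.monoP (i - 1)) _ hsu hut p2.1 p2.2] at e2
  rw [e2, e1]
  ring

lemma eq_of_no_jump (h : IsRegularFire ξ nS nM nP) {i : ℤ} {s t : ℝ≥0} (hst : s ≤ t)
    (hS : nS i t = nS i s) (hM : nM i t = nM i s)
    (hP : ∀ j, i - 1 ≤ j → j ≤ i + 1 → nP j t = nP j s) : ξ t i = ξ s i := by
  rcases hst.eq_or_lt with rfl | hlt
  · rfl
  have aux : ∀ {f : ℝ≥0 → ℕ}, Monotone f → f t = f s → OnlyJumpsAt f s t t := by
    intro f hf he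
    refine ⟨fun v h1 h2 => le_antisymm (he ▸ hf h2.le) (hf h1), fun v h1 h2 => ?_⟩
    rw [le_antisymm h2 h1]
  have := h.eq_add hlt le_rfl (aux (h.monoS i) hS) (aux (h.monoM i) hM)
    (fun j h1 h2 => aux (h.monoP j) (hP j h1 h2))
  rw [hS, hM, hP i (by omega) (by omega), hP (i + 1) (by omega) (by omega),
    hP (i - 1) (by omega) (by omega)] at this
  apply Fin.ext
  have h3 : (((ξ t i : Fin 3) : ℕ) : ℤ) = (((ξ s i : Fin 3) : ℕ) : ℤ) := by rw [this]; ring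
  exact_mod_cast h3

/-- The transition over an interval in which the processes jump at most at one time. -/
lemma transition (h : IsRegularFire ξ nS nM nP) {N : ℤ} {s u t : ℝ≥0} (hsu : s < u) (hut : u ≤ t)
    (hJ : ∀ i, |i| ≤ N + 2 → OnlyJumpsAt (nS i) s u t ∧ OnlyJumpsAt (nM i) s u t ∧
      OnlyJumpsAt (nP i) s u t) :
    (∀ v, s ≤ v → v < u → ∀ i, |i| ≤ N + 1 → ξ v i = ξ s i) ∧
    (∀ v, u ≤ v → v ≤ t → ∀ i, |i| ≤ N → ξ v i = ξ t i) ∧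
    ∀ i, |i| ≤ N → (((ξ t i : Fin 3) : ℕ) : ℤ) = (((ξ s i : Fin 3) : ℕ) : ℤ)
      + ind (ξ s i = 0) * ((nS i t : ℤ) - nS i s)
      + ind (ξ s i = 1) * ((nM i t : ℤ) - nM i s)
      + ind (ξ s (i + 1) = 2 ∧ ξ s i = 1) * ((nP (i + 1) t : ℤ) - nP (i + 1) s)
      + ind (ξ s (i - 1) = 2 ∧ ξ s i = 1) * ((nP (i - 1) t : ℤ) - nP (i - 1) s)
      - 2 * (ind (ξ s i = 2) * ((nP i t : ℤ) - nP i s)) := by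
  have hbefore : ∀ v, s ≤ v → v < u → ∀ i, |i| ≤ N + 1 → ξ v i = ξ s i := by
    intro v h1 h2 i hi
    rw [abs_le] at hi
    refine h.eq_of_no_jump h1 ((hJ i (by rw [abs_le]; omega)).1.1 v h1 h2)
      ((hJ i (by rw [abs_le]; omega)).2.1.1 v h1 h2)
      (fun j h3 h4 => (hJ j (by rw [abs_le]; omega)).2.2.1 v h1 h2)
  have hafter : ∀ v, u ≤ v → v ≤ t → ∀ i, |i| ≤ N → ξ v i = ξ t i := by
    intro v h1 h2 i hi
    rw [abs_le] at hi
    refine (h.eq_of_no_jump h2 ((hJ i (by rw [abs_le]; omega)).1.2 v h1 h2).symm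
      ((hJ i (by rw [abs_le]; omega)).2.1.2 v h1 h2).symm
      (fun j h3 h4 => ((hJ j (by rw [abs_le]; omega)).2.2.2 v h1 h2).symm)).symm
  refine ⟨hbefore, hafter, fun i hi => ?_⟩
  rw [abs_le] at hi
  -- The integrands of the equation look at left limits at `u`. Nothing happens between `s` and `u`,
  -- so these are the states at `s`. Since a site depends on its neighbours, one site is lost on
  -- each side here, and one more after the jump.
  have hl : ∀ j, |j| ≤ N + 1 → Function.leftLim (fun v => ξ v j) u = ξ s j := fun j hj =>
    leftLim_eq_of_const (f := fun v => ξ v j) hsu fun v h1 h2 => hbefore v h1 h2 j hj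
  have := h.eq_add (i := i) hsu hut (hJ i (by rw [abs_le]; omega)).1
    (hJ i (by rw [abs_le]; omega)).2.1 (fun j h3 h4 => (hJ j (by rw [abs_le]; omega)).2.2)
  rwa [hl i (by rw [abs_le]; omega), hl (i + 1) (by rw [abs_le]; omega),
    hl (i - 1) (by rw [abs_le]; omega)] at this

/-- Over an interval with at most one jump, the transition follows the rules of `IsEvolution`. -/
lemma exists_jump (h : IsRegularFire ξ nS nM nP) {N : ℤ} {s t : ℝ≥0} (hst : s < t)
    (h1 : ∀ (k : Fin 3) i, |i| ≤ N + 2 → (![nS, nM, nP] k) i t ≤ (![nS, nM, nP] k) i s + 1)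
    (h2 : ∀ (k k' : Fin 3) i i', |i| ≤ N + 2 → |i'| ≤ N + 2 →
      (![nS, nM, nP] k) i t ≠ (![nS, nM, nP] k) i s →
      (![nS, nM, nP] k') i' t ≠ (![nS, nM, nP] k') i' s → k = k' ∧ i = i') :
    ∃ u, s < u ∧ u ≤ t ∧ ∀ i, |i| ≤ N + 2 → OnlyJumpsAt (nS i) s u t ∧
      OnlyJumpsAt (nM i) s u t ∧ OnlyJumpsAt (nP i) s u t := by
  have hmono : ∀ k i, Monotone ((![nS, nM, nP] k) i) := by
    intro k i
    fin_cases k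
    exacts [h.monoS i, h.monoM i, h.monoP i]
  have hcad : ∀ k i, IsCadlag ((![nS, nM, nP] k) i) := by
    intro k i
    fin_cases k
    exacts [h.cadlagS i, h.cadlagM i, h.cadlagP i]
  suffices hk : ∃ u, s < u ∧ u ≤ t ∧ ∀ (k : Fin 3) i, |i| ≤ N + 2 →
      OnlyJumpsAt ((![nS, nM, nP] k) i) s u t by
    obtain ⟨u, hu1, hu2, hu3⟩ := hk
    exact ⟨u, hu1, hu2, fun i hi => ⟨hu3 0 i hi, hu3 1 i hi, hu3 2 i hi⟩⟩
  have hconst : ∀ (k : Fin 3) i, (![nS, nM, nP] k) i t = (![nS, nM, nP] k) i s →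
      ∀ u, s ≤ u → u ≤ t → OnlyJumpsAt ((![nS, nM, nP] k) i) s u t := by
    intro k i he u hsu hu
    refine ⟨fun v a b => le_antisymm (he ▸ hmono k i (b.le.trans hu)) (hmono k i a),
      fun v a b => le_antisymm (hmono k i b) (he ▸ hmono k i (hsu.trans a))⟩
  by_cases hex : ∃ (k : Fin 3) (i : ℤ), |i| ≤ N + 2 ∧
      (![nS, nM, nP] k) i t ≠ (![nS, nM, nP] k) i s
  · obtain ⟨k, i, hi, hne⟩ := hex
    have hle := hmono k i hst.le
    have h1' := h1 k i hi
    obtain ⟨u, hu1, hu2, hu3⟩ := exists_jump_time (hmono k i) (hcad k i)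
      (show (![nS, nM, nP] k) i t = (![nS, nM, nP] k) i s + 1 by omega)
    refine ⟨u, hu1, hu2, fun k' i' hi' => ?_⟩
    by_cases he : (![nS, nM, nP] k') i' t = (![nS, nM, nP] k') i' s
    · exact hconst k' i' he u hu1.le hu2
    · obtain ⟨rfl, rfl⟩ := h2 k k' i i' hi hi' hne he
      exact hu3
  · push Not at hex
    exact ⟨t, hst, le_rfl, fun k i hi => hconst k i (hex k i hi) t hst.le le_rfl⟩

end IsRegularFire

/-- The counting process `n i` has a jump in the time cell `(c h, (c + 1) h]`. -/
def rings (n : ℤ → ℝ≥0 → ℕ) (h : ℝ≥0) (c : ℕ) (i : ℤ) : Prop :=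
  n i (((c + 1 : ℕ) : ℝ≥0) * h) - n i ((c : ℝ≥0) * h) ≠ 0

/-- The three families of counting processes have in total at most one jump in each cell. -/
def SimpleCells (N : ℤ) (K : ℕ) (n : Fin 3 → ℤ → ℝ≥0 → ℕ) (h : ℝ≥0) : Prop :=
  (∀ c < K, ∀ k i, |i| ≤ N → n k i (((c + 1 : ℕ) : ℝ≥0) * h) - n k i ((c : ℝ≥0) * h) ≤ 1) ∧
  ∀ c < K, ∀ k k' i i', |i| ≤ N → |i'| ≤ N → rings (n k) h c i → rings (n k') h c i' →
    k = k' ∧ i = i'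

/-- With at most one jump per cell near the box, the integral equation over a cell reduces to one
transition from the state at its beginning, and at an intermediate time the configuration is that of
one of the two ends. The margin `2` around the box pays for the dependence on neighbours. -/
lemma IsRegularFire.isEvolution {ξ : ℝ≥0 → ℤ → Fin 3} {nS nM nP : ℤ → ℝ≥0 → ℕ}
    (hr : IsRegularFire ξ nS nM nP) {N : ℤ} {K : ℕ} {h : ℝ≥0} (hh : 0 < h)
    (hs : SimpleCells (N + 2) K ![nS, nM, nP] h) :
    IsEvolution N K (fun c i => ξ ((c : ℝ≥0) * h) i) (rings nS h) (rings nM h) (rings nP h) ∧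
    ∀ c < K, ∀ v, (c : ℝ≥0) * h ≤ v → v ≤ ((c + 1 : ℕ) : ℝ≥0) * h →
      (∀ i, |i| ≤ N → ξ v i = ξ ((c : ℝ≥0) * h) i) ∨
      (∀ i, |i| ≤ N → ξ v i = ξ (((c + 1 : ℕ) : ℝ≥0) * h) i) := by
  have hmono : ∀ k i, Monotone ((![nS, nM, nP] k) i) := by
    intro k i
    fin_cases k
    exacts [hr.monoS i, hr.monoM i, hr.monoP i]
  have hlt : ∀ c : ℕ, (c : ℝ≥0) * h < ((c + 1 : ℕ) : ℝ≥0) * h := fun c => by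
    push_cast
    exact mul_lt_mul_of_pos_right (by simp) hh
  have hring : ∀ k c i, (![nS, nM, nP] k) i (((c + 1 : ℕ) : ℝ≥0) * h) ≠
      (![nS, nM, nP] k) i ((c : ℝ≥0) * h) → rings (![nS, nM, nP] k) h c i := by
    intro k c i hne
    have := hmono k i (hlt c).le
    unfold rings
    omega
  have hjump : ∀ c < K, ∃ u, (c : ℝ≥0) * h < u ∧ u ≤ ((c + 1 : ℕ) : ℝ≥0) * h ∧
      ∀ i, |i| ≤ N + 2 → OnlyJumpsAt (nS i) ((c : ℝ≥0) * h) u (((c + 1 : ℕ) : ℝ≥0) * h) ∧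
      OnlyJumpsAt (nM i) ((c : ℝ≥0) * h) u (((c + 1 : ℕ) : ℝ≥0) * h) ∧
      OnlyJumpsAt (nP i) ((c : ℝ≥0) * h) u (((c + 1 : ℕ) : ℝ≥0) * h) := by
    intro c hc
    refine hr.exists_jump (hlt c) (fun k i hi => ?_) (fun k k' i i' hi hi' h1 h2 => ?_)
    · have := hs.1 c hc k i hi
      omega
    · exact hs.2 c hc k k' i i' hi hi' (hring k c i h1) (hring k' c i' h2)
  have hmid : ∀ c < K, ∀ v, (c : ℝ≥0) * h ≤ v → v ≤ ((c + 1 : ℕ) : ℝ≥0) * h →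
      (∀ i, |i| ≤ N → ξ v i = ξ ((c : ℝ≥0) * h) i) ∨
      (∀ i, |i| ≤ N → ξ v i = ξ (((c + 1 : ℕ) : ℝ≥0) * h) i) := by
    intro c hc v h1 h2
    obtain ⟨u, hu1, hu2, hu3⟩ := hjump c hc
    obtain ⟨t1, t2, -⟩ := hr.transition hu1 hu2 hu3
    rcases lt_or_ge v u with h3 | h3
    · exact Or.inl fun i hi => t1 v h1 h3 i (by omega)
    · exact Or.inr fun i hi => t2 v h3 h2 i hi
  -- The natural numbers are the increments of the clocks seen by the site. The bound `dM + dR + dL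
  -- ≤ 1` prevents a double ignition, which would bring the sum of the equation above the value `2`
  -- of a burning site.
  have hform : ∀ c < K, ∀ i, |i| ≤ N → ∃ dS dM dR dL dP : ℕ,
      (dS ≠ 0 ↔ rings nS h c i) ∧ (dM ≠ 0 ↔ rings nM h c i) ∧ (dR ≠ 0 ↔ rings nP h c (i + 1)) ∧
      (dL ≠ 0 ↔ rings nP h c (i - 1)) ∧ (dP ≠ 0 ↔ rings nP h c i) ∧
      dS ≤ 1 ∧ dP ≤ 1 ∧ dM + dR + dL ≤ 1 ∧
      (((ξ (((c + 1 : ℕ) : ℝ≥0) * h) i : Fin 3) : ℕ) : ℤ) =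
        (((ξ ((c : ℝ≥0) * h) i : Fin 3) : ℕ) : ℤ) + ind (ξ ((c : ℝ≥0) * h) i = 0) * dS
        + ind (ξ ((c : ℝ≥0) * h) i = 1) * dM
        + ind (ξ ((c : ℝ≥0) * h) (i + 1) = 2 ∧ ξ ((c : ℝ≥0) * h) i = 1) * dR
        + ind (ξ ((c : ℝ≥0) * h) (i - 1) = 2 ∧ ξ ((c : ℝ≥0) * h) i = 1) * dL
        - 2 * (ind (ξ ((c : ℝ≥0) * h) i = 2) * dP) := by
    intro c hc i hi
    obtain ⟨u, hu1, hu2, hu3⟩ := hjump c hc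
    obtain ⟨-, -, t3⟩ := hr.transition hu1 hu2 hu3
    have e := t3 i hi
    rw [abs_le] at hi
    have b0 : |i| ≤ N + 2 := by rw [abs_le]; omega
    have b1 : |i + 1| ≤ N + 2 := by rw [abs_le]; omega
    have b2 : |i - 1| ≤ N + 2 := by rw [abs_le]; omega
    have m0 := hr.monoS i (hlt c).le
    have m1 := hr.monoM i (hlt c).le
    have m2 := hr.monoP (i + 1) (hlt c).le
    have m3 := hr.monoP (i - 1) (hlt c).le
    have m4 := hr.monoP i (hlt c).le
    have c0 := hs.1 c hc 0 i b0
    have c1 := hs.1 c hc 1 i b0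
    have c2 := hs.1 c hc 2 (i + 1) b1
    have c3 := hs.1 c hc 2 (i - 1) b2
    have c4 := hs.1 c hc 2 i b0
    have d1 := hs.2 c hc 1 2 i (i + 1) b0 b1
    have d2 := hs.2 c hc 1 2 i (i - 1) b0 b2
    have d3 := hs.2 c hc 2 2 (i + 1) (i - 1) b1 b2
    simp only [Matrix.cons_val_zero, Matrix.cons_val_one, Matrix.cons_val, rings] at c0 c1 c2 c3 c4 d1 d2 d3
    refine ⟨_, _, _, _, _, Iff.rfl, Iff.rfl, Iff.rfl, Iff.rfl, Iff.rfl, c0, c4, ?_, ?_⟩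
    · have e1 : (1 : Fin 3) ≠ 2 := by decide
      have e2 : i + 1 ≠ i - 1 := by omega
      simp only [e1, e2, and_false, false_and, imp_false, not_not] at d1 d2 d3
      omega
    · rw [e, Nat.cast_sub m0, Nat.cast_sub m1, Nat.cast_sub m2, Nat.cast_sub m3, Nat.cast_sub m4]
  have hi0 : ∀ p : Prop, p → ind p = 1 := fun p hp => by simp [ind, hp]
  have hi1 : ∀ p : Prop, ¬p → ind p = 0 := fun p hp => by simp [ind, hp]
  have hval : ∀ (x y : Fin 3), (((x : Fin 3) : ℕ) : ℤ) = (((y : Fin 3) : ℕ) : ℤ) → x = y :=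
    fun x y hxy => Fin.ext (by exact_mod_cast hxy)
  have n01 : ¬((0 : Fin 3) = 1) := by decide
  have n02 : ¬((0 : Fin 3) = 2) := by decide
  have n10 : ¬((1 : Fin 3) = 0) := by decide
  have n12 : ¬((1 : Fin 3) = 2) := by decide
  have n20 : ¬((2 : Fin 3) = 0) := by decide
  have n21 : ¬((2 : Fin 3) = 1) := by decide
  refine ⟨⟨?_, ?_, ?_, ?_, ?_, ?_, ?_⟩, hmid⟩
  · intro i _
    simpa using hr.zero_eq i
  · intro c i hc hi hz hS
    obtain ⟨dS, dM, dR, dL, dP, r1, r2, r3, r4, r5, l1, l2, l3, e⟩ := hform c hc i hi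
    rw [← r1] at hS
    have hz' : ξ ((c : ℝ≥0) * h) i = 0 := hz
    simp only [hz', n01, n02, and_false, hi0 True trivial, hi1 False not_false] at e
    apply hval
    rw [e]; simp; omega
  · intro c i hc hi hz hS
    obtain ⟨dS, dM, dR, dL, dP, r1, r2, r3, r4, r5, l1, l2, l3, e⟩ := hform c hc i hi
    rw [← r1] at hS
    have hz' : ξ ((c : ℝ≥0) * h) i = 0 := hz
    simp only [hz', n01, n02, and_false, hi0 True trivial, hi1 False not_false] at e
    apply hval
    rw [e]; simp; omega
  · intro c i hc hi hz hM hL hR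
    obtain ⟨dS, dM, dR, dL, dP, r1, r2, r3, r4, r5, l1, l2, l3, e⟩ := hform c hc i hi
    have hz' : ξ ((c : ℝ≥0) * h) i = 1 := hz
    rw [← r2] at hM
    simp only [hz', n10, n12, and_true, hi0 True trivial, hi1 False not_false] at e
    have aL : ind (ξ ((c : ℝ≥0) * h) (i - 1) = 2) * (dL : ℤ) = 0 := by
      by_cases hb : ξ ((c : ℝ≥0) * h) (i - 1) = 2
      · have : ¬rings nP h c (i - 1) := fun hq => hL ⟨hq, hb⟩
        rw [← r4, not_not] at this
        simp [this]
      · simp [hi1 _ hb]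
    have aR : ind (ξ ((c : ℝ≥0) * h) (i + 1) = 2) * (dR : ℤ) = 0 := by
      by_cases hb : ξ ((c : ℝ≥0) * h) (i + 1) = 2
      · have : ¬rings nP h c (i + 1) := fun hq => hR ⟨hq, hb⟩
        rw [← r3, not_not] at this
        simp [this]
      · simp [hi1 _ hb]
    rw [aL, aR] at e
    apply hval
    rw [e]; simp; omega
  · intro c i hc hi hz hI
    obtain ⟨dS, dM, dR, dL, dP, r1, r2, r3, r4, r5, l1, l2, l3, e⟩ := hform c hc i hi
    have hz' : ξ ((c : ℝ≥0) * h) i = 1 := hz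
    simp only [hz', n10, n12, and_true, hi0 True trivial, hi1 False not_false] at e
    apply hval
    rw [e]
    rcases hI with hm | ⟨hq, hb⟩ | ⟨hq, hb⟩
    · rw [← r2] at hm
      have a1 : dR = 0 := by omega
      have a2 : dL = 0 := by omega
      simp [a1, a2]; omega
    · rw [← r4] at hq
      have hb' : ξ ((c : ℝ≥0) * h) (i - 1) = 2 := hb
      have a1 : dR = 0 := by omega
      have a2 : dM = 0 := by omega
      simp [a1, a2, hi0 _ hb']; omega
    · rw [← r3] at hq
      have hb' : ξ ((c : ℝ≥0) * h) (i + 1) = 2 := hb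
      have a1 : dL = 0 := by omega
      have a2 : dM = 0 := by omega
      simp [a1, a2, hi0 _ hb']; omega
  · intro c i hc hi hz hQ
    obtain ⟨dS, dM, dR, dL, dP, r1, r2, r3, r4, r5, l1, l2, l3, e⟩ := hform c hc i hi
    rw [← r5, not_not] at hQ
    have hz' : ξ ((c : ℝ≥0) * h) i = 2 := hz
    simp only [hz', n20, n21, and_false, hi0 True trivial, hi1 False not_false, hQ] at e
    apply hval
    rw [e]; simp
  · intro c i hc hi hz hQ
    obtain ⟨dS, dM, dR, dL, dP, r1, r2, r3, r4, r5, l1, l2, l3, e⟩ := hform c hc i hi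
    rw [← r5] at hQ
    have hz' : ξ ((c : ℝ≥0) * h) i = 2 := hz
    simp only [hz', n20, n21, and_false, hi0 True trivial, hi1 False not_false] at e
    apply hval
    rw [e]; simp; omega

/-- A site without seeds stays vacant. -/
lemma IsRegularFire.vacant_of_no_seed {ξ : ℝ≥0 → ℤ → Fin 3} {nS nM nP : ℤ → ℝ≥0 → ℕ}
    (hr : IsRegularFire ξ nS nM nP) {i : ℤ} {T : ℝ≥0} (hS : nS i T = nS i 0) :
    ∀ t ≤ T, ξ t i = 0 := by
  by_contra hcon
  push Not at hcon
  obtain ⟨t₀, ht₀, hne⟩ := hcon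
  set A : Set ℝ≥0 := {t | ξ t i ≠ 0} with hA
  have hbdd : BddBelow A := OrderBot.bddBelow A
  -- Up to the first time `u` at which the site is not vacant all left limits are `0`, so only the
  -- seed integral could contribute at `u`, and there is no seed. Right continuity then keeps the
  -- site vacant a little after `u`, a contradiction.
  set u := sInf A with hu
  have hu0 : u ≤ t₀ := csInf_le hbdd hne
  have hlt : ∀ v, v < u → ξ v i = 0 := fun v hv => by
    by_contra hv'
    exact absurd (csInf_le hbdd (show v ∈ A from hv')) (not_le.2 hv)
  have hleft : ∀ v, 0 < v → v ≤ u → Function.leftLim (fun w => ξ w i) v = 0 := fun v hv0 hvu => by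
    rw [leftLim_eq_of_const (f := fun w => ξ w i) hv0
      (fun w _ hw => by rw [hlt w (hw.trans_le hvu), hr.zero_eq])]
    exact hr.zero_eq i
  have hind : ∀ p : Prop, ¬p → ind p = 0 := fun p hp => by simp [ind, hp]
  have n01 : ¬((0 : Fin 3) = 1) := by decide
  have n02 : ¬((0 : Fin 3) = 2) := by decide
  have hju : ξ u i = 0 := by
    have e := hr.eqn i u
    have z1 : ∀ (φ : ℝ≥0 → ℤ) (f : ℝ≥0 → ℕ), (∀ s, 0 < s → s ≤ u → φ s = 0) →
        jumpIntegral φ f u = 0 := fun φ f hφ => by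
      unfold jumpIntegral
      refine finsum_mem_eq_zero_of_forall_eq_zero fun s hs => ?_
      rw [hφ s hs.1 hs.2, zero_mul]
    have z2 : ∀ φ : ℝ≥0 → ℤ, jumpIntegral φ (nS i) u = 0 := fun φ => by
      unfold jumpIntegral
      refine finsum_mem_eq_zero_of_forall_eq_zero fun s hs => ?_
      have hc : ∀ v, v ≤ T → nS i v = nS i 0 := fun v hv =>
        le_antisymm (hS ▸ hr.monoS i hv) (hr.monoS i zero_le)
      rw [leftLim_eq_of_const (f := nS i) hs.1
        (fun v _ hv => hc v (hv.le.trans (hs.2.trans (hu0.trans ht₀)))),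
        hc s (hs.2.trans (hu0.trans ht₀)), sub_self, mul_zero]
    simp only at e
    rw [z2, z1 _ (nM i) (fun s h1 h2 => hind _ (by rw [hleft s h1 h2]; exact n01)),
      z1 _ (nP (i + 1)) (fun s h1 h2 => hind _ (by rw [hleft s h1 h2]; exact fun h => n01 h.2)),
      z1 _ (nP (i - 1)) (fun s h1 h2 => hind _ (by rw [hleft s h1 h2]; exact fun h => n01 h.2)),
      z1 _ (nP i) (fun s h1 h2 => hind _ (by rw [hleft s h1 h2]; exact n02))] at e
    simpa using e
  have hright : ∀ᶠ w in 𝓝[≥] u, ξ w i = 0 := by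
    have := (hr.cadlag i u).1.eventually (p := fun y => y = ξ u i)
      (by rw [nhds_discrete]; exact Filter.eventually_pure.2 rfl)
    rwa [hju] at this
  obtain ⟨w, hw, hw'⟩ :=
    mem_nhdsGE_iff_exists_Ico_subset' (show u < u + 1 by simp) |>.1 hright
  have : w ≤ u := le_csInf ⟨t₀, hne⟩ fun x hx => by
    by_contra hxw
    exact hx (hw' ⟨csInf_le hbdd hx, not_le.1 hxw⟩)
  exact absurd hw (not_lt.2 this)

/-! ### Poisson measures -/

lemma poissonMeasure_zero (r : ℝ≥0) : poissonMeasure r {0} = ENNReal.ofReal (Real.exp (-r)) := by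
  rw [poissonMeasure_singleton]; simp

lemma poissonMeasure_ne_zero_le (r : ℝ≥0) : poissonMeasure r {n | n ≠ 0} ≤ r := by
  have : {n : ℕ | n ≠ 0} = {0}ᶜ := by ext; simp
  rw [this, prob_compl_eq_one_sub (measurableSet_singleton 0), poissonMeasure_zero,
    ← ENNReal.ofReal_one, ← ENNReal.ofReal_sub _ (Real.exp_pos _).le, ← ENNReal.ofReal_coe_nnreal]
  exact ENNReal.ofReal_le_ofReal (by linarith [Real.add_one_le_exp (-(r : ℝ))])

/-- From `exp (-r) ≥ 1 - r`: the probability of at most one point is at least `(1 + r) * (1 - r)`.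
-/
lemma poissonMeasure_two_le (r : ℝ≥0) : poissonMeasure r {n | 2 ≤ n} ≤ (r : ℝ≥0∞) ^ 2 := by
  have : {n : ℕ | 2 ≤ n} = ({0} ∪ {1})ᶜ := by
    ext n
    simp only [mem_ofPred_eq, mem_compl_iff, mem_union, mem_singleton_iff]
    omega
  rw [this, prob_compl_eq_one_sub (.of_discrete),
    measure_union (by simp) (measurableSet_singleton 1), poissonMeasure_zero,
    poissonMeasure_singleton, ← ENNReal.ofReal_add (Real.exp_pos _).le (by positivity),
    ← ENNReal.ofReal_one, ← ENNReal.ofReal_sub _ (by positivity), ← ENNReal.ofReal_coe_nnreal,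
    ← ENNReal.ofReal_pow (NNReal.coe_nonneg r)]
  refine ENNReal.ofReal_le_ofReal ?_
  have h1 := Real.add_one_le_exp (-(r : ℝ))
  have h2 : (0 : ℝ) ≤ r := r.2
  simp only [pow_one, Nat.factorial_one, Nat.cast_one, div_one]
  nlinarith

namespace IsPoissonMeasure

variable {Ω E : Type*} [MeasurableSpace Ω] [MeasurableSpace E] {M : Ω → Measure E}
  {ν : Measure E} {P : Measure Ω}

lemma measure_eq (h : IsPoissonMeasure M ν P) {B : Set E} (hB : MeasurableSet B) (hν : ν B ≠ ∞)
    {p : ℝ≥0∞ → Prop} (hp : MeasurableSet {x | p x}) :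
    P {ω | p (M ω B)} = poissonMeasure (ν B).toNNReal {n | p n} := by
  rw [(h.law B hB hν).measure_eq hp, Measure.map_apply (by fun_prop) hp]
  rfl

lemma measure_zero (h : IsPoissonMeasure M ν P) {B : Set E} (hB : MeasurableSet B)
    (hν : ν B ≠ ∞) : P {ω | M ω B = 0} = ENNReal.ofReal (Real.exp (-(ν B).toReal)) := by
  rw [h.measure_eq hB hν (p := fun x => x = 0) (measurableSet_singleton 0)]
  simp only [Nat.cast_eq_zero, ofPred_eq_eq_singleton, poissonMeasure_zero]
  rfl

lemma measure_ne_zero_le (h : IsPoissonMeasure M ν P) {B : Set E} (hB : MeasurableSet B)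
    (hν : ν B ≠ ∞) : P {ω | M ω B ≠ 0} ≤ ν B := by
  rw [h.measure_eq hB hν (p := fun x => x ≠ 0) (measurableSet_singleton 0).compl]
  simp only [ne_eq, Nat.cast_eq_zero]
  exact (poissonMeasure_ne_zero_le _).trans (ENNReal.coe_toNNReal hν).le

lemma measure_two_le (h : IsPoissonMeasure M ν P) {B : Set E} (hB : MeasurableSet B)
    (hν : ν B ≠ ∞) : P {ω | 2 ≤ M ω B} ≤ (ν B) ^ 2 := by
  rw [h.measure_eq hB hν (p := fun x => 2 ≤ x) measurableSet_Ici]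
  have : {n : ℕ | (2 : ℝ≥0∞) ≤ n} = {n | 2 ≤ n} := by ext n; simp
  rw [this]
  exact (poissonMeasure_two_le _).trans (by rw [ENNReal.coe_toNNReal hν])

lemma ae_ne_top (h : IsPoissonMeasure M ν P) {B : Set E} (hB : MeasurableSet B)
    (hν : ν B ≠ ∞) : ∀ᵐ ω ∂P, M ω B ≠ ∞ := by
  rw [ae_iff]
  simp only [ne_eq, not_not]
  rw [h.measure_eq hB hν (p := fun x => x = ∞) (measurableSet_singleton _)]
  simp

lemma ae_eq_zero (h : IsPoissonMeasure M ν P) {B : Set E} (hB : MeasurableSet B)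
    (hν : ν B = 0) : ∀ᵐ ω ∂P, M ω B = 0 := by
  rw [ae_iff]
  exact le_antisymm ((h.measure_ne_zero_le hB (by simp [hν])).trans hν.le) zero_le

end IsPoissonMeasure

/-! ### Atoms of the match measure -/

/-- The almost sure properties of the measure of matches. -/
structure GoodMarks (z₀ : ℝ) (μ : Measure (ℝ × ℝ)) : Prop where
  integer : ∀ B, MeasurableSet B → ∃ n : ℕ∞, μ B = n
  finite : ∀ A : ℕ, μ (Icc (-A : ℝ) A ×ˢ Icc (0 : ℝ) A) ≠ ∞
  pos : μ (univ ×ˢ Iic (0 : ℝ)) = 0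
  ne : μ (univ ×ˢ {z₀}) = 0
  simple : ∀ (x : ℝ) (A : ℕ), μ ({x} ×ˢ Icc (0 : ℝ) A) ≤ 1

/-- The finiteness and the two null sets come from the intensity. The real content is `simple`,
uniform over uncountably many abscissas: two marks above the same point would put two marks in one
strip of width `1 / (m + 1)` for every `m`, which is an event of probability zero. -/
lemma goodMarks_ae {Ω : Type*} [MeasurableSpace Ω] {P : Measure Ω} [IsProbabilityMeasure P]
    {M : Ω → Measure (ℝ × ℝ)}
    (h : IsPoissonMeasure M (volume.restrict (univ ×ˢ Ici (0 : ℝ))) P) (z₀ : ℝ) :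
    ∀ᵐ ω ∂P, GoodMarks z₀ (M ω) := by
  have hsq : MeasurableSet ((univ : Set ℝ) ×ˢ Ici (0 : ℝ)) := MeasurableSet.univ.prod measurableSet_Ici
  have hνle : ∀ B, volume.restrict (univ ×ˢ Ici (0 : ℝ)) B ≤ (volume : Measure (ℝ × ℝ)) B :=
    fun B => Measure.restrict_apply_le _ _
  have hvol : ∀ S T : Set ℝ, (volume : Measure (ℝ × ℝ)) (S ×ˢ T) = volume S * volume T :=
    fun S T => by rw [Measure.volume_eq_prod, Measure.prod_prod]
  have hfin : ∀ᵐ ω ∂P, ∀ A : ℕ, M ω (Icc (-A : ℝ) A ×ˢ Icc (0 : ℝ) A) ≠ ∞ := by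
    rw [ae_all_iff]
    intro A
    refine h.ae_ne_top (measurableSet_Icc.prod measurableSet_Icc)
      (ne_top_of_le_ne_top ?_ (hνle _))
    rw [hvol, Real.volume_Icc, Real.volume_Icc]
    exact ENNReal.mul_ne_top ENNReal.ofReal_ne_top ENNReal.ofReal_ne_top
  have hpos : ∀ᵐ ω ∂P, M ω (univ ×ˢ Iic (0 : ℝ)) = 0 := by
    refine h.ae_eq_zero (MeasurableSet.univ.prod measurableSet_Iic) ?_
    rw [Measure.restrict_apply (MeasurableSet.univ.prod measurableSet_Iic), prod_inter_prod,
      univ_inter, Iic_inter_Ici, Icc_self, hvol]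
    simp
  have hne : ∀ᵐ ω ∂P, M ω (univ ×ˢ {z₀}) = 0 := by
    refine h.ae_eq_zero (MeasurableSet.univ.prod (measurableSet_singleton _)) ?_
    refine le_antisymm ((hνle _).trans ?_) zero_le
    rw [hvol]; simp
  have hsimple : ∀ᵐ ω ∂P, ∀ A : ℕ, ∀ x ∈ Ico (-A : ℝ) A, M ω ({x} ×ˢ Icc (0 : ℝ) A) ≤ 1 := by
    rw [ae_all_iff]
    intro A
    set strip : ℕ → ℤ → Set (ℝ × ℝ) := fun m b =>
      Ico ((b : ℝ) / (m + 1 : ℕ)) ((b + 1) / (m + 1 : ℕ)) ×ˢ Icc (0 : ℝ) A with hstrip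
    set bad : ℕ → Set Ω := fun m =>
      ⋃ b ∈ Finset.Ico (-(A * (m + 1 : ℕ)) : ℤ) (A * (m + 1 : ℕ)), {ω | 2 ≤ M ω (strip m b)}
      with hbad
    have hm0 : ∀ m : ℕ, (0 : ℝ) < (m + 1 : ℕ) := fun m => by positivity
    have hstripν : ∀ m b, volume.restrict (univ ×ˢ Ici (0 : ℝ)) (strip m b) ≤
        ENNReal.ofReal (A / (m + 1 : ℕ)) := fun m b => by
      refine (hνle _).trans ?_
      rw [hstrip, hvol, Real.volume_Ico, Real.volume_Icc, ← ENNReal.ofReal_mul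
        (by rw [sub_nonneg]; gcongr; linarith)]
      refine ENNReal.ofReal_le_ofReal (le_of_eq ?_)
      field_simp
      ring
    -- There are `2 * A * (m + 1)` strips, each with two marks with probability at most the square
    -- of its intensity `A / (m + 1)`.
    have hPbad : ∀ m, P (bad m) ≤ ENNReal.ofReal (2 * A ^ 3 / (m + 1 : ℕ)) := by
      intro m
      refine (measure_biUnion_finset_le _ _).trans ?_
      refine (Finset.sum_le_sum (g := fun _ => ENNReal.ofReal ((A / (m + 1 : ℕ)) ^ 2))
        fun b _ => ?_).trans ?_
      · refine (h.measure_two_le (measurableSet_Ico.prod measurableSet_Icc)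
          (ne_top_of_le_ne_top ENNReal.ofReal_ne_top (hstripν m b))).trans ?_
        rw [ENNReal.ofReal_pow (by positivity)]
        gcongr
        exact hstripν m b
      · rw [Finset.sum_const, Int.card_Ico, nsmul_eq_mul, ← ENNReal.ofReal_natCast,
          ← ENNReal.ofReal_mul (by positivity)]
        refine ENNReal.ofReal_le_ofReal (le_of_eq ?_)
        have : (((A * (m + 1 : ℕ) : ℤ) - (-(A * (m + 1 : ℕ)) : ℤ)).toNat : ℝ) =
            2 * A * (m + 1 : ℕ) := by
          have h0 : ((A * (m + 1 : ℕ) : ℤ) - (-(A * (m + 1 : ℕ)) : ℤ)) =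
            ((2 * A * (m + 1) : ℕ) : ℤ) := by push_cast; ring
          rw [h0, Int.toNat_natCast]; push_cast; ring
        rw [this]
        have := (hm0 m).ne'
        field_simp
    have hnull : P (⋂ m, bad m) = 0 := by
      have hlim : Tendsto (fun m : ℕ => ENNReal.ofReal (2 * A ^ 3 / (m + 1 : ℕ))) atTop (𝓝 0) := by
        rw [← ENNReal.ofReal_zero]
        refine ENNReal.tendsto_ofReal ?_
        have := (tendsto_const_div_atTop_nhds_zero_nat (2 * (A : ℝ) ^ 3)).comp (tendsto_add_atTop_nat 1)
        exact this
      exact le_antisymm (ge_of_tendsto' hlim fun m =>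
        (measure_mono (iInter_subset _ m)).trans (hPbad m)) zero_le
    have hae : ∀ᵐ ω ∂P, ω ∉ ⋂ m, bad m := measure_eq_zero_iff_ae_notMem.1 hnull
    filter_upwards [hae, h.integer] with ω hω hint x hx
    simp only [mem_iInter, not_forall] at hω
    obtain ⟨m, hm⟩ := hω
    simp only [hbad, mem_iUnion, not_exists, mem_ofPred_eq, not_le] at hm
    set b := ⌊x * (m + 1 : ℕ)⌋ with hb
    have hb1 : (b : ℝ) ≤ x * (m + 1 : ℕ) := Int.floor_le _
    have hb2 : x * (m + 1 : ℕ) < b + 1 := Int.lt_floor_add_one _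
    have hbmem : b ∈ Finset.Ico (-(A * (m + 1 : ℕ)) : ℤ) (A * (m + 1 : ℕ)) := by
      rw [Finset.mem_Ico]
      constructor
      · rw [hb, Int.le_floor]
        push_cast
        have := hm0 m
        push_cast at this
        nlinarith [hx.1]
      · rw [hb, Int.floor_lt]
        push_cast
        have := hm0 m
        push_cast at this
        nlinarith [hx.2]
    have h2 := hm b hbmem
    have hsub : ({x} : Set ℝ) ×ˢ Icc (0 : ℝ) A ⊆ strip m b := by
      refine prod_mono_left ?_
      rw [singleton_subset_iff]
      exact ⟨by rw [div_le_iff₀ (hm0 m)]; exact hb1, by rw [lt_div_iff₀ (hm0 m)]; exact hb2⟩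
    obtain ⟨k, hk⟩ := hint (strip m b) (measurableSet_Ico.prod measurableSet_Icc)
    refine (measure_mono hsub).trans ?_
    rw [hk] at h2 ⊢
    have : k < 2 := by exact_mod_cast h2
    have : k ≤ 1 := by
      lift k to ℕ using ne_top_of_lt this
      norm_cast at this ⊢
      omega
    exact_mod_cast this
  filter_upwards [h.integer, hfin, hpos, hne, hsimple] with ω h1 h2 h3 h4 h5
  refine ⟨h1, h2, h3, h4, fun x A => ?_⟩
  obtain ⟨B, hB⟩ := exists_nat_gt (max |x| A)
  have hB1 : |x| < B := (le_max_left _ _).trans_lt hB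
  have hB2 : (A : ℝ) < B := (le_max_right _ _).trans_lt hB
  rw [abs_lt] at hB1
  exact (measure_mono (prod_mono_right (Icc_subset_Icc_right hB2.le))).trans
    (h5 B x ⟨hB1.1.le, hB1.2⟩)

namespace GoodMarks

variable {z₀ : ℝ} {μ : Measure (ℝ × ℝ)}

lemma one_le (h : GoodMarks z₀ μ) {B : Set (ℝ × ℝ)} (hB : MeasurableSet B) (h0 : μ B ≠ 0) :
    1 ≤ μ B := by
  obtain ⟨n, hn⟩ := h.integer B hB
  rw [hn] at h0 ⊢
  have h1 : n ≠ 0 := by simpa using h0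
  exact_mod_cast Order.one_le_iff_ne_zero.2 h1

/-- Some point of `B` has only neighbourhoods of positive mass. The mass is an integer, so each of
them has mass at least `1`, and continuity from above passes this to the singleton. -/
lemma exists_atom (h : GoodMarks z₀ μ) {B : Set (ℝ × ℝ)} (hB : MeasurableSet B) (h0 : μ B ≠ 0)
    (hfin : μ B ≠ ∞) : ∃ p ∈ B, μ {p} ≠ 0 := by
  obtain ⟨p, hpB, hp⟩ := exists_mem_forall_mem_nhdsWithin_pos_measure h0
  refine ⟨p, hpB, fun hp0 => ?_⟩
  have hS : ∀ n : ℕ, MeasurableSet (B ∩ Metric.closedBall p (1 / ((n : ℝ) + 1))) := fun n =>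
    hB.inter measurableSet_closedBall
  have hone : ∀ n : ℕ, 1 ≤ μ (B ∩ Metric.closedBall p (1 / ((n : ℝ) + 1))) := fun n =>
    h.one_le (hS n) (hp _ (inter_mem self_mem_nhdsWithin
      (mem_nhdsWithin_of_mem_nhds (Metric.closedBall_mem_nhds p (by positivity))))).ne'
  have hinter : ⋂ n : ℕ, B ∩ Metric.closedBall p (1 / ((n : ℝ) + 1)) = {p} := by
    ext x
    simp only [mem_iInter, mem_inter_iff, Metric.mem_closedBall, mem_singleton_iff]
    constructor
    · intro hx
      refine dist_le_zero.1 (ge_of_tendsto' tendsto_one_div_add_atTop_nhds_zero_nat fun n => (hx n).2)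
    · rintro rfl n
      exact ⟨hpB, by rw [dist_self]; positivity⟩
  have hlim := tendsto_measure_iInter_atTop (μ := μ)
    (s := fun n : ℕ => B ∩ Metric.closedBall p (1 / ((n : ℝ) + 1)))
    (fun n => (hS n).nullMeasurableSet) (fun m n hmn => inter_subset_inter_right _
      (Metric.closedBall_subset_closedBall (by gcongr)))
    ⟨0, ne_top_of_le_ne_top hfin (measure_mono inter_subset_left)⟩
  rw [hinter, hp0] at hlim
  exact absurd (ge_of_tendsto' hlim hone) (by simp)

/-- The vertical line above `x` carries mass at most `1`, and an atom has mass at least `1`: the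
atom takes it all. -/
lemma measure_line_eq (h : GoodMarks z₀ μ) {x s : ℝ} (hs : μ {(x, s)} ≠ 0) {I : Set ℝ}
    (hI : MeasurableSet I) {A : ℕ} (hIA : I ⊆ Icc 0 (A : ℝ)) (hsA : s ≤ A) :
    0 < s ∧ s ≠ z₀ ∧ μ (({x} ×ˢ I) \ {(x, s)}) = 0 ∧ μ {(x, s)} = 1 := by
  have hs0 : 0 < s := by
    by_contra hcon
    exact hs (le_antisymm ((measure_mono (by
      rw [singleton_subset_iff]; exact ⟨mem_univ _, not_lt.1 hcon⟩)).trans h.pos.le) zero_le)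
  have hsz : s ≠ z₀ := by
    rintro rfl
    exact hs (le_antisymm ((measure_mono (by
      rw [singleton_subset_iff]; exact ⟨mem_univ _, rfl⟩)).trans h.ne.le) zero_le)
  have hone := h.one_le (measurableSet_singleton (x, s)) hs
  have hle := h.simple x A
  have hdisj : Disjoint {(x, s)} (({x} ×ˢ I) \ {(x, s)}) := disjoint_sdiff_right
  have hunion : μ {(x, s)} + μ (({x} ×ˢ I) \ {(x, s)}) ≤ 1 := by
    rw [← measure_union hdisj (((measurableSet_singleton x).prod hI).diff
      (measurableSet_singleton _))]
    refine (measure_mono ?_).trans hle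
    rintro p (hp | hp)
    · rw [mem_singleton_iff.1 hp]
      exact ⟨rfl, hs0.le, hsA⟩
    · exact ⟨hp.1.1, hIA hp.1.2⟩
  have h1 : μ {(x, s)} = 1 := le_antisymm (le_self_add.trans hunion) hone
  refine ⟨hs0, hsz, ?_, h1⟩
  rw [h1] at hunion
  by_contra hne
  exact absurd hunion (not_le.2 (ENNReal.lt_add_right ENNReal.one_ne_top hne))

lemma measure_line_mem (h : GoodMarks z₀ μ) {x s : ℝ} (hs : μ {(x, s)} ≠ 0) {I : Set ℝ}
    (hI : MeasurableSet I) {A : ℕ} (hIA : I ⊆ Icc 0 (A : ℝ)) (hsI : s ∈ I) :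
    μ ({x} ×ˢ I) = 1 ∧ ∫ p in {x} ×ˢ I, p.2 ∂μ = s := by
  obtain ⟨-, -, h0, h1⟩ := h.measure_line_eq hs hI hIA (hIA hsI).2
  have hm : μ ({x} ×ˢ I) = 1 := by
    have hmem : {(x, s)} ⊆ ({x} : Set ℝ) ×ˢ I := singleton_subset_iff.2 ⟨rfl, hsI⟩
    rw [← measure_sdiff_add_inter ({x} ×ˢ I) (measurableSet_singleton (x, s)), h0, zero_add,
      inter_eq_right.2 hmem, h1]
  refine ⟨hm, ?_⟩
  have : ∫ p in {x} ×ˢ I, p.2 ∂μ = ∫ p in {x} ×ˢ I, s ∂μ := by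
    refine integral_congr_ae ?_
    rw [EventuallyEq, ae_restrict_iff' ((measurableSet_singleton x).prod hI), ae_iff]
    refine measure_mono_null (fun p hp => ?_) h0
    simp only [mem_ofPred_eq, Classical.not_imp] at hp
    exact ⟨hp.1, fun he => hp.2 (by rw [mem_singleton_iff.1 he])⟩
  rw [this]
  simp [measureReal_def, hm]

lemma measure_line_notMem (h : GoodMarks z₀ μ) {x s : ℝ} (hs : μ {(x, s)} ≠ 0) {I : Set ℝ}
    (hI : MeasurableSet I) {A : ℕ} (hIA : I ⊆ Icc 0 (A : ℝ)) (hsI : s ∉ I) :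
    μ ({x} ×ˢ I) = 0 := by
  obtain ⟨B, hB⟩ := exists_nat_ge (max s A)
  obtain ⟨-, -, h0, -⟩ := h.measure_line_eq hs hI (A := B)
    (hIA.trans (Icc_subset_Icc_right ((le_max_right _ _).trans hB))) ((le_max_left _ _).trans hB)
  rwa [sdiff_singleton_eq_self (fun hp => hsI hp.2)] at h0

lemma measure_line_zero (h : GoodMarks z₀ μ) {x : ℝ} (hx : ∀ s, μ {(x, s)} = 0) {I : Set ℝ}
    (hI : MeasurableSet I) {A : ℕ} (hIA : I ⊆ Icc 0 (A : ℝ)) : μ ({x} ×ˢ I) = 0 := by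
  by_contra hne
  obtain ⟨p, hp, hp0⟩ := h.exists_atom ((measurableSet_singleton x).prod hI) hne
    (ne_top_of_le_ne_top ENNReal.one_ne_top ((measure_mono (prod_mono_right hIA)).trans
      (h.simple x A)))
  exact hp0 (by rw [← hx p.2, ← mem_singleton_iff.1 hp.1])

end GoodMarks

/-! ### The limit process at one site -/

/-- By right continuity the function is the limit of its step approximations, sampled slightly to
the right. -/
lemma measurable_of_cadlag {f : ℝ≥0 → ℝ} (hf : IsCadlag f) : Measurable f := by
  let s : ℕ → ℝ≥0 → ℝ≥0 := fun n t => ((⌊((n : ℝ≥0) + 1) * t⌋₊ : ℝ≥0) + 1) / ((n : ℝ≥0) + 1)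
  have hpos : ∀ n : ℕ, (0 : ℝ≥0) < (n : ℝ≥0) + 1 := fun n => by positivity
  have hs1 : ∀ n t, t ≤ s n t := fun n t => by
    rw [le_div_iff₀ (hpos n), mul_comm]
    exact (Nat.lt_floor_add_one _).le
  have hs2 : ∀ n t, s n t ≤ t + 1 / ((n : ℝ≥0) + 1) := fun n t => by
    have h1 : (t + 1 / ((n : ℝ≥0) + 1)) * ((n : ℝ≥0) + 1) = ((n : ℝ≥0) + 1) * t + 1 := by
      have := (hpos n).ne'
      field_simp
    rw [div_le_iff₀ (hpos n), h1]
    gcongr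
    exact Nat.floor_le zero_le
  refine measurable_of_tendsto_metrizable (f := fun (n : ℕ) t => f (s n t)) (fun n => ?_) ?_
  · exact (measurable_from_top (f := fun k : ℕ => f (((k : ℝ≥0) + 1) / ((n : ℝ≥0) + 1)))).comp
      (Nat.measurable_floor.comp (measurable_const.mul measurable_id))
  · rw [tendsto_pi_nhds]
    intro t
    refine (hf t).1.tendsto.comp (tendsto_nhdsWithin_iff.2 ⟨?_, Eventually.of_forall fun n => hs1 n t⟩)
    refine tendsto_of_tendsto_of_tendsto_of_le_of_le tendsto_const_nhds
      (h := fun n : ℕ => t + 1 / ((n : ℝ≥0) + 1)) ?_ (fun n => hs1 n t) (fun n => hs2 n t)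
    simpa using (tendsto_const_nhds (x := t)).add
      (tendsto_one_div_add_atTop_nhds_zero_nat (𝕜 := ℝ≥0))

/-- The path of the limit process at a site with a single match at time `s < 1`. -/
lemma pos_iff_of_decay {f : ℝ≥0 → ℝ} (hf : IsCadlag f) {s : ℝ≥0}
    (hs0 : 0 < s) (hs1 : s < 1)
    (h1 : ∀ t < s, f t = 0)
    (h2 : ∀ t, s ≤ t → f t = s - ∫ v in (0 : ℝ)..t,
      (Ioo (0 : ℝ) 1).indicator (fun _ => (1 : ℝ)) (f v.toNNReal)) (t : ℝ≥0) :
    0 < f t ↔ s ≤ t ∧ t < 2 * s := by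
  set g : ℝ → ℝ := fun v => (Ioo (0 : ℝ) 1).indicator (fun _ => (1 : ℝ)) (f v.toNNReal) with hg
  have hgm : Measurable g := (measurable_const.indicator measurableSet_Ioo).comp
    ((measurable_of_cadlag hf).comp measurable_real_toNNReal)
  have hg0 : ∀ v, 0 ≤ g v := fun v => indicator_nonneg (fun _ _ => zero_le_one) _
  have hg1 : ∀ v, g v ≤ 1 := fun v => indicator_le_self' (fun _ _ => zero_le_one) _
  have hgi : ∀ a b, IntervalIntegrable g volume a b := fun a b =>
    (intervalIntegrable_const (c := (1 : ℝ))).mono_fun hgm.aestronglyMeasurable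
      (Eventually.of_forall fun v => by
        simpa only [Real.norm_of_nonneg (hg0 v), norm_one] using hg1 v)
  have hgs : ∫ v in (0 : ℝ)..s, g v = 0 := by
    have : ∫ v in (0 : ℝ)..s, g v = ∫ v in (0 : ℝ)..s, (0 : ℝ) := by
      refine intervalIntegral.integral_congr_ae ?_
      have hne : ∀ᵐ v : ℝ, v ≠ s := by simp [ae_iff]
      filter_upwards [hne] with v hvne hv
      rw [uIoc_of_le (NNReal.coe_nonneg s)] at hv
      have hlt : v < s := lt_of_le_of_ne hv.2 hvne
      have hv' : v.toNNReal < s := by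
        rw [← NNReal.coe_lt_coe, Real.coe_toNNReal _ hv.1.le]; exact hlt
      simp [hg, h1 _ hv']
    rw [this]; simp
  have hsplit : ∀ t : ℝ≥0, ∫ v in (0 : ℝ)..t, g v = ∫ v in (s : ℝ)..t, g v := fun t => by
    rw [← intervalIntegral.integral_add_adjacent_intervals (hgi 0 s) (hgi s t), hgs, zero_add]
  have hle : ∀ t : ℝ≥0, s ≤ t → ∫ v in (s : ℝ)..t, g v ≤ t - s := fun t hst => by
    have := intervalIntegral.integral_mono_on (μ := volume) (NNReal.coe_le_coe.2 hst) (hgi s t)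
      (intervalIntegrable_const (c := (1 : ℝ))) (fun v _ => hg1 v)
    simpa using this
  -- The value decreases at rate at most `1`, hence is positive before `2 * s`; it also stays at
  -- most `s < 1`. So it lies in `(0, 1)` on `[s, 2 * s)`, the rate there is exactly `1`, and the
  -- whole amount `s` is used up at time `2 * s`.
  have hlow : ∀ t : ℝ≥0, s ≤ t → 2 * (s : ℝ) - t ≤ f t := fun t hst => by
    have e := h2 t hst
    change f t = s - ∫ v in (0 : ℝ)..t, g v at e
    rw [e, hsplit]
    linarith [hle t hst]
  have hup : ∀ t : ℝ≥0, s ≤ t → f t ≤ s := fun t hst => by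
    have e := h2 t hst
    change f t = s - ∫ v in (0 : ℝ)..t, g v at e
    rw [e, hsplit]
    have := intervalIntegral.integral_nonneg (μ := volume) (NNReal.coe_le_coe.2 hst)
      (fun v _ => hg0 v)
    linarith
  have hint2 : ∫ v in (s : ℝ)..((2 * s : ℝ≥0) : ℝ), g v = s := by
    have : ∫ v in (s : ℝ)..((2 * s : ℝ≥0) : ℝ), g v =
        ∫ v in (s : ℝ)..((2 * s : ℝ≥0) : ℝ), (1 : ℝ) := by
      refine intervalIntegral.integral_congr_ae ?_
      have hne : ∀ᵐ v : ℝ, v ≠ ((2 * s : ℝ≥0) : ℝ) := by simp [ae_iff]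
      filter_upwards [hne] with v hvne hv
      rw [uIoc_of_le (by push_cast; linarith [NNReal.coe_nonneg s])] at hv
      have hlt : v < 2 * s := lt_of_le_of_ne (by simpa using hv.2) (by simpa using hvne)
      have hv0 : 0 ≤ v := le_trans (NNReal.coe_nonneg s) hv.1.le
      have hv' : s ≤ v.toNNReal := by
        rw [← NNReal.coe_le_coe, Real.coe_toNNReal _ hv0]; exact hv.1.le
      have l1 := hlow _ hv'
      rw [Real.coe_toNNReal _ hv0] at l1
      have hs1' : (s : ℝ) < 1 := by exact_mod_cast hs1
      exact indicator_of_mem (show f v.toNNReal ∈ Ioo (0 : ℝ) 1 from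
        ⟨by linarith, (hup _ hv').trans_lt hs1'⟩) _
    rw [this]
    simp
    ring
  constructor
  · intro hpos
    have hst : s ≤ t := by
      by_contra hlt
      rw [h1 t (not_le.1 hlt)] at hpos
      exact lt_irrefl _ hpos
    refine ⟨hst, ?_⟩
    by_contra h2s
    rw [not_lt] at h2s
    have e := h2 t hst
    change f t = s - ∫ v in (0 : ℝ)..t, g v at e
    rw [hsplit, ← intervalIntegral.integral_add_adjacent_intervals
      (hgi s ((2 * s : ℝ≥0) : ℝ)) (hgi _ t), hint2] at e
    have := intervalIntegral.integral_nonneg (μ := volume) (NNReal.coe_le_coe.2 h2s)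
      (fun v _ => hg0 v)
    linarith
  · rintro ⟨h3, h4⟩
    have := hlow t h3
    have h4' : (t : ℝ) < 2 * s := by exact_mod_cast h4
    linarith

/-- The equation of the limit process for given marks. -/
def LimitEquation (z₀ : ℝ) (μ : Measure (ℝ × ℝ)) (y : ℝ≥0 → ℝ → ℝ) : Prop :=
  ∀ x : ℝ, IsCadlag (fun t => y t x) ∧ (∀ t, 0 ≤ y t x) ∧
    (∀ t : ℝ≥0, y t x =
      (∫ p in {x} ×ˢ Icc (0 : ℝ) (min (t : ℝ) z₀), p.2 ∂μ)
      - (∫ s in (0 : ℝ)..t, (Ioo (0 : ℝ) 1).indicator (fun _ => (1 : ℝ)) (y s.toNNReal x))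
      + (if z₀ ≤ t then (μ ({x} ×ˢ Icc z₀ (t : ℝ))).toReal else 0)) ∧
    (∀ t s : ℝ≥0, z₀ < t → t ≤ s → μ {(x, (t : ℝ))} ≠ 0 → y s x = 1)

/-- Without mass on the line, the equation makes `y` minus a nonnegative integral, while `y` is
required to be nonnegative. -/
lemma LimitEquation.eq_zero {z₀ : ℝ} {μ : Measure (ℝ × ℝ)} {y : ℝ≥0 → ℝ → ℝ}
    (h : LimitEquation z₀ μ y) {x : ℝ} {t : ℝ≥0}
    (h1 : μ ({x} ×ˢ Icc (0 : ℝ) (min (t : ℝ) z₀)) = 0)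
    (h2 : z₀ ≤ t → μ ({x} ×ˢ Icc z₀ (t : ℝ)) = 0) : y t x = 0 := by
  obtain ⟨-, h0, heq, -⟩ := h x
  refine le_antisymm ?_ (h0 t)
  rw [heq t, setIntegral_measure_zero _ h1]
  have h3 : (if z₀ ≤ t then (μ ({x} ×ˢ Icc z₀ (t : ℝ))).toReal else 0) = 0 := by
    split_ifs with hz
    · rw [h2 hz]; rfl
    · rfl
  rw [h3]
  have := intervalIntegral.integral_nonneg (μ := volume) (f := fun s : ℝ =>
    (Ioo (0 : ℝ) 1).indicator (fun _ => (1 : ℝ)) (y s.toNNReal x)) (NNReal.coe_nonneg t)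
    (fun v _ => indicator_nonneg (fun _ _ => zero_le_one) _)
  linarith

/-- The single mark on the line contributes to exactly one of the two mark terms. If `s < z₀` the
first term equals `s` from time `s` on, and `pos_iff_of_decay` applies; if `s > z₀` the last clause
of the equation fixes the value `1`. -/
lemma LimitEquation.pos_iff_of_mark {z₀ : ℝ} (hz : z₀ ∈ Icc (0 : ℝ) 1) {μ : Measure (ℝ × ℝ)}
    (hμ : GoodMarks z₀ μ) {y : ℝ≥0 → ℝ → ℝ} (h : LimitEquation z₀ μ y) {x : ℝ} {s : ℝ≥0}
    (hs : μ {(x, (s : ℝ))} ≠ 0) :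
    ((s : ℝ) < z₀ → ∀ t, 0 < y t x ↔ s ≤ t ∧ t < 2 * s) ∧
      (z₀ < s → ∀ t, 0 < y t x ↔ s ≤ t) := by
  obtain ⟨hs0, -, -, -⟩ := hμ.measure_line_eq hs MeasurableSet.empty (empty_subset _)
    (Nat.le_ceil (s : ℝ))
  have hA : ∀ (a b : ℝ), 0 ≤ a → Icc a b ⊆ Icc 0 ((⌈b⌉₊ : ℕ) : ℝ) := fun a b ha v hv =>
    ⟨ha.trans hv.1, hv.2.trans (Nat.le_ceil b)⟩
  have hzero : ∀ t < s, y t x = 0 := fun t ht => by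
    have ht' : (t : ℝ) < s := by exact_mod_cast ht
    refine h.eq_zero (hμ.measure_line_notMem hs measurableSet_Icc (hA _ _ le_rfl) ?_)
      (fun _ => hμ.measure_line_notMem hs measurableSet_Icc (hA _ _ hz.1) ?_)
    · exact fun hmem => absurd (hmem.2.trans (min_le_left _ _)) (not_le.2 ht')
    · exact fun hmem => absurd hmem.2 (not_le.2 ht')
  obtain ⟨hc, -, heq, hstay⟩ := h x
  constructor
  · intro hsz t
    refine pos_iff_of_decay (f := fun t => y t x) hc (by exact_mod_cast hs0)
      (by exact_mod_cast hsz.trans_le hz.2) hzero (fun t hst => ?_) t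
    have hst' : (s : ℝ) ≤ t := by exact_mod_cast hst
    have e := heq t
    rw [(hμ.measure_line_mem hs measurableSet_Icc (hA _ _ le_rfl)
      (show (s : ℝ) ∈ Icc (0 : ℝ) (min (t : ℝ) z₀) from ⟨hs0.le, le_min hst' hsz.le⟩)).2,
      hμ.measure_line_notMem hs measurableSet_Icc (hA _ _ hz.1)
        (fun hmem => absurd hmem.1 (not_le.2 hsz))] at e
    simpa using e
  · intro hsz t
    constructor
    · intro hpos
      by_contra hlt
      rw [hzero t (not_le.1 hlt)] at hpos
      exact lt_irrefl _ hpos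
    · intro hst
      rw [hstay s t hsz hst hs]
      exact one_pos

lemma LimitEquation.eq_zero_of_no_mark {z₀ : ℝ} (hz : z₀ ∈ Icc (0 : ℝ) 1) {μ : Measure (ℝ × ℝ)}
    (hμ : GoodMarks z₀ μ) {y : ℝ≥0 → ℝ → ℝ} (h : LimitEquation z₀ μ y) {x : ℝ}
    (hx : ∀ s, μ {(x, s)} = 0) (t : ℝ≥0) : y t x = 0 := by
  have hA : ∀ (a b : ℝ), 0 ≤ a → Icc a b ⊆ Icc 0 ((⌈b⌉₊ : ℕ) : ℝ) := fun a b ha v hv =>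
    ⟨ha.trans hv.1, hv.2.trans (Nat.le_ceil b)⟩
  exact h.eq_zero (hμ.measure_line_zero hx measurableSet_Icc (hA _ _ le_rfl))
    (fun _ => hμ.measure_line_zero hx measurableSet_Icc (hA _ _ hz.1))

/-- The sites at which the limit process is positive are those of the active marks. -/
lemma LimitEquation.pos_iff {z₀ : ℝ} (hz : z₀ ∈ Icc (0 : ℝ) 1) {μ : Measure (ℝ × ℝ)}
    (hμ : GoodMarks z₀ μ) {y : ℝ≥0 → ℝ → ℝ} (h : LimitEquation z₀ μ y) (x : ℝ) (t : ℝ≥0) :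
    0 < y t x ↔ ∃ s : ℝ, μ {(x, s)} ≠ 0 ∧ s ≤ t ∧ (s < z₀ → t < 2 * s) := by
  have hmark : ∀ s : ℝ, μ {(x, s)} ≠ 0 → (0 < y t x ↔ s ≤ t ∧ (s < z₀ → t < 2 * s)) := by
    intro s hs
    obtain ⟨hs0, hsz, -, -⟩ := hμ.measure_line_eq hs MeasurableSet.empty (empty_subset _)
      (Nat.le_ceil s)
    lift s to ℝ≥0 using hs0.le
    obtain ⟨p1, p2⟩ := h.pos_iff_of_mark hz hμ hs
    rcases lt_or_gt_of_ne hsz with hlt | hgt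
    · rw [p1 hlt t]
      simp only [hlt, true_imp_iff]
      norm_cast
    · rw [p2 hgt t]
      simp only [not_lt.2 hgt.le, false_imp_iff, and_true]
      norm_cast
  constructor
  · intro hpos
    by_contra hcon
    push Not at hcon
    by_cases hx : ∃ s, μ {(x, s)} ≠ 0
    · obtain ⟨s, hs⟩ := hx
      obtain ⟨a, b⟩ := (hmark s hs).1 hpos
      obtain ⟨c, d⟩ := hcon s hs a
      exact absurd (b c) (not_lt.2 d)
    · push Not at hx
      rw [h.eq_zero_of_no_mark hz hμ hx] at hpos
      exact lt_irrefl _ hpos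
  · rintro ⟨s, hs, h1⟩
    exact (hmark s hs).2 h1

/-! ### Discretisation of the marks -/

/-- Marks of the time cell `(j / m, (j + 1) / m]` delimit clusters during the time cell
`[k / m, (k + 1) / m)`. -/
def Active (z₀ : ℝ) (m k j : ℕ) : Prop :=
  j + 1 ≤ k ∧ ((k + 1 < 2 * j ∧ (j : ℝ) + 1 ≤ z₀ * m) ∨ z₀ * m < j)

/-- Marks of the time cell `(j / m, (j + 1) / m]` have no effect during the time cell
`[k / m, (k + 1) / m)`. -/
def Inactive (z₀ : ℝ) (m k j : ℕ) : Prop :=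
  k < j ∨ (2 * (j + 1) < k ∧ (j : ℝ) + 1 < z₀ * m)

/-- Some mark has an uncertain effect during the time cell `[k / m, (k + 1) / m)`. -/
def Hit (z₀ : ℝ) (m : ℕ) (V : ℤ → ℕ → Prop) (k : ℕ) : Prop :=
  ∃ b j, V b j ∧ ¬Active z₀ m k j ∧ ¬Inactive z₀ m k j

/-- The block `b` contains an active mark. -/
def ActiveBlock (z₀ : ℝ) (m : ℕ) (V : ℤ → ℕ → Prop) (k : ℕ) (b : ℤ) : Prop :=
  ∃ j, Active z₀ m k j ∧ V b j

/-- The first active block on the right of `x`. -/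
def rightBlock (z₀ : ℝ) (m : ℕ) (V : ℤ → ℕ → Prop) (k : ℕ) (x : ℝ) : ℤ :=
  sInf {b | ⌊x * m⌋ < b ∧ ActiveBlock z₀ m V k b}

/-- The first active block on the left of `x`. -/
def leftBlock (z₀ : ℝ) (m : ℕ) (V : ℤ → ℕ → Prop) (k : ℕ) (x : ℝ) : ℤ :=
  sSup {b | b < ⌊x * m⌋ ∧ ActiveBlock z₀ m V k b}

/-- The cluster of `x` delimited by the active blocks. -/
def gridCluster (z₀ : ℝ) (m : ℕ) (V : ℤ → ℕ → Prop) (k : ℕ) (x : ℝ) : Interval ℝ :=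
  if k < m then mkInterval x x
  else mkInterval ((leftBlock z₀ m V k x : ℝ) / m) ((rightBlock z₀ m V k x : ℝ) / m)

/-- There is no mark near `x`, and at each time the cluster of `x` is bounded. -/
structure GoodCells (z₀ : ℝ) (m : ℕ) (B : ℤ) (J : ℕ) (V : ℤ → ℕ → Prop) (x : ℝ) : Prop where
  near : ∀ b j, |b - ⌊x * m⌋| ≤ 20 → ¬V b j
  right : ∀ k, m ≤ k + 1 → k < J → ∃ b, ⌊x * m⌋ < b ∧ b + 20 ≤ B ∧ ActiveBlock z₀ m V k b
  left : ∀ k, m ≤ k + 1 → k < J → ∃ b, b < ⌊x * m⌋ ∧ -B + 20 ≤ b ∧ ActiveBlock z₀ m V k b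

/-- The path `X` of clusters of `x` is close to the path of the clusters `gridCluster`. -/
structure CloseToGrid (z₀ : ℝ) (m : ℕ) (B : ℤ) (J : ℕ) (V : ℤ → ℕ → Prop) (x : ℝ)
    (X : ℝ → Cluster x) : Prop where
  early : ∀ t : ℝ, 0 ≤ t → t * m < m - 1 → clusterDist x (X t) (mkInterval x x) ≤ 20 / m
  close : ∀ (t : ℝ) (k : ℕ), (k : ℝ) ≤ t * m → t * m < k + 1 → m ≤ k → k < J → ¬Hit z₀ m V k →
    clusterDist x (X t) (gridCluster z₀ m V k x) ≤ 20 / m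
  bdd : ∀ t : ℝ, 0 ≤ t → t * m < J → clusterDist x (X t) (mkInterval x x) ≤ 2 * B / m

lemma mkInterval_of_le {a b : ℝ} (h : a ≤ b) :
    mkInterval a b = ((⟨(a, b), h⟩ : NonemptyInterval ℝ) : WithBot (NonemptyInterval ℝ)) := by
  exact dif_pos h

lemma ends_mkInterval (x : ℝ) {a b : ℝ} (h : a ≤ b) : ends x (mkInterval a b) = (a, b) := by
  rw [mkInterval_of_le h]; rfl

lemma ends_mkInterval_self (x : ℝ) : ends x (mkInterval x x) = (x, x) :=
  ends_mkInterval x le_rfl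

lemma ends_bot (x : ℝ) : ends x ⊥ = (x, x) := rfl

section GridSpec

variable {z₀ : ℝ} {m : ℕ} {V : ℤ → ℕ → Prop} {k : ℕ} {x : ℝ}

lemma rightBlock_spec (h : ∃ b, ⌊x * m⌋ < b ∧ ActiveBlock z₀ m V k b) :
    ⌊x * m⌋ < rightBlock z₀ m V k x ∧ ActiveBlock z₀ m V k (rightBlock z₀ m V k x) ∧
      ∀ b, ⌊x * m⌋ < b → ActiveBlock z₀ m V k b → rightBlock z₀ m V k x ≤ b := by
  have hbdd : BddBelow {b | ⌊x * m⌋ < b ∧ ActiveBlock z₀ m V k b} := ⟨⌊x * m⌋, fun b hb => hb.1.le⟩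
  have hmem := Int.csInf_mem h hbdd
  exact ⟨hmem.1, hmem.2, fun b h1 h2 => csInf_le hbdd ⟨h1, h2⟩⟩

lemma leftBlock_spec (h : ∃ b, b < ⌊x * m⌋ ∧ ActiveBlock z₀ m V k b) :
    leftBlock z₀ m V k x < ⌊x * m⌋ ∧ ActiveBlock z₀ m V k (leftBlock z₀ m V k x) ∧
      ∀ b, b < ⌊x * m⌋ → ActiveBlock z₀ m V k b → b ≤ leftBlock z₀ m V k x := by
  have hbdd : BddAbove {b | b < ⌊x * m⌋ ∧ ActiveBlock z₀ m V k b} := ⟨⌊x * m⌋, fun b hb => hb.1.le⟩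
  have hmem := Int.csSup_mem h hbdd
  exact ⟨hmem.1, hmem.2, fun b h1 h2 => le_csSup hbdd ⟨h1, h2⟩⟩

end GridSpec

namespace GoodCells

variable {z₀ : ℝ} {m : ℕ} {B : ℤ} {J : ℕ} {V : ℤ → ℕ → Prop} {x : ℝ}

/-- The nearest active block is marked, and no mark lies within `20` blocks of `x`. This margin
absorbs all later errors of a few blocks. -/
lemma exists_right (h : GoodCells z₀ m B J V x) {k : ℕ} (hk : m ≤ k + 1) (hkJ : k < J) :
    ⌊x * m⌋ + 20 < rightBlock z₀ m V k x ∧ rightBlock z₀ m V k x + 20 ≤ B ∧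
      ActiveBlock z₀ m V k (rightBlock z₀ m V k x) ∧
      ∀ b, ⌊x * m⌋ ≤ b → ActiveBlock z₀ m V k b → rightBlock z₀ m V k x ≤ b := by
  obtain ⟨b, h1, h2, h3⟩ := h.right k hk hkJ
  obtain ⟨s1, s2, s3⟩ := rightBlock_spec ⟨b, h1, h3⟩
  have hfar : ∀ b, ⌊x * m⌋ ≤ b → ActiveBlock z₀ m V k b → ⌊x * m⌋ + 20 < b := by
    rintro b hb ⟨j, -, hj⟩
    by_contra hcon
    exact h.near b j (by rw [abs_le]; omega) hj
  have := s3 b h1 h3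
  exact ⟨hfar _ s1.le s2, by omega, s2, fun b h4 h5 => s3 b (by have := hfar b h4 h5; omega) h5⟩

lemma exists_left (h : GoodCells z₀ m B J V x) {k : ℕ} (hk : m ≤ k + 1) (hkJ : k < J) :
    leftBlock z₀ m V k x + 20 < ⌊x * m⌋ ∧ -B + 20 ≤ leftBlock z₀ m V k x ∧
      ActiveBlock z₀ m V k (leftBlock z₀ m V k x) ∧
      ∀ b, b ≤ ⌊x * m⌋ → ActiveBlock z₀ m V k b → b ≤ leftBlock z₀ m V k x := by
  obtain ⟨b, h1, h2, h3⟩ := h.left k hk hkJ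
  obtain ⟨s1, s2, s3⟩ := leftBlock_spec ⟨b, h1, h3⟩
  have hfar : ∀ b, b ≤ ⌊x * m⌋ → ActiveBlock z₀ m V k b → b + 20 < ⌊x * m⌋ := by
    rintro b hb ⟨j, -, hj⟩
    by_contra hcon
    exact h.near b j (by rw [abs_le]; omega) hj
  have := s3 b h1 h3
  exact ⟨hfar _ s1.le s2, by omega, s2, fun b h4 h5 => s3 b (by have := hfar b h4 h5; omega) h5⟩

lemma floor_bounds (hm : 0 < m) (x : ℝ) :
    (⌊x * m⌋ : ℝ) / m ≤ x ∧ x < ((⌊x * m⌋ : ℝ) + 1) / m := by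
  have hm' : (0 : ℝ) < m := by exact_mod_cast hm
  exact ⟨by rw [div_le_iff₀ hm']; exact Int.floor_le _,
    by rw [lt_div_iff₀ hm']; exact Int.lt_floor_add_one _⟩

lemma ends_gridCluster (h : GoodCells z₀ m B J V x) {k : ℕ} (hk : m ≤ k) (hkJ : k < J) :
    ends x (gridCluster z₀ m V k x) =
      ((leftBlock z₀ m V k x : ℝ) / m, (rightBlock z₀ m V k x : ℝ) / m) := by
  have h1 := (h.exists_left (by omega) hkJ).1
  have h2 := (h.exists_right (by omega) hkJ).1
  have h3 : (leftBlock z₀ m V k x : ℝ) ≤ rightBlock z₀ m V k x := by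
    exact_mod_cast (show leftBlock z₀ m V k x ≤ rightBlock z₀ m V k x by omega)
  unfold gridCluster
  rw [if_neg (not_lt.2 hk), ends_mkInterval x (by gcongr)]

/-- The clusters of the grid are bounded. -/
lemma gridCluster_bdd (h : GoodCells z₀ m B J V x) (hm : 0 < m) {k : ℕ} (hkJ : k < J)
    (hB : 0 ≤ B) : clusterDist x (gridCluster z₀ m V k x) (mkInterval x x) ≤ 2 * B / m := by
  have hm' : (0 : ℝ) < m := by exact_mod_cast hm
  have hB' : (0 : ℝ) ≤ B := by exact_mod_cast hB
  rcases lt_or_ge k m with hk | hk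
  · unfold gridCluster
    rw [if_pos hk, clusterDist_self]
    positivity
  · obtain ⟨l1, l2, -, -⟩ := h.exists_left (by omega) hkJ
    obtain ⟨r1, r2, -, -⟩ := h.exists_right (by omega) hkJ
    obtain ⟨x1, x2⟩ := floor_bounds hm x
    unfold clusterDist
    rw [h.ends_gridCluster hk hkJ, ends_mkInterval_self]
    have e1 : (leftBlock z₀ m V k x : ℝ) / m ≤ x := by
      refine le_trans ?_ x1
      gcongr
      omega
    have e2 : x ≤ (rightBlock z₀ m V k x : ℝ) / m := by
      refine x2.le.trans ?_
      have : (⌊x * m⌋ : ℝ) + 1 ≤ rightBlock z₀ m V k x := by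
        exact_mod_cast (show ⌊x * m⌋ + 1 ≤ rightBlock z₀ m V k x by omega)
      gcongr
    rw [abs_of_nonpos (by simpa using e1), abs_of_nonneg (by simpa using e2)]
    have e3 : (-B : ℝ) / m ≤ (leftBlock z₀ m V k x : ℝ) / m := by
      have : (-B : ℝ) ≤ leftBlock z₀ m V k x := by
        exact_mod_cast (show -B ≤ leftBlock z₀ m V k x by omega)
      gcongr
    have e4 : (rightBlock z₀ m V k x : ℝ) / m ≤ B / m := by
      have : (rightBlock z₀ m V k x : ℝ) ≤ B := by
        exact_mod_cast (show rightBlock z₀ m V k x ≤ B by omega)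
      gcongr
    have e5 : (2 * B : ℝ) / m = B / m - -B / m := by ring
    rw [e5]
    simp only
    linarith

end GoodCells

/-! ### The limit process is close to the grid -/

/-- The cell `[b / m, (b + 1) / m) × (j / m, (j + 1) / m]`. -/
def cell (m : ℕ) (b : ℤ) (j : ℕ) : Set (ℝ × ℝ) :=
  Ico ((b : ℝ) / m) (((b : ℝ) + 1) / m) ×ˢ Ioc ((j : ℝ) / m) (((j : ℝ) + 1) / m)

lemma measurableSet_cell (m : ℕ) (b : ℤ) (j : ℕ) : MeasurableSet (cell m b j) :=
  measurableSet_Ico.prod measurableSet_Ioc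

/-- The cells of the grid `[-B, B) × [0, J)` that contain marks. -/
def markedCells (m : ℕ) (B : ℤ) (J : ℕ) (μ : Measure (ℝ × ℝ)) (b : ℤ) (j : ℕ) : Prop :=
  -B ≤ b ∧ b < B ∧ j < J ∧ μ (cell m b j) ≠ 0

lemma mem_cell {m : ℕ} (hm : 0 < m) {u s : ℝ} (hs : 0 < s) :
    (u, s) ∈ cell m ⌊u * m⌋ (⌈s * m⌉₊ - 1) := by
  have hm' : (0 : ℝ) < m := by exact_mod_cast hm
  have h1 : 0 < ⌈s * m⌉₊ := Nat.ceil_pos.2 (by positivity)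
  have h2 : ((⌈s * m⌉₊ - 1 : ℕ) : ℝ) = (⌈s * m⌉₊ : ℝ) - 1 := by
    rw [Nat.cast_sub h1]; simp
  refine ⟨⟨?_, ?_⟩, ?_, ?_⟩
  · rw [div_le_iff₀ hm']; exact Int.floor_le _
  · rw [lt_div_iff₀ hm']; exact Int.lt_floor_add_one _
  · rw [div_lt_iff₀ hm', h2]
    linarith [Nat.ceil_lt_add_one (show 0 ≤ s * m by positivity)]
  · rw [le_div_iff₀ hm', h2, sub_add_cancel]; exact Nat.le_ceil _

section LimitClose

variable {z₀ : ℝ} {μ : Measure (ℝ × ℝ)} {y : ℝ≥0 → ℝ → ℝ} {m : ℕ} {B : ℤ} {J : ℕ}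

lemma mark_pos (hμ : GoodMarks z₀ μ) {u s : ℝ} (hs : μ {(u, s)} ≠ 0) : 0 < s :=
  (hμ.measure_line_eq hs MeasurableSet.empty (empty_subset _) (Nat.le_ceil s)).1

/-- A positive site lies in a marked cell which is not inactive. -/
lemma marked_of_pos (hz : z₀ ∈ Icc (0 : ℝ) 1) (hμ : GoodMarks z₀ μ) (hy : LimitEquation z₀ μ y)
    (hm : 0 < m) {t : ℝ≥0} {k : ℕ} (hk1 : (k : ℝ) ≤ t * m) (hk2 : (t : ℝ) * m < k + 1)
    (hkJ : k < J) {u : ℝ} (hu : 0 < y t u) (huB1 : -B ≤ ⌊u * m⌋) (huB2 : ⌊u * m⌋ < B) :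
    ∃ j, markedCells m B J μ ⌊u * m⌋ j ∧ ¬Inactive z₀ m k j := by
  have hm' : (0 : ℝ) < m := by exact_mod_cast hm
  obtain ⟨s, hs, hst, hs2⟩ := (hy.pos_iff hz hμ u t).1 hu
  have hs0 := mark_pos hμ hs
  have hmem := mem_cell (u := u) hm hs0
  set j := ⌈s * m⌉₊ - 1 with hj
  have h1 : (j : ℝ) < s * m := by
    have := hmem.2.1; rwa [div_lt_iff₀ hm'] at this
  have h2 : s * m ≤ j + 1 := by
    have := hmem.2.2; rwa [le_div_iff₀ hm'] at this
  have hstm : s * m ≤ t * m := by gcongr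
  have hjk : j ≤ k := by
    have : (j : ℝ) < k + 1 := by linarith
    exact_mod_cast Nat.lt_succ_iff.1 (by exact_mod_cast this)
  refine ⟨j, ⟨huB1, huB2, by omega, fun h0 => hs (measure_mono_null
    (singleton_subset_iff.2 hmem) h0)⟩, ?_⟩
  rintro (h3 | ⟨h3, h4⟩)
  · omega
  · have hsz : s < z₀ := by
      by_contra hcon
      have : z₀ * m ≤ s * m := by gcongr; exact not_lt.1 hcon
      linarith
    have h5 := hs2 hsz
    have h6 : (t : ℝ) * m < 2 * s * m := by gcongr
    have h7 : ((2 * (j + 1) : ℕ) : ℝ) < k := by exact_mod_cast h3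
    push_cast at h7
    linarith

/-- An active block contains a positive site. -/
lemma exists_pos_of_active (hz : z₀ ∈ Icc (0 : ℝ) 1) (hμ : GoodMarks z₀ μ)
    (hy : LimitEquation z₀ μ y) (hm : 0 < m) {t : ℝ≥0} {k : ℕ} (hk1 : (k : ℝ) ≤ t * m)
    (hk2 : (t : ℝ) * m < k + 1) {b : ℤ} (hb : ActiveBlock z₀ m (markedCells m B J μ) k b) :
    ∃ u, (b : ℝ) / m ≤ u ∧ u < ((b : ℝ) + 1) / m ∧ 0 < y t u := by
  have hm' : (0 : ℝ) < m := by exact_mod_cast hm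
  obtain ⟨j, ⟨hjk, hact⟩, -, -, -, hne⟩ := hb
  obtain ⟨A, hA⟩ := exists_nat_ge (max (max (-((b : ℝ) / m)) (((b : ℝ) + 1) / m))
    (((j : ℝ) + 1) / m))
  have hfin : μ (cell m b j) ≠ ∞ := by
    refine ne_top_of_le_ne_top (hμ.finite A) (measure_mono (prod_mono ?_ ?_))
    · intro v hv
      have h1 := ((le_max_left _ _).trans (le_max_left _ _)).trans hA
      have h2 := ((le_max_right _ _).trans (le_max_left _ _)).trans hA
      exact ⟨by linarith [hv.1], by linarith [hv.2]⟩
    · intro v hv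
      have h1 := (le_max_right _ _).trans hA
      exact ⟨(by positivity : (0 : ℝ) ≤ (j : ℝ) / m).trans hv.1.le, hv.2.trans h1⟩
  obtain ⟨⟨u, s⟩, hp, hs⟩ := hμ.exists_atom (measurableSet_cell m b j) hne hfin
  have h1 : (j : ℝ) < s * m := by
    have := hp.2.1; rwa [div_lt_iff₀ hm'] at this
  have h2 : s * m ≤ j + 1 := by
    have := hp.2.2; rwa [le_div_iff₀ hm'] at this
  have hjk' : (j : ℝ) + 1 ≤ k := by exact_mod_cast hjk
  refine ⟨u, hp.1.1, hp.1.2, (hy.pos_iff hz hμ u t).2 ⟨s, hs, ?_, fun hsz => ?_⟩⟩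
  · exact le_of_mul_le_mul_right (by linarith : s * m ≤ t * m) hm'
  -- For an early cell, `t < (k + 1) / m < 2 * j / m < 2 * s`, so the mark is still alive whichever
  -- point of the cells is taken. For a late cell the mark is after `z₀`.
  · rcases hact with ⟨h3, -⟩ | h3
    · have : ((k + 1 : ℕ) : ℝ) < (2 * j : ℕ) := by exact_mod_cast h3
      push_cast at this
      exact lt_of_mul_lt_mul_right (by linarith : (t : ℝ) * m < 2 * s * m) hm'.le
    · have : s * m < z₀ * m := by gcongr
      linarith

lemma clusterDist_mkInterval (x : ℝ) {a b c d : ℝ} (h : a ≤ b) (h' : c ≤ d) :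
    clusterDist x (mkInterval a b) (mkInterval c d) = |a - c| + |b - d| := by
  unfold clusterDist
  rw [ends_mkInterval x h, ends_mkInterval x h']

lemma limitCluster_of_lt {t x : ℝ} (ht : t < 1) : limitCluster y t x = mkInterval x x :=
  if_pos ht

lemma limitCluster_of_le {t : ℝ≥0} {x : ℝ} (ht : 1 ≤ (t : ℝ)) : limitCluster y t x =
    mkInterval (sSup {u | u ≤ x ∧ 0 < y t u}) (sInf {u | x ≤ u ∧ 0 < y t u}) := by
  have := Real.toNNReal_coe (r := t)
  conv_rhs => rw [← this]
  exact if_neg (not_lt.2 ht)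

/-- An active block contains a positive site, which confines each end of the cluster from outside.
Conversely a positive site lies in a marked cell that is not inactive; without `Hit` that cell is
active, hence not strictly between the two nearest active blocks. Each end is thus in the
corresponding active block. The first half needs no assumption on `Hit` and gives the crude bound at
all times. -/
lemma limit_closeToGrid (hz : z₀ ∈ Icc (0 : ℝ) 1) (hμ : GoodMarks z₀ μ)
    (hy : LimitEquation z₀ μ y) (hm : 0 < m) {x : ℝ}
    (hB : 0 ≤ B) (hG : GoodCells z₀ m B J (markedCells m B J μ) x) :
    CloseToGrid z₀ m B J (markedCells m B J μ) x (fun t => limitCluster y t x) := by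
  have hm' : (0 : ℝ) < m := by exact_mod_cast hm
  have hB' : (0 : ℝ) ≤ B := by exact_mod_cast hB
  obtain ⟨x1, x2⟩ := GoodCells.floor_bounds hm x
  have hsmall : ∀ t : ℝ, t < 1 → limitCluster y t x = mkInterval x x := fun t ht =>
    limitCluster_of_lt ht
  have key : ∀ (t : ℝ≥0) (k : ℕ), (k : ℝ) ≤ t * m → (t : ℝ) * m < k + 1 → m ≤ k → k < J →
      ∃ L R : ℝ, limitCluster y t x = mkInterval L R ∧ L ≤ x ∧ x ≤ R ∧
        (leftBlock z₀ m (markedCells m B J μ) k x : ℝ) / m ≤ L ∧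
        R ≤ ((rightBlock z₀ m (markedCells m B J μ) k x : ℝ) + 1) / m ∧
        (¬Hit z₀ m (markedCells m B J μ) k →
          L ≤ ((leftBlock z₀ m (markedCells m B J μ) k x : ℝ) + 1) / m ∧
          (rightBlock z₀ m (markedCells m B J μ) k x : ℝ) / m ≤ R) := by
    intro t k hk1 hk2 hmk hkJ
    have ht1 : ¬((t : ℝ) < 1) := by
      rw [not_lt]
      have : (m : ℝ) ≤ k := by exact_mod_cast hmk
      exact le_of_mul_le_mul_right (by linarith : 1 * (m : ℝ) ≤ t * m) hm'
    obtain ⟨r1, r2, r3, r4⟩ := hG.exists_right (by omega : m ≤ k + 1) hkJ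
    obtain ⟨l1, l2, l3, l4⟩ := hG.exists_left (by omega : m ≤ k + 1) hkJ
    obtain ⟨u, hu1, hu2, hu3⟩ := exists_pos_of_active hz hμ hy hm hk1 hk2 r3
    obtain ⟨w, hw1, hw2, hw3⟩ := exists_pos_of_active hz hμ hy hm hk1 hk2 l3
    set rb := rightBlock z₀ m (markedCells m B J μ) k x
    set lb := leftBlock z₀ m (markedCells m B J μ) k x
    have hxu : x ≤ u := by
      refine x2.le.trans (le_trans ?_ hu1)
      have : (⌊x * m⌋ : ℝ) + 1 ≤ rb := by exact_mod_cast (show ⌊x * m⌋ + 1 ≤ rb by omega)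
      gcongr
    have hwx : w ≤ x := by
      refine le_trans (hw2.le.trans ?_) x1
      have : (lb : ℝ) + 1 ≤ ⌊x * m⌋ := by exact_mod_cast (show lb + 1 ≤ ⌊x * m⌋ by omega)
      gcongr
    have hbelow : BddBelow {u | x ≤ u ∧ 0 < y t u} := ⟨x, fun v hv => hv.1⟩
    have habove : BddAbove {u | u ≤ x ∧ 0 < y t u} := ⟨x, fun v hv => hv.1⟩
    refine ⟨_, _, limitCluster_of_le (not_lt.1 ht1),
      csSup_le ⟨w, hwx, hw3⟩ (fun v hv => hv.1), le_csInf ⟨u, hxu, hu3⟩ (fun v hv => hv.1),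
      hw1.trans (le_csSup habove ⟨hwx, hw3⟩),
      (csInf_le hbelow ⟨hxu, hu3⟩).trans hu2.le, fun hhit => ⟨?_, ?_⟩⟩
    · refine csSup_le ⟨w, hwx, hw3⟩ fun v hv => ?_
      by_contra hcon
      rw [not_le] at hcon
      have hvm : (lb : ℝ) + 1 < v * m := by rwa [div_lt_iff₀ hm'] at hcon
      have e1 : lb + 1 ≤ ⌊v * m⌋ := by rw [Int.le_floor]; push_cast; exact hvm.le
      have e2 : ⌊v * m⌋ ≤ ⌊x * m⌋ := Int.floor_le_floor (by gcongr; exact hv.1)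
      obtain ⟨j, hj1, hj2⟩ := marked_of_pos (B := B) (J := J) hz hμ hy hm hk1 hk2 hkJ hv.2
        (by omega) (by omega)
      have hact : Active z₀ m k j := by
        by_contra hna
        exact hhit ⟨_, j, hj1, hna, hj2⟩
      have := l4 _ e2 ⟨j, hact, hj1⟩
      omega
    · refine le_csInf ⟨u, hxu, hu3⟩ fun v hv => ?_
      by_contra hcon
      rw [not_le] at hcon
      have hvm : v * m < rb := by rwa [lt_div_iff₀ hm'] at hcon
      have e1 : ⌊v * m⌋ < rb := by rw [Int.floor_lt]; exact hvm
      have e2 : ⌊x * m⌋ ≤ ⌊v * m⌋ := Int.floor_le_floor (by gcongr; exact hv.1)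
      obtain ⟨j, hj1, hj2⟩ := marked_of_pos (B := B) (J := J) hz hμ hy hm hk1 hk2 hkJ hv.2
        (by omega) (by omega)
      have hact : Active z₀ m k j := by
        by_contra hna
        exact hhit ⟨_, j, hj1, hna, hj2⟩
      have := r4 _ e2 ⟨j, hact, hj1⟩
      omega
  refine ⟨?_, ?_, ?_⟩
  · intro t _ ht
    have : t < 1 := lt_of_mul_lt_mul_right (by linarith : t * m < 1 * m) hm'.le
    simp only [hsmall t this]
    rw [clusterDist_self]
    positivity
  · intro t k hk1 hk2 hmk hkJ hhit
    have ht0 : 0 ≤ t := by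
      have : (0 : ℝ) ≤ t * m := (Nat.cast_nonneg k).trans hk1
      exact nonneg_of_mul_nonneg_left this hm'
    lift t to ℝ≥0 using ht0
    obtain ⟨L, R, e, hL, hR, c1, c2, c3⟩ := key t k hk1 hk2 hmk hkJ
    obtain ⟨c4, c5⟩ := c3 hhit
    simp only [e]
    unfold clusterDist
    rw [ends_mkInterval x (hL.trans hR), hG.ends_gridCluster hmk hkJ]
    simp only
    rw [add_div] at c2 c4
    rw [abs_of_nonneg (by linarith), abs_of_nonneg (by linarith)]
    have : (20 : ℝ) / m = 20 * (1 / m) := by ring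
    have h1 : (0 : ℝ) < 1 / m := by positivity
    linarith
  · intro t ht0 htJ
    rcases lt_or_ge t 1 with h1 | h1
    · simp only [hsmall t h1]
      rw [clusterDist_self]
      positivity
    · lift t to ℝ≥0 using ht0
      have hk1 : ((⌊(t : ℝ) * m⌋₊ : ℕ) : ℝ) ≤ t * m := Nat.floor_le (by positivity)
      have hmk : m ≤ ⌊(t : ℝ) * m⌋₊ := Nat.le_floor (le_mul_of_one_le_left hm'.le h1)
      have hkJ : ⌊(t : ℝ) * m⌋₊ < J := by exact_mod_cast hk1.trans_lt htJ
      obtain ⟨L, R, e, hL, hR, c1, c2, -⟩ := key t _ hk1 (Nat.lt_floor_add_one _) hmk hkJ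
      obtain ⟨-, r2, -, -⟩ := hG.exists_right (by omega) hkJ
      obtain ⟨-, l2, -, -⟩ := hG.exists_left (by omega) hkJ
      simp only [e]
      rw [clusterDist_mkInterval x (hL.trans hR) le_rfl, abs_of_nonpos (by linarith),
        abs_of_nonneg (by linarith)]
      have e3 : (-B : ℝ) / m ≤ L := by
        refine le_trans ?_ c1
        have : (-B : ℝ) ≤ leftBlock z₀ m (markedCells m B J μ) ⌊(t : ℝ) * m⌋₊ x := by
          exact_mod_cast (show -B ≤ leftBlock z₀ m (markedCells m B J μ) ⌊(t : ℝ) * m⌋₊ x by omega)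
        gcongr
      have e4 : R ≤ B / m := by
        refine c2.trans ?_
        have : (rightBlock z₀ m (markedCells m B J μ) ⌊(t : ℝ) * m⌋₊ x : ℝ) + 1 ≤ B := by
          exact_mod_cast
            (show rightBlock z₀ m (markedCells m B J μ) ⌊(t : ℝ) * m⌋₊ x + 1 ≤ B by omega)
        gcongr
      have e5 : (2 * B : ℝ) / m = B / m - -B / m := by ring
      rw [e5]
      linarith

end LimitClose

/-! ### Distances to the path of the grid clusters -/

lemma IsCadlag.comp_subtype {E : Type*} [TopologicalSpace E] {f : ℝ → E} (hf : IsCadlag f)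
    (s : Set ℝ) : IsCadlag (fun t : s => f t) := by
  intro t
  obtain ⟨h1, l, h2⟩ := hf t
  refine ⟨?_, l, ?_⟩
  · exact h1.comp continuous_subtype_val.continuousWithinAt fun u hu => hu
  · refine h2.comp (tendsto_nhdsWithin_iff.2 ⟨?_, ?_⟩)
    · exact (continuous_subtype_val.tendsto t).mono_left nhdsWithin_le_nhds
    · filter_upwards [self_mem_nhdsWithin] with u hu using hu

/-- Step functions are càdlàg. -/
lemma isCadlag_step {E : Type*} [TopologicalSpace E] (g : ℕ → E) {r : ℝ} (hr : 0 < r) :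
    IsCadlag (fun t : ℝ => g ⌊t * r⌋₊) := by
  intro t
  refine ⟨?_, g (⌈t * r⌉ - 1).toNat, ?_⟩
  · refine tendsto_nhds_of_eventually_eq ?_
    have h1 : Tendsto (fun s : ℝ => s * r) (𝓝[≥] t) (𝓝[≥] (t * r)) :=
      tendsto_nhdsWithin_iff.2 ⟨(continuous_mul_const r).continuousAt.continuousWithinAt,
        eventually_mem_nhdsWithin.mono fun s hs => mul_le_mul_of_nonneg_right hs hr.le⟩
    filter_upwards [h1.eventually (tendsto_pure.1 (tendsto_floor_right_pure_floor (t * r)))]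
      with s hs
    rw [← Int.floor_toNat, ← Int.floor_toNat, hs]
  · refine tendsto_nhds_of_eventually_eq ?_
    have h1 : Tendsto (fun s : ℝ => s * r) (𝓝[<] t) (𝓝[<] (t * r)) :=
      tendsto_nhdsWithin_iff.2 ⟨(continuous_mul_const r).continuousAt.continuousWithinAt,
        eventually_mem_nhdsWithin.mono fun s hs => mul_lt_mul_of_pos_right hs hr⟩
    filter_upwards [h1.eventually (tendsto_pure.1 (tendsto_floor_left_pure_ceil_sub_one (t * r)))]
      with s hs
    rw [← Int.floor_toNat, hs]

section Distances

variable {z₀ : ℝ} {m : ℕ} {B : ℤ} {J : ℕ} {V : ℤ → ℕ → Prop}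

/-- The path of the grid clusters of `x`. -/
def gridPath (z₀ : ℝ) (m : ℕ) (V : ℤ → ℕ → Prop) (x t : ℝ) : Cluster x :=
  gridCluster z₀ m V ⌊t * m⌋₊ x

lemma isCadlag_gridPath (hm : 0 < m) (x T : ℝ) :
    IsCadlag (fun t : Icc (0 : ℝ) T => gridPath z₀ m V x t) :=
  (isCadlag_step (E := Cluster x) (fun k => gridCluster z₀ m V k x)
    (r := (m : ℝ)) (by exact_mod_cast hm)).comp_subtype _

variable {x : ℝ} {X : ℝ → Cluster x}

/-- The time cell `m - 1`, just before time `1`, is excluded: the grid cluster is still a point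
there, while the bound `early` stops at the beginning of that cell. -/
lemma CloseToGrid.gridPath_le_of_not_hit (h : CloseToGrid z₀ m B J V x X) (hm : 0 < m) {t : ℝ}
    (ht : 0 ≤ t) (htJ : ⌊t * m⌋₊ < J) (h1 : ⌊t * m⌋₊ + 1 ≠ m) (hh : ¬Hit z₀ m V ⌊t * m⌋₊) :
    clusterDist x (X t) (gridPath z₀ m V x t) ≤ 20 / m := by
  have hm' : (0 : ℝ) < m := by exact_mod_cast hm
  have hf := Nat.floor_le (show 0 ≤ t * m by positivity)
  have hf' := Nat.lt_floor_add_one (t * m)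
  rcases lt_or_ge ⌊t * m⌋₊ m with hk | hk
  · have e : gridPath z₀ m V x t = mkInterval x x := if_pos hk
    rw [e]
    refine h.early t ht ?_
    have : ((⌊t * m⌋₊ + 2 : ℕ) : ℝ) ≤ m := by exact_mod_cast (show ⌊t * m⌋₊ + 2 ≤ m by omega)
    push_cast at this
    linarith
  · exact h.close t _ hf hf' hk htJ hh

lemma CloseToGrid.gridPath_le (h : CloseToGrid z₀ m B J V x X) (hG : GoodCells z₀ m B J V x)
    (hm : 0 < m) (hB : 0 ≤ B) {t : ℝ} (ht : 0 ≤ t) (htJ : ⌊t * m⌋₊ < J) :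
    clusterDist x (X t) (gridPath z₀ m V x t) ≤ 4 * B / m := by
  have hm' : (0 : ℝ) < m := by exact_mod_cast hm
  have h1 : t * m < J := (Nat.lt_floor_add_one (t * m)).trans_le (by exact_mod_cast htJ)
  have h2 := h.bdd t ht h1
  have h3 := hG.gridCluster_bdd hm htJ hB
  rw [clusterDist_comm] at h3
  have h4 := clusterDist_triangle x (X t) (mkInterval x x) (gridPath z₀ m V x t)
  have : (4 * B / m : ℝ) = 2 * B / m + 2 * B / m := by ring
  rw [this]
  exact h4.trans (add_le_add h2 h3)

open Classical in
-- At most `n₀ + 1` time cells of length `1 / m` are exceptional, namely the hit ones and the cell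
-- `m - 1`. They contribute with the crude bound `4 * B / m`, the others with `20 / m`.
lemma pathDist_gridPath_le {T : ℝ} (hT : 0 ≤ T) (h : CloseToGrid z₀ m B J V x X)
    (hG : GoodCells z₀ m B J V x) (hm : 0 < m) (hB : 0 ≤ B) (hJ : T * m < J)
    (hX : IsCadlag (fun t : Icc (0 : ℝ) T => X t)) {n₀ : ℕ}
    (hn : ((Finset.range J).filter (Hit z₀ m V)).card ≤ n₀) :
    pathDist T x (fun t => X t) (fun t => gridPath z₀ m V x t) ≤
      20 / m * T + 4 * B / m * ((n₀ + 1) / m) := by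
  have hm' : (0 : ℝ) < m := by exact_mod_cast hm
  have hB' : (0 : ℝ) ≤ B := by exact_mod_cast hB
  set bad : Finset ℕ := insert (m - 1) ((Finset.range J).filter (Hit z₀ m V)) with hbad
  set I : ℕ → Set ℝ := fun k => Ico ((k : ℝ) / m) (((k : ℝ) + 1) / m) with hI
  have hIm : ∀ k, MeasurableSet (I k) := fun k => measurableSet_Ico
  have hIv : ∀ k, volume.real (I k) = 1 / m := fun k => by
    rw [hI, measureReal_def, Real.volume_Ico, ENNReal.toReal_ofReal
      (sub_nonneg.2 (by gcongr; linarith))]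
    ring
  set g : ℝ → ℝ := fun t => 20 / m + ∑ k ∈ bad, (I k).indicator (fun _ => (4 * B / m : ℝ)) t
    with hg
  have hle : ∀ t : Icc (0 : ℝ) T, clusterDist x (X t) (gridPath z₀ m V x t) ≤ g t := by
    intro t
    have ht0 := t.2.1
    have htJ : ⌊(t : ℝ) * m⌋₊ < J := by
      rw [Nat.floor_lt (by positivity)]
      exact lt_of_le_of_lt (by gcongr; exact t.2.2) hJ
    have hnn : ∀ k ∈ bad, 0 ≤ (I k).indicator (fun _ => (4 * B / m : ℝ)) t := fun k _ =>
      indicator_nonneg (fun _ _ => by positivity) _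
    by_cases hk : ⌊(t : ℝ) * m⌋₊ ∈ bad
    · have h1 : (t : ℝ) ∈ I ⌊(t : ℝ) * m⌋₊ := by
        refine ⟨?_, ?_⟩
        · rw [div_le_iff₀ hm']; exact Nat.floor_le (by positivity)
        · rw [lt_div_iff₀ hm']; exact Nat.lt_floor_add_one _
      have h2 := Finset.single_le_sum hnn hk
      rw [indicator_of_mem h1] at h2
      have h3 := h.gridPath_le hG hm hB ht0 htJ
      have : (0 : ℝ) ≤ 20 / m := by positivity
      simp only [hg]
      linarith
    · simp only [hbad, Finset.mem_insert, Finset.mem_filter, Finset.mem_range, not_or,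
        not_and] at hk
      have h3 := h.gridPath_le_of_not_hit hm ht0 htJ (by omega) (hk.2 htJ)
      have := Finset.sum_nonneg hnn
      simp only [hg]
      linarith
  have hgi : ∀ k, IntegrableOn ((I k).indicator (fun _ => (4 * B / m : ℝ))) (Icc 0 T) := fun k =>
    (integrable_const (4 * B / m : ℝ)).indicator (hIm k)
  have hgint : IntegrableOn g (Icc 0 T) :=
    (integrable_const _).add (integrable_finsetSum _ fun k _ => hgi k)
  have hgint' : Integrable (fun t : Icc (0 : ℝ) T => g t)
      (volume.comap ((↑) : Icc (0 : ℝ) T → ℝ)) := by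
    have := (MeasurableEmbedding.subtype_coe (measurableSet_Icc (a := (0 : ℝ)) (b := T))
      ).integrable_map_iff (μ := volume.comap ((↑) : Icc (0 : ℝ) T → ℝ)) (g := g)
    rw [map_comap_subtype_coe measurableSet_Icc] at this
    exact this.1 hgint
  have h1 : pathDist T x (fun t => X t) (fun t => gridPath z₀ m V x t) ≤ ∫ t in Icc 0 T, g t := by
    rw [← integral_subtype_comap measurableSet_Icc g]
    exact integral_mono (integrable_clusterDist hX (isCadlag_gridPath hm x T)) hgint' hle
  refine h1.trans ?_
  rw [hg, integral_add (integrable_const _) (integrable_finsetSum _ fun k _ => hgi k),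
    integral_finsetSum _ fun k _ => hgi k]
  refine add_le_add ?_ ?_
  · rw [setIntegral_const, measureReal_def, Real.volume_Icc, sub_zero, ENNReal.toReal_ofReal hT,
      smul_eq_mul, mul_comm]
  · have h2 : ∀ k ∈ bad, ∫ t in Icc 0 T, (I k).indicator (fun _ => (4 * B / m : ℝ)) t ≤
        4 * B / m * (1 / m) := fun k _ => by
      rw [integral_indicator (hIm k), Measure.restrict_restrict (hIm k), setIntegral_const,
        smul_eq_mul, mul_comm, ← hIv k]
      gcongr
      · rw [hI]; simp
      · exact inter_subset_left
    refine (Finset.sum_le_sum h2).trans ?_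
    rw [Finset.sum_const, nsmul_eq_mul]
    have h3 : (bad.card : ℝ) ≤ n₀ + 1 := by
      exact_mod_cast (Finset.card_insert_le _ _).trans (Nat.add_le_add_right hn 1)
    calc (bad.card : ℝ) * (4 * B / m * (1 / m)) ≤ (n₀ + 1) * (4 * B / m * (1 / m)) := by gcongr
      _ = 4 * B / m * ((n₀ + 1) / m) := by ring

end Distances

lemma toPathTuple_val {T : ℝ} {q : ℕ} {x : Fin q → ℝ} {f : ∀ i, Icc (0 : ℝ) T → Cluster (x i)}
    (h : ∀ i, IsCadlag (f i)) : (toPathTuple T x f).1 = f := by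
  exact congrArg Subtype.val (dif_pos h)

open Classical in
lemma dist_toPathTuple_gridPath_le {z₀ : ℝ} {m : ℕ} {B : ℤ} {J : ℕ} {V : ℤ → ℕ → Prop} {T : ℝ}
    {q : ℕ} {x : Fin q → ℝ} {X : ∀ i, ℝ → Cluster (x i)} (hT : 0 ≤ T)
    (h : ∀ i, CloseToGrid z₀ m B J V (x i) (X i))
    (hG : ∀ i, GoodCells z₀ m B J V (x i)) (hm : 0 < m) (hB : 0 ≤ B) (hJ : T * m < J)
    (hX : ∀ i, IsCadlag (fun t : Icc (0 : ℝ) T => X i t)) {n₀ : ℕ}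
    (hn : ((Finset.range J).filter (Hit z₀ m V)).card ≤ n₀) :
    dist (toPathTuple T x fun i t => X i t) (toPathTuple T x fun i t => gridPath z₀ m V (x i) t) ≤
      q * (20 / m * T + 4 * B / m * ((n₀ + 1) / m)) := by
  change ∑ i, pathDist T (x i) ((toPathTuple T x fun i t => X i t).1 i)
    ((toPathTuple T x fun i t => gridPath z₀ m V (x i) t).1 i) ≤ _
  rw [toPathTuple_val hX, toPathTuple_val fun i => isCadlag_gridPath hm (x i) T]
  refine (Finset.sum_le_sum fun i _ =>
    pathDist_gridPath_le hT (h i) (hG i) hm hB hJ (hX i) hn).trans ?_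
  rw [Finset.sum_const, Finset.card_univ, Fintype.card_fin, nsmul_eq_mul]

lemma dist_clusterTuple_gridPath_le {z₀ : ℝ} {m : ℕ} {B : ℤ} {J : ℕ} {V : ℤ → ℕ → Prop}
    {q : ℕ} {x t : Fin q → ℝ} {X : ∀ i, ℝ → Cluster (x i)}
    (h : ∀ i, CloseToGrid z₀ m B J V (x i) (X i)) (hm : 0 < m) (ht : ∀ i, 0 ≤ t i)
    (hJ : ∀ i, ⌊t i * m⌋₊ < J) (h1 : ∀ i, ⌊t i * m⌋₊ + 1 ≠ m)
    (hh : ∀ i, ¬Hit z₀ m V ⌊t i * m⌋₊) :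
    dist (α := ClusterTuple x) (fun i => X i (t i)) (fun i => gridPath z₀ m V (x i) (t i)) ≤
      q * (20 / m) := by
  change ∑ i, clusterDist (x i) (X i (t i)) (gridPath z₀ m V (x i) (t i)) ≤ _
  refine (Finset.sum_le_sum fun i _ =>
    (h i).gridPath_le_of_not_hit hm (ht i) (hJ i) (h1 i) (hh i)).trans ?_
  rw [Finset.sum_const, Finset.card_univ, Fintype.card_fin, nsmul_eq_mul]

/-! ### The clusters of the limit process are càdlàg -/

/-- Disjoint atoms of mass at least `1` in a set of finite mass. -/
lemma GoodMarks.finite_atoms {z₀ : ℝ} {μ : Measure (ℝ × ℝ)} (h : GoodMarks z₀ μ) (A : ℕ) :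
    {p | p ∈ Icc (-A : ℝ) A ×ˢ Icc (0 : ℝ) A ∧ μ {p} ≠ 0}.Finite := by
  set s := Icc (-A : ℝ) A ×ˢ Icc (0 : ℝ) A
  have h1 := Measure.finite_const_le_meas_of_disjoint_iUnion μ (ι := s) (ε := 1) one_pos
    (As := fun p => {(p : ℝ × ℝ)}) (fun p => measurableSet_singleton _)
    (fun p q hpq => by
      simp only [Function.onFun, disjoint_singleton]
      exact fun h => hpq (Subtype.ext h))
    (ne_top_of_le_ne_top (h.finite A) (measure_mono (iUnion_subset fun p =>
      singleton_subset_iff.2 p.2)))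
  refine (h1.image Subtype.val).subset ?_
  rintro p ⟨hp, hp0⟩
  exact ⟨⟨p, hp⟩, h.one_le (measurableSet_singleton _) hp0, rfl⟩

/-- The mark at time `s` makes its site positive at time `t`. -/
def Alive (z₀ s t : ℝ) : Prop := s ≤ t ∧ (s < z₀ → t < 2 * s)

lemma eventually_alive_iff (z₀ s t : ℝ) : ∀ᶠ u in 𝓝[≥] t, Alive z₀ s u ↔ Alive z₀ s t := by
  have h1 : ∀ᶠ u in 𝓝[≥] t, (s ≤ u ↔ s ≤ t) := by
    rcases le_or_gt s t with h | h
    · filter_upwards [self_mem_nhdsWithin] with u hu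
      exact iff_of_true (h.trans hu) h
    · filter_upwards [mem_nhdsWithin_of_mem_nhds (Iio_mem_nhds h)] with u hu
      exact iff_of_false (not_le.2 hu) (not_le.2 h)
  have h2 : ∀ᶠ u in 𝓝[≥] t, (u < 2 * s ↔ t < 2 * s) := by
    rcases lt_or_ge t (2 * s) with h | h
    · filter_upwards [mem_nhdsWithin_of_mem_nhds (Iio_mem_nhds h)] with u hu
      exact iff_of_true hu h
    · filter_upwards [self_mem_nhdsWithin] with u hu
      exact iff_of_false (not_lt.2 (h.trans hu)) (not_lt.2 h)
  filter_upwards [h1, h2] with u h1 h2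
  simp only [Alive, h1, h2]

lemma eventually_alive_iff_left (z₀ s t : ℝ) :
    ∃ p : Prop, ∀ᶠ u in 𝓝[<] t, Alive z₀ s u ↔ p := by
  have h1 : ∀ᶠ u in 𝓝[<] t, (s ≤ u ↔ s < t) := by
    rcases lt_or_ge s t with h | h
    · filter_upwards [mem_nhdsWithin_of_mem_nhds (Ioi_mem_nhds h)] with u hu
      exact iff_of_true (le_of_lt hu) h
    · filter_upwards [self_mem_nhdsWithin] with u hu
      exact iff_of_false (not_le.2 (lt_of_lt_of_le hu h)) (not_lt.2 h)
  have h2 : ∀ᶠ u in 𝓝[<] t, (u < 2 * s ↔ t ≤ 2 * s) := by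
    rcases le_or_gt t (2 * s) with h | h
    · filter_upwards [self_mem_nhdsWithin] with u hu
      exact iff_of_true (lt_of_lt_of_le hu h) h
    · filter_upwards [mem_nhdsWithin_of_mem_nhds (Ioi_mem_nhds h)] with u hu
      exact iff_of_false (not_lt.2 (le_of_lt hu)) (not_le.2 h)
  refine ⟨s < t ∧ (s < z₀ → t ≤ 2 * s), ?_⟩
  filter_upwards [h1, h2] with u h1 h2
  simp only [Alive, h1, h2]

lemma csInf_eq_of_inter_eq {s t : Set ℝ} {b : ℝ} (hs : BddBelow s) (ht : BddBelow t)
    (h : s ∩ Iic b = t ∩ Iic b) (hne : (s ∩ Iic b).Nonempty) : sInf s = sInf t := by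
  have aux : ∀ {s : Set ℝ}, BddBelow s → (s ∩ Iic b).Nonempty → sInf s = sInf (s ∩ Iic b) := by
    intro s hs hne
    refine le_antisymm (csInf_le_csInf hs hne inter_subset_left) ?_
    obtain ⟨v, hv⟩ := hne
    have hb : BddBelow (s ∩ Iic b) := hs.mono inter_subset_left
    refine le_csInf ⟨v, hv.1⟩ fun u hu => ?_
    rcases le_or_gt u b with h | h
    · exact csInf_le hb ⟨hu, h⟩
    · exact (csInf_le hb hv).trans (le_trans hv.2 h.le)
  rw [aux hs hne, aux ht (h ▸ hne), h]

lemma csSup_eq_of_inter_eq {s t : Set ℝ} {b : ℝ} (hs : BddAbove s) (ht : BddAbove t)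
    (h : s ∩ Ici b = t ∩ Ici b) (hne : (s ∩ Ici b).Nonempty) : sSup s = sSup t := by
  have h1 := csInf_eq_of_inter_eq (s := -s) (t := -t) (b := -b) hs.neg ht.neg
    (by
      ext u
      have := Set.ext_iff.1 h (-u)
      simpa [le_neg] using this)
    (by
      obtain ⟨v, hv⟩ := hne
      exact ⟨-v, by simpa using hv⟩)
  rw [Real.sInf_def, Real.sInf_def, neg_neg, neg_neg] at h1
  exact neg_injective h1

/-- After time `1` the ends of the cluster are found in a bounded box, which contains finitely many
marks. Whether a given mark is alive is constant just after and just before any time, so the cluster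
itself is locally constant on each side. -/
lemma limitCluster_isCadlag {z₀ : ℝ} (hz : z₀ ∈ Icc (0 : ℝ) 1) {μ : Measure (ℝ × ℝ)}
    (hμ : GoodMarks z₀ μ) {y : ℝ≥0 → ℝ → ℝ} (hy : LimitEquation z₀ μ y) {m : ℕ} (hm : 0 < m)
    {B : ℤ} {J : ℕ} {T x : ℝ} (hJ : T * m < J)
    (hG : GoodCells z₀ m B J (markedCells m B J μ) x) :
    IsCadlag (fun t : Icc (0 : ℝ) T => limitCluster y t x) := by
  have hm' : (0 : ℝ) < m := by exact_mod_cast hm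
  obtain ⟨x1, x2⟩ := GoodCells.floor_bounds hm x
  obtain ⟨A, hA⟩ := exists_nat_ge (max (max |x| (B / m)) T)
  have hAx : |x| ≤ A := (le_max_left _ _).trans ((le_max_left _ _).trans hA)
  have hAB : (B : ℝ) / m ≤ A := (le_max_right _ _).trans ((le_max_left _ _).trans hA)
  have hAT : T ≤ A := (le_max_right _ _).trans hA
  have hfin := hμ.finite_atoms A
  set F := {p | p ∈ Icc (-A : ℝ) A ×ˢ Icc (0 : ℝ) A ∧ μ {p} ≠ 0} with hF
  have hsite : ∀ t : ℝ, 0 ≤ t → t ≤ T → ∀ u : ℝ, -A ≤ u → u ≤ A →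
      (0 < y t.toNNReal u ↔ ∃ p ∈ F, p.1 = u ∧ Alive z₀ p.2 t) := by
    intro t ht0 htT u hu1 hu2
    rw [hy.pos_iff hz hμ, Real.coe_toNNReal t ht0]
    constructor
    · rintro ⟨s, h1, h2, h3⟩
      exact ⟨(u, s), ⟨⟨⟨hu1, hu2⟩, (mark_pos hμ h1).le, h2.trans (htT.trans hAT)⟩, h1⟩, rfl, h2, h3⟩
    · rintro ⟨⟨u', s⟩, ⟨-, h1⟩, rfl, h2⟩
      exact ⟨s, h1, h2⟩
  have hpos : ∀ t : ℝ, 1 ≤ t → t ≤ T →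
      (∃ u, x ≤ u ∧ u ≤ A ∧ 0 < y t.toNNReal u) ∧ ∃ u : ℝ, -A ≤ u ∧ u ≤ x ∧ 0 < y t.toNNReal u := by
    intro t ht1 htT
    have ht0 : 0 ≤ t := zero_le_one.trans ht1
    have hc := Real.coe_toNNReal t ht0
    have hk1 : ((⌊t * m⌋₊ : ℕ) : ℝ) ≤ (t.toNNReal : ℝ) * m := by
      rw [hc]; exact Nat.floor_le (by positivity)
    have hk2 : (t.toNNReal : ℝ) * m < (⌊t * m⌋₊ : ℕ) + 1 := by
      rw [hc]; exact Nat.lt_floor_add_one _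
    have hmk : m ≤ ⌊t * m⌋₊ := Nat.le_floor (le_mul_of_one_le_left hm'.le ht1)
    have hkJ : ⌊t * m⌋₊ < J := by
      rw [Nat.floor_lt (by positivity)]
      exact lt_of_le_of_lt (by gcongr) hJ
    obtain ⟨r1, r2, r3, -⟩ := hG.exists_right (by omega : m ≤ ⌊t * m⌋₊ + 1) hkJ
    obtain ⟨l1, l2, l3, -⟩ := hG.exists_left (by omega : m ≤ ⌊t * m⌋₊ + 1) hkJ
    obtain ⟨u, hu1, hu2, hu3⟩ := exists_pos_of_active hz hμ hy hm hk1 hk2 r3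
    obtain ⟨w, hw1, hw2, hw3⟩ := exists_pos_of_active hz hμ hy hm hk1 hk2 l3
    refine ⟨⟨u, ?_, ?_, hu3⟩, w, ?_, ?_, hw3⟩
    · refine x2.le.trans (le_trans ?_ hu1)
      have := (Int.cast_le (R := ℝ)).2 (show ⌊x * m⌋ + 1 ≤ rightBlock z₀ m (markedCells m B J μ)
        ⌊t * m⌋₊ x by omega)
      push_cast at this
      gcongr
    · refine hu2.le.trans (le_trans ?_ hAB)
      have := (Int.cast_le (R := ℝ)).2 (show rightBlock z₀ m (markedCells m B J μ)
        ⌊t * m⌋₊ x + 1 ≤ B by omega)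
      push_cast at this
      gcongr
    · refine le_trans ?_ hw1
      have := (Int.cast_le (R := ℝ)).2 (show -B ≤ leftBlock z₀ m (markedCells m B J μ)
        ⌊t * m⌋₊ x by omega)
      push_cast at this
      calc -(A : ℝ) ≤ -B / m := by rw [neg_div]; linarith
        _ ≤ _ := by gcongr
    · refine le_trans (hw2.le.trans ?_) x1
      have := (Int.cast_le (R := ℝ)).2 (show leftBlock z₀ m (markedCells m B J μ)
        ⌊t * m⌋₊ x + 1 ≤ ⌊x * m⌋ by omega)
      push_cast at this
      gcongr
  have heq : ∀ t u : ℝ, 1 ≤ t → t ≤ T → 1 ≤ u → u ≤ T →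
      (∀ p ∈ F, Alive z₀ p.2 t ↔ Alive z₀ p.2 u) → limitCluster y t x = limitCluster y u x := by
    intro t u ht htT hu huT hF
    have hS : ∀ v : ℝ, -A ≤ v → v ≤ A → (0 < y t.toNNReal v ↔ 0 < y u.toNNReal v) := by
      intro v hv1 hv2
      rw [hsite t (by linarith) htT v hv1 hv2, hsite u (by linarith) huT v hv1 hv2]
      exact exists_congr fun p => and_congr_right fun hp => and_congr_right fun _ => hF p hp
    obtain ⟨⟨a, ha1, ha2, ha3⟩, b, hb1, hb2, hb3⟩ := hpos t ht htT
    have hx := abs_le.1 hAx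
    have e1 : sInf {v | x ≤ v ∧ 0 < y t.toNNReal v} = sInf {v | x ≤ v ∧ 0 < y u.toNNReal v} := by
      refine csInf_eq_of_inter_eq (b := A) ⟨x, fun v hv => hv.1⟩ ⟨x, fun v hv => hv.1⟩ ?_
        ⟨a, ⟨ha1, ha3⟩, ha2⟩
      ext v
      refine and_congr_left fun hv => and_congr_right fun hxv => hS v (by linarith) hv
    have e2 : sSup {v | v ≤ x ∧ 0 < y t.toNNReal v} = sSup {v | v ≤ x ∧ 0 < y u.toNNReal v} := by
      refine csSup_eq_of_inter_eq (b := -A) ⟨x, fun v hv => hv.1⟩ ⟨x, fun v hv => hv.1⟩ ?_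
        ⟨b, ⟨hb2, hb3⟩, hb1⟩
      ext v
      refine and_congr_left fun hv => and_congr_right fun hxv => hS v hv (by linarith)
    lift t to ℝ≥0 using by linarith
    lift u to ℝ≥0 using by linarith
    rw [Real.toNNReal_coe, Real.toNNReal_coe] at e1 e2
    rw [limitCluster_of_le ht, limitCluster_of_le hu, e1, e2]
  have hcoe : ∀ {l : Filter ℝ} {t : Icc (0 : ℝ) T} {I : Set ℝ} {I' : Set (Icc (0 : ℝ) T)},
      (∀ u ∈ I', (u : ℝ) ∈ I) → Tendsto ((↑) : Icc (0 : ℝ) T → ℝ) (𝓝[I'] t) (𝓝[I] (t : ℝ)) :=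
    fun {l t I I'} h => tendsto_nhdsWithin_iff.2
      ⟨(continuous_subtype_val.tendsto t).mono_left nhdsWithin_le_nhds,
        eventually_mem_nhdsWithin.mono fun u hu => h u hu⟩
  intro t
  refine ⟨tendsto_nhds_of_eventually_eq ?_, ?_⟩
  · have hto := hcoe (l := ⊤) (t := t) (I := Ici (t : ℝ)) (I' := Ici t) fun u hu => hu
    rcases lt_or_ge (t : ℝ) 1 with h1 | h1
    · filter_upwards [hto.eventually (mem_nhdsWithin_of_mem_nhds (Iio_mem_nhds h1))] with u hu
      rw [limitCluster_of_lt h1, limitCluster_of_lt hu]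
    · have h2 : ∀ᶠ u in 𝓝[≥] (t : ℝ), ∀ p ∈ F, Alive z₀ p.2 u ↔ Alive z₀ p.2 t :=
        (eventually_all_finite hfin).2 fun p _ => eventually_alive_iff z₀ p.2 t
      filter_upwards [hto.eventually h2, self_mem_nhdsWithin] with u hu hut
      exact heq u t (h1.trans hut) u.2.2 h1 t.2.2 hu
  · have hto := hcoe (l := ⊤) (t := t) (I := Iio (t : ℝ)) (I' := Iio t) fun u hu => hu
    rcases le_or_gt (t : ℝ) 1 with h1 | h1
    · refine ⟨mkInterval x x, tendsto_nhds_of_eventually_eq ?_⟩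
      filter_upwards [self_mem_nhdsWithin] with u hu
      exact limitCluster_of_lt (lt_of_lt_of_le hu h1)
    · have h2 : ∀ᶠ u in 𝓝[<] (t : ℝ), ∀ p ∈ F,
          Alive z₀ p.2 u ↔ (eventually_alive_iff_left z₀ p.2 t).choose :=
        (eventually_all_finite hfin).2 fun p _ => (eventually_alive_iff_left z₀ p.2 t).choose_spec
      have h3 := (hto.eventually h2).and
        (hto.eventually (mem_nhdsWithin_of_mem_nhds (Ioi_mem_nhds h1)))
      -- When the left neighbourhood filter is trivial, any value is a left limit.
      by_cases hne : (𝓝[<] t).NeBot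
      · obtain ⟨v, hv1, hv2⟩ := h3.exists
        refine ⟨limitCluster y v x, tendsto_nhds_of_eventually_eq ?_⟩
        filter_upwards [h3] with u hu
        exact heq u v (le_of_lt hu.2) u.2.2 (le_of_lt hv2) v.2.2
          fun p hp => (hu.1 p hp).trans (hv1 p hp).symm
      · rw [not_neBot.1 hne]
        exact ⟨mkInterval x x, tendsto_bot⟩

/-! ### The grid is good with high probability -/

open Classical in
/-- The configuration of marks separates the clusters of the points `x i`. -/
structure GoodState (z₀ : ℝ) (m : ℕ) (B : ℤ) (J : ℕ) (V : ℤ → ℕ → Prop) {q : ℕ} (x : Fin q → ℝ)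
    (n₀ : ℕ) (κ : Fin q → ℕ) : Prop where
  cells : ∀ i, GoodCells z₀ m B J V (x i)
  isolated : ∀ b j b' j', V b j → V b' j' → |b - b'| ≤ 10 → b = b' ∧ j = j'
  few : ((Finset.range J).filter (Hit z₀ m V)).card ≤ n₀
  not_hit : ∀ i, ¬Hit z₀ m V (κ i)

open Classical in
-- Markov's inequality for the number of events that occur, after replacing each event by its
-- measurable hull.
lemma measure_card_gt_le {Ω ι : Type*} [MeasurableSpace Ω] (P : Measure Ω) (s : Finset ι)
    (E : ι → Set Ω) {p : ℝ} (hE : ∀ k ∈ s, P (E k) ≤ ENNReal.ofReal p) {n : ℕ}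
    (hn : 0 < n) :
    P {ω | n < (s.filter fun k => ω ∈ E k).card} ≤ ENNReal.ofReal (s.card * p / n) := by
  have hm : ∀ k, MeasurableSet (toMeasurable P (E k)) := fun k => measurableSet_toMeasurable _ _
  set f : Ω → ℝ≥0∞ := fun ω => ∑ k ∈ s, (toMeasurable P (E k)).indicator (fun _ => 1) ω with hf
  have hfm : Measurable f := Finset.measurable_sum _ fun k _ => measurable_const.indicator (hm k)
  have h1 : {ω | n < (s.filter fun k => ω ∈ E k).card} ⊆ {ω | (n : ℝ≥0∞) ≤ f ω} := by
    intro ω hω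
    have h2 : ((s.filter fun k => ω ∈ E k).card : ℝ≥0∞) ≤ f ω := by
      rw [hf, Finset.card_filter]
      push_cast
      refine Finset.sum_le_sum fun k _ => ?_
      by_cases hk : ω ∈ E k
      · rw [if_pos hk, indicator_of_mem (subset_toMeasurable _ _ hk)]
      · rw [if_neg hk]; exact zero_le
    refine le_trans ?_ h2
    exact_mod_cast (le_of_lt hω)
  have h2 : ∫⁻ ω, f ω ∂P ≤ ENNReal.ofReal (s.card * p) := by
    rw [hf, lintegral_finsetSum _ fun k _ => measurable_const.indicator (hm k)]
    refine (Finset.sum_le_sum (g := fun _ => ENNReal.ofReal p) fun k hk => ?_).trans ?_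
    · rw [lintegral_indicator (hm k), setLIntegral_const, one_mul, measure_toMeasurable]
      exact hE k hk
    · rw [Finset.sum_const, nsmul_eq_mul, ENNReal.ofReal_mul (by positivity), ENNReal.ofReal_natCast]
  have hn' : (n : ℝ≥0∞) ≠ 0 := by exact_mod_cast hn.ne'
  have h3 := meas_ge_le_lintegral_div hfm.aemeasurable (μ := P) hn' (ENNReal.natCast_ne_top n)
  refine (measure_mono h1).trans (h3.trans ?_)
  rw [ENNReal.ofReal_div_of_pos (by exact_mod_cast hn), ENNReal.ofReal_natCast]
  gcongr

section Rectangles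

variable {Ω : Type*} [MeasurableSpace Ω] {P : Measure Ω}
  {M : Ω → Measure (ℝ × ℝ)} (hM : IsPoissonMeasure M (volume.restrict (univ ×ˢ Ici (0 : ℝ))) P)
  {m : ℕ} {B : ℤ} {J : ℕ}

/-- The union of the cells of `[b, b') × [j, j')`. -/
def cellRect (m : ℕ) (b b' : ℤ) (j j' : ℕ) : Set (ℝ × ℝ) :=
  Ico ((b : ℝ) / m) ((b' : ℝ) / m) ×ˢ Ioc ((j : ℝ) / m) ((j' : ℝ) / m)

lemma measurableSet_cellRect (m : ℕ) (b b' : ℤ) (j j' : ℕ) :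
    MeasurableSet (cellRect m b b' j j') := measurableSet_Ico.prod measurableSet_Ioc

lemma cell_eq_cellRect (m : ℕ) (b : ℤ) (j : ℕ) : cell m b j = cellRect m b (b + 1) j (j + 1) := by
  simp [cell, cellRect]

lemma cell_subset_cellRect {b₀ b₁ b : ℤ} {j₀ j₁ j : ℕ} (h1 : b₀ ≤ b)
    (h2 : b < b₁) (h3 : j₀ ≤ j) (h4 : j < j₁) : cell m b j ⊆ cellRect m b₀ b₁ j₀ j₁ := by
  have e1 : (b₀ : ℝ) ≤ b := by exact_mod_cast h1
  have e2 : (b : ℝ) + 1 ≤ b₁ := by exact_mod_cast h2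
  have e3 : (j₀ : ℝ) ≤ j := by exact_mod_cast h3
  have e4 : (j : ℝ) + 1 ≤ j₁ := by exact_mod_cast h4
  exact prod_mono (Ico_subset_Ico (by gcongr) (by gcongr)) (Ioc_subset_Ioc (by gcongr) (by gcongr))

lemma exists_cell_of_cellRect (hm : 0 < m) {b₀ b₁ : ℤ} {j₀ j₁ : ℕ} {p : ℝ × ℝ}
    (hp : p ∈ cellRect m b₀ b₁ j₀ j₁) :
    ∃ b j, b₀ ≤ b ∧ b < b₁ ∧ j₀ ≤ j ∧ j < j₁ ∧ p ∈ cell m b j := by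
  have hm' : (0 : ℝ) < m := by exact_mod_cast hm
  obtain ⟨⟨h1, h2⟩, h3, h4⟩ := hp
  rw [div_le_iff₀ hm'] at h1
  rw [lt_div_iff₀ hm'] at h2
  rw [div_lt_iff₀ hm'] at h3
  rw [le_div_iff₀ hm'] at h4
  have hs : 0 < p.2 := by
    have : 0 < p.2 * m := (Nat.cast_nonneg _).trans_lt h3
    exact pos_of_mul_pos_left this hm'.le
  have e1 : j₀ < ⌈p.2 * m⌉₊ := Nat.lt_ceil.2 h3
  have e2 : ⌈p.2 * m⌉₊ ≤ j₁ := Nat.ceil_le.2 h4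
  exact ⟨⌊p.1 * m⌋, ⌈p.2 * m⌉₊ - 1, Int.le_floor.2 h1, Int.floor_lt.2 h2, by omega, by omega,
    mem_cell hm hs⟩

lemma intensity_cellRect (hm : 0 < m) (b₀ b₁ : ℤ) (j₀ j₁ : ℕ) :
    (volume.restrict (univ ×ˢ Ici (0 : ℝ))) (cellRect m b₀ b₁ j₀ j₁) =
      ENNReal.ofReal (((b₁ : ℝ) - b₀) / m) * ENNReal.ofReal (((j₁ : ℝ) - j₀) / m) := by
  have hm' : (0 : ℝ) < m := by exact_mod_cast hm
  have h1 : cellRect m b₀ b₁ j₀ j₁ ⊆ univ ×ˢ Ici (0 : ℝ) :=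
    prod_mono (subset_univ _) fun s hs =>
      (by positivity : (0 : ℝ) ≤ (j₀ : ℝ) / m).trans hs.1.le
  rw [Measure.restrict_eq_self _ h1, cellRect, Measure.volume_eq_prod, Measure.prod_prod,
    Real.volume_Ico, Real.volume_Ioc, sub_div, sub_div]

include hM

lemma measure_marked_le (hm : 0 < m) {b₀ b₁ : ℤ} {j₀ j₁ : ℕ} (hb : b₀ ≤ b₁) :
    P {ω | ∃ b j, b₀ ≤ b ∧ b < b₁ ∧ j₀ ≤ j ∧ j < j₁ ∧ markedCells m B J (M ω) b j} ≤
      ENNReal.ofReal (((b₁ : ℝ) - b₀) / m * (((j₁ : ℝ) - j₀) / m)) := by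
  have hb' : (b₀ : ℝ) ≤ b₁ := by exact_mod_cast hb
  rw [ENNReal.ofReal_mul (div_nonneg (sub_nonneg.2 hb') (by positivity)),
    ← intensity_cellRect hm]
  refine (measure_mono ?_).trans
    (hM.measure_ne_zero_le (measurableSet_cellRect m b₀ b₁ j₀ j₁) ?_)
  · rintro ω ⟨b, j, h1, h2, h3, h4, h5⟩
    exact fun h0 => h5.2.2.2 (measure_mono_null (cell_subset_cellRect h1 h2 h3 h4) h0)
  · rw [intensity_cellRect hm]
    exact ENNReal.mul_ne_top ENNReal.ofReal_ne_top ENNReal.ofReal_ne_top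

lemma measure_unmarked_le (hm : 0 < m) {b₀ b₁ : ℤ} {j₀ j₁ : ℕ} (hb : b₀ ≤ b₁) (hj : j₀ ≤ j₁)
    (hB0 : -B ≤ b₀) (hB1 : b₁ ≤ B) (hJ : j₁ ≤ J) :
    P {ω | ¬∃ b j, b₀ ≤ b ∧ b < b₁ ∧ j₀ ≤ j ∧ j < j₁ ∧ markedCells m B J (M ω) b j} ≤
      ENNReal.ofReal (Real.exp (-(((b₁ : ℝ) - b₀) / m * (((j₁ : ℝ) - j₀) / m)))) := by
  have hb' : (b₀ : ℝ) ≤ b₁ := by exact_mod_cast hb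
  have hj' : (j₀ : ℝ) ≤ j₁ := by exact_mod_cast hj
  have h0 := hM.measure_zero (measurableSet_cellRect m b₀ b₁ j₀ j₁) (by
    rw [intensity_cellRect hm]
    exact ENNReal.mul_ne_top ENNReal.ofReal_ne_top ENNReal.ofReal_ne_top)
  rw [intensity_cellRect hm, ENNReal.toReal_mul,
    ENNReal.toReal_ofReal (div_nonneg (sub_nonneg.2 hb') (by positivity)),
    ENNReal.toReal_ofReal (div_nonneg (sub_nonneg.2 hj') (by positivity))] at h0
  rw [← h0]
  refine measure_mono fun ω hω => ?_
  rw [mem_ofPred_eq]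
  have : cellRect m b₀ b₁ j₀ j₁ ⊆ ⋃ b ∈ Finset.Ico b₀ b₁, ⋃ j ∈ Finset.Ico j₀ j₁, cell m b j := by
    intro p hp
    obtain ⟨b, j, h1, h2, h3, h4, h5⟩ := exists_cell_of_cellRect hm hp
    simp only [mem_iUnion, Finset.mem_Ico]
    exact ⟨b, ⟨h1, h2⟩, j, ⟨h3, h4⟩, h5⟩
  refine measure_mono_null this ((measure_biUnion_null_iff (Finset.countable_toSet _)).2
    fun b hb => (measure_biUnion_null_iff (Finset.countable_toSet _)).2 fun j hj => ?_)
  by_contra h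
  simp only [Finset.coe_Ico, mem_Ico] at hb hj
  exact hω ⟨b, j, hb.1, hb.2, hj.1, hj.2, by omega, by omega, by omega, h⟩

lemma measure_two_marked_le (hm : 0 < m) {b b' : ℤ} {j j' : ℕ} (hne : ¬(b = b' ∧ j = j')) :
    P {ω | markedCells m B J (M ω) b j ∧ markedCells m B J (M ω) b' j'} ≤
      ENNReal.ofReal (1 / m ^ 4) := by
  have hm' : (0 : ℝ) < m := by exact_mod_cast hm
  have hdisj : Disjoint (cell m b j) (cell m b' j') := by
    rw [Set.disjoint_left]
    rintro ⟨u, s⟩ ⟨⟨h1, h2⟩, h3, h4⟩ ⟨⟨h5, h6⟩, h7, h8⟩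
    refine hne ⟨?_, ?_⟩
    · have e1 := h1.trans_lt h6
      have e2 := h5.trans_lt h2
      rw [div_lt_div_iff_of_pos_right hm'] at e1 e2
      have e1' : b < b' + 1 := by exact_mod_cast e1
      have e2' : b' < b + 1 := by exact_mod_cast e2
      omega
    · have e1 := h3.trans_le h8
      have e2 := h7.trans_le h4
      rw [div_lt_div_iff_of_pos_right hm'] at e1 e2
      have e1' : j < j' + 1 := by exact_mod_cast e1
      have e2' : j' < j + 1 := by exact_mod_cast e2
      omega
  have hind := hM.indep 2 ![cell m b j, cell m b' j']
    (fun i => by fin_cases i <;> exact measurableSet_cell _ _ _)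
    (fun i i' hii => by
      fin_cases i <;> fin_cases i' <;>
        first
          | exact absurd rfl hii
          | exact hdisj
          | exact hdisj.symm)
  have h01 := hind.indepFun (i := 0) (j := 1) (by decide)
  have hone : ∀ b j, P {ω | M ω (cell m b j) ≠ 0} ≤ ENNReal.ofReal (1 / m ^ 2) := by
    intro b j
    have hν : (volume.restrict (univ ×ˢ Ici (0 : ℝ))) (cell m b j) = ENNReal.ofReal (1 / m ^ 2) := by
      rw [cell_eq_cellRect, intensity_cellRect hm, ← ENNReal.ofReal_mul]
      · congr 1; push_cast; field_simp; ring
      · push_cast; rw [add_sub_cancel_left]; positivity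
    have := hM.measure_ne_zero_le (measurableSet_cell m b j) (by rw [hν]; exact ENNReal.ofReal_ne_top)
    rwa [hν] at this
  have h2 := h01.measure_inter_preimage_eq_mul {0}ᶜ {0}ᶜ
    (measurableSet_singleton _).compl (measurableSet_singleton _).compl
  refine (measure_mono (t := (fun ω => M ω (cell m b j)) ⁻¹' {0}ᶜ ∩
    (fun ω => M ω (cell m b' j')) ⁻¹' {0}ᶜ) fun ω hω => ⟨hω.1.2.2.2, hω.2.2.2.2⟩).trans ?_
  refine h2.le.trans ?_
  have e : (1 / m ^ 4 : ℝ) = 1 / m ^ 2 * (1 / m ^ 2) := by field_simp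
  rw [e, ENNReal.ofReal_mul (by positivity)]
  exact mul_le_mul' (hone b j) (hone b' j')

end Rectangles

/-- At each time from about `1` on, some window of times of positive length must consist of active
marks. If `z₀ < 1`, the marks of `(z₀, 1)` are permanent. If `z₀ = 1`, the marks of `(3/4, 1)` are
alive until `3/2`, and those of `(1, 3/2)` take over from there. -/
lemma exists_windows {z₀ : ℝ} (hz : z₀ ∈ Icc (0 : ℝ) 1) :
    ∃ c : ℝ, 0 < c ∧ ∀ᶠ m : ℕ in atTop, ∃ j₀ j₁ j₀' j₁' : ℕ, j₁ ≤ 2 * m ∧ j₁' ≤ 2 * m ∧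
      c * m ≤ (j₁ : ℝ) - j₀ ∧ c * m ≤ (j₁' : ℝ) - j₀' ∧ ∀ k, m ≤ k + 1 →
        (∀ j, j₀ ≤ j → j < j₁ → Active z₀ m k j) ∨ ∀ j, j₀' ≤ j → j < j₁' → Active z₀ m k j := by
  rcases hz.2.lt_or_eq with hz1 | hz1
  · refine ⟨(1 - z₀) / 2, by linarith, ?_⟩
    have h1 : Tendsto (fun m : ℕ => (1 - z₀) / 2 * (m : ℝ)) atTop atTop :=
      tendsto_natCast_atTop_atTop.const_mul_atTop (by linarith)
    filter_upwards [h1.eventually_ge_atTop 3, eventually_ge_atTop 2] with m hm hm2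
    have hf := Nat.floor_le (mul_nonneg hz.1 (Nat.cast_nonneg m) : 0 ≤ z₀ * m)
    have e1 : ((m - 1 : ℕ) : ℝ) = m - 1 := by rw [Nat.cast_sub (by omega)]; simp
    refine ⟨⌊z₀ * m⌋₊ + 1, m - 1, ⌊z₀ * m⌋₊ + 1, m - 1, by omega, by omega, ?_, ?_, ?_⟩
    · push_cast [e1]; nlinarith
    · push_cast [e1]; nlinarith
    · intro k hk
      left
      intro j h1 h2
      exact ⟨by omega, Or.inr ((Nat.lt_floor_add_one _).trans_le (by exact_mod_cast h1))⟩
  · subst hz1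
    refine ⟨1 / 8, by norm_num, ?_⟩
    filter_upwards [eventually_ge_atTop 64] with m hm
    have hm' : (64 : ℝ) ≤ m := by exact_mod_cast hm
    have e1 : ((m - 1 : ℕ) : ℝ) = m - 1 := by rw [Nat.cast_sub (by omega)]; simp
    have e2 : ((3 * m / 4 : ℕ) : ℝ) ≤ 3 * m / 4 := by
      have := Nat.cast_div_le (α := ℝ) (m := 3 * m) (n := 4)
      push_cast at this
      exact this
    have e3 : (3 * m / 2 - 1 : ℝ) ≤ (3 * m / 2 : ℕ) := by
      have : 3 * m ≤ 2 * (3 * m / 2) + 1 := by omega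
      have : (3 * m : ℝ) ≤ 2 * (3 * m / 2 : ℕ) + 1 := by exact_mod_cast this
      linarith
    refine ⟨3 * m / 4 + 2, m - 1, m + 1, 3 * m / 2, by omega, by omega, ?_, ?_, ?_⟩
    · push_cast [e1]; linarith
    · push_cast; linarith
    · intro k hk
      rcases le_or_gt (2 * (k + 1)) (3 * m) with hk2 | hk2
      · left
        intro j h1 h2
        refine ⟨by omega, Or.inl ⟨by omega, ?_⟩⟩
        rw [one_mul]
        exact_mod_cast (show j + 1 ≤ m by omega)
      · right
        intro j h1 h2
        refine ⟨by omega, Or.inr ?_⟩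
        rw [one_mul]
        exact_mod_cast (show m < j by omega)

/-- The time cells whose marks have an uncertain effect. -/
def ambiguousCells (z₀ : ℝ) (m k : ℕ) : Finset ℕ :=
  {k, ⌊z₀ * m⌋₊, ⌊z₀ * m⌋₊ - 1, k / 2, k / 2 - 1, (k + 1) / 2}

/-- Uncertainty has three sources: the mark falls in the current time cell, it falls near `z₀`, or
its hole is filled near the current time, at about twice its own time. Each of them concerns a
bounded number of cells. -/
lemma mem_ambiguousCells {z₀ : ℝ} (hz : 0 ≤ z₀) {m k j : ℕ} (h1 : ¬Active z₀ m k j)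
    (h2 : ¬Inactive z₀ m k j) : j ∈ ambiguousCells z₀ m k := by
  simp only [Active, Inactive, not_or, not_and, not_lt] at h1 h2
  simp only [ambiguousCells, Finset.mem_insert, Finset.mem_singleton]
  rcases h2.1.lt_or_eq with hjk | hjk
  swap
  · exact Or.inl hjk
  obtain ⟨h3, h4⟩ := h1 hjk
  have h0 : 0 ≤ z₀ * m := mul_nonneg hz (Nat.cast_nonneg m)
  rcases le_or_gt (z₀ * m) (j + 1) with h5 | h5
  · have e1 : j ≤ ⌊z₀ * m⌋₊ := Nat.le_floor h4
    have e2 : ⌊z₀ * m⌋₊ ≤ j + 1 := by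
      have := Nat.floor_le_floor h5
      rwa [show ((j : ℝ) + 1) = ((j + 1 : ℕ) : ℝ) by push_cast; ring, Nat.floor_natCast] at this
    omega
  · have e1 : ¬2 * (j + 1) < k := fun h => absurd (h2.2 h) (not_le.2 h5)
    have e2 : ¬k + 1 < 2 * j := fun h => absurd (h3 h) (not_not.2 h5.le)
    omega

section GoodProbability

variable {Ω : Type*} [MeasurableSpace Ω] {P : Measure Ω}
  {M : Ω → Measure (ℝ × ℝ)} (hM : IsPoissonMeasure M (volume.restrict (univ ×ˢ Ici (0 : ℝ))) P)
  {m : ℕ} {B : ℤ} {J : ℕ}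
include hM

/-- At most six time cells are ambiguous, each with `2 * B` blocks of intensity `1 / m ^ 2`. With `B
= A * m` this is of order `1 / m`. -/
lemma measure_hit_le {z₀ : ℝ} (hz : 0 ≤ z₀) (hm : 0 < m) (hB : 0 ≤ B) (k : ℕ) :
    P {ω | Hit z₀ m (markedCells m B J (M ω)) k} ≤ ENNReal.ofReal (12 * B / m ^ 2) := by
  have hm' : (0 : ℝ) < m := by exact_mod_cast hm
  have hB' : (0 : ℝ) ≤ B := by exact_mod_cast hB
  have h1 : {ω | Hit z₀ m (markedCells m B J (M ω)) k} ⊆ ⋃ j ∈ ambiguousCells z₀ m k,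
      {ω | ∃ b j', -B ≤ b ∧ b < B ∧ j ≤ j' ∧ j' < j + 1 ∧ markedCells m B J (M ω) b j'} := by
    rintro ω ⟨b, j, h1, h2, h3⟩
    simp only [mem_iUnion]
    exact ⟨j, mem_ambiguousCells hz h2 h3, b, j, h1.1, h1.2.1, le_rfl, Nat.lt_succ_self j, h1⟩
  refine (measure_mono h1).trans ((measure_biUnion_finset_le _ _).trans ?_)
  refine (Finset.sum_le_sum fun j _ => measure_marked_le hM hm (by omega)).trans ?_
  have h2 : ∀ j : ℕ, ENNReal.ofReal (((B : ℝ) - (-B : ℤ)) / m * ((((j + 1 : ℕ) : ℝ) - j) / m)) =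
      ENNReal.ofReal (2 * B / m ^ 2) := fun j => by
    congr 1
    push_cast
    field_simp
    ring
  simp only [h2]
  rw [Finset.sum_const, nsmul_eq_mul]
  have h3 : ((ambiguousCells z₀ m k).card : ℝ≥0∞) ≤ 6 := by
    exact_mod_cast Finset.card_le_six
  refine (mul_le_mul_left h3 _).trans ?_
  rw [show (12 * B / m ^ 2 : ℝ) = 6 * (2 * B / m ^ 2) by ring, ENNReal.ofReal_mul (by norm_num)]
  simp

open Classical in
lemma measure_not_few_le {z₀ : ℝ} (hz : 0 ≤ z₀) (hm : 0 < m) (hB : 0 ≤ B) {n₀ : ℕ} (hn : 0 < n₀) :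
    P {ω | ¬((Finset.range J).filter (Hit z₀ m (markedCells m B J (M ω)))).card ≤ n₀} ≤
      ENNReal.ofReal (J * (12 * B / m ^ 2) / n₀) := by
  have := measure_card_gt_le P (Finset.range J)
    (fun k => {ω | Hit z₀ m (markedCells m B J (M ω)) k})
    (fun k _ => measure_hit_le hM hz hm hB k) hn
  rw [Finset.card_range] at this
  refine (measure_mono fun ω hω => ?_).trans this
  simpa using hω

lemma measure_not_near_le (hm : 0 < m) (x : ℝ) :
    P {ω | ¬∀ b j, |b - ⌊x * m⌋| ≤ 20 → ¬markedCells m B J (M ω) b j} ≤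
      ENNReal.ofReal (41 / m * (J / m)) := by
  refine (measure_mono fun ω hω => ?_).trans ((measure_marked_le (B := B) (J := J) hM hm (b₀ := ⌊x * m⌋ - 20)
    (b₁ := ⌊x * m⌋ + 21) (j₀ := 0) (j₁ := J) (by omega)).trans (le_of_eq ?_))
  · simp only [mem_ofPred_eq, not_forall, not_not] at hω
    obtain ⟨b, j, h1, h2⟩ := hω
    rw [abs_le] at h1
    exact ⟨b, j, by omega, by omega, by omega, h2.2.2.1, h2⟩
  · congr 1
    push_cast
    ring

/-- Union bound over pairs of distinct cells: `2 * B` blocks, `21` relative positions and `J ^ 2`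
pairs of times, each pair being marked with probability at most `1 / m ^ 4` by independence. -/
lemma measure_not_isolated_le (hm : 0 < m) (hB : 0 ≤ B) :
    P {ω | ¬∀ b j b' j', markedCells m B J (M ω) b j → markedCells m B J (M ω) b' j' →
      |b - b'| ≤ 10 → b = b' ∧ j = j'} ≤ ENNReal.ofReal (42 * B * J ^ 2 / m ^ 4) := by
  set s : Finset ((ℤ × ℤ) × ℕ × ℕ) := (Finset.Ico (-B) B ×ˢ Finset.Icc (-10) 10) ×ˢ
    (Finset.range J ×ˢ Finset.range J) with hs
  have h1 : {ω | ¬∀ b j b' j', markedCells m B J (M ω) b j → markedCells m B J (M ω) b' j' →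
      |b - b'| ≤ 10 → b = b' ∧ j = j'} ⊆ ⋃ p ∈ s,
      {ω | ¬(p.1.1 = p.1.1 + p.1.2 ∧ p.2.1 = p.2.2) ∧ markedCells m B J (M ω) p.1.1 p.2.1 ∧
        markedCells m B J (M ω) (p.1.1 + p.1.2) p.2.2} := by
    intro ω hω
    simp only [mem_ofPred_eq, not_forall] at hω
    obtain ⟨b, j, b', j', h1, h2, h3, h4⟩ := hω
    simp only [mem_iUnion]
    rw [abs_le] at h3
    refine ⟨((b, b' - b), (j, j')), ?_, ?_, h1, ?_⟩
    · have e1 := h1.1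
      have e2 := h1.2.1
      have e3 := h1.2.2.1
      have e4 := h2.2.2.1
      simp only [hs, Finset.mem_product, Finset.mem_Ico, Finset.mem_Icc, Finset.mem_range]
      omega
    · simpa using h4
    · simpa using h2
  refine (measure_mono h1).trans ((measure_biUnion_finset_le _ _).trans ?_)
  refine (Finset.sum_le_sum (g := fun _ => ENNReal.ofReal (1 / m ^ 4)) fun p _ => ?_).trans ?_
  · by_cases hp : p.1.1 = p.1.1 + p.1.2 ∧ p.2.1 = p.2.2
    · have : {ω | ¬(p.1.1 = p.1.1 + p.1.2 ∧ p.2.1 = p.2.2) ∧ markedCells m B J (M ω) p.1.1 p.2.1 ∧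
        markedCells m B J (M ω) (p.1.1 + p.1.2) p.2.2} = ∅ := by
        ext ω; simp only [mem_ofPred_eq, mem_empty_iff_false, iff_false]; exact fun h => h.1 hp
      rw [this, measure_empty]
      exact zero_le
    · exact (measure_mono fun ω hω => hω.2).trans (measure_two_marked_le hM hm hp)
  · rw [Finset.sum_const, nsmul_eq_mul, hs]
    simp only [Finset.card_product, Int.card_Ico, Int.card_Icc, Finset.card_range]
    rw [← ENNReal.ofReal_natCast, ← ENNReal.ofReal_mul (by positivity)]
    refine ENNReal.ofReal_le_ofReal (le_of_eq ?_)
    have : (((B - -B).toNat : ℕ) : ℝ) = 2 * B := by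
      have : (((B - -B).toNat : ℕ) : ℤ) = 2 * B := by omega
      exact_mod_cast this
    push_cast [this]
    norm_num
    ring

/-- If the required blocks are missing at some time, one of four rectangles is empty: one for each
side of `x` and each of the two time windows of `exists_windows`. Each has area at least `(A - |x| -
1) * c`. -/
lemma measure_not_sides_le {z₀ c : ℝ} (hm : 21 ≤ m) {x A : ℝ} (hA : |x| + 1 ≤ A)
    (hc : 0 ≤ c) (hBA : A * m ≤ B) (hJ : 2 * m ≤ J)
    (hw : ∃ j₀ j₁ j₀' j₁' : ℕ, j₁ ≤ 2 * m ∧ j₁' ≤ 2 * m ∧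
      c * m ≤ (j₁ : ℝ) - j₀ ∧ c * m ≤ (j₁' : ℝ) - j₀' ∧ ∀ k, m ≤ k + 1 →
        (∀ j, j₀ ≤ j → j < j₁ → Active z₀ m k j) ∨ ∀ j, j₀' ≤ j → j < j₁' → Active z₀ m k j) :
    P {ω | ¬((∀ k, m ≤ k + 1 → k < J → ∃ b, ⌊x * m⌋ < b ∧ b + 20 ≤ B ∧
        ActiveBlock z₀ m (markedCells m B J (M ω)) k b) ∧
      ∀ k, m ≤ k + 1 → k < J → ∃ b, b < ⌊x * m⌋ ∧ -B + 20 ≤ b ∧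
        ActiveBlock z₀ m (markedCells m B J (M ω)) k b)} ≤
      ENNReal.ofReal (4 * Real.exp (-((A - |x| - 1) * c))) := by
  have hm21 : (21 : ℝ) ≤ m := by exact_mod_cast hm
  have hm' : (0 : ℝ) < m := by linarith
  obtain ⟨j₀, j₁, j₀', j₁', hj1, hj2, hl1, hl2, hact⟩ := hw
  have hx := abs_le.1 (le_refl |x|)
  have hf1 := Int.floor_le (x * m)
  have hf2 := Int.lt_floor_add_one (x * m)
  set f := ⌊x * m⌋
  have hr : (A - |x| - 1) * m ≤ ((B - 19 : ℤ) : ℝ) - (f + 1 : ℤ) := by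
    push_cast
    nlinarith
  have hl : (A - |x| - 1) * m ≤ (f : ℝ) - (-B + 20 : ℤ) := by
    push_cast
    nlinarith
  have hA0 : 0 ≤ A - |x| - 1 := by linarith
  have hr' : f + 1 ≤ B - 19 := by
    have : (0 : ℝ) ≤ ((B - 19 : ℤ) : ℝ) - (f + 1 : ℤ) := le_trans (by positivity) hr
    exact_mod_cast sub_nonneg.1 this
  have hl' : -B + 20 ≤ f := by
    have : (0 : ℝ) ≤ (f : ℝ) - (-B + 20 : ℤ) := le_trans (by positivity) hl
    exact_mod_cast sub_nonneg.1 this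
  have key : ∀ (b₀ b₁ : ℤ) (i₀ i₁ : ℕ), (A - |x| - 1) * m ≤ (b₁ : ℝ) - b₀ → -B ≤ b₀ → b₁ ≤ B →
      i₁ ≤ 2 * m → c * m ≤ (i₁ : ℝ) - i₀ →
      P {ω | ¬∃ b j, b₀ ≤ b ∧ b < b₁ ∧ i₀ ≤ j ∧ j < i₁ ∧ markedCells m B J (M ω) b j} ≤
        ENNReal.ofReal (Real.exp (-((A - |x| - 1) * c))) := by
    intro b₀ b₁ i₀ i₁ h1 h2 h3 h4 h5
    have e1 : b₀ ≤ b₁ := by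
      have : (0 : ℝ) ≤ (b₁ : ℝ) - b₀ := le_trans (by positivity) h1
      exact_mod_cast sub_nonneg.1 this
    have e2 : i₀ ≤ i₁ := by
      have : (0 : ℝ) ≤ (i₁ : ℝ) - i₀ := le_trans (by positivity) h5
      exact_mod_cast sub_nonneg.1 this
    refine (measure_unmarked_le hM (by omega) e1 e2 h2 h3 (by omega)).trans ?_
    have e3 : A - |x| - 1 ≤ ((b₁ : ℝ) - b₀) / m := by rwa [le_div_iff₀ hm']
    have e4 : c ≤ ((i₁ : ℝ) - i₀) / m := by rwa [le_div_iff₀ hm']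
    exact ENNReal.ofReal_le_ofReal (Real.exp_le_exp.2 (neg_le_neg
      (mul_le_mul e3 e4 hc (hA0.trans e3))))
  set E : ℤ → ℤ → ℕ → ℕ → Set Ω := fun b₀ b₁ i₀ i₁ =>
    {ω | ¬∃ b j, b₀ ≤ b ∧ b < b₁ ∧ i₀ ≤ j ∧ j < i₁ ∧ markedCells m B J (M ω) b j} with hE
  have hsub : {ω | ¬((∀ k, m ≤ k + 1 → k < J → ∃ b, f < b ∧ b + 20 ≤ B ∧
        ActiveBlock z₀ m (markedCells m B J (M ω)) k b) ∧
      ∀ k, m ≤ k + 1 → k < J → ∃ b, b < f ∧ -B + 20 ≤ b ∧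
        ActiveBlock z₀ m (markedCells m B J (M ω)) k b)} ⊆
      (E (f + 1) (B - 19) j₀ j₁ ∪ E (f + 1) (B - 19) j₀' j₁') ∪
      (E (-B + 20) f j₀ j₁ ∪ E (-B + 20) f j₀' j₁') := by
    intro ω hω
    by_contra hcon
    simp only [hE, mem_union, mem_ofPred_eq, not_or, not_not] at hcon
    obtain ⟨⟨⟨b1, i1, h11, h12, h13, h14, h15⟩, b2, i2, h21, h22, h23, h24, h25⟩,
      ⟨b3, i3, h31, h32, h33, h34, h35⟩, b4, i4, h41, h42, h43, h44, h45⟩ := hcon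
    refine hω ⟨fun k hk _ => ?_, fun k hk _ => ?_⟩
    · rcases hact k hk with h | h
      · exact ⟨b1, by omega, by omega, i1, h i1 h13 h14, h15⟩
      · exact ⟨b2, by omega, by omega, i2, h i2 h23 h24, h25⟩
    · rcases hact k hk with h | h
      · exact ⟨b3, by omega, by omega, i3, h i3 h33 h34, h35⟩
      · exact ⟨b4, by omega, by omega, i4, h i4 h43 h44, h45⟩
  refine (measure_mono hsub).trans ?_
  have h4 : ENNReal.ofReal (4 * Real.exp (-((A - |x| - 1) * c))) =
      (ENNReal.ofReal (Real.exp (-((A - |x| - 1) * c))) +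
        ENNReal.ofReal (Real.exp (-((A - |x| - 1) * c)))) +
      (ENNReal.ofReal (Real.exp (-((A - |x| - 1) * c))) +
        ENNReal.ofReal (Real.exp (-((A - |x| - 1) * c)))) := by
    rw [← ENNReal.ofReal_add (by positivity) (by positivity),
      ← ENNReal.ofReal_add (by positivity) (by positivity)]
    congr 1
    ring
  rw [h4]
  refine (measure_union_le _ _).trans (add_le_add ((measure_union_le _ _).trans
    (add_le_add ?_ ?_)) ((measure_union_le _ _).trans (add_le_add ?_ ?_)))
  · exact key _ _ _ _ hr (by omega) (by omega) hj1 hl1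
  · exact key _ _ _ _ hr (by omega) (by omega) hj2 hl2
  · exact key _ _ _ _ hl (by omega) (by omega) hj1 hl1
  · exact key _ _ _ _ hl (by omega) (by omega) hj2 hl2

open Classical in
/-- The grid is good with high probability. -/
theorem exists_goodState {z₀ : ℝ} (hz : z₀ ∈ Icc (0 : ℝ) 1) {q : ℕ} (x : Fin q → ℝ)
    (κ : ℕ → Fin q → ℕ) {n₀ : ℕ → ℕ} (hn : Tendsto n₀ atTop atTop) {T : ℕ} (hT : 2 ≤ T) {ε : ℝ}
    (hε : 0 < ε) :
    ∃ A : ℕ, 0 < A ∧ ∀ᶠ m : ℕ in atTop,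
      P {ω | ¬GoodState z₀ m (A * m : ℕ) (T * m) (markedCells m (A * m : ℕ) (T * m) (M ω)) x
        (n₀ m) (κ m)} ≤ ENNReal.ofReal ε := by
  obtain ⟨c, hc, hw⟩ := exists_windows hz
  -- Three events for each point `x i` (near, sides, hit) and two global ones (isolated, few).
  set δ : ℝ := ε / (3 * q + 2) with hδ
  have hδ0 : 0 < δ := by positivity
  have hexp : ∀ᶠ A : ℕ in atTop, ∀ i, |x i| + 1 ≤ (A : ℝ) ∧
      4 * Real.exp (-(((A : ℝ) - |x i| - 1) * c)) ≤ δ := by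
    refine eventually_all.2 fun i => ?_
    have h1 : Tendsto (fun A : ℕ => 4 * Real.exp (-(((A : ℝ) - |x i| - 1) * c))) atTop
        (𝓝 (4 * 0)) := by
      refine (Real.tendsto_exp_neg_atTop_nhds_zero.comp ?_).const_mul 4
      refine Tendsto.atTop_mul_const hc ?_
      exact tendsto_atTop_add_const_right _ _ (tendsto_atTop_add_const_right _ _
        tendsto_natCast_atTop_atTop)
    rw [mul_zero] at h1
    filter_upwards [tendsto_natCast_atTop_atTop.eventually_ge_atTop (|x i| + 1),
      h1.eventually_le_const hδ0] with A h2 h3 using ⟨h2, h3⟩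
  -- The width `A` of the window is fixed first: it makes the empty rectangles unlikely uniformly in
  -- `m`. All the other probabilities tend to `0` as `m → ∞` with `A` fixed.
  obtain ⟨A, hA, hA0⟩ := (hexp.and (eventually_gt_atTop 0)).exists
  refine ⟨A, hA0, ?_⟩
  have hinv : Tendsto (fun m : ℕ => (m : ℝ)⁻¹) atTop (𝓝 0) :=
    tendsto_inv_atTop_zero.comp tendsto_natCast_atTop_atTop
  have hlim : ∀ C : ℝ, ∀ᶠ m : ℕ in atTop, C * (m : ℝ)⁻¹ ≤ δ := fun C => by
    have := hinv.const_mul C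
    rw [mul_zero] at this
    exact this.eventually_le_const hδ0
  have hn' : ∀ᶠ m : ℕ in atTop, 12 * A * T * (n₀ m : ℝ)⁻¹ ≤ δ := by
    have := ((tendsto_inv_atTop_zero.comp (tendsto_natCast_atTop_atTop (R := ℝ))).comp
      hn).const_mul (12 * A * T : ℝ)
    rw [mul_zero] at this
    exact this.eventually_le_const hδ0
  filter_upwards [hw, eventually_ge_atTop 21, hlim (41 * T), hlim (12 * A),
    hlim (42 * A * T ^ 2), hn', hn.eventually_ge_atTop 1] with m hw hm h1 h2 h3 h4 hn1
  have hm0 : 0 < m := by omega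
  have hm' : (0 : ℝ) < m := by exact_mod_cast hm0
  set B : ℤ := ((A * m : ℕ) : ℤ) with hB
  have hBR : (B : ℝ) = A * m := by rw [hB]; push_cast; ring
  set J := T * m with hJ
  have hJR : (J : ℝ) = T * m := by rw [hJ]; push_cast; ring
  have hB0 : 0 ≤ B := by positivity
  have hsub : {ω | ¬GoodState z₀ m B J (markedCells m B J (M ω)) x (n₀ m) (κ m)} ⊆
      ((⋃ i, (({ω | ¬∀ b j, |b - ⌊x i * m⌋| ≤ 20 → ¬markedCells m B J (M ω) b j} ∪
        {ω | ¬((∀ k, m ≤ k + 1 → k < J → ∃ b, ⌊x i * m⌋ < b ∧ b + 20 ≤ B ∧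
            ActiveBlock z₀ m (markedCells m B J (M ω)) k b) ∧
          ∀ k, m ≤ k + 1 → k < J → ∃ b, b < ⌊x i * m⌋ ∧ -B + 20 ≤ b ∧
            ActiveBlock z₀ m (markedCells m B J (M ω)) k b)}) ∪
        {ω | Hit z₀ m (markedCells m B J (M ω)) (κ m i)})) ∪
      {ω | ¬∀ b j b' j', markedCells m B J (M ω) b j → markedCells m B J (M ω) b' j' →
        |b - b'| ≤ 10 → b = b' ∧ j = j'}) ∪
      {ω | ¬((Finset.range J).filter (Hit z₀ m (markedCells m B J (M ω)))).card ≤ n₀ m} := by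
    intro ω hω
    by_contra hcon
    simp only [mem_union, mem_iUnion, mem_ofPred_eq, not_or, not_exists] at hcon
    obtain ⟨⟨hc1, hc2⟩, hc3⟩ := hcon
    exact hω ⟨fun i => ⟨not_not.1 (hc1 i).1.1, (not_not.1 (hc1 i).1.2).1,
      (not_not.1 (hc1 i).1.2).2⟩, not_not.1 hc2, not_not.1 hc3, fun i => (hc1 i).2⟩
  have hb1 : ∀ i, P {ω | ¬∀ b j, |b - ⌊x i * m⌋| ≤ 20 → ¬markedCells m B J (M ω) b j} ≤
      ENNReal.ofReal δ := fun i => (measure_not_near_le hM hm0 (x i)).trans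
    (ENNReal.ofReal_le_ofReal (by
      refine le_trans (le_of_eq ?_) h1
      rw [hJR]; field_simp))
  have hb2 := fun i => (measure_not_sides_le hM (B := B) (J := J) hm (hA i).1 hc.le hBR.ge
    (by rw [hJ]; exact Nat.mul_le_mul_right _ hT) hw).trans (ENNReal.ofReal_le_ofReal (hA i).2)
  have hb3 : ∀ i, P {ω | Hit z₀ m (markedCells m B J (M ω)) (κ m i)} ≤ ENNReal.ofReal δ :=
    fun i => (measure_hit_le hM hz.1 hm0 hB0 _).trans (ENNReal.ofReal_le_ofReal (by
      refine le_trans (le_of_eq ?_) h2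
      rw [hBR]; field_simp))
  have hb4 := (measure_not_isolated_le hM (J := J) hm0 hB0).trans (ENNReal.ofReal_le_ofReal
    (show _ ≤ δ by
      refine le_trans (le_of_eq ?_) h3
      rw [hBR, hJR]; field_simp))
  have hn0 : (n₀ m : ℝ) ≠ 0 := by
    have : n₀ m ≠ 0 := by omega
    exact_mod_cast this
  have hb5 := (measure_not_few_le hM (J := J) hz.1 hm0 hB0 (n₀ := n₀ m) (by omega)).trans
    (ENNReal.ofReal_le_ofReal (show _ ≤ δ by
      refine le_trans (le_of_eq ?_) h4
      rw [hBR, hJR]; field_simp))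
  refine (measure_mono hsub).trans ((measure_union_le _ _).trans ((add_le_add
    ((measure_union_le _ _).trans (add_le_add ((measure_iUnion_fintype_le _ _).trans
    (Finset.sum_le_sum fun i _ => (measure_union_le _ _).trans
      (add_le_add ((measure_union_le _ _).trans (add_le_add (hb1 i) (hb2 i))) (hb3 i))))
    hb4)) hb5).trans (le_of_eq ?_)))
  rw [Finset.sum_const, Finset.card_univ, Fintype.card_fin, nsmul_eq_mul,
    ← ENNReal.ofReal_natCast, ← ENNReal.ofReal_add hδ0.le hδ0.le,
    ← ENNReal.ofReal_add (by positivity) hδ0.le, ← ENNReal.ofReal_mul (by positivity),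
    ← ENNReal.ofReal_add (by positivity) hδ0.le, ← ENNReal.ofReal_add (by positivity) hδ0.le]
  congr 1
  rw [hδ]
  field_simp
  ring

end GoodProbability

/-! ### The clusters of an evolution are close to the grid -/

lemma ne_one_iff (a : Fin 3) : a ≠ 1 ↔ a = 0 ∨ a = 2 := by
  rcases fin_three_cases a with h | h | h <;> simp [h]

/-- An unoccupied site on the right makes the defining set nonempty, so that its infimum is attained
and not a default value. -/
lemma rightEnd_spec {ξ : ℤ → Fin 3} {i f : ℤ} (hif : i < f) (hf : ξ f ≠ 1) :
    i ≤ rightEnd ξ i ∧ rightEnd ξ i < f ∧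
      ∀ r, (∀ g, i < g → g ≤ r → ξ g = 1) → r ≤ rightEnd ξ i := by
  have hbdd : BddBelow {k | i < k ∧ (ξ k = 0 ∨ ξ k = 2)} := ⟨i, fun k hk => hk.1.le⟩
  have hne : {k | i < k ∧ (ξ k = 0 ∨ ξ k = 2)}.Nonempty := ⟨f, hif, (ne_one_iff _).1 hf⟩
  have hmem := Int.csInf_mem hne hbdd
  have hle := csInf_le hbdd (show f ∈ _ from ⟨hif, (ne_one_iff _).1 hf⟩)
  unfold rightEnd
  set s := sInf {k | i < k ∧ (ξ k = 0 ∨ ξ k = 2)}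
  have h1 := hmem.1
  refine ⟨by omega, by omega, fun r hr => ?_⟩
  by_contra hcon
  exact (ne_one_iff _).2 hmem.2 (hr s h1 (by omega))

lemma leftEnd_spec {ξ : ℤ → Fin 3} {i f : ℤ} (hif : f < i) (hf : ξ f ≠ 1) :
    leftEnd ξ i ≤ i ∧ f < leftEnd ξ i ∧
      ∀ l, (∀ g, l ≤ g → g < i → ξ g = 1) → leftEnd ξ i ≤ l := by
  have hbdd : BddAbove {k | k < i ∧ (ξ k = 0 ∨ ξ k = 2)} := ⟨i, fun k hk => hk.1.le⟩
  have hne : {k | k < i ∧ (ξ k = 0 ∨ ξ k = 2)}.Nonempty := ⟨f, hif, (ne_one_iff _).1 hf⟩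
  have hmem := Int.csSup_mem hne hbdd
  have hle := le_csSup hbdd (show f ∈ _ from ⟨hif, (ne_one_iff _).1 hf⟩)
  unfold leftEnd
  set s := sSup {k | k < i ∧ (ξ k = 0 ∨ ξ k = 2)}
  have h1 := hmem.1
  refine ⟨by omega, by omega, fun l hl => ?_⟩
  by_contra hcon
  exact (ne_one_iff _).2 hmem.2 (hl s (by omega) h1)

lemma ends_scaledComponent {n : ℤ} (hn : 0 < n) (x : ℝ) {ξ : ℤ → Fin 3} {i fl fr : ℤ}
    (hi : ξ i = 1) (hl : fl < i) (hr : i < fr) (hfl : ξ fl ≠ 1) (hfr : ξ fr ≠ 1) :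
    ends x (scaledComponent n ξ i) = ((leftEnd ξ i : ℝ) / n, (rightEnd ξ i : ℝ) / n) := by
  have hn' : (0 : ℝ) < n := by exact_mod_cast hn
  have h1 := (leftEnd_spec hl hfl).1
  have h2 := (rightEnd_spec hr hfr).1
  have h3 : (leftEnd ξ i : ℝ) ≤ rightEnd ξ i := by exact_mod_cast h1.trans h2
  unfold scaledComponent
  rw [if_pos hi, ends_mkInterval x (by gcongr)]

/-- The component lies strictly between the two unoccupied sites. The additional site in the bound
pays for the rounding of `n * x`. -/
lemma clusterDist_scaledComponent_le {n : ℤ} (hn : 0 < n) {x : ℝ} {ξ : ℤ → Fin 3} {fl fr : ℤ}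
    (hl : fl < ⌊(n : ℝ) * x⌋) (hr : ⌊(n : ℝ) * x⌋ < fr) (hfl : ξ fl ≠ 1) (hfr : ξ fr ≠ 1) {β : ℝ}
    (hβ : ((fr : ℝ) - fl + 1) / n ≤ β) :
    clusterDist x (scaledComponent n ξ ⌊(n : ℝ) * x⌋) (mkInterval x x) ≤ β := by
  have hn' : (0 : ℝ) < n := by exact_mod_cast hn
  set i := ⌊(n : ℝ) * x⌋ with hi
  have hf1 : (i : ℝ) ≤ n * x := Int.floor_le _
  have hf2 : (n : ℝ) * x < i + 1 := Int.lt_floor_add_one _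
  by_cases h1 : ξ i = 1
  · obtain ⟨a1, a2, -⟩ := leftEnd_spec hl hfl
    obtain ⟨b1, b2, -⟩ := rightEnd_spec hr hfr
    unfold clusterDist
    rw [ends_scaledComponent hn x h1 hl hr hfl hfr, ends_mkInterval_self]
    simp only
    refine le_trans ?_ hβ
    rw [le_div_iff₀ hn', add_mul, ← abs_of_pos hn', ← abs_mul, ← abs_mul, abs_of_pos hn']
    have e1 : ((leftEnd ξ i : ℝ) / n - x) * n = leftEnd ξ i - n * x := by field_simp
    have e2 : ((rightEnd ξ i : ℝ) / n - x) * n = rightEnd ξ i - n * x := by field_simp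
    rw [e1, e2]
    have a1' : (leftEnd ξ i : ℝ) ≤ i := by exact_mod_cast a1
    have a2' : (fl : ℝ) ≤ leftEnd ξ i := by exact_mod_cast a2.le
    have b1' : (i : ℝ) ≤ rightEnd ξ i := by exact_mod_cast b1
    have b2' : (rightEnd ξ i : ℝ) + 1 ≤ fr := by exact_mod_cast b2
    rw [abs_of_nonpos (by linarith)]
    rcases abs_cases ((rightEnd ξ i : ℝ) - n * x) with ⟨h, -⟩ | ⟨h, -⟩ <;> rw [h] <;> linarith
  · have e : scaledComponent n ξ i = ⊥ := if_neg h1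
    rw [e, show clusterDist x ⊥ (mkInterval x x) = 0 by
      unfold clusterDist; rw [ends_bot, ends_mkInterval_self]; simp]
    have a : (fl : ℝ) ≤ fr := by exact_mod_cast (hl.trans hr).le
    exact le_trans (div_nonneg (by linarith) hn'.le) hβ

/-- The block of the site `i`. -/
def block (n : ℤ) (m : ℕ) (i : ℤ) : ℤ := i * m / n

lemma block_spec {n : ℤ} (hn : 0 < n) (m : ℕ) (i : ℤ) :
    block n m i * n ≤ i * m ∧ i * m < (block n m i + 1) * n :=
  ⟨Int.ediv_mul_le _ hn.ne', Int.lt_ediv_add_one_mul_self _ hn⟩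

/-- The rings of the seeds `S`, matches `M` and fronts `Q` are typical, at the scale `n` in space,
with `K₀` steps in a time cell. -/
structure TypicalRings (z₀ : ℝ) (m : ℕ) (J K₀ : ℕ) (n d N : ℤ) (S M Q : ℕ → ℤ → Prop) :
    Prop where
  noCrossing : NoCrossing N d (J * K₀) Q
  simple : ∀ i c i' c', |i| ≤ N → |i'| ≤ N → c < J * K₀ → c' < J * K₀ → M c i → M c' i' →
    block n m i = block n m i' → c / K₀ = c' / K₀ → i = i' ∧ c = c'
  lasting : ∀ k j, m ≤ k + 1 → k < J → Active z₀ m k j → ∀ i c, |i| ≤ N → j * K₀ ≤ c →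
    c < (j + 1) * K₀ → M c i → ∃ l, 0 ≤ l ∧ l ≤ d ∧ LastingMatch l S Q i c ((k + 1) * K₀)
  brief : ∀ k j, k < J → 2 * (j + 1) < k → (j : ℝ) + 1 < z₀ * m → ∀ i c, |i| ≤ N → j * K₀ ≤ c →
    c < (j + 1) * K₀ → M c i → ∃ l W, l ≤ d ∧ c + 1 + W ≤ k * K₀ ∧ BriefMatch l W S Q i c (k * K₀)
  seeded : ∀ i, |i| ≤ N → ∃ c < m * K₀, S c i

/-- Some sites near `i` have not been seeded shortly before the time `1`. -/
def LateSites (m K₀ : ℕ) (d : ℤ) (S : ℕ → ℤ → Prop) (i : ℤ) : Prop :=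
  (∃ f, i < f ∧ f ≤ i + d ∧ ∀ c < (m - 1) * K₀, ¬S c f) ∧
  ∃ f, i - d ≤ f ∧ f < i ∧ ∀ c < (m - 1) * K₀, ¬S c f

section Close

variable {z₀ : ℝ} {m : ℕ} {B : ℤ} {J K₀ : ℕ} {n d N : ℤ} {z : ℕ → ℤ → Fin 3}
  {S M Q : ℕ → ℤ → Prop} {V : ℤ → ℕ → Prop} {x : ℝ}

/-- Sites at distance at most `8 * d` are in blocks at most `10` apart, so a good pattern puts their
matches in the same cell, where `simple` leaves only one. -/
lemma TypicalRings.isolated (hR : TypicalRings z₀ m J K₀ n d N S M Q) (hn : 0 < n)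
    (hd : d * m ≤ n) (hK : 0 < K₀) (hN : ∀ i, |i| ≤ N → -B ≤ block n m i ∧ block n m i < B)
    (hV : ∀ b j, V b j ↔ -B ≤ b ∧ b < B ∧ j < J ∧ ∃ i c, block n m i = b ∧ j * K₀ ≤ c ∧
      c < (j + 1) * K₀ ∧ M c i)
    (hI : ∀ b j b' j', V b j → V b' j' → |b - b'| ≤ 10 → b = b' ∧ j = j') :
    MatchesIsolated N d (J * K₀) M := by
  intro i c i' c' hi hi' hc hc' hM hM' hii
  have hv : ∀ i c, |i| ≤ N → c < J * K₀ → M c i → V (block n m i) (c / K₀) := by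
    intro i c hi hc hM
    refine (hV _ _).2 ⟨(hN i hi).1, (hN i hi).2, Nat.div_lt_of_lt_mul (by rwa [mul_comm]),
      i, c, rfl, Nat.div_mul_le_self c K₀, (Nat.div_lt_iff_lt_mul hK).1 (Nat.lt_succ_self _), hM⟩
  obtain ⟨h1, h2⟩ := block_spec hn m i
  obtain ⟨h3, h4⟩ := block_spec hn m i'
  have h5 : |block n m i - block n m i'| ≤ 10 := by
    rw [abs_le] at hii ⊢
    have e1 : i * m - i' * m ≤ 8 * n := by nlinarith [hii.2]
    have e2 : -(8 * n) ≤ i * m - i' * m := by nlinarith [hii.1]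
    constructor <;> nlinarith
  obtain ⟨h6, h7⟩ := hI _ _ _ _ (hv i c hi hc hM) (hv i' c' hi' hc' hM') h5
  exact hR.simple i c i' c' hi hi' hc hc' hM hM' h6 h7

lemma block_mem_of_abs_le (hn : 0 < n) (hm : 0 < m) (hdm : d * m ≤ n)
    {i : ℤ} (hi : |i| ≤ (B - 1) * d) (hB : 1 ≤ B) : -B ≤ block n m i ∧ block n m i < B := by
  obtain ⟨h1, h2⟩ := block_spec hn m i
  have hm' : (0 : ℤ) < m := by exact_mod_cast hm
  rw [abs_le] at hi
  have e1 : i * m ≤ (B - 1) * n := by nlinarith [hi.2]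
  have e2 : -((B - 1) * n) ≤ i * m := by nlinarith [hi.1]
  constructor
  · have : -((B - 1) * n) < (block n m i + 1) * n := lt_of_le_of_lt e2 h2
    nlinarith
  · nlinarith

/-- A block has up to `d + 1` sites, so `B` blocks exceed `B * d` sites by at most `B ≤ d`. The
margin of `20` blocks absorbs this and leaves `10 * d` sites to spare. -/
lemma abs_le_of_block (hn : 0 < n) (hm : 0 < m) (hnd : n < (d + 1) * m) (hB : 20 ≤ B)
    (hBd : B ≤ d) {i : ℤ} (h1 : -B + 20 ≤ block n m i) (h2 : block n m i + 20 ≤ B) :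
    |i| + 10 * d ≤ (B - 1) * d := by
  obtain ⟨h3, h4⟩ := block_spec hn m i
  have hm' : (0 : ℤ) < m := by exact_mod_cast hm
  have e1 : i * m ≤ (B - 19) * ((d + 1) * m) := by nlinarith
  have e2 : -((B - 19) * ((d + 1) * m)) ≤ i * m := by nlinarith
  have e3 : i ≤ (B - 19) * (d + 1) := le_of_mul_le_mul_right (by linarith) hm'
  have e4 : -((B - 19) * (d + 1)) ≤ i := le_of_mul_le_mul_right (by linarith) hm'
  have e5 : |i| ≤ (B - 19) * (d + 1) := abs_le.2 ⟨e4, e3⟩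
  nlinarith

lemma IsEvolution.exists_unoccupied_of_active (hz : IsEvolution N (J * K₀) z S M Q)
    (hR : TypicalRings z₀ m J K₀ n d N S M Q) (hI : MatchesIsolated N d (J * K₀) M)
    (hn : 0 < n) (hm : 0 < m) (hnd : n < (d + 1) * m) (hB : 20 ≤ B)
    (hBd : B ≤ d) (hNB : N = (B - 1) * d)
    (hV : ∀ b j, V b j ↔ -B ≤ b ∧ b < B ∧ j < J ∧ ∃ i c, block n m i = b ∧ j * K₀ ≤ c ∧
      c < (j + 1) * K₀ ∧ M c i)
    {k : ℕ} (hk : m ≤ k + 1) (hkJ : k < J) {b : ℤ} (h1 : -B + 20 ≤ b) (h2 : b + 20 ≤ B)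
    (hb : ActiveBlock z₀ m V k b) :
    ∃ i c₀, block n m i = b ∧ |i| + 10 * d ≤ N ∧ c₀ < J * K₀ ∧ M c₀ i ∧
      ∀ c, k * K₀ ≤ c → c ≤ (k + 1) * K₀ → ∃ f, i ≤ f ∧ f ≤ i + d ∧ z c f ≠ 1 := by
  obtain ⟨j, hj, hVj⟩ := hb
  obtain ⟨-, -, hjJ, i, c₀, hi, hc1, hc2, hM⟩ := (hV b j).1 hVj
  have hbox := abs_le_of_block hn hm hnd hB hBd (hi.symm ▸ h1) (hi.symm ▸ h2)
  rw [← hNB] at hbox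
  have hjk : (j + 1) * K₀ ≤ k * K₀ := Nat.mul_le_mul_right _ hj.1
  have hkJ' : (k + 1) * K₀ ≤ J * K₀ := Nat.mul_le_mul_right _ hkJ
  have hkk : k * K₀ ≤ (k + 1) * K₀ := Nat.mul_le_mul_right _ (Nat.le_succ k)
  obtain ⟨l, hl0, hld, hL⟩ := hR.lasting k j hk hkJ hj i c₀ (by omega) hc1 hc2 hM
  refine ⟨i, c₀, hi, hbox, by omega, hM, fun c h3 h4 => ?_⟩
  obtain ⟨f, h5, h6, h7⟩ := hz.exists_unoccupied hR.noCrossing hI (by omega) (by omega) hl0 hld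
    (by omega) hkJ' hM hL c (by omega) h4
  exact ⟨f, h5, by omega, h7⟩

/-- Either no match has occurred near `g`, which then has not burnt, or one has. Being inactive and
already in the past, that match is an early one whose hole has been refilled. -/
lemma IsEvolution.occupied_of_inactive (hz : IsEvolution N (J * K₀) z S M Q)
    (hR : TypicalRings z₀ m J K₀ n d N S M Q) (hI : MatchesIsolated N d (J * K₀) M)
    (hK : 0 < K₀) (hd : 0 < d) {k : ℕ} (hk : m ≤ k) (hkJ : k < J) {c : ℕ}
    (hc1 : k * K₀ ≤ c) (hc2 : c ≤ (k + 1) * K₀) {g : ℤ} (hg : |g| + 2 * d ≤ N)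
    (hin : ∀ i c', |i - g| < 2 * d → c' < c → M c' i →
      Inactive z₀ m k (c' / K₀) ∧ |i| + 6 * d ≤ N) : z c g = 1 := by
  have hkJ' : (k + 1) * K₀ ≤ J * K₀ := Nat.mul_le_mul_right _ hkJ
  have hmk : m * K₀ ≤ k * K₀ := Nat.mul_le_mul_right _ hk
  obtain ⟨cs, hcs, hS⟩ := hR.seeded g (by omega)
  by_cases hM : ∃ c' < c, ∃ i, |i - g| < 2 * d ∧ M c' i
  · obtain ⟨c', hc', i, hig, hMi⟩ := hM
    obtain ⟨hina, hbox⟩ := hin i c' hig hc' hMi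
    have e1 : c' / K₀ * K₀ ≤ c' := Nat.div_mul_le_self c' K₀
    have e2 : c' < (c' / K₀ + 1) * K₀ := (Nat.div_lt_iff_lt_mul hK).1 (Nat.lt_succ_self _)
    rcases hina with h | ⟨h3, h4⟩
    · have : (k + 1) * K₀ ≤ c' / K₀ * K₀ := Nat.mul_le_mul_right _ h
      omega
    · obtain ⟨l, W, hl, hW, hbr⟩ := hR.brief k (c' / K₀) hkJ h3 h4 i c' (by omega) e1 e2 hMi
      exact hz.occupied_of_brief hR.noCrossing hI hd hbox hl hW hc1 (hc2.trans hkJ') hMi hbr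
        (by rw [abs_sub_comm]; omega) ⟨cs, by omega, hS⟩
  · push Not at hM
    have hnb := hz.not_burning_of_far hR.noCrossing hd hg (C := c) (hc2.trans hkJ')
      fun c' hc' i hig => hM c' hc' i hig
    exact hz.occupied_of_seed (by omega) (c₀ := 0) (hc2.trans hkJ')
      (fun c' _ hc' => hnb c' hc') ⟨cs, Nat.zero_le _, by omega, hS⟩

set_option maxHeartbeats 400000 in
-- The discrete counterpart of `limit_closeToGrid`. Each of the two nearest active blocks contains a
-- match, within `d` of which some site is always unoccupied; strictly between them every other
-- match is inactive, and the sites at distance at least `3 * d` from both matches are occupied.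
-- Before time `1 - 1 / m` the sites of `LateSites` confine the cluster.
lemma TypicalRings.closeToGrid (hz : IsEvolution N (J * K₀) z S M Q)
    (hR : TypicalRings z₀ m J K₀ n d N S M Q) (hn : 0 < n) (hm : 0 < m) (hK : 0 < K₀)
    (hdm : d * m ≤ n) (hnd : n < (d + 1) * m) (hB : 20 ≤ B) (hBd : B ≤ d) (hNB : N = (B - 1) * d)
    (hmJ : m ≤ J)
    (hV : ∀ b j, V b j ↔ -B ≤ b ∧ b < B ∧ j < J ∧ ∃ i c, block n m i = b ∧ j * K₀ ≤ c ∧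
      c < (j + 1) * K₀ ∧ M c i)
    (hIV : ∀ b j b' j', V b j → V b' j' → |b - b'| ≤ 10 → b = b' ∧ j = j')
    (hG : GoodCells z₀ m B J V x) (hlate : LateSites m K₀ d S ⌊(n : ℝ) * x⌋) {ξ : ℝ → ℤ → Fin 3}
    (hξ : ∀ (t : ℝ) (k : ℕ), k ≤ t * m → t * m < k + 1 → k < J →
      ∃ c, k * K₀ ≤ c ∧ c ≤ (k + 1) * K₀ ∧ ∀ i, |i| ≤ N → ξ t i = z c i) :
    CloseToGrid z₀ m B J V x (fun t => scaledComponent n (ξ t) ⌊(n : ℝ) * x⌋) := by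
  have hm' : (0 : ℝ) < m := by exact_mod_cast hm
  have hmZ : (0 : ℤ) < m := by exact_mod_cast hm
  have hn' : (0 : ℝ) < n := by exact_mod_cast hn
  have hd : 0 < d := by omega
  have hI := hR.isolated hn hdm hK
    (fun i hi => block_mem_of_abs_le hn hm hdm (by rwa [← hNB]) (by omega)) hV hIV
  have hmn : (m : ℤ) ≤ n := by nlinarith
  have mono : ∀ {u v : ℤ}, u ≤ v → u * m ≤ v * m := fun h => mul_le_mul_of_nonneg_right h hmZ.le
  have mono' : ∀ {u v : ℤ}, u ≤ v → u * n ≤ v * n := fun h => mul_le_mul_of_nonneg_right h hn.le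
  have hdn : (d : ℝ) / n ≤ 1 / m := by
    rw [div_le_div_iff₀ hn' hm', one_mul]
    exact_mod_cast hdm
  have h1n : (1 : ℝ) / n ≤ 1 / m := by
    refine le_trans ?_ hdn
    have : (1 : ℝ) ≤ d := by exact_mod_cast hd
    gcongr
  obtain ⟨x1, x2⟩ := GoodCells.floor_bounds hm x
  set i₀ := ⌊(n : ℝ) * x⌋ with hi₀
  have hf1 : (i₀ : ℝ) ≤ n * x := Int.floor_le _
  have hf2 : (n : ℝ) * x < i₀ + 1 := Int.lt_floor_add_one _
  have hxm : (n : ℝ) * x * m = n * (x * m) := by ring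
  have hi₀1 : i₀ * m < (⌊x * m⌋ + 1) * n := by
    have : (i₀ : ℝ) * m < (⌊x * m⌋ + 1) * n := by
      calc (i₀ : ℝ) * m ≤ n * (x * m) := by rw [← hxm]; gcongr
        _ < n * (⌊x * m⌋ + 1) := by gcongr; exact Int.lt_floor_add_one _
        _ = _ := by ring
    exact_mod_cast this
  have hi₀2 : (⌊x * m⌋ : ℤ) * n < (i₀ + 1) * m := by
    have : (⌊x * m⌋ : ℝ) * n < (i₀ + 1) * m := by
      calc (⌊x * m⌋ : ℝ) * n ≤ x * m * n := by gcongr; exact Int.floor_le _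
        _ = n * x * m := by ring
        _ < _ := by gcongr
    exact_mod_cast this
  have hsides : ∀ k, m ≤ k + 1 → k < J → ∃ ir il : ℤ, ∃ cr cl : ℕ,
      block n m ir = rightBlock z₀ m V k x ∧ block n m il = leftBlock z₀ m V k x ∧
      |ir| + 10 * d ≤ N ∧ |il| + 10 * d ≤ N ∧ cr < J * K₀ ∧ cl < J * K₀ ∧ M cr ir ∧ M cl il ∧
      i₀ + 10 * d ≤ ir ∧ il + 10 * d ≤ i₀ ∧
      ∀ c, k * K₀ ≤ c → c ≤ (k + 1) * K₀ → (∃ f, ir ≤ f ∧ f ≤ ir + d ∧ z c f ≠ 1) ∧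
        ∃ f, il ≤ f ∧ f ≤ il + d ∧ z c f ≠ 1 := by
    intro k hk hkJ
    obtain ⟨r1, r2, r3, -⟩ := hG.exists_right hk hkJ
    obtain ⟨l1, l2, l3, -⟩ := hG.exists_left hk hkJ
    obtain ⟨ir, cr, e1, e2, e3, e4, e5⟩ := hz.exists_unoccupied_of_active hR hI hn hm hnd hB hBd
      hNB hV hk hkJ (by omega) r2 r3
    obtain ⟨il, cl, e6, e7, e8, e9, e10⟩ := hz.exists_unoccupied_of_active hR hI hn hm hnd hB
      hBd hNB hV hk hkJ l2 (by omega) l3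
    refine ⟨ir, il, cr, cl, e1, e6, e2, e7, e3, e8, e4, e9, ?_, ?_,
      fun c h1 h2 => ⟨e5 c h1 h2, e10 c h1 h2⟩⟩
    · have h1 := (block_spec hn m ir).1
      rw [e1] at h1
      have h3 := mono' (show ⌊x * m⌋ + 21 ≤ rightBlock z₀ m V k x by omega)
      have h4 : (i₀ + 10 * d) * m ≤ ir * m := by linarith
      exact le_of_mul_le_mul_right h4 hmZ
    · have h1 := (block_spec hn m il).2
      rw [e6] at h1
      have h3 := mono' (show leftBlock z₀ m V k x + 1 ≤ ⌊x * m⌋ - 20 by omega)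
      have h4 : (il + 10 * d) * m < (i₀ + 1) * m := by linarith
      have := lt_of_mul_lt_mul_right h4 hmZ.le
      omega
  have hdistant : ∀ (t : ℝ) (k : ℕ), k ≤ t * m → t * m < k + 1 → m ≤ k + 1 → k < J →
      clusterDist x (scaledComponent n (ξ t) i₀) (mkInterval x x) ≤ 2 * B / m := by
    intro t k hk1 hk2 hk hkJ
    obtain ⟨c, hc1, hc2, hc3⟩ := hξ t k hk1 hk2 hkJ
    obtain ⟨ir, il, cr, cl, e1, e2, e3, e4, -, -, -, -, e5, e6, e7⟩ := hsides k hk hkJ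
    obtain ⟨⟨fr, r1, r2, r3⟩, fl, l1, l2, l3⟩ := e7 c hc1 hc2
    refine clusterDist_scaledComponent_le hn (fl := fl) (fr := fr) (by omega) (by omega)
      (by rwa [hc3 fl (by rw [abs_le]; have := abs_le.1 (show |il| ≤ N - 10 * d by omega); omega)])
      (by rwa [hc3 fr (by rw [abs_le]; have := abs_le.1 (show |ir| ≤ N - 10 * d by omega); omega)])
      ?_
    rw [div_le_div_iff₀ hn' hm']
    have h1 := (block_spec hn m ir).2
    have h2 := (block_spec hn m il).1
    have h3 := (hG.exists_right hk hkJ).2.1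
    have h4 := (hG.exists_left hk hkJ).2.1
    rw [e1] at h1
    rw [e2] at h2
    have h5 := mono' (show rightBlock z₀ m V k x + 1 ≤ B - 19 by omega)
    have h6 := mono' h4
    have h7 := mono (show fr - fl + 1 ≤ ir + d - il + 1 by omega)
    have h8 : (fr - fl + 1) * m ≤ 2 * B * n := by linarith
    exact_mod_cast h8
  have hearly : ∀ t : ℝ, 0 ≤ t → t * m < m - 1 →
      clusterDist x (scaledComponent n (ξ t) i₀) (mkInterval x x) ≤ 20 / m := by
    intro t ht htm
    have hk1 : ((⌊t * m⌋₊ : ℕ) : ℝ) ≤ t * m := Nat.floor_le (by positivity)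
    have hk2 : ⌊t * m⌋₊ + 1 < m := by
      have : ((⌊t * m⌋₊ + 1 : ℕ) : ℝ) < m := by push_cast; linarith
      exact_mod_cast this
    obtain ⟨c, hc1, hc2, hc3⟩ := hξ t _ hk1 (Nat.lt_floor_add_one _) (by omega)
    have hc4 : (⌊t * m⌋₊ + 1) * K₀ ≤ (m - 1) * K₀ := Nat.mul_le_mul_right _ (by omega)
    have hc5 : (m - 1) * K₀ ≤ J * K₀ := Nat.mul_le_mul_right _ (by omega)
    obtain ⟨⟨fr, r1, r2, r3⟩, fl, l1, l2, l3⟩ := hlate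
    obtain ⟨ir, il, cr, cl, -, -, e3, e4, -, -, -, -, e5, e6, -⟩ :=
      hsides (m - 1) (by omega) (by omega)
    have e3' := abs_le.1 (show |ir| ≤ N - 10 * d by omega)
    have e4' := abs_le.1 (show |il| ≤ N - 10 * d by omega)
    have hbr : |fr| ≤ N := by rw [abs_le]; omega
    have hbl : |fl| ≤ N := by rw [abs_le]; omega
    have zr : ξ t fr = 0 := by
      rw [hc3 fr hbr]
      exact hz.vacant_of_no_seed hbr hc5 r3 c (by omega)
    have zl : ξ t fl = 0 := by
      rw [hc3 fl hbl]
      exact hz.vacant_of_no_seed hbl hc5 l3 c (by omega)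
    refine clusterDist_scaledComponent_le hn (fl := fl) (fr := fr) (by omega) (by omega)
      (by rw [zl]; decide) (by rw [zr]; decide) ?_
    rw [div_le_div_iff₀ hn' hm']
    have h7 : (fr - fl + 1) * m ≤ 20 * n := by
      linarith [mono (show fr - fl + 1 ≤ 2 * d + 1 by omega)]
    exact_mod_cast h7
  refine ⟨hearly, ?_, ?_⟩
  · intro t k hk1 hk2 hk hkJ hhit
    obtain ⟨c, hc1, hc2, hc3⟩ := hξ t k hk1 hk2 hkJ
    obtain ⟨ir, il, cr, cl, e1, e2, e3, e4, hcr, hcl, hMr, hMl, e5, e6, e7⟩ :=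
      hsides k (by omega) hkJ
    obtain ⟨⟨fr, r1, r2, r3⟩, fl, l1, l2, l3⟩ := e7 c hc1 hc2
    have e3' := abs_le.1 (show |ir| ≤ N - 10 * d by omega)
    have e4' := abs_le.1 (show |il| ≤ N - 10 * d by omega)
    obtain ⟨-, -, -, hfirst⟩ := hG.exists_right (by omega : m ≤ k + 1) hkJ
    obtain ⟨-, -, -, hlast⟩ := hG.exists_left (by omega : m ≤ k + 1) hkJ
    set rb := rightBlock z₀ m V k x
    set lb := leftBlock z₀ m V k x
    have hkJ' : (k + 1) * K₀ ≤ J * K₀ := Nat.mul_le_mul_right _ hkJ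
    obtain ⟨br1, br2⟩ := block_spec hn m ir
    obtain ⟨bl1, bl2⟩ := block_spec hn m il
    rw [e1] at br1 br2
    rw [e2] at bl1 bl2
    -- The margin `3 * d` keeps a site more than `d` away from either delimiting match even after
    -- the radius `2 * d`, within which matches can influence `g`, is taken off.
    have hocc : ∀ g, il + 3 * d ≤ g → g ≤ ir - 3 * d → ξ t g = 1 := by
      intro g hg1 hg2
      have hgN : |g| + 2 * d ≤ N := by
        have : |g| ≤ N - 2 * d := by rw [abs_le]; omega
        omega
      rw [hc3 g (by omega)]
      refine hz.occupied_of_inactive hR hI hK hd hk hkJ hc1 hc2 hgN fun i c' hig hc' hMi => ?_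
      rw [abs_lt] at hig
      have hiN : |i| ≤ N - 8 * d := by rw [abs_le]; omega
      refine ⟨?_, by omega⟩
      obtain ⟨bi1, bi2⟩ := block_spec hn m i
      set b := block n m i with hb
      have hcJ : c' < J * K₀ := by omega
      have hbox := block_mem_of_abs_le (B := B) hn hm hdm
        (show |i| ≤ (B - 1) * d by omega) (by omega)
      have hVb : V b (c' / K₀) := (hV _ _).2 ⟨hbox.1, hbox.2,
        Nat.div_lt_of_lt_mul (by rwa [mul_comm]), i, c', rfl, Nat.div_mul_le_self c' K₀,
        (Nat.div_lt_iff_lt_mul hK).1 (Nat.lt_succ_self _), hMi⟩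
      have hbr : b ≤ rb := by
        have : b * n < (rb + 1) * n := by linarith [mono (show i ≤ ir by omega)]
        have := lt_of_mul_lt_mul_right this hn.le
        omega
      have hbl : lb ≤ b := by
        have : lb * n < (b + 1) * n := by linarith [mono (show il ≤ i by omega)]
        have := lt_of_mul_lt_mul_right this hn.le
        omega
      -- A match in the block of `ir` would be within `d + 1` of `ir`, hence equal to it by
      -- isolation, whereas `i` is at distance at least `d` from `ir`.
      have hbr' : b ≠ rb := by
        intro h
        have h1 : (ir - i) * m ≤ 1 * ((d + 1) * m) := by rw [h] at bi1; linarith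
        have h2 : ir - i ≤ d + 1 := le_of_mul_le_mul_right (by linarith) hmZ
        have := (hI i c' ir cr (by omega) (by omega) hcJ hcr hMi hMr (by rw [abs_le]; omega)).1
        omega
      have hbl' : b ≠ lb := by
        intro h
        have h1 : (i - il) * m ≤ 1 * ((d + 1) * m) := by rw [h] at bi2; linarith
        have h2 : i - il ≤ d + 1 := le_of_mul_le_mul_right (by linarith) hmZ
        have := (hI i c' il cl (by omega) (by omega) hcJ hcl hMi hMl (by rw [abs_le]; omega)).1
        omega
      by_contra hin
      have hact : Active z₀ m k (c' / K₀) := by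
        by_contra hna
        exact hhit ⟨b, _, hVb, hna, hin⟩
      rcases le_total ⌊x * m⌋ b with h | h
      · have := hfirst b h ⟨_, hact, hVb⟩
        omega
      · have := hlast b h ⟨_, hact, hVb⟩
        omega
    have hone : ξ t i₀ = 1 := hocc i₀ (by omega) (by omega)
    have hfr : ξ t fr ≠ 1 := by rwa [hc3 fr (by rw [abs_le]; omega)]
    have hfl : ξ t fl ≠ 1 := by rwa [hc3 fl (by rw [abs_le]; omega)]
    have hlt : fl < i₀ := by omega
    have hrt : i₀ < fr := by omega
    obtain ⟨-, a2, a3⟩ := leftEnd_spec hlt hfl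
    obtain ⟨-, b2, b3⟩ := rightEnd_spec hrt hfr
    have a4 := a3 (il + 3 * d) fun g h1 h2 => hocc g h1 (by omega)
    have b4 := b3 (ir - 3 * d) fun g h1 h2 => hocc g (by omega) h2
    unfold clusterDist
    rw [ends_scaledComponent hn x hone hlt hrt hfl hfr, hG.ends_gridCluster hk hkJ]
    simp only
    have key : ∀ (e b : ℤ), -(7 * n) ≤ e * m - b * n → e * m - b * n ≤ 7 * n →
        |(e : ℝ) / n - (b : ℝ) / m| ≤ 7 / m := by
      intro e b h1 h2
      have h1' : -(7 * n : ℝ) ≤ e * m - b * n := by exact_mod_cast h1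
      have h2' : (e * m - b * n : ℝ) ≤ 7 * n := by exact_mod_cast h2
      have e1 : (e : ℝ) / n - (b : ℝ) / m = (e * m - b * n) / (n * m) := by field_simp
      have e2 : (7 : ℝ) / m = 7 * n / (n * m) := by field_simp
      rw [e1, e2, abs_le, ← neg_div]
      constructor <;> gcongr
    have k1 := key (leftEnd (ξ t) i₀) lb
      (by linarith [mono (show il ≤ leftEnd (ξ t) i₀ by omega)]) (by linarith [mono a4])
    have k2 := key (rightEnd (ξ t) i₀) rb (by linarith [mono b4])
      (by linarith [mono (show rightEnd (ξ t) i₀ ≤ ir + d by omega)])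
    have e20 : (20 : ℝ) / m = 7 / m + 7 / m + 6 / m := by ring
    have : (0 : ℝ) ≤ 6 / m := by positivity
    rw [e20]
    linarith
  · intro t ht htJ
    have hk1 : ((⌊t * m⌋₊ : ℕ) : ℝ) ≤ t * m := Nat.floor_le (by positivity)
    have hkJ : ⌊t * m⌋₊ < J := by exact_mod_cast hk1.trans_lt htJ
    rcases lt_or_ge (t * m) (m - 1) with h | h
    · refine (hearly t ht h).trans ?_
      have : (20 : ℝ) ≤ B := by exact_mod_cast hB
      gcongr
      linarith
    · refine hdistant t _ hk1 (Nat.lt_floor_add_one _) ?_ hkJ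
      have h1 := Nat.lt_floor_add_one (t * m)
      have : (m : ℝ) < (⌊t * m⌋₊ + 2 : ℕ) := by push_cast; linarith
      have : m < ⌊t * m⌋₊ + 2 := by exact_mod_cast this
      omega

end Close

/-! ### Independent rings -/

/-- The ring events `R (k, c, i)`, for the kinds `k` (seeds, matches, fronts), the steps `c` and the
sites `i`, are independent, with parameters `r k`. -/
structure RingModel {Ω : Type*} [MeasurableSpace Ω] (P : Measure Ω) (R : Fin 3 × ℕ × ℤ → Set Ω)
    (r : Fin 3 → ℝ) : Prop where
  measurable : ∀ p, MeasurableSet (R p)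
  indep : iIndepSet R P
  law : ∀ p, P.real (R p)ᶜ = Real.exp (-r p.1)

/-- The events that only depend on the rings in `A`. -/
@[reducible] def ringAlgebra {Ω : Type*} (R : Fin 3 × ℕ × ℤ → Set Ω) (A : Set (Fin 3 × ℕ × ℤ)) :
    MeasurableSpace Ω := ⨆ p ∈ A, MeasurableSpace.generateFrom {R p}

lemma measurableSet_ringAlgebra {Ω : Type*} {R : Fin 3 × ℕ × ℤ → Set Ω}
    {A : Set (Fin 3 × ℕ × ℤ)} {p : Fin 3 × ℕ × ℤ} (hp : p ∈ A) :
    MeasurableSet[ringAlgebra R A] (R p) := by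
  have h : MeasurableSpace.generateFrom {R p} ≤ ringAlgebra R A :=
    le_iSup₂ (f := fun p (_ : p ∈ A) => MeasurableSpace.generateFrom {R p}) p hp
  exact h _ (MeasurableSpace.measurableSet_generateFrom rfl)

/-- The number of steps that the front from `x` in direction `dir` makes in `w` steps after `c`. -/
def frontCount (Q : ℕ → ℤ → Prop) (dir x : ℤ) (c : ℕ) : ℕ → ℕ
  | 0 => 0
  | w + 1 => frontCount Q dir x c w +
      (open Classical in if Q (c + w) (x + dir * frontCount Q dir x c w) then 1 else 0)

lemma front_eq (Q : ℕ → ℤ → Prop) (dir x : ℤ) (c w : ℕ) :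
    front Q dir x c w = x + dir * frontCount Q dir x c w := by
  induction w with
  | zero => simp [front, frontCount]
  | succ w ih =>
    by_cases h : Q (c + w) (x + dir * frontCount Q dir x c w)
    · rw [front_succ_of _ _ _ _ _ (by rwa [ih]), ih, frontCount, if_pos h]
      push_cast
      ring
    · rw [front_succ_of_not _ _ _ _ _ (by rwa [ih]), ih, frontCount, if_neg h, add_zero]

/-- The rings of kind `k`. -/
def ringsOf {Ω : Type*} (R : Fin 3 × ℕ × ℤ → Set Ω) (k : Fin 3) (ω : Ω) (c : ℕ) (i : ℤ) : Prop :=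
  ω ∈ R (k, c, i)

/-- The position after `w` steps is a function of the rings of the steps before `c + w`. The
hypothesis concerns only these, so the lemma also applies to the σ-algebra of the past. -/
lemma measurable_frontCount {Ω : Type*} [MeasurableSpace Ω] {R : Fin 3 × ℕ × ℤ → Set Ω}
    {c w : ℕ} (hR : ∀ c' i, c' < c + w → MeasurableSet (R (2, c', i))) (dir x : ℤ) :
    Measurable fun ω => frontCount (ringsOf R 2 ω) dir x c w := by
  classical
  induction w with
  | zero => exact measurable_const
  | succ w ih =>
    have ih' := ih fun c' i h => hR c' i (by omega)
    simp only [frontCount]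
    refine ih'.add (Measurable.ite ?_ measurable_const measurable_const)
    have : {ω | ringsOf R 2 ω (c + w) (x + dir * frontCount (ringsOf R 2 ω) dir x c w)} =
        ⋃ v : ℕ, (fun ω => frontCount (ringsOf R 2 ω) dir x c w) ⁻¹' {v} ∩
          R (2, c + w, x + dir * v) := by
      ext ω
      simp [ringsOf]
    rw [this]
    exact MeasurableSet.iUnion fun v => (ih' (measurableSet_singleton v)).inter
      (hR _ _ (by omega))

namespace RingModel

variable {Ω : Type*} [MeasurableSpace Ω] {P : Measure Ω}
  {R : Fin 3 × ℕ × ℤ → Set Ω} {r : Fin 3 → ℝ}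

lemma generateFrom_le (h : RingModel P R r) (p : Fin 3 × ℕ × ℤ) :
    MeasurableSpace.generateFrom {R p} ≤ ‹MeasurableSpace Ω› :=
  MeasurableSpace.generateFrom_le fun s hs => by rw [hs]; exact h.measurable p

lemma ringAlgebra_le (h : RingModel P R r) (A : Set (Fin 3 × ℕ × ℤ)) :
    ringAlgebra R A ≤ ‹MeasurableSpace Ω› := iSup₂_le fun p _ => h.generateFrom_le p

lemma measurableSet_ring_at_front (h : RingModel P R r) (dir x o : ℤ) (c w : ℕ) (k : Fin 3) :
    MeasurableSet
      {ω | ringsOf R k ω (c + w) (x + dir * frontCount (ringsOf R 2 ω) dir x c w + o)} := by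
  have : {ω | ringsOf R k ω (c + w) (x + dir * frontCount (ringsOf R 2 ω) dir x c w + o)} =
      ⋃ v : ℕ, (fun ω => frontCount (ringsOf R 2 ω) dir x c w) ⁻¹' {v} ∩
        R (k, c + w, x + dir * v + o) := by
    ext ω
    simp [ringsOf]
  rw [this]
  exact MeasurableSet.iUnion fun v => (measurable_frontCount (fun c' i _ => h.measurable _) dir x
    (measurableSet_singleton v)).inter (h.measurable _)

/-- Disjoint sets of independent rings generate independent σ-algebras. -/
lemma measureReal_inter (h : RingModel P R r) {A A' : Set (Fin 3 × ℕ × ℤ)} (hA : Disjoint A A')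
    {E F : Set Ω} (hE : MeasurableSet[ringAlgebra R A] E)
    (hF : MeasurableSet[ringAlgebra R A'] F) : P.real (E ∩ F) = P.real E * P.real F := by
  have := (Indep_iff _ _ _).1 (indep_iSup_of_disjoint h.generateFrom_le h.indep hA) E F hE hF
  rw [measureReal_def, this, ENNReal.toReal_mul]
  rfl

variable [IsProbabilityMeasure P]

lemma real_eq (h : RingModel P R r) (p : Fin 3 × ℕ × ℤ) :
    P.real (R p) = 1 - Real.exp (-r p.1) := by
  have := probReal_compl_eq_one_sub (μ := P) (h.measurable p)
  rw [h.law] at this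
  linarith

lemma real_le (h : RingModel P R r) (p : Fin 3 × ℕ × ℤ) : P.real (R p) ≤ r p.1 := by
  rw [h.real_eq]
  linarith [Real.add_one_le_exp (-r p.1)]

/-- The probability that there is no ring at `i` in `[c₁, c₂)`. -/
lemma real_no_ring (h : RingModel P R r) (k : Fin 3) (i : ℤ) {c₁ c₂ : ℕ} (hc : c₁ ≤ c₂) :
    P.real {ω | ∀ c, c₁ ≤ c → c < c₂ → ¬ringsOf R k ω c i} =
      Real.exp (-((c₂ - c₁ : ℝ) * r k)) := by
  induction c₂, hc using Nat.le_induction with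
  | base =>
    have : {ω | ∀ c, c₁ ≤ c → c < c₁ → ¬ringsOf R k ω c i} = univ := by
      ext ω
      simp only [mem_ofPred_eq, mem_univ, iff_true]
      intro c h1 h2
      omega
    rw [this]
    simp
  | succ c₂ hc ih =>
    have e : {ω | ∀ c, c₁ ≤ c → c < c₂ + 1 → ¬ringsOf R k ω c i} =
        {ω | ∀ c, c₁ ≤ c → c < c₂ → ¬ringsOf R k ω c i} ∩ (R (k, c₂, i))ᶜ := by
      ext ω
      constructor
      · exact fun hω => ⟨fun c h1 h2 => hω c h1 (by omega), hω c₂ hc (Nat.lt_succ_self _)⟩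
      · rintro ⟨h1, h2⟩ c h3 h4
        rcases (Nat.lt_succ_iff.1 h4).lt_or_eq with h5 | rfl
        · exact h1 c h3 h5
        · exact h2
    rw [e, h.measureReal_inter (A := {p | p.2.1 < c₂}) (A' := {p | p.2.1 = c₂}), ih, h.law,
      ← Real.exp_add]
    · congr 1; push_cast; ring
    · rw [Set.disjoint_left]; intro p h1 h2; exact absurd h2 (ne_of_lt h1)
    · have : {ω | ∀ c, c₁ ≤ c → c < c₂ → ¬ringsOf R k ω c i} =
          ⋂ c ∈ Finset.Ico c₁ c₂, (R (k, c, i))ᶜ := by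
        ext ω; simp [ringsOf]
      rw [this]
      refine Finset.measurableSet_biInter _ fun c hc => ?_
      exact (measurableSet_ringAlgebra (by simpa using (Finset.mem_Ico.1 hc).2)).compl
    · exact (measurableSet_ringAlgebra (by simp)).compl

lemma measurableSet_exists_ring {Ω : Type*} [MeasurableSpace Ω] {R : Fin 3 × ℕ × ℤ → Set Ω}
    {k : Fin 3} {i : ℤ} (hR : ∀ c, MeasurableSet (R (k, c, i))) (c₁ c₂ : ℕ) :
    MeasurableSet {ω | ∃ c, c₁ ≤ c ∧ c < c₂ ∧ ringsOf R k ω c i} := by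
  have : {ω | ∃ c, c₁ ≤ c ∧ c < c₂ ∧ ringsOf R k ω c i} =
      ⋃ c ∈ Finset.Ico c₁ c₂, R (k, c, i) := by
    ext ω; simp [ringsOf, and_assoc]
  rw [this]
  exact Finset.measurableSet_biUnion _ fun c _ => hR c

lemma measurableSet_all_ring {Ω : Type*} [MeasurableSpace Ω] {R : Fin 3 × ℕ × ℤ → Set Ω}
    {k : Fin 3} {i : ℤ} {l : ℕ} (hR : ∀ c g, i ≤ g → g < i + l → MeasurableSet (R (k, c, g)))
    (c₁ c₂ : ℕ) :
    MeasurableSet {ω | ∀ g, i ≤ g → g < i + l → ∃ c, c₁ ≤ c ∧ c < c₂ ∧ ringsOf R k ω c g} := by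
  have : {ω | ∀ g, i ≤ g → g < i + l → ∃ c, c₁ ≤ c ∧ c < c₂ ∧ ringsOf R k ω c g} =
      ⋂ g ∈ Finset.Ico i (i + l), {ω | ∃ c, c₁ ≤ c ∧ c < c₂ ∧ ringsOf R k ω c g} := by
    ext ω; simp
  rw [this]
  refine Finset.measurableSet_biInter _ fun g hg => measurableSet_exists_ring (fun c => ?_) _ _
  exact hR c g (Finset.mem_Ico.1 hg).1 (Finset.mem_Ico.1 hg).2

lemma real_exists_ring (h : RingModel P R r) (k : Fin 3) (i : ℤ) {c₁ c₂ : ℕ} (hc : c₁ ≤ c₂) :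
    P.real {ω | ∃ c, c₁ ≤ c ∧ c < c₂ ∧ ringsOf R k ω c i} =
      1 - Real.exp (-((c₂ - c₁ : ℝ) * r k)) := by
  rw [← h.real_no_ring k i hc, ← probReal_compl_eq_one_sub₀]
  · congr 1
    ext ω
    simp
  · refine MeasurableSet.nullMeasurableSet ?_
    have := (measurableSet_exists_ring (R := R) (k := k) (i := i)
      (fun c => h.measurable (k, c, i)) c₁ c₂).compl
    convert this using 1
    ext ω
    simp

/-- The probability that a site of `[i, i + l)` has no ring in `[c₁, c₂)`. -/
lemma real_exists_no_ring_le (h : RingModel P R r) (k : Fin 3) (i : ℤ) (l : ℕ) {c₁ c₂ : ℕ}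
    (hc : c₁ ≤ c₂) :
    P.real {ω | ∃ g, i ≤ g ∧ g < i + l ∧ ∀ c, c₁ ≤ c → c < c₂ → ¬ringsOf R k ω c g} ≤
      l * Real.exp (-((c₂ - c₁ : ℝ) * r k)) := by
  have e : {ω | ∃ g, i ≤ g ∧ g < i + l ∧ ∀ c, c₁ ≤ c → c < c₂ → ¬ringsOf R k ω c g} =
      ⋃ g ∈ Finset.Ico i (i + l), {ω | ∀ c, c₁ ≤ c → c < c₂ → ¬ringsOf R k ω c g} := by
    ext ω; simp [and_assoc]
  rw [e]
  refine (measureReal_biUnion_finset_le _ _).trans ?_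
  simp only [h.real_no_ring k _ hc]
  rw [Finset.sum_const, nsmul_eq_mul]
  simp

/-- The probability that all sites of `[i, i + l)` have a ring in `[c₁, c₂)`. -/
lemma real_all_ring_le (h : RingModel P R r) (k : Fin 3) (i : ℤ) (l : ℕ) {c₁ c₂ : ℕ}
    (hc : c₁ ≤ c₂) :
    P.real {ω | ∀ g, i ≤ g → g < i + l → ∃ c, c₁ ≤ c ∧ c < c₂ ∧ ringsOf R k ω c g} ≤
      Real.exp (-(l * Real.exp (-((c₂ - c₁ : ℝ) * r k)))) := by
  induction l with
  | zero => simp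
  | succ l ih =>
    have e : {ω | ∀ g, i ≤ g → g < i + (l + 1 : ℕ) → ∃ c, c₁ ≤ c ∧ c < c₂ ∧ ringsOf R k ω c g} =
        {ω | ∀ g, i ≤ g → g < i + l → ∃ c, c₁ ≤ c ∧ c < c₂ ∧ ringsOf R k ω c g} ∩
        {ω | ∃ c, c₁ ≤ c ∧ c < c₂ ∧ ringsOf R k ω c (i + l)} := by
      ext ω
      constructor
      · exact fun hω => ⟨fun g h1 h2 => hω g h1 (by push_cast; omega),
          hω (i + l) (by omega) (by push_cast; omega)⟩
      · rintro ⟨h1, h2⟩ g h3 h4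
        rcases lt_or_eq_of_le (show g ≤ i + l by push_cast at h4; omega) with h5 | rfl
        · exact h1 g h3 h5
        · exact h2
    rw [e, h.measureReal_inter (A := {p | p.2.2 < i + l}) (A' := {p | p.2.2 = i + l}),
      h.real_exists_ring k _ hc]
    · push_cast
      rw [add_mul, one_mul, neg_add, Real.exp_add]
      refine mul_le_mul ih ?_ ?_ (Real.exp_pos _).le
      · have := Real.add_one_le_exp (-Real.exp (-((c₂ - c₁ : ℝ) * r k)))
        linarith
      · rw [← h.real_exists_ring k (i + l) hc]
        positivity
    · rw [Set.disjoint_left]; intro p h1 h2; exact absurd h2 (ne_of_lt h1)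
    · exact @measurableSet_all_ring Ω (ringAlgebra R _) R k i l
        (fun c g _ hg => measurableSet_ringAlgebra hg) c₁ c₂
    · exact @measurableSet_exists_ring Ω (ringAlgebra R _) R k (i + l)
        (fun c => measurableSet_ringAlgebra rfl) c₁ c₂

/-- A ring of kind `k` next to a front, which the front does not depend on. -/
lemma real_ring_at_front (h : RingModel P R r) (dir x o : ℤ) (c w : ℕ) (k : Fin 3) (v : ℕ) :
    P.real ((fun ω => frontCount (ringsOf R 2 ω) dir x c w) ⁻¹' {v} ∩
      {ω | ringsOf R k ω (c + w) (x + dir * frontCount (ringsOf R 2 ω) dir x c w + o)}) =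
      P.real ((fun ω => frontCount (ringsOf R 2 ω) dir x c w) ⁻¹' {v}) *
        (1 - Real.exp (-r k)) := by
  have e : (fun ω => frontCount (ringsOf R 2 ω) dir x c w) ⁻¹' {v} ∩
      {ω | ringsOf R k ω (c + w) (x + dir * frontCount (ringsOf R 2 ω) dir x c w + o)} =
      (fun ω => frontCount (ringsOf R 2 ω) dir x c w) ⁻¹' {v} ∩
        R (k, c + w, x + dir * v + o) := by
    ext ω
    simp only [mem_inter_iff, mem_preimage, mem_singleton_iff, mem_ofPred_eq]
    exact and_congr_right fun hv => by rw [hv]; rfl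
  rw [e, h.measureReal_inter (A := {p | p.2.1 < c + w}) (A' := {p | p.2.1 = c + w}), h.real_eq]
  · rw [Set.disjoint_left]; intro p h1 h2; exact absurd h2 (ne_of_lt h1)
  · exact @measurable_frontCount Ω (ringAlgebra R _) R c w
      (fun c' i hc => measurableSet_ringAlgebra hc) dir x _ (measurableSet_singleton v)
  · exact measurableSet_ringAlgebra rfl

/-- The front reaches its position at step `c + w` using earlier rings only. Whatever that position
is, a ring at a fixed offset from it at step `c + w` is independent of the past and has its usual
probability. -/
lemma lintegral_ring_at_front (h : RingModel P R r) (dir x o : ℤ) (c w : ℕ) (k : Fin 3)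
    (f : ℕ → ℝ≥0∞) :
    ∫⁻ ω in {ω | ringsOf R k ω (c + w) (x + dir * frontCount (ringsOf R 2 ω) dir x c w + o)},
      f (frontCount (ringsOf R 2 ω) dir x c w) ∂P =
    ENNReal.ofReal (1 - Real.exp (-r k)) *
      ∫⁻ ω, f (frontCount (ringsOf R 2 ω) dir x c w) ∂P := by
  have hm : Measurable fun ω => frontCount (ringsOf R 2 ω) dir x c w :=
    measurable_frontCount (fun c' i _ => h.measurable _) dir x
  have hf : Measurable f := measurable_from_top
  set E := {ω | ringsOf R k ω (c + w) (x + dir * frontCount (ringsOf R 2 ω) dir x c w + o)} with hE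
  have hlaw : (P.restrict E).map (fun ω => frontCount (ringsOf R 2 ω) dir x c w) =
      ENNReal.ofReal (1 - Real.exp (-r k)) •
        P.map (fun ω => frontCount (ringsOf R 2 ω) dir x c w) := by
    refine Measure.ext_of_singleton fun v => ?_
    rw [Measure.map_apply hm (measurableSet_singleton v), Measure.smul_apply,
      Measure.map_apply hm (measurableSet_singleton v),
      Measure.restrict_apply (hm (measurableSet_singleton v)), smul_eq_mul, mul_comm]
    have := h.real_ring_at_front dir x o c w k v
    rw [← ofReal_measureReal, this, ENNReal.ofReal_mul (by positivity), ofReal_measureReal]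
  rw [← lintegral_map hf hm, hlaw, lintegral_smul_measure, lintegral_map hf hm, smul_eq_mul]

lemma lintegral_frontCount (h : RingModel P R r) (dir x : ℤ) (c w : ℕ) :
    ∫⁻ ω, (frontCount (ringsOf R 2 ω) dir x c w : ℝ≥0∞) ∂P =
      w * ENNReal.ofReal (1 - Real.exp (-r 2)) := by
  classical
  induction w with
  | zero => simp [frontCount]
  | succ w ih =>
    have h1 := h.lintegral_ring_at_front dir x 0 c w 2 fun _ => 1
    simp only [add_zero] at h1
    have hE := h.measurableSet_ring_at_front dir x 0 c w 2
    simp only [add_zero] at hE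
    rw [lintegral_one, lintegral_one, Measure.restrict_apply_univ, measure_univ, mul_one] at h1
    have h2 : ∀ ω, (frontCount (ringsOf R 2 ω) dir x c (w + 1) : ℝ≥0∞) =
        frontCount (ringsOf R 2 ω) dir x c w + ({ω | ringsOf R 2 ω (c + w)
          (x + dir * frontCount (ringsOf R 2 ω) dir x c w)}).indicator 1 ω := by
      intro ω
      rw [frontCount]
      by_cases hω : ringsOf R 2 ω (c + w) (x + dir * frontCount (ringsOf R 2 ω) dir x c w)
      · rw [if_pos hω, indicator_of_mem (by exact hω)]; simp
      · rw [if_neg hω, indicator_of_notMem (by exact hω)]; simp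
    simp only [h2]
    rw [lintegral_add_right _ (measurable_one.indicator hE), ih, lintegral_indicator_one hE]
    rw [h1]
    push_cast
    ring

/-- Fronts do not move too fast. -/
lemma real_frontCount_ge_le (h : RingModel P R r) (dir x : ℤ) (c w : ℕ) {l : ℕ}
    (hl : 0 < l) :
    P.real {ω | l ≤ frontCount (ringsOf R 2 ω) dir x c w} ≤ w * r 2 / l := by
  have hr : 0 ≤ 1 - Real.exp (-r 2) := by
    rw [← h.real_eq (2, 0, 0)]; positivity
  have hm : Measurable fun ω => (frontCount (ringsOf R 2 ω) dir x c w : ℝ≥0∞) :=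
    (measurable_from_top (f := fun v : ℕ => (v : ℝ≥0∞))).comp
      (measurable_frontCount (fun c' i _ => h.measurable _) dir x)
  have h1 := meas_ge_le_lintegral_div hm.aemeasurable (μ := P)
    (show (l : ℝ≥0∞) ≠ 0 by exact_mod_cast hl.ne') (ENNReal.natCast_ne_top l)
  rw [h.lintegral_frontCount] at h1
  have hl' : (0 : ℝ) < l := by exact_mod_cast hl
  have h2 : P {ω | l ≤ frontCount (ringsOf R 2 ω) dir x c w} ≤
      ENNReal.ofReal (w * (1 - Real.exp (-r 2)) / l) := by
    rw [ENNReal.ofReal_div_of_pos hl', ENNReal.ofReal_mul (by positivity), ENNReal.ofReal_natCast,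
      ENNReal.ofReal_natCast]
    refine le_trans (measure_mono fun ω hω => ?_) h1
    simpa using hω
  refine (ENNReal.toReal_le_of_le_ofReal (by positivity) h2).trans ?_
  gcongr
  linarith [Real.add_one_le_exp (-r 2)]

/-- Each step multiplies the mean of `2⁻¹ ^ frontCount` by `1 - ρ / 2 ≤ exp (-(ρ / 2))`, where `ρ`
is the probability of a ring at the front. This exponential moment gives the lower tail of the
front. -/
lemma lintegral_two_pow_frontCount (h : RingModel P R r) (dir x : ℤ) (c w : ℕ) :
    ∫⁻ ω, (2⁻¹ : ℝ≥0∞) ^ frontCount (ringsOf R 2 ω) dir x c w ∂P ≤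
      ENNReal.ofReal (Real.exp (-(w * ((1 - Real.exp (-r 2)) / 2)))) := by
  classical
  have hr : 0 ≤ 1 - Real.exp (-r 2) := by
    rw [← h.real_eq (2, 0, 0)]; positivity
  set ρ := 1 - Real.exp (-r 2) with hρ
  have hρ1 : ρ ≤ 1 := by
    have := Real.exp_pos (-r 2)
    linarith
  have hm : ∀ w, Measurable fun ω => (2⁻¹ : ℝ≥0∞) ^ frontCount (ringsOf R 2 ω) dir x c w :=
    fun w => (measurable_from_top (f := fun v : ℕ => (2⁻¹ : ℝ≥0∞) ^ v)).comp
      (measurable_frontCount (fun c' i _ => h.measurable _) dir x)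
  have hfin : ∀ w, ∫⁻ ω, (2⁻¹ : ℝ≥0∞) ^ frontCount (ringsOf R 2 ω) dir x c w ∂P ≤ 1 := fun w =>
    (lintegral_mono (g := fun _ => 1) fun ω => pow_le_one₀ zero_le
      (ENNReal.inv_le_one.2 one_le_two)).trans (by simp)
  induction w with
  | zero => simp [frontCount]
  | succ w ih =>
    set E := {ω | ringsOf R 2 ω (c + w) (x + dir * frontCount (ringsOf R 2 ω) dir x c w)} with hEdef
    have h1 := h.lintegral_ring_at_front dir x 0 c w 2 fun v => (2⁻¹ : ℝ≥0∞) ^ v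
    simp only [add_zero] at h1
    have hE := h.measurableSet_ring_at_front dir x 0 c w 2
    simp only [add_zero] at hE
    rw [← hEdef, ← hρ] at h1
    rw [← hEdef] at hE
    set I := ∫⁻ ω, (2⁻¹ : ℝ≥0∞) ^ frontCount (ringsOf R 2 ω) dir x c w ∂P with hI
    have h2 : ∫⁻ ω, (2⁻¹ : ℝ≥0∞) ^ frontCount (ringsOf R 2 ω) dir x c (w + 1) ∂P =
        2⁻¹ * (ENNReal.ofReal ρ * I) +
        ∫⁻ ω in Eᶜ, (2⁻¹ : ℝ≥0∞) ^ frontCount (ringsOf R 2 ω) dir x c w ∂P := by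
      rw [← lintegral_add_compl _ hE, ← h1, ← lintegral_const_mul _ (hm w)]
      congr 1
      · refine setLIntegral_congr_fun hE fun ω hω => ?_
        simp only [frontCount]
        rw [if_pos (by exact hω), pow_succ, mul_comm]
      · refine setLIntegral_congr_fun hE.compl fun ω hω => ?_
        simp only [frontCount]
        rw [if_neg (by exact hω), add_zero]
    have h3 : I = ENNReal.ofReal ρ * I +
        ∫⁻ ω in Eᶜ, (2⁻¹ : ℝ≥0∞) ^ frontCount (ringsOf R 2 ω) dir x c w ∂P := by
      rw [← h1, hI, lintegral_add_compl _ hE]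
    have hItop : I ≠ ∞ := ne_top_of_le_ne_top ENNReal.one_ne_top (hfin w)
    set K := ∫⁻ ω in Eᶜ, (2⁻¹ : ℝ≥0∞) ^ frontCount (ringsOf R 2 ω) dir x c w ∂P with hK
    have hKtop : K ≠ ∞ := ne_top_of_le_ne_top hItop (h3 ▸ le_add_self)
    have h4 : (2⁻¹ * (ENNReal.ofReal ρ * I) + K).toReal = (1 - ρ / 2) * I.toReal := by
      have h5 := congrArg ENNReal.toReal h3
      rw [ENNReal.toReal_add (ENNReal.mul_ne_top ENNReal.ofReal_ne_top hItop) hKtop,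
        ENNReal.toReal_mul, ENNReal.toReal_ofReal hr] at h5
      rw [ENNReal.toReal_add (ENNReal.mul_ne_top (by simp)
        (ENNReal.mul_ne_top ENNReal.ofReal_ne_top hItop)) hKtop, ENNReal.toReal_mul,
        ENNReal.toReal_mul, ENNReal.toReal_ofReal hr]
      simp only [ENNReal.toReal_inv, ENNReal.toReal_ofNat]
      linarith
    rw [h2, ← ENNReal.ofReal_toReal (a := 2⁻¹ * (ENNReal.ofReal ρ * I) + K)
      (ENNReal.add_ne_top.2 ⟨ENNReal.mul_ne_top (by simp)
        (ENNReal.mul_ne_top ENNReal.ofReal_ne_top hItop), hKtop⟩), h4]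
    refine ENNReal.ofReal_le_ofReal ?_
    have h6 : I.toReal ≤ Real.exp (-(w * (ρ / 2))) :=
      ENNReal.toReal_le_of_le_ofReal (Real.exp_pos _).le ih
    push_cast
    rw [add_mul, one_mul, neg_add, Real.exp_add, mul_comm (Real.exp _)]
    refine mul_le_mul ?_ h6 ENNReal.toReal_nonneg (Real.exp_pos _).le
    linarith [Real.add_one_le_exp (-(ρ / 2))]

/-- Fronts do not move too slowly. -/
lemma real_frontCount_lt_le (h : RingModel P R r) (dir x : ℤ) (c w l : ℕ) :
    P.real {ω | frontCount (ringsOf R 2 ω) dir x c w < l} ≤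
      Real.exp (l - w * ((1 - Real.exp (-r 2)) / 2)) := by
  have hm : Measurable fun ω => (2⁻¹ : ℝ≥0∞) ^ frontCount (ringsOf R 2 ω) dir x c w :=
    (measurable_from_top (f := fun v : ℕ => (2⁻¹ : ℝ≥0∞) ^ v)).comp
      (measurable_frontCount (fun c' i _ => h.measurable _) dir x)
  -- Exponential Markov inequality: fewer than `l` steps means a power larger than `2⁻¹ ^ l`.
  -- Afterwards `2 ≤ e`.
  have h1 := mul_meas_ge_le_lintegral hm (μ := P) ((2⁻¹ : ℝ≥0∞) ^ l)
  have h2 : P.real {ω | (2⁻¹ : ℝ≥0∞) ^ l ≤ (2⁻¹ : ℝ≥0∞) ^ frontCount (ringsOf R 2 ω) dir x c w} ≤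
      2 ^ l * Real.exp (-(w * ((1 - Real.exp (-r 2)) / 2))) := by
    have h3 := h1.trans (h.lintegral_two_pow_frontCount dir x c w)
    have h4 := ENNReal.toReal_le_of_le_ofReal (Real.exp_pos _).le h3
    rw [ENNReal.toReal_mul, ENNReal.toReal_pow, ENNReal.toReal_inv, ENNReal.toReal_ofNat,
      inv_pow, inv_mul_le_iff₀ (by positivity)] at h4
    exact h4
  have h5 : (2 : ℝ) ^ l ≤ Real.exp l := by
    have : (2 : ℝ) ≤ Real.exp 1 := by linarith [Real.add_one_le_exp 1]
    calc (2 : ℝ) ^ l ≤ Real.exp 1 ^ l := by gcongr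
      _ = Real.exp l := by rw [← Real.exp_nat_mul, mul_one]
  calc P.real {ω | frontCount (ringsOf R 2 ω) dir x c w < l}
      ≤ P.real {ω | (2⁻¹ : ℝ≥0∞) ^ l ≤ (2⁻¹ : ℝ≥0∞) ^ frontCount (ringsOf R 2 ω) dir x c w} :=
        measureReal_mono fun ω hω =>
          pow_le_pow_of_le_one zero_le (ENNReal.inv_le_one.2 one_le_two) (le_of_lt hω)
    _ ≤ 2 ^ l * Real.exp (-(w * ((1 - Real.exp (-r 2)) / 2))) := h2
    _ ≤ Real.exp l * Real.exp (-(w * ((1 - Real.exp (-r 2)) / 2))) := by gcongr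
    _ = _ := by rw [← Real.exp_add]; rfl

/-- There is no seed next to a front for a short time. -/
lemma real_ring_near_front_le (h : RingModel P R r) (dir x o : ℤ) (c W : ℕ) (k : Fin 3) :
    P.real {ω | ∃ w < W, ringsOf R k ω (c + w)
      (x + dir * frontCount (ringsOf R 2 ω) dir x c w + o)} ≤ W * r k := by
  have hr : 0 ≤ 1 - Real.exp (-r k) := by
    rw [← h.real_eq (k, 0, 0)]; positivity
  have e : {ω | ∃ w < W, ringsOf R k ω (c + w)
      (x + dir * frontCount (ringsOf R 2 ω) dir x c w + o)} = ⋃ w ∈ Finset.range W,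
      {ω | ringsOf R k ω (c + w) (x + dir * frontCount (ringsOf R 2 ω) dir x c w + o)} := by
    ext ω; simp
  rw [e]
  refine (measureReal_biUnion_finset_le _ _).trans
    ((Finset.sum_le_sum (g := fun _ => r k) fun w _ => ?_).trans (by simp))
  have h1 := h.lintegral_ring_at_front dir x o c w k fun _ => 1
  rw [lintegral_one, lintegral_one, Measure.restrict_apply_univ, measure_univ, mul_one] at h1
  rw [measureReal_def, h1, ENNReal.toReal_ofReal hr]
  linarith [Real.add_one_le_exp (-r k)]

end RingModel

/-! ### Rings are typical with high probability -/

lemma frontCount_mono (Q : ℕ → ℤ → Prop) (dir x : ℤ) (c : ℕ) :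
    Monotone (frontCount Q dir x c) :=
  monotone_nat_of_le_succ fun w => by rw [frontCount]; exact Nat.le_add_right _ _

namespace RingModel

variable {Ω : Type*} [MeasurableSpace Ω] {P : Measure Ω} [IsProbabilityMeasure P]
  {R : Fin 3 × ℕ × ℤ → Set Ω} {r : Fin 3 → ℝ}

lemma nonneg (h : RingModel P R r) (k : Fin 3) : 0 ≤ r k :=
  measureReal_nonneg.trans (h.real_le (k, 0, 0))

/-- Only the last position of a front matters, by monotonicity. There are fewer than `2 * B`
starting points and two directions, and a crossing requires `D` steps, to which Markov's inequality
applies. -/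
lemma real_not_noCrossing_le (h : RingModel P R r) {B D K : ℕ} (hB : 0 < B) (hD : 0 < D) :
    P.real {ω | ¬NoCrossing ((B - 1 : ℤ) * D) D K (ringsOf R 2 ω)} ≤
      4 * B * (K * r 2 / D) := by
  have hsub : {ω | ¬NoCrossing ((B - 1 : ℤ) * D) D K (ringsOf R 2 ω)} ⊆
      ⋃ b ∈ Finset.Ioo (-B : ℤ) B,
        ({ω | D ≤ frontCount (ringsOf R 2 ω) 1 (b * D) 0 K} ∪
          {ω | D ≤ frontCount (ringsOf R 2 ω) (-1) (b * D) 0 K}) := by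
    intro ω hω
    simp only [NoCrossing, mem_ofPred_eq, not_forall] at hω
    obtain ⟨b, hb, w, hw, hcon⟩ := hω
    have hD' : (0 : ℤ) < D := by exact_mod_cast hD
    have hb' : |b| ≤ B - 1 := by
      rw [abs_mul, abs_of_pos hD'] at hb
      exact le_of_mul_le_mul_right hb hD'
    rw [abs_le] at hb'
    simp only [mem_iUnion, Finset.mem_Ioo]
    refine ⟨b, by omega, ?_⟩
    have m1 := frontCount_mono (ringsOf R 2 ω) 1 (b * D) 0 hw
    have m2 := frontCount_mono (ringsOf R 2 ω) (-1) (b * D) 0 hw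
    rw [front_eq, front_eq] at hcon
    simp only [mem_union, mem_ofPred_eq]
    by_contra hcon2
    exact hcon ⟨by omega, by omega⟩
  refine (measureReal_mono hsub (measure_ne_top _ _)).trans ((measureReal_biUnion_finset_le _ _).trans
    ((Finset.sum_le_sum (g := fun _ => 2 * (K * r 2 / D)) fun b _ => ?_).trans ?_))
  · refine (measureReal_union_le _ _).trans ?_
    rw [two_mul]
    exact add_le_add (h.real_frontCount_ge_le _ _ _ _ hD) (h.real_frontCount_ge_le _ _ _ _ hD)
  · rw [Finset.sum_const, nsmul_eq_mul, Int.card_Ioo]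
    have h1 : ((((B : ℤ) - -B - 1).toNat : ℕ) : ℝ) ≤ 2 * B := by
      have : (((B : ℤ) - -B - 1).toNat : ℕ) ≤ 2 * B := by omega
      exact_mod_cast this
    have h2 : 0 ≤ 2 * (K * r 2 / D) := by
      have := h.nonneg 2
      positivity
    calc _ ≤ 2 * B * (2 * (K * r 2 / D)) := by gcongr
      _ = _ := by ring

lemma real_not_seeded_le (h : RingModel P R r) (N : ℕ) (C : ℕ) :
    P.real {ω | ¬∀ i : ℤ, |i| ≤ N → ∃ c < C, ringsOf R 0 ω c i} ≤
      (2 * N + 1) * Real.exp (-(C * r 0)) := by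
  have h1 := h.real_exists_no_ring_le 0 (-N) (2 * N + 1) (Nat.zero_le C)
  push_cast at h1
  rw [sub_zero] at h1
  refine (measureReal_mono fun ω hω => ?_).trans h1
  simp only [mem_ofPred_eq, not_forall, not_exists, not_and] at hω ⊢
  obtain ⟨i, hi, hs⟩ := hω
  rw [abs_le] at hi
  exact ⟨i, hi.1, by omega, fun c _ hc => hs c hc⟩

lemma real_not_lateSites_le (h : RingModel P R r) (m K₀ D : ℕ) (i : ℤ) :
    P.real {ω | ¬LateSites m K₀ D (ringsOf R 0 ω) i} ≤
      2 * Real.exp (-(D * Real.exp (-(((m - 1) * K₀ : ℕ) * r 0)))) := by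
  have h1 := h.real_all_ring_le 0 (i + 1) D (Nat.zero_le ((m - 1) * K₀))
  have h2 := h.real_all_ring_le 0 (i - D) D (Nat.zero_le ((m - 1) * K₀))
  rw [Nat.cast_zero, sub_zero] at h1 h2
  rw [two_mul]
  refine (measureReal_mono fun ω hω => ?_).trans ((measureReal_union_le _ _).trans
    (add_le_add h1 h2))
  by_contra hcon
  simp only [mem_union, mem_ofPred_eq, not_or, not_forall] at hcon
  obtain ⟨⟨f, h3, h4, h5⟩, g, h6, h7, h8⟩ := hcon
  exact hω ⟨⟨f, by omega, by omega, fun c hc hS => h5 ⟨c, Nat.zero_le _, hc, hS⟩⟩,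
    g, h6, by omega, fun c hc hS => h8 ⟨c, Nat.zero_le _, hc, hS⟩⟩

/-- Two sites of a block differ by at most `D + 1`, and two steps of a time cell are determined by
one of them and a remainder modulo `K₀`. The bound counts such pairs, each with probability at most
`r 1 ^ 2`. -/
lemma real_not_simple_le (h : RingModel P R r) {n : ℤ} (hn : 0 < n) {m D : ℕ} (hm : 0 < m)
    (hnd : n < (D + 1) * m) (N J K₀ : ℕ) :
    P.real {ω | ¬∀ (i : ℤ) c (i' : ℤ) c', |i| ≤ N → |i'| ≤ N → c < J * K₀ → c' < J * K₀ →
      ringsOf R 1 ω c i → ringsOf R 1 ω c' i' → block n m i = block n m i' →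
      c / K₀ = c' / K₀ → i = i' ∧ c = c'} ≤
      (2 * N + 1) * (2 * D + 3) * (J * K₀) * K₀ * r 1 ^ 2 := by
  have hm' : (0 : ℤ) < m := by exact_mod_cast hm
  set s : Finset ((ℤ × ℤ) × ℕ × ℕ) :=
    (Finset.Icc (-N : ℤ) N ×ˢ Finset.Icc (-(D + 1) : ℤ) (D + 1)) ×ˢ
      (Finset.range (J * K₀) ×ˢ Finset.range K₀) with hs
  have hsub : {ω | ¬∀ (i : ℤ) c (i' : ℤ) c', |i| ≤ N → |i'| ≤ N → c < J * K₀ → c' < J * K₀ →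
      ringsOf R 1 ω c i → ringsOf R 1 ω c' i' → block n m i = block n m i' →
      c / K₀ = c' / K₀ → i = i' ∧ c = c'} ⊆
      ⋃ p ∈ s, {ω | (p.1.2 ≠ 0 ∨ p.2.1 / K₀ * K₀ + p.2.2 ≠ p.2.1) ∧
        ω ∈ R (1, p.2.1, p.1.1) ∧ ω ∈ R (1, p.2.1 / K₀ * K₀ + p.2.2, p.1.1 + p.1.2)} := by
    intro ω hω
    simp only [mem_ofPred_eq, not_forall] at hω
    obtain ⟨i, c, i', c', hi, hi', hc, hc', hM, hM', hb, hcc, hne⟩ := hω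
    have hK : 0 < K₀ := by
      rcases Nat.eq_zero_or_pos K₀ with h0 | h0
      · rw [h0, mul_zero] at hc; omega
      · exact h0
    obtain ⟨b1, b2⟩ := block_spec hn m i
    obtain ⟨b3, b4⟩ := block_spec hn m i'
    rw [hb] at b1 b2
    have e1 : (i' - i) * m < (D + 1 + 1) * m := by nlinarith
    have e2 : (i - i') * m < (D + 1 + 1) * m := by nlinarith
    have e1' := lt_of_mul_lt_mul_right e1 hm'.le
    have e2' := lt_of_mul_lt_mul_right e2 hm'.le
    rw [abs_le] at hi
    have hmod := Nat.div_add_mod' c' K₀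
    have hmod' := Nat.mod_lt c' hK
    simp only [mem_iUnion]
    refine ⟨((i, i' - i), (c, c' % K₀)), ?_, ?_, hM, ?_⟩
    · simp only [hs, Finset.mem_product, Finset.mem_Icc, Finset.mem_range]
      omega
    · simp only
      rw [hcc, hmod]
      by_contra hcon
      push Not at hcon
      exact hne ⟨by omega, hcon.2.symm⟩
    · simp only
      rw [hcc, hmod, add_sub_cancel]
      exact hM'
  refine (measureReal_mono hsub (measure_ne_top _ _)).trans ((measureReal_biUnion_finset_le _ _).trans
    ((Finset.sum_le_sum (g := fun _ => r 1 ^ 2) fun p _ => ?_).trans ?_))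
  · by_cases hp : p.1.2 ≠ 0 ∨ p.2.1 / K₀ * K₀ + p.2.2 ≠ p.2.1
    · have e : P.real (R (1, p.2.1, p.1.1) ∩ R (1, p.2.1 / K₀ * K₀ + p.2.2, p.1.1 + p.1.2)) =
          P.real (R (1, p.2.1, p.1.1)) * P.real (R (1, p.2.1 / K₀ * K₀ + p.2.2, p.1.1 + p.1.2)) := by
        refine h.measureReal_inter (A := {(1, p.2.1, p.1.1)})
          (A' := {(1, p.2.1 / K₀ * K₀ + p.2.2, p.1.1 + p.1.2)}) ?_
          (measurableSet_ringAlgebra rfl) (measurableSet_ringAlgebra rfl)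
        rw [disjoint_singleton]
        intro heq
        simp only [Prod.mk.injEq, true_and] at heq
        rcases hp with hp | hp
        · exact hp (by omega)
        · exact hp heq.1.symm
      refine (measureReal_mono fun ω hω => hω.2).trans (e.le.trans ?_)
      rw [sq]
      exact mul_le_mul (h.real_le _) (h.real_le _) measureReal_nonneg (h.nonneg 1)
    · have e : {ω | (p.1.2 ≠ 0 ∨ p.2.1 / K₀ * K₀ + p.2.2 ≠ p.2.1) ∧
        ω ∈ R (1, p.2.1, p.1.1) ∧ ω ∈ R (1, p.2.1 / K₀ * K₀ + p.2.2, p.1.1 + p.1.2)} = ∅ := by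
        ext ω
        simp only [mem_ofPred_eq, mem_empty_iff_false, iff_false]
        exact fun h => hp h.1
      rw [e, measureReal_empty]
      positivity
  · rw [Finset.sum_const, nsmul_eq_mul, hs]
    simp only [Finset.card_product, Int.card_Icc, Finset.card_range]
    refine le_of_eq ?_
    have e1 : ((((N : ℤ) + 1 - -N).toNat : ℕ) : ℝ) = 2 * N + 1 := by
      have : (((N : ℤ) + 1 - -N).toNat : ℕ) = 2 * N + 1 := by omega
      rw [this]; push_cast; ring
    have e2 : ((((D : ℤ) + 1 + 1 - -(D + 1)).toNat : ℕ) : ℝ) = 2 * D + 3 := by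
      have : (((D : ℤ) + 1 + 1 - -(D + 1)).toNat : ℕ) = 2 * D + 3 := by omega
      rw [this]; push_cast; ring
    push_cast [e1, e2]
    ring

/-- Union bound over the matches of a time cell. -/
lemma real_exists_match_le (h : RingModel P R r) (N j K₀ : ℕ) {Bad : ℕ → ℤ → Set Ω} {δ : ℝ}
    (hm : ∀ c i, MeasurableSet[ringAlgebra R {p | p.1 ≠ 1}] (Bad c i))
    (hδ : ∀ c i, P.real (Bad c i) ≤ δ) :
    P.real {ω | ∃ i c, |i| ≤ (N : ℤ) ∧ j * K₀ ≤ c ∧ c < (j + 1) * K₀ ∧ ringsOf R 1 ω c i ∧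
      ω ∈ Bad c i} ≤ (2 * N + 1) * K₀ * r 1 * δ := by
  have hsub : {ω | ∃ i c, |i| ≤ (N : ℤ) ∧ j * K₀ ≤ c ∧ c < (j + 1) * K₀ ∧ ringsOf R 1 ω c i ∧
      ω ∈ Bad c i} ⊆ ⋃ p ∈ Finset.Icc (-N : ℤ) N ×ˢ Finset.Ico (j * K₀) ((j + 1) * K₀),
        (R (1, p.2, p.1) ∩ Bad p.2 p.1) := by
    rintro ω ⟨i, c, h1, h2, h3, h4, h5⟩
    simp only [mem_iUnion]
    refine ⟨(i, c), ?_, h4, h5⟩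
    rw [abs_le] at h1
    simp only [Finset.mem_product, Finset.mem_Icc, Finset.mem_Ico]
    exact ⟨h1, h2, h3⟩
  refine (measureReal_mono hsub (measure_ne_top _ _)).trans ((measureReal_biUnion_finset_le _ _).trans
    ((Finset.sum_le_sum (g := fun _ => r 1 * δ) fun p _ => ?_).trans (le_of_eq ?_)))
  -- The bad event involves seeds and propagations only, so it is independent of the match that
  -- triggers it.
  · rw [h.measureReal_inter (A := {p | p.1 = 1}) (A' := {p | p.1 ≠ 1}) ?_
      (measurableSet_ringAlgebra rfl) (hm _ _)]
    · exact mul_le_mul (h.real_le _) (hδ _ _) measureReal_nonneg (h.nonneg 1)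
    · rw [Set.disjoint_left]; exact fun p h1 h2 => h2 h1
  · rw [Finset.sum_const, nsmul_eq_mul]
    simp only [Finset.card_product, Int.card_Icc, Nat.card_Ico]
    have e1 : ((((N : ℤ) + 1 - -N).toNat : ℕ) : ℝ) = 2 * N + 1 := by
      have : (((N : ℤ) + 1 - -N).toNat : ℕ) = 2 * N + 1 := by omega
      rw [this]; push_cast; ring
    have e2 : (j + 1) * K₀ - j * K₀ = K₀ := by rw [add_mul, one_mul, Nat.add_sub_cancel_left]
    rw [e2]
    push_cast [e1]
    ring

section Events

variable {A : Set (Fin 3 × ℕ × ℤ)}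

omit [MeasurableSpace Ω] in
lemma measurableSet_exists_no_ring {k : Fin 3} (hA : ∀ c i, (k, c, i) ∈ A) (i : ℤ) (l : ℕ)
    (c₁ c₂ : ℕ) :
    MeasurableSet[ringAlgebra R A]
      {ω | ∃ g, i ≤ g ∧ g < i + l ∧ ∀ c, c₁ ≤ c → c < c₂ → ¬ringsOf R k ω c g} := by
  have := (@measurableSet_all_ring Ω (ringAlgebra R A) R k i l
    (fun c g _ _ => measurableSet_ringAlgebra (hA c g)) c₁ c₂).compl
  convert this using 1
  ext ω
  simp

omit [MeasurableSpace Ω] in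
lemma measurableSet_all_ring' {k : Fin 3} (hA : ∀ c i, (k, c, i) ∈ A) (i : ℤ) (l : ℕ)
    (c₁ c₂ : ℕ) :
    MeasurableSet[ringAlgebra R A]
      {ω | ∀ g, i ≤ g → g < i + l → ∃ c, c₁ ≤ c ∧ c < c₂ ∧ ringsOf R k ω c g} :=
  @measurableSet_all_ring Ω (ringAlgebra R A) R k i l
    (fun c g _ _ => measurableSet_ringAlgebra (hA c g)) c₁ c₂

omit [MeasurableSpace Ω] in
lemma measurable_frontCount' (hA : ∀ c i, (2, c, i) ∈ A) (dir x : ℤ) (c w : ℕ) :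
    Measurable[ringAlgebra R A] fun ω => frontCount (ringsOf R 2 ω) dir x c w :=
  @measurable_frontCount Ω (ringAlgebra R A) R c w
    (fun c' i _ => measurableSet_ringAlgebra (hA c' i)) dir x

omit [MeasurableSpace Ω] in
lemma measurableSet_ring_near_front' {k : Fin 3} (hA : ∀ c i, (k, c, i) ∈ A)
    (hA2 : ∀ c i, (2, c, i) ∈ A) (dir x o : ℤ) (c W : ℕ) :
    MeasurableSet[ringAlgebra R A] {ω | ∃ w < W, ringsOf R k ω (c + w)
      (x + dir * frontCount (ringsOf R 2 ω) dir x c w + o)} := by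
  have : {ω | ∃ w < W, ringsOf R k ω (c + w)
      (x + dir * frontCount (ringsOf R 2 ω) dir x c w + o)} = ⋃ w ∈ Finset.range W, ⋃ v : ℕ,
      (fun ω => frontCount (ringsOf R 2 ω) dir x c w) ⁻¹' {v} ∩
        R (k, c + w, x + dir * v + o) := by
    ext ω
    simp [ringsOf]
  rw [this]
  refine @Finset.measurableSet_biUnion _ _ (ringAlgebra R A) _ _ fun w _ =>
    @MeasurableSet.iUnion _ _ (ringAlgebra R A) _ _ fun v => ?_
  exact @MeasurableSet.inter _ (ringAlgebra R A) _ _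
    (measurable_frontCount' hA2 dir x c w (measurableSet_singleton v))
    (measurableSet_ringAlgebra (hA _ _))

end Events

/-- Matches have a lasting effect if the reseeding of an interval takes longer. -/
lemma real_not_lasting_le_of_seeds (h : RingModel P R r) (N j K₀ l : ℕ) {C : ℕ}
    (hC : j * K₀ ≤ C) :
    P.real {ω | ¬∀ i c, |i| ≤ (N : ℤ) → j * K₀ ≤ c → c < (j + 1) * K₀ → ringsOf R 1 ω c i →
      LastingMatch l (ringsOf R 0 ω) (ringsOf R 2 ω) i c C} ≤
      (2 * N + 1) * K₀ * r 1 * ((l + 1) * Real.exp (-((j * K₀ : ℕ) * r 0)) +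
        Real.exp (-((l + 1) * Real.exp (-((C - (j * K₀ : ℕ)) * r 0))))) := by
  -- Both events refer to the beginning `j * K₀` of the time cell instead of the step of the match.
  -- This only enlarges them, and makes them independent of the step: some site is unseeded before
  -- the cell, or all sites are seeded between its beginning and `C`.
  set E₁ : ℤ → Set Ω := fun i =>
    {ω | ∃ g, i ≤ g ∧ g < i + (l + 1 : ℕ) ∧ ∀ c, 0 ≤ c → c < j * K₀ → ¬ringsOf R 0 ω c g}
  set E₂ : ℤ → Set Ω := fun i =>
    {ω | ∀ g, i ≤ g → g < i + (l + 1 : ℕ) → ∃ c, j * K₀ ≤ c ∧ c < C ∧ ringsOf R 0 ω c g}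
  refine (measureReal_mono (fun ω hω => ?_)).trans (h.real_exists_match_le N j K₀
    (Bad := fun _ i => E₁ i ∪ E₂ i) (fun c i => ?_) (fun c i => ?_))
  · simp only [mem_ofPred_eq, not_forall] at hω
    obtain ⟨i, c, h1, h2, h3, h4, h5⟩ := hω
    refine ⟨i, c, h1, h2, h3, h4, ?_⟩
    by_contra hcon
    simp only [E₁, E₂, mem_union, mem_ofPred_eq, not_or, not_exists, not_and, not_forall,
      not_not] at hcon
    obtain ⟨h6, g, h7, h8, h9⟩ := hcon
    refine h5 ⟨fun g hg1 hg2 => ?_, Or.inl ⟨g, h7, by push_cast at h8; omega,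
      fun c' hc1 hc2 => h9 c' (by omega) hc2⟩⟩
    obtain ⟨c', -, h10, h11⟩ := h6 g hg1 (by push_cast; omega)
    exact ⟨c', by omega, h11⟩
  · exact @MeasurableSet.union _ (ringAlgebra R _) _ _
      (measurableSet_exists_no_ring (fun c i => by simp) _ _ _ _)
      (measurableSet_all_ring' (fun c i => by simp) _ _ _ _)
  · refine (measureReal_union_le _ _).trans (add_le_add ?_ ?_)
    · have := h.real_exists_no_ring_le 0 i (l + 1) (Nat.zero_le (j * K₀))
      refine this.trans (le_of_eq ?_)
      rw [Nat.cast_zero, sub_zero]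
      push_cast
      ring
    · have := h.real_all_ring_le 0 i (l + 1) hC
      refine this.trans (le_of_eq ?_)
      push_cast
      ring_nf

/-- Matches have a lasting effect if the fronts do not cross an interval. -/
lemma real_not_lasting_le_of_front (h : RingModel P R r) (N j K₀ : ℕ) {l : ℕ} (hl : 0 < l)
    (C : ℕ) :
    P.real {ω | ¬∀ i c, |i| ≤ (N : ℤ) → j * K₀ ≤ c → c < (j + 1) * K₀ → ringsOf R 1 ω c i →
      LastingMatch l (ringsOf R 0 ω) (ringsOf R 2 ω) i c C} ≤
      (2 * N + 1) * K₀ * r 1 * ((l + 1) * Real.exp (-((j * K₀ : ℕ) * r 0)) + C * r 2 / l) := by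
  set E₁ : ℤ → Set Ω := fun i =>
    {ω | ∃ g, i ≤ g ∧ g < i + (l + 1 : ℕ) ∧ ∀ c, 0 ≤ c → c < j * K₀ → ¬ringsOf R 0 ω c g}
  set E₂ : ℕ → ℤ → Set Ω := fun c i =>
    {ω | l ≤ frontCount (ringsOf R 2 ω) 1 i (c + 1) C}
  refine (measureReal_mono (fun ω hω => ?_)).trans (h.real_exists_match_le N j K₀
    (Bad := fun c i => E₁ i ∪ E₂ c i) (fun c i => ?_) (fun c i => ?_))
  · simp only [mem_ofPred_eq, not_forall] at hω
    obtain ⟨i, c, h1, h2, h3, h4, h5⟩ := hω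
    refine ⟨i, c, h1, h2, h3, h4, ?_⟩
    by_contra hcon
    simp only [E₁, E₂, mem_union, mem_ofPred_eq, not_or, not_exists, not_and, not_forall,
      not_not, not_le] at hcon
    obtain ⟨h6, h7⟩ := hcon
    refine h5 ⟨fun g hg1 hg2 => ?_, Or.inr fun w hw => ?_⟩
    · obtain ⟨c', -, h10, h11⟩ := h6 g hg1 (by push_cast; omega)
      exact ⟨c', by omega, h11⟩
    · have := frontCount_mono (ringsOf R 2 ω) 1 i (c + 1) (show w ≤ C by omega)
      rw [front_eq]
      omega
  · exact @MeasurableSet.union _ (ringAlgebra R _) _ _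
      (measurableSet_exists_no_ring (fun c i => by simp) _ _ _ _)
      (measurable_frontCount' (fun c i => by simp) _ _ _ _ (measurableSet_Ici (a := l)))
  · refine (measureReal_union_le _ _).trans (add_le_add ?_ ?_)
    · have := h.real_exists_no_ring_le 0 i (l + 1) (Nat.zero_le (j * K₀))
      refine this.trans (le_of_eq ?_)
      rw [Nat.cast_zero, sub_zero]
      push_cast
      ring
    · exact h.real_frontCount_ge_le _ _ _ _ hl

/-- Matches have a brief effect if the fire is quickly extinguished. -/
lemma real_not_brief_le (h : RingModel P R r) (N j K₀ L W : ℕ) {C' C : ℕ}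
    (hW : (j + 1) * K₀ + W ≤ C') (hC : C' ≤ C) :
    P.real {ω | ¬∀ i c, |i| ≤ (N : ℤ) → j * K₀ ≤ c → c < (j + 1) * K₀ → ringsOf R 1 ω c i →
      BriefMatch L W (ringsOf R 0 ω) (ringsOf R 2 ω) i c C} ≤
      (2 * N + 1) * K₀ * r 1 * (2 * Real.exp (-(L * Real.exp (-(C' * r 0)))) +
        2 * Real.exp (L - W * ((1 - Real.exp (-r 2)) / 2)) + 2 * (W * r 0) +
        (2 * L + 1) * Real.exp (-((C - C' : ℝ) * r 0))) := by
  -- The four obstacles to a brief effect: no unseeded barrier on one side up to `C'`; a front with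
  -- fewer than `L` steps; a seed just behind a front; a site not reseeded between `C'` and `C`.
  set E₁ : ℤ → Set Ω := fun i =>
    {ω | ∀ g, i ≤ g → g < i + L → ∃ c, 0 ≤ c ∧ c < C' ∧ ringsOf R 0 ω c g}
  set E₃ : ℤ → ℕ → ℤ → Set Ω := fun dir c i =>
    {ω | frontCount (ringsOf R 2 ω) dir i (c + 1) W < L}
  set E₅ : ℤ → ℕ → ℤ → Set Ω := fun dir c i =>
    {ω | ∃ w < W, ringsOf R 0 ω (c + 1 + w)
      (i + dir * frontCount (ringsOf R 2 ω) dir i (c + 1) w + -dir)}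
  set E₇ : ℤ → Set Ω := fun i =>
    {ω | ∃ g, i ≤ g ∧ g < i + (2 * L + 1 : ℕ) ∧ ∀ c, C' ≤ c → c < C → ¬ringsOf R 0 ω c g}
  refine (measureReal_mono (fun ω hω => ?_)).trans (h.real_exists_match_le N j K₀
    (Bad := fun c i => (((E₁ (i - L) ∪ E₁ (i + 1)) ∪ (E₃ 1 c i ∪ E₃ (-1) c i)) ∪
      (E₅ 1 c i ∪ E₅ (-1) c i)) ∪ E₇ (i - L)) (fun c i => ?_) (fun c i => ?_))
  · simp only [mem_ofPred_eq, not_forall] at hω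
    obtain ⟨i, c, h1, h2, h3, h4, h5⟩ := hω
    refine ⟨i, c, h1, h2, h3, h4, ?_⟩
    by_contra hcon
    simp only [E₁, E₃, E₅, E₇, mem_union, mem_ofPred_eq, not_or, not_exists, not_and, not_forall,
      not_not, not_lt] at hcon
    obtain ⟨⟨⟨⟨⟨bl, b1, b2, b3⟩, br, b4, b5, b6⟩, f1, f2⟩, s1, s2⟩, h7⟩ := hcon
    refine h5 ⟨⟨bl, b1, by omega, fun c' hc' => b3 c' (Nat.zero_le _) (by omega), ?_⟩,
      ⟨br, by omega, by omega, fun c' hc' => b6 c' (Nat.zero_le _) (by omega), ?_⟩,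
      fun w hw => ?_, fun w hw => ?_, fun g hg1 hg2 => ?_⟩
    · rw [front_eq]; omega
    · rw [front_eq]; omega
    · rw [front_eq]; exact s1 w hw
    · rw [front_eq]; simpa using s2 w hw
    · obtain ⟨c', h8, h9, h10⟩ := h7 g hg1 (by push_cast; omega)
      exact ⟨c', by omega, h9, h10⟩
  · have u : ∀ {s t : Set Ω}, MeasurableSet[ringAlgebra R {p | p.1 ≠ 1}] s →
        MeasurableSet[ringAlgebra R {p | p.1 ≠ 1}] t →
        MeasurableSet[ringAlgebra R {p | p.1 ≠ 1}] (s ∪ t) :=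
      fun h1 h2 => @MeasurableSet.union _ (ringAlgebra R _) _ _ h1 h2
    refine u (u (u (u ?_ ?_) (u ?_ ?_)) (u ?_ ?_)) ?_
    · exact measurableSet_all_ring' (fun c i => by simp) _ _ _ _
    · exact measurableSet_all_ring' (fun c i => by simp) _ _ _ _
    · exact measurable_frontCount' (fun c i => by simp) _ _ _ _ (measurableSet_Iio (a := L))
    · exact measurable_frontCount' (fun c i => by simp) _ _ _ _ (measurableSet_Iio (a := L))
    · exact measurableSet_ring_near_front' (fun c i => by simp) (fun c i => by simp) _ _ _ _ _
    · exact measurableSet_ring_near_front' (fun c i => by simp) (fun c i => by simp) _ _ _ _ _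
    · exact measurableSet_exists_no_ring (fun c i => by simp) _ _ _ _
  · have h1 : ∀ i, P.real (E₁ i) ≤ Real.exp (-(L * Real.exp (-(C' * r 0)))) := fun i => by
      have := h.real_all_ring_le 0 i L (Nat.zero_le C')
      rwa [Nat.cast_zero, sub_zero] at this
    have h3 : ∀ dir, P.real (E₃ dir c i) ≤ Real.exp (L - W * ((1 - Real.exp (-r 2)) / 2)) :=
      fun dir => h.real_frontCount_lt_le dir i (c + 1) W L
    have h5 : ∀ dir, P.real (E₅ dir c i) ≤ W * r 0 :=
      fun dir => h.real_ring_near_front_le dir i (-dir) (c + 1) W 0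
    have h7 : P.real (E₇ (i - L)) ≤ (2 * L + 1) * Real.exp (-((C - C' : ℝ) * r 0)) := by
      have := h.real_exists_no_ring_le 0 (i - L) (2 * L + 1) hC
      refine this.trans (le_of_eq ?_)
      push_cast
      ring
    refine (measureReal_union_le _ _).trans (add_le_add ((measureReal_union_le _ _).trans
      (add_le_add ((measureReal_union_le _ _).trans (add_le_add
        ((measureReal_union_le _ _).trans ?_) ((measureReal_union_le _ _).trans ?_)))
        ((measureReal_union_le _ _).trans ?_))) h7)
    · rw [two_mul]; exact add_le_add (h1 _) (h1 _)
    · rw [two_mul]; exact add_le_add (h3 _) (h3 _)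
    · rw [two_mul]; exact add_le_add (h5 _) (h5 _)

end RingModel

/-- Matches of the time cell `j` are lasting until the end of the time cell `k`, with high
probability: `τ` is the length of a time cell and `ρ` the rate of the fronts. -/
def LastingBound (τ ρ : ℝ) (D k j : ℕ) (δ : ℝ) : Prop :=
  ∃ l : ℕ, l ≤ D ∧
    ((j ≤ k ∧ (l + 1) * Real.exp (-(j * τ)) +
        Real.exp (-((l + 1) * Real.exp (-((k + 1 - j) * τ)))) ≤ δ) ∨
      (0 < l ∧ (l + 1) * Real.exp (-(j * τ)) + (k + 1) * (τ * ρ) / l ≤ δ))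

/-- Matches of the time cell `j` have been repaired before the time cell `k`, with high
probability: a time cell of length `τ` has `K₀` steps, and `ρ` is the rate of the fronts. -/
def BriefBound (τ ρ : ℝ) (D K₀ k j : ℕ) (δ : ℝ) : Prop :=
  ∃ L W : ℕ, L ≤ D ∧ (j + 1) * K₀ + W ≤ k * K₀ ∧
    2 * Real.exp (-(L * Real.exp (-(((j + 1) * K₀ + W : ℕ) * (τ / K₀))))) +
      2 * Real.exp (L - W * ((1 - Real.exp (-(ρ * (τ / K₀)))) / 2)) + 2 * (W * (τ / K₀)) +
      (2 * L + 1) * Real.exp (-(((k * K₀ : ℕ) - ((j + 1) * K₀ + W : ℕ) : ℝ) * (τ / K₀))) ≤ δ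

namespace RingModel

variable {Ω : Type*} [MeasurableSpace Ω] {P : Measure Ω} [IsProbabilityMeasure P]
  {R : Fin 3 × ℕ × ℤ → Set Ω}

open Classical in
-- The factor `(2 * N + 1) * (μ * τ)` bounds the mean number of matches in a time cell. It
-- multiplies the probability `δ` that a given match misbehaves, for each of the `J * J` pairs of
-- time cells and for lasting as well as brief matches. The bound no longer involves `K₀`.
lemma real_not_typicalRings_le {τ μ ρ : ℝ} {z₀ : ℝ} {m J K₀ D N B : ℕ} {n : ℤ} {δ : ℝ}
    (h : RingModel P R ![τ / K₀, μ * (τ / K₀), ρ * (τ / K₀)]) (hm : 0 < m) (hK : 0 < K₀)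
    (hD : 0 < D) (hB : 0 < B) (hn : 0 < n) (hnd : n < (D + 1) * m) (hN : (N : ℤ) = (B - 1) * D)
    (hδ : 0 ≤ δ) (hμ : 0 ≤ μ * τ)
    (hl : ∀ k < J, ∀ j, Active z₀ m k j → LastingBound τ ρ D k j δ)
    (hb : ∀ k < J, ∀ j, 2 * (j + 1) < k → (j : ℝ) + 1 < z₀ * m → BriefBound τ ρ D K₀ k j δ) :
    P.real {ω | ¬TypicalRings z₀ m J K₀ n D N (ringsOf R 0 ω) (ringsOf R 1 ω) (ringsOf R 2 ω)} ≤
      4 * B * (J * (τ * ρ) / D) + (2 * N + 1) * (2 * D + 3) * J * (μ * τ) ^ 2 +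
      (2 * N + 1) * Real.exp (-(m * τ)) + 2 * (J * J * ((2 * N + 1) * (μ * τ) * δ)) := by
  have hK' : (0 : ℝ) < K₀ := by exact_mod_cast hK
  have hK1 : (K₀ : ℝ) * (τ / K₀) = τ := mul_div_cancel₀ _ hK'.ne'
  set L : ℕ × ℕ → Set Ω := fun p => {ω | Active z₀ m p.1 p.2 ∧
    ¬∃ l : ℤ, 0 ≤ l ∧ l ≤ D ∧ ∀ i c, |i| ≤ (N : ℤ) → p.2 * K₀ ≤ c → c < (p.2 + 1) * K₀ →
      ringsOf R 1 ω c i → LastingMatch l (ringsOf R 0 ω) (ringsOf R 2 ω) i c ((p.1 + 1) * K₀)}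
    with hLdef
  set F : ℕ × ℕ → Set Ω := fun p => {ω | (2 * (p.2 + 1) < p.1 ∧ (p.2 : ℝ) + 1 < z₀ * m) ∧
    ¬∃ (l : ℤ) (W : ℕ), l ≤ D ∧ (p.2 + 1) * K₀ + W ≤ p.1 * K₀ ∧
      ∀ i c, |i| ≤ (N : ℤ) → p.2 * K₀ ≤ c → c < (p.2 + 1) * K₀ →
      ringsOf R 1 ω c i → BriefMatch l W (ringsOf R 0 ω) (ringsOf R 2 ω) i c (p.1 * K₀)}
    with hFdef
  have hfac : (2 * N + 1 : ℝ) * K₀ * (μ * (τ / K₀)) = (2 * N + 1) * (μ * τ) := by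
    rw [show (2 * N + 1 : ℝ) * K₀ * (μ * (τ / K₀)) = (2 * N + 1) * (μ * (K₀ * (τ / K₀))) by ring,
      hK1]
  have hfac0 : 0 ≤ (2 * N + 1 : ℝ) * (μ * τ) := by positivity
  have hL : ∀ p ∈ Finset.range J ×ˢ Finset.range J,
      P.real (L p) ≤ (2 * N + 1) * (μ * τ) * δ := by
    rintro ⟨k, j⟩ hp
    simp only [Finset.mem_product, Finset.mem_range] at hp
    by_cases hA : Active z₀ m k j
    swap
    · rw [hLdef]
      simp only [hA, false_and, ofPred_false, measureReal_empty]
      positivity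
    obtain ⟨l, hlD, hl'⟩ := hl k hp.1 j hA
    have sub : ∀ {ω}, ω ∈ L (k, j) → ¬∀ i c, |i| ≤ (N : ℤ) → j * K₀ ≤ c → c < (j + 1) * K₀ →
        ringsOf R 1 ω c i → LastingMatch l (ringsOf R 0 ω) (ringsOf R 2 ω) i c ((k + 1) * K₀) :=
      fun hω hcon => hω.2 ⟨l, by positivity, by exact_mod_cast hlD, hcon⟩
    have hj : ((j * K₀ : ℕ) : ℝ) * (τ / K₀) = j * τ := by
      push_cast
      rw [mul_assoc, hK1]
    rcases hl' with ⟨hjk, h1⟩ | ⟨hl0, h1⟩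
    · refine (measureReal_mono (fun ω hω => sub hω)).trans
        ((h.real_not_lasting_le_of_seeds N j K₀ l (C := (k + 1) * K₀)
        (Nat.mul_le_mul_right _ (by omega))).trans ?_)
      simp only [Matrix.cons_val_zero, Matrix.cons_val_one]
      rw [hfac, hj]
      refine mul_le_mul_of_nonneg_left (le_trans (le_of_eq ?_) h1) hfac0
      congr 5
      push_cast
      rw [← sub_mul, mul_assoc, hK1]
    · refine (measureReal_mono (fun ω hω => sub hω)).trans
        ((h.real_not_lasting_le_of_front N j K₀ hl0 ((k + 1) * K₀)).trans ?_)
      simp only [Matrix.cons_val_zero, Matrix.cons_val_one, Matrix.cons_val]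
      rw [hfac, hj]
      refine mul_le_mul_of_nonneg_left (le_trans (le_of_eq ?_) h1) hfac0
      congr 2
      push_cast
      rw [show ((k : ℝ) + 1) * K₀ * (ρ * (τ / K₀)) = (k + 1) * (K₀ * (τ / K₀) * ρ) by ring, hK1]
  have hF : ∀ p ∈ Finset.range J ×ˢ Finset.range J,
      P.real (F p) ≤ (2 * N + 1) * (μ * τ) * δ := by
    rintro ⟨k, j⟩ hp
    simp only [Finset.mem_product, Finset.mem_range] at hp
    by_cases hA : 2 * (j + 1) < k ∧ (j : ℝ) + 1 < z₀ * m
    swap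
    · rw [hFdef]
      simp only [hA, false_and, ofPred_false, measureReal_empty]
      positivity
    obtain ⟨l, W, hlD, hW, h1⟩ := hb k hp.1 j hA.1 hA.2
    refine (measureReal_mono (fun ω hω => ?_)).trans
        ((h.real_not_brief_le N j K₀ l W le_rfl hW).trans ?_)
    · exact fun hcon => hω.2 ⟨l, W, by exact_mod_cast hlD, hW, hcon⟩
    · simp only [Matrix.cons_val_zero, Matrix.cons_val_one, Matrix.cons_val]
      rw [hfac]
      exact mul_le_mul_of_nonneg_left h1 hfac0
  have hcross := h.real_not_noCrossing_le (K := J * K₀) hB hD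
  have hsimple := h.real_not_simple_le hn hm hnd N J K₀
  have hseed := h.real_not_seeded_le N (m * K₀)
  simp only [Matrix.cons_val_zero, Matrix.cons_val_one, Matrix.cons_val] at hcross hsimple hseed
  have hunion : ∀ G : ℕ × ℕ → Set Ω, (∀ p ∈ Finset.range J ×ˢ Finset.range J,
      P.real (G p) ≤ (2 * N + 1) * (μ * τ) * δ) →
      P.real (⋃ p ∈ Finset.range J ×ˢ Finset.range J, G p) ≤
        J * J * ((2 * N + 1) * (μ * τ) * δ) := by
    intro G hG
    refine (measureReal_biUnion_finset_le _ _).trans ((Finset.sum_le_sum hG).trans ?_)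
    rw [Finset.sum_const, nsmul_eq_mul]
    simp
  refine (measureReal_mono (s₂ := ((({ω | ¬NoCrossing ((B - 1 : ℤ) * D) D (J * K₀)
    (ringsOf R 2 ω)} ∪ _) ∪ _) ∪ ((⋃ p ∈ Finset.range J ×ˢ Finset.range J, L p) ∪
      ⋃ p ∈ Finset.range J ×ˢ Finset.range J, F p))) (fun ω hω => ?_) (measure_ne_top _ _)).trans
    ((measureReal_union_le _ _).trans (add_le_add ((measureReal_union_le _ _).trans (add_le_add
      ((measureReal_union_le _ _).trans (add_le_add (hcross.trans (le_of_eq ?_))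
        (hsimple.trans (le_of_eq ?_)))) (hseed.trans (le_of_eq ?_))))
      ((measureReal_union_le _ _).trans ((add_le_add (hunion L hL) (hunion F hF)).trans
        (le_of_eq (two_mul _).symm)))))
  · by_contra hcon
    simp only [mem_union, mem_iUnion, not_or, not_exists, mem_ofPred_eq, not_not, hLdef, hFdef,
      Finset.mem_product, Finset.mem_range, not_and, and_imp, Prod.forall, not_forall] at hcon
    obtain ⟨⟨⟨h1, h2⟩, h3⟩, h4, h5⟩ := hcon
    refine hω ⟨by rw [hN]; exact h1, fun i c i' c' a1 a2 a3 a4 a5 a6 a7 a8 => by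
      obtain ⟨e1, e2⟩ := h2 i c i' c' a1 a2 a3 a4 a5 a6 a7 a8
      exact ⟨e1, e2⟩, fun k j hmk hk hA i c hi hc1 hc2 hM => ?_,
      fun k j hk hjk hjz i c hi hc1 hc2 hM => ?_, fun i hi => by
      obtain ⟨c, e1, e2⟩ := h3 i hi
      exact ⟨c, e1, e2⟩⟩
    · obtain ⟨l, hl0, hlD, hL'⟩ := h4 k j hk (by have := hA.1; omega) hA
      exact ⟨l, hl0, hlD, hL' i c hi hc1 hc2 hM⟩
    · obtain ⟨l, W, hlD, hW, hB'⟩ := h5 k j hk (by omega) hjk hjz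
      exact ⟨l, W, hlD, by omega, hB' i c hi hc1 hc2 hM⟩
  · push_cast
    rw [show (J : ℝ) * K₀ * (ρ * (τ / K₀)) = J * (K₀ * (τ / K₀) * ρ) by ring, hK1]
  · rw [show (2 * N + 1 : ℝ) * (2 * D + 3) * (J * K₀) * K₀ * (μ * (τ / K₀)) ^ 2 =
      (2 * N + 1) * (2 * D + 3) * J * (μ * (K₀ * (τ / K₀))) ^ 2 by ring, hK1]
  · push_cast
    rw [mul_assoc (m : ℝ), hK1]

end RingModel

/-! ### Asymptotics in the slow regime -/

lemma aScale_pos (p : Params) : 0 < aScale p.lam := by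
  unfold aScale
  exact Real.log_pos ((one_lt_div p.lam_pos).2 p.lam_lt_one)

lemma lam_eq_exp (p : Params) : p.lam = Real.exp (-aScale p.lam) := by
  unfold aScale
  rw [one_div, Real.log_inv, neg_neg, Real.exp_log p.lam_pos]

section Regime

variable {z₀ : ℝ}

lemma tendsto_lam : Tendsto (fun p : Params => p.lam) (slowRegime z₀) (𝓝 0) :=
  tendsto_comap.mono_left (inf_le_left.trans inf_le_left)

lemma tendsto_aScale : Tendsto (fun p : Params => aScale p.lam) (slowRegime z₀) atTop := by
  have h1 : Tendsto (fun p : Params => p.lam) (slowRegime z₀) (𝓝[>] 0) :=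
    tendsto_nhdsWithin_iff.2 ⟨tendsto_lam, Eventually.of_forall fun p => p.lam_pos⟩
  refine (tendsto_neg_atBot_atTop.comp (Real.tendsto_log_nhdsGT_zero.comp h1)).congr fun p => ?_
  simp [aScale]

lemma tendsto_exp_mul_aScale {c : ℝ} (hc : 0 < c) :
    Tendsto (fun p : Params => Real.exp (c * aScale p.lam)) (slowRegime z₀) atTop :=
  Real.tendsto_exp_atTop.comp (tendsto_aScale.const_mul_atTop hc)

lemma tendsto_exp_neg_mul_aScale {c : ℝ} (hc : 0 < c) :
    Tendsto (fun p : Params => Real.exp (-(c * aScale p.lam))) (slowRegime z₀) (𝓝 0) :=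
  Real.tendsto_exp_neg_atTop_nhds_zero.comp (tendsto_aScale.const_mul_atTop hc)

lemma tendsto_aScale_mul_exp {c : ℝ} (hc : 0 < c) :
    Tendsto (fun p : Params => aScale p.lam * Real.exp (-(c * aScale p.lam))) (slowRegime z₀)
      (𝓝 0) := by
  have h := ((Real.tendsto_pow_mul_exp_neg_atTop_nhds_zero 1).comp
    ((tendsto_aScale (z₀ := z₀)).const_mul_atTop hc)).const_mul (1 / c)
  rw [mul_zero] at h
  refine h.congr fun p => ?_
  simp only [Function.comp, pow_one]
  field_simp

lemma tendsto_lam_mul_aScale :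
    Tendsto (fun p : Params => p.lam * aScale p.lam) (slowRegime z₀) (𝓝 0) := by
  refine (tendsto_aScale_mul_exp (z₀ := z₀) one_pos).congr fun p => ?_
  rw [one_mul, ← lam_eq_exp, mul_comm]

lemma tendsto_log_pi :
    Tendsto (fun p : Params => Real.log p.pi / aScale p.lam) (slowRegime z₀) (𝓝 z₀) :=
  tendsto_comap.mono_left inf_le_right

lemma eventually_pi_le {c : ℝ} (hc : z₀ < c) :
    ∀ᶠ p in slowRegime z₀, p.pi ≤ Real.exp (c * aScale p.lam) := by
  filter_upwards [tendsto_log_pi.eventually_le_const hc] with p hp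
  rw [div_le_iff₀ (aScale_pos p)] at hp
  rwa [← Real.log_le_iff_le_exp (by linarith [p.one_le_pi])]

lemma eventually_le_pi {c : ℝ} (hc : c < z₀) :
    ∀ᶠ p in slowRegime z₀, Real.exp (c * aScale p.lam) ≤ p.pi := by
  filter_upwards [tendsto_log_pi.eventually_const_le hc] with p hp
  rw [le_div_iff₀ (aScale_pos p)] at hp
  rwa [← Real.le_log_iff_exp_le (by linarith [p.one_le_pi])]

lemma tendsto_nScale_mul : Tendsto (fun p : Params => (nScale p.lam : ℝ) * (p.lam * aScale p.lam))
    (slowRegime z₀) (𝓝 1) := by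
  have h := (tendsto_const_nhds (x := (1 : ℝ))).sub (tendsto_lam_mul_aScale (z₀ := z₀))
  rw [sub_zero] at h
  refine tendsto_of_tendsto_of_tendsto_of_le_of_le h tendsto_const_nhds (fun p => ?_) fun p => ?_
  · have h0 : 0 < p.lam * aScale p.lam := mul_pos p.lam_pos (aScale_pos p)
    have h1 := (Int.lt_floor_add_one (1 / (p.lam * aScale p.lam))).le
    rw [div_le_iff₀ h0] at h1
    simp only [nScale]
    linarith
  · have h0 : 0 < p.lam * aScale p.lam := mul_pos p.lam_pos (aScale_pos p)
    have h1 := Int.floor_le (1 / (p.lam * aScale p.lam))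
    rw [le_div_iff₀ h0] at h1
    exact h1

lemma nScale_nonneg (p : Params) : 0 ≤ nScale p.lam := by
  unfold nScale
  have h0 : 0 < p.lam * aScale p.lam := mul_pos p.lam_pos (aScale_pos p)
  exact Int.floor_nonneg.2 (by positivity)

/-- The number of sites in a block of length `1 / m`. -/
def blockSize (m : ℕ) (p : Params) : ℕ := (nScale p.lam / m).toNat

lemma blockSize_spec {m : ℕ} (hm : 0 < m) (p : Params) :
    (blockSize m p : ℤ) * m ≤ nScale p.lam ∧ nScale p.lam < ((blockSize m p : ℤ) + 1) * m := by
  have hm' : (0 : ℤ) < m := by exact_mod_cast hm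
  have e : (blockSize m p : ℤ) = nScale p.lam / m :=
    Int.toNat_of_nonneg (Int.ediv_nonneg (nScale_nonneg p) hm'.le)
  rw [e]
  exact ⟨Int.ediv_mul_le _ hm'.ne', Int.lt_ediv_add_one_mul_self _ hm'⟩

variable {m : ℕ}

lemma tendsto_blockSize_mul (hm : 0 < m) :
    Tendsto (fun p : Params => (blockSize m p : ℝ) * (p.lam * aScale p.lam)) (slowRegime z₀)
      (𝓝 (1 / m)) := by
  have hm' : (0 : ℝ) < m := by exact_mod_cast hm
  have h1 := (tendsto_nScale_mul (z₀ := z₀)).div_const (m : ℝ)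
  have h2 := h1.sub (tendsto_lam_mul_aScale (z₀ := z₀))
  rw [sub_zero] at h2
  refine tendsto_of_tendsto_of_tendsto_of_le_of_le h2 h1 (fun p => ?_) fun p => ?_
  · have h0 : 0 < p.lam * aScale p.lam := mul_pos p.lam_pos (aScale_pos p)
    have h3 : (nScale p.lam : ℝ) ≤ (blockSize m p + 1) * m := by
      exact_mod_cast (blockSize_spec hm p).2.le
    have h4 := mul_le_mul_of_nonneg_right h3 h0.le
    simp only
    rw [sub_le_iff_le_add, div_le_iff₀ hm']
    linarith
  · have h0 : 0 < p.lam * aScale p.lam := mul_pos p.lam_pos (aScale_pos p)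
    have h3 : (blockSize m p : ℝ) * m ≤ nScale p.lam := by
      exact_mod_cast (blockSize_spec hm p).1
    have h4 := mul_le_mul_of_nonneg_right h3 h0.le
    simp only
    rw [le_div_iff₀ hm']
    linarith

lemma tendsto_blockSize_mul_lam (hm : 0 < m) :
    Tendsto (fun p : Params => (blockSize m p : ℝ) * p.lam) (slowRegime z₀) (𝓝 0) := by
  have h := (tendsto_blockSize_mul (z₀ := z₀) hm).mul
    (tendsto_inv_atTop_zero.comp (tendsto_aScale (z₀ := z₀)))
  rw [mul_zero] at h
  refine h.congr fun p => ?_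
  have := (aScale_pos p).ne'
  simp only [Function.comp]
  field_simp

/-- A block has about `1 / (m * λ * a)` sites, more than any power `λ ^ (-γ)` with `γ < 1`. -/
lemma tendsto_exp_div_blockSize (hm : 0 < m) {γ : ℝ} (hγ : γ < 1) :
    Tendsto (fun p : Params => Real.exp (γ * aScale p.lam) / blockSize m p) (slowRegime z₀)
      (𝓝 0) := by
  have hm' : (0 : ℝ) < m := by exact_mod_cast hm
  have h := (tendsto_aScale_mul_exp (z₀ := z₀) (sub_pos.2 hγ)).div (tendsto_blockSize_mul hm)
    (by positivity)
  rw [zero_div] at h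
  refine h.congr fun p => ?_
  have h0 : p.lam * aScale p.lam ≠ 0 := (mul_pos p.lam_pos (aScale_pos p)).ne'
  simp only [Pi.div_apply]
  rw [← mul_div_mul_right (Real.exp (γ * aScale p.lam)) _ h0]
  congr 1
  rw [show -((1 - γ) * aScale p.lam) = γ * aScale p.lam + -aScale p.lam by ring, Real.exp_add,
    ← lam_eq_exp]
  ring

lemma eventually_blockSize_pos (hm : 0 < m) : ∀ᶠ p in slowRegime z₀, 0 < blockSize m p := by
  have hm' : (0 : ℝ) < m := by exact_mod_cast hm
  filter_upwards [(tendsto_blockSize_mul (z₀ := z₀) hm).eventually_const_lt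
    (show (0 : ℝ) < 1 / m by positivity)] with p hp
  rcases Nat.eq_zero_or_pos (blockSize m p) with h | h
  · rw [h, Nat.cast_zero, zero_mul] at hp
    exact absurd hp (lt_irrefl _)
  · exact h

lemma eventually_exp_le_blockSize (hm : 0 < m) {γ : ℝ} (hγ : γ < 1) :
    ∀ᶠ p in slowRegime z₀, Real.exp (γ * aScale p.lam) ≤ blockSize m p := by
  filter_upwards [(tendsto_exp_div_blockSize (z₀ := z₀) hm hγ).eventually_le_const one_pos,
    eventually_blockSize_pos hm] with p h1 h2
  have h2' : (0 : ℝ) < blockSize m p := by exact_mod_cast h2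
  rwa [div_le_one h2'] at h1

lemma tendsto_blockSize (hm : 0 < m) :
    Tendsto (fun p : Params => (blockSize m p : ℝ)) (slowRegime z₀) atTop :=
  tendsto_atTop_mono' _ (eventually_exp_le_blockSize hm (by norm_num : (1 / 2 : ℝ) < 1))
    (tendsto_exp_mul_aScale (by norm_num))

/-- Here the condition `n / (a π) → ∞` of the slow regime enters: in a unit of rescaled time a front
covers a negligible part of a block. -/
lemma tendsto_front_div_blockSize (hm : 0 < m) :
    Tendsto (fun p : Params => aScale p.lam * p.pi / blockSize m p) (slowRegime z₀) (𝓝 0) := by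
  have hm' : (0 : ℝ) < m := by exact_mod_cast hm
  have h1 : Tendsto (fun p : Params => ((nScale p.lam : ℝ) / (aScale p.lam * p.pi))⁻¹)
      (slowRegime z₀) (𝓝 0) :=
    tendsto_inv_atTop_zero.comp (tendsto_comap.mono_left (inf_le_left.trans inf_le_right))
  have h2 := h1.mul ((tendsto_nScale_mul (z₀ := z₀)).div (tendsto_blockSize_mul hm)
    (by positivity))
  rw [zero_mul] at h2
  refine h2.congr' ?_
  filter_upwards [tendsto_nScale_mul.eventually_const_lt one_half_lt_one,
    eventually_blockSize_pos hm] with p h3 h4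
  have h0 : p.lam * aScale p.lam ≠ 0 := (mul_pos p.lam_pos (aScale_pos p)).ne'
  have h5 : (nScale p.lam : ℝ) ≠ 0 := fun h => by rw [h] at h3; norm_num at h3
  have h4' : (blockSize m p : ℝ) ≠ 0 := by exact_mod_cast h4.ne'
  simp only [Pi.div_apply]
  rw [mul_div_mul_right _ _ h0, inv_div]
  field_simp

lemma eventually_nScale_pos : ∀ᶠ p in slowRegime z₀, 0 < nScale p.lam := by
  filter_upwards [(tendsto_nScale_mul (z₀ := z₀)).eventually_const_lt one_half_lt_one] with p h3
  refine lt_of_le_of_ne (nScale_nonneg p) fun h => ?_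
  rw [← h] at h3
  norm_num at h3

/-- The stretch around the match has `λ ^ (-γ)` sites, where `γ` is below the time `j / m` of the
match, so that the stretch is full. For a match before `z₀`, `γ` must exceed the time elapsed since
the match, so that some site is not reseeded; for a match after `z₀`, `γ > z₀` makes the stretch too
long for the fronts. For `j ≥ m` a whole block is used. -/
lemma eventually_lastingBound (hz : z₀ ∈ Icc (0 : ℝ) 1) (hm : 0 < m) {k j : ℕ}
    (hA : Active z₀ m k j) {δ : ℝ} (hδ : 0 < δ) :
    ∀ᶠ p in slowRegime z₀,
      LastingBound (aScale p.lam / m) p.pi (blockSize m p) k j δ := by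
  have hm' : (0 : ℝ) < m := by exact_mod_cast hm
  have hexp1 : ∀ (γ : ℝ) (p : Params), 0 ≤ γ → 1 ≤ Real.exp (γ * aScale p.lam) := fun γ p h =>
    Real.one_le_exp (mul_nonneg h (aScale_pos p).le)
  have hfloor : ∀ (γ : ℝ) (p : Params), γ < j / m → 0 ≤ γ →
      ((⌊Real.exp (γ * aScale p.lam)⌋₊ : ℝ) + 1) * Real.exp (-(j * (aScale p.lam / m))) ≤
        2 * Real.exp (-((j / m - γ) * aScale p.lam)) := by
    intro γ p h1 h2
    have h3 := Nat.floor_le (Real.exp_pos (γ * aScale p.lam)).le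
    have h4 := hexp1 γ p h2
    calc _ ≤ (2 * Real.exp (γ * aScale p.lam)) * Real.exp (-(j * (aScale p.lam / m))) := by
          gcongr
          linarith
      _ = _ := by
          rw [mul_assoc, ← Real.exp_add]
          congr 2
          ring
  obtain ⟨hjk, ⟨h1, h2⟩ | h1⟩ := hA
  -- Half of the current time: since `k + 1 < 2 * j`, it lies strictly between the elapsed time `(k
  -- + 1 - j) / m` and `j / m`.
  · set γ : ℝ := (k + 1) / (2 * m) with hγ
    have hγ0 : 0 ≤ γ := by positivity
    have h1' : ((k : ℝ) + 1) < 2 * j := by exact_mod_cast h1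
    have hγj : γ < j / m := by
      rw [hγ, div_lt_div_iff₀ (by positivity) hm']
      linarith [mul_lt_mul_of_pos_right h1' hm']
    have hγ1 : γ < 1 := by
      refine hγj.trans_le ?_
      rw [div_le_one hm']
      linarith [mul_le_mul_of_nonneg_right hz.2 hm'.le]
    have hγ2 : 0 < γ - (k + 1 - j) / m := by
      rw [hγ, sub_pos, div_lt_div_iff₀ hm' (by positivity)]
      linarith [mul_lt_mul_of_pos_right h1' hm']
    have hlim : Tendsto (fun p : Params => 2 * Real.exp (-((j / m - γ) * aScale p.lam)) +
        Real.exp (-Real.exp ((γ - (k + 1 - j) / m) * aScale p.lam))) (slowRegime z₀)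
        (𝓝 (2 * 0 + 0)) :=
      ((tendsto_exp_neg_mul_aScale (sub_pos.2 hγj)).const_mul 2).add
        (Real.tendsto_exp_neg_atTop_nhds_zero.comp (tendsto_exp_mul_aScale hγ2))
    rw [mul_zero, add_zero] at hlim
    filter_upwards [hlim.eventually_le_const hδ, eventually_exp_le_blockSize hm hγ1] with p h3 h4
    refine ⟨⌊Real.exp (γ * aScale p.lam)⌋₊, Nat.floor_le_of_le h4, Or.inl ⟨by omega, ?_⟩⟩
    refine le_trans (add_le_add (hfloor γ p hγj hγ0) ?_) h3
    rw [Real.exp_le_exp, neg_le_neg_iff]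
    calc _ = Real.exp (γ * aScale p.lam) * Real.exp (-((k + 1 - j) * (aScale p.lam / m))) := by
          rw [← Real.exp_add]; congr 1; ring
      _ ≤ _ := by gcongr; exact (Nat.lt_floor_add_one _).le
  · have h1' : z₀ < j / m := by rwa [lt_div_iff₀ hm']
    rcases lt_or_ge (j : ℝ) m with hjm | hjm
    -- Then `z₀ < c < γ < j / m` and `π ≤ λ ^ (-c)` eventually, so a front makes far fewer than `λ ^
    -- (-γ)` steps.
    · set γ : ℝ := (z₀ + j / m) / 2 with hγ
      have hγ0 : 0 ≤ γ := by have := hz.1; positivity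
      have hγj : γ < j / m := by rw [hγ]; linarith
      have hγ1 : γ < 1 := hγj.trans ((div_lt_one hm').2 hjm)
      have hzγ : z₀ < γ := by rw [hγ]; linarith
      set c : ℝ := (z₀ + γ) / 2 with hc
      have hzc : z₀ < c := by rw [hc]; linarith
      have hcγ : c < γ := by rw [hc]; linarith
      have hlim : Tendsto (fun p : Params => 2 * Real.exp (-((j / m - γ) * aScale p.lam)) +
          2 * (k + 1) / m * (aScale p.lam * Real.exp (-((γ - c) * aScale p.lam))))
          (slowRegime z₀) (𝓝 (2 * 0 + 2 * (k + 1) / m * 0)) :=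
        ((tendsto_exp_neg_mul_aScale (sub_pos.2 hγj)).const_mul 2).add
          ((tendsto_aScale_mul_exp (sub_pos.2 hcγ)).const_mul _)
      rw [mul_zero, mul_zero, add_zero] at hlim
      filter_upwards [hlim.eventually_le_const hδ, eventually_exp_le_blockSize hm hγ1,
        eventually_pi_le hzc] with p h3 h4 h5
      have ha := aScale_pos p
      have hl1 : 1 ≤ ⌊Real.exp (γ * aScale p.lam)⌋₊ := Nat.one_le_floor_iff _ |>.2 (hexp1 γ p hγ0)
      have hl2 : Real.exp (γ * aScale p.lam) / 2 ≤ ⌊Real.exp (γ * aScale p.lam)⌋₊ := by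
        have := Nat.lt_floor_add_one (Real.exp (γ * aScale p.lam))
        have h6 : (1 : ℝ) ≤ ⌊Real.exp (γ * aScale p.lam)⌋₊ := by exact_mod_cast hl1
        linarith
      refine ⟨⌊Real.exp (γ * aScale p.lam)⌋₊, Nat.floor_le_of_le h4, Or.inr ⟨hl1, ?_⟩⟩
      refine le_trans (add_le_add (hfloor γ p hγj hγ0) ?_) h3
      calc _ ≤ (k + 1) * (aScale p.lam / m * Real.exp (c * aScale p.lam)) /
            (Real.exp (γ * aScale p.lam) / 2) := by gcongr
        _ = _ := by
            rw [show -((γ - c) * aScale p.lam) = c * aScale p.lam - γ * aScale p.lam by ring,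
              Real.exp_sub]
            field_simp
    -- After time `1` the whole block is seeded, since its expected number of unseeded sites is at
    -- most about `blockSize * λ`, and no front crosses it.
    · have hlim : Tendsto (fun p : Params => (blockSize m p * p.lam + p.lam) +
          (k + 1) / m * (aScale p.lam * p.pi / blockSize m p)) (slowRegime z₀)
          (𝓝 ((0 + 0) + (k + 1) / m * 0)) :=
        ((tendsto_blockSize_mul_lam hm).add tendsto_lam).add
          ((tendsto_front_div_blockSize hm).const_mul _)
      rw [mul_zero, add_zero, add_zero] at hlim
      filter_upwards [hlim.eventually_le_const hδ, eventually_blockSize_pos hm] with p h3 h4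
      refine ⟨blockSize m p, le_rfl, Or.inr ⟨h4, le_trans (add_le_add ?_ (le_of_eq ?_)) h3⟩⟩
      · rw [← add_one_mul]
        gcongr
        nth_rewrite 2 [lam_eq_exp p]
        rw [Real.exp_le_exp, neg_le_neg_iff, ← mul_div_assoc, le_div_iff₀ hm', mul_comm]
        exact mul_le_mul_of_nonneg_right hjm (aScale_pos p).le
      · field_simp

/-- Let `u` be the end of the time cell of the match. Among `L = λ ^ (-(u + e))` sites on either
side there is still a vacant barrier. As `π` is larger than `L` by a power of `1 / λ`, the fire
reaches the barriers in a time of order `λ ^ e`, too short for a seed to fall just behind a front.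
The remaining time exceeds `u + e`, enough to reseed the stretch. -/
lemma eventually_briefBound (hz : z₀ ∈ Icc (0 : ℝ) 1) (hm : 0 < m) {k j : ℕ}
    (hk : 2 * (j + 1) < k) (hj : (j : ℝ) + 1 < z₀ * m) {δ : ℝ} (hδ : 0 < δ) :
    ∀ᶠ p in slowRegime z₀, ∀ K₀ : ℕ, 0 < K₀ → aScale p.lam / m / K₀ ≤ p.lam →
      p.pi * (aScale p.lam / m / K₀) ≤ 1 →
      BriefBound (aScale p.lam / m) p.pi (blockSize m p) K₀ k j δ := by
  have hm' : (0 : ℝ) < m := by exact_mod_cast hm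
  set u : ℝ := (j + 1) / m with hu
  have hu0 : 0 < u := by positivity
  have huz : u < z₀ := by rwa [hu, div_lt_iff₀ hm']
  -- The first bound gives `u + 5 / 2 * e < z₀`, so that `π ≥ λ ^ (-(u + 5 / 2 * e))`; the second
  -- gives `e < 1 / m`, the spare time left by `2 * (j + 1) < k`.
  set e : ℝ := min ((z₀ - u) / 3) (1 / (2 * m)) with he
  have he0 : 0 < e := lt_min (by linarith) (by positivity)
  have he1 : e ≤ (z₀ - u) / 3 := min_le_left _ _
  have he2 : e ≤ 1 / (2 * m) := min_le_right _ _
  have he3 : 0 < 1 / m - e := by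
    have : (1 : ℝ) / m = 2 * (1 / (2 * m)) := by field_simp
    have h2 : (0 : ℝ) < 1 / (2 * m) := by positivity
    linarith
  have hz1 := hz.2
  have hlim : Tendsto (fun p : Params =>
      2 * Real.exp (-(Real.exp (-2) / 2 * Real.exp (e * aScale p.lam))) +
      2 * Real.exp (-(1 / 8 * Real.exp ((u + 3 / 2 * e) * aScale p.lam))) +
      4 * Real.exp (-(e * aScale p.lam)) +
      3 * Real.exp 2 * Real.exp (-((1 / m - e) * aScale p.lam))) (slowRegime z₀)
      (𝓝 (2 * 0 + 2 * 0 + 4 * 0 + 3 * Real.exp 2 * 0)) := by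
    refine ((Tendsto.add ?_ ?_).add ?_).add ?_
    · exact (Real.tendsto_exp_neg_atTop_nhds_zero.comp
        ((tendsto_exp_mul_aScale he0).const_mul_atTop (by positivity))).const_mul 2
    · exact (Real.tendsto_exp_neg_atTop_nhds_zero.comp
        ((tendsto_exp_mul_aScale (by positivity)).const_mul_atTop (by positivity))).const_mul 2
    · exact (tendsto_exp_neg_mul_aScale he0).const_mul 4
    · exact (tendsto_exp_neg_mul_aScale he3).const_mul _
  simp only [mul_zero, add_zero] at hlim
  filter_upwards [hlim.eventually_le_const hδ,
    eventually_exp_le_blockSize hm (show u + e < 1 by linarith),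
    eventually_le_pi (show u + 5 / 2 * e < z₀ by linarith),
    tendsto_aScale.eventually_ge_atTop (2 * (m : ℝ)),
    (tendsto_exp_neg_mul_aScale (z₀ := z₀) (half_pos he0)).eventually_le_const
      (show (0 : ℝ) < 1 / 8 by norm_num)] with p h1 h2 h3 h4 h5 K₀ hK hh1 hh2
  have ha := aScale_pos p
  have hK' : (0 : ℝ) < K₀ := by exact_mod_cast hK
  set a := aScale p.lam with hadef
  set h : ℝ := a / m / K₀ with hh
  have hh0 : 0 < h := by positivity
  have hKh : (K₀ : ℝ) * h = a / m := mul_div_cancel₀ _ hK'.ne'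
  set θ : ℝ := Real.exp (-(e * a)) with hθ
  have hθ1 : θ ≤ 1 := by
    rw [hθ, Real.exp_le_one_iff, neg_nonpos]
    positivity
  have hhθ : h ≤ θ := by
    refine hh1.trans ?_
    rw [lam_eq_exp p, hθ, Real.exp_le_exp, neg_le_neg_iff]
    have : e ≤ 1 := by linarith
    calc e * a ≤ 1 * a := by gcongr
      _ = a := one_mul a
  -- `W` steps of length `h` last between `θ` and `2 * θ`, where `θ = λ ^ e`; rounding costs one
  -- step, and `h ≤ λ ≤ θ`.
  set W : ℕ := ⌈θ / h⌉₊ with hW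
  have hW1 : θ ≤ W * h := by
    rw [← div_le_iff₀ hh0]
    exact Nat.le_ceil _
  have hW2 : W * h ≤ 2 * θ := by
    have h6 := (Nat.ceil_lt_add_one (show 0 ≤ θ / h by positivity)).le
    calc W * h ≤ (θ / h + 1) * h := by gcongr
      _ = θ + h := by field_simp
      _ ≤ 2 * θ := by linarith
  have hWK : W ≤ K₀ := by
    have h6 : (W : ℝ) * h ≤ K₀ * h := by
      rw [hKh, le_div_iff₀ hm']
      calc W * h * m ≤ 2 * θ * m := by gcongr
        _ ≤ 2 * 1 * m := by gcongr
        _ ≤ a := by linarith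
    exact_mod_cast le_of_mul_le_mul_right h6 hh0
  set L : ℕ := ⌊Real.exp ((u + e) * a)⌋₊ with hL
  have hE1 : 1 ≤ Real.exp ((u + e) * a) := Real.one_le_exp (by positivity)
  have hL1 : (L : ℝ) ≤ Real.exp ((u + e) * a) := Nat.floor_le (Real.exp_pos _).le
  have hL2 : Real.exp ((u + e) * a) / 2 ≤ L := by
    have h6 := Nat.lt_floor_add_one (Real.exp ((u + e) * a))
    have h7 : (1 : ℝ) ≤ L := by exact_mod_cast (Nat.one_le_floor_iff _ |>.2 hE1)
    linarith
  have hC : (((j + 1) * K₀ + W : ℕ) : ℝ) * h ≤ u * a + 2 := by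
    push_cast
    rw [add_mul, mul_assoc, hKh]
    have : ((j : ℝ) + 1) * (a / m) = u * a := by rw [hu]; ring
    linarith
  refine ⟨L, W, Nat.floor_le_of_le h2, ?_, le_trans (add_le_add (add_le_add (add_le_add ?_ ?_) ?_)
    ?_) h1⟩
  · calc (j + 1) * K₀ + W ≤ (j + 1) * K₀ + K₀ := by omega
      _ = (j + 2) * K₀ := by ring
      _ ≤ k * K₀ := Nat.mul_le_mul_right _ (by omega)
  · refine mul_le_mul_of_nonneg_left ?_ two_pos.le
    rw [Real.exp_le_exp, neg_le_neg_iff]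
    calc Real.exp (-2) / 2 * Real.exp (e * a)
        = Real.exp ((u + e) * a) / 2 * Real.exp (-(u * a + 2)) := by
          rw [div_mul_eq_mul_div, div_mul_eq_mul_div, ← Real.exp_add, ← Real.exp_add]
          congr 2
          ring
      _ ≤ L * Real.exp (-((((j + 1) * K₀ + W : ℕ) : ℝ) * h)) := by gcongr
  · refine mul_le_mul_of_nonneg_left ?_ two_pos.le
    rw [Real.exp_le_exp]
    have hpi : 0 ≤ p.pi := by linarith [p.one_le_pi]
    have hx0 : 0 ≤ p.pi * h := mul_nonneg hpi hh0.le
    have hx : p.pi * h / 2 ≤ 1 - Real.exp (-(p.pi * h)) := by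
      have h6 := Real.exp_bound_div_one_sub_of_interval hx0
      have h7 : Real.exp (-(p.pi * h)) ≤ 1 / (1 + p.pi * h) := by
        rw [Real.exp_neg, ← one_div]
        gcongr
        linarith [Real.add_one_le_exp (p.pi * h)]
      have h8 : 1 / (1 + p.pi * h) ≤ 1 - p.pi * h / 2 := by
        rw [div_le_iff₀ (by positivity)]
        linarith [mul_nonneg hx0 (sub_nonneg.2 hh2)]
      linarith
    -- In a time `θ` the mean number of propagations is of order `π * θ ≥ λ ^ (-(u + 3 / 2 * e))`,
    -- which beats `L` by the factor `λ ^ (-e / 2)`.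
    have h6 : Real.exp ((u + 3 / 2 * e) * a) / 4 ≤
        W * ((1 - Real.exp (-(p.pi * h))) / 2) := by
      calc Real.exp ((u + 3 / 2 * e) * a) / 4 = Real.exp ((u + 5 / 2 * e) * a) * θ / 4 := by
            rw [hθ, ← Real.exp_add]
            congr 2
            ring
        _ ≤ p.pi * (W * h) / 4 := by gcongr
        _ = W * ((p.pi * h / 2) / 2) := by ring
        _ ≤ _ := by gcongr
    have h7 : Real.exp ((u + e) * a) ≤ Real.exp ((u + 3 / 2 * e) * a) * (1 / 8) := by
      calc Real.exp ((u + e) * a) = Real.exp ((u + 3 / 2 * e) * a) * Real.exp (-(e / 2 * a)) := by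
            rw [← Real.exp_add]
            congr 1
            ring
        _ ≤ _ := by gcongr
    linarith
  · linarith
  -- From `k ≥ 2 * (j + 1) + 1`, a rescaled time `u + 1 / m` remains after the cell of the match.
  -- The constant `2` bounds the duration of the fire, and becomes the factor `exp 2`.
  · have h6 : ((u + 1 / m) * a - 2) ≤
        (((k * K₀ : ℕ) : ℝ) - ((j + 1) * K₀ + W : ℕ)) * h := by
      have h7 : ((k * K₀ : ℕ) : ℝ) * h = k * (a / m) := by
        push_cast
        rw [mul_assoc, hKh]
      rw [sub_mul, h7]
      have h8 : 2 * ((j : ℝ) + 1) + 1 ≤ k := by exact_mod_cast hk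
      have h9 : (u + 1 / m) * a + u * a ≤ k * (a / m) := by
        calc (u + 1 / m) * a + u * a = (2 * ((j : ℝ) + 1) + 1) * (a / m) := by
              rw [hu]; ring
          _ ≤ _ := by gcongr
      linarith
    calc (2 * (L : ℝ) + 1) *
          Real.exp (-((((k * K₀ : ℕ) : ℝ) - ((j + 1) * K₀ + W : ℕ)) * h))
        ≤ (3 * Real.exp ((u + e) * a)) * Real.exp (-((u + 1 / m) * a - 2)) := by
          gcongr
          linarith
      _ = _ := by
          rw [mul_assoc, ← Real.exp_add, mul_assoc, ← Real.exp_add]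
          congr 2
          ring

end Regime

universe u

/-- In the slow regime the rings are typical with high probability. -/
lemma eventually_typicalRings {z₀ : ℝ} (hz : z₀ ∈ Icc (0 : ℝ) 1) {m A T : ℕ} (hm : 0 < m)
    (hA : 0 < A) {ε : ℝ} (hε : 0 < ε) :
    ∀ᶠ p in slowRegime z₀, ∀ K₀ : ℕ, 0 < K₀ → aScale p.lam / m / K₀ ≤ p.lam →
      p.pi * (aScale p.lam / m / K₀) ≤ 1 →
      ∀ {Ω : Type u} [MeasurableSpace Ω] (P : Measure Ω) [IsProbabilityMeasure P]
        (R : Fin 3 × ℕ × ℤ → Set Ω),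
        RingModel P R ![aScale p.lam / m / K₀, p.lam * (aScale p.lam / m / K₀),
          p.pi * (aScale p.lam / m / K₀)] →
        P.real {ω | ¬TypicalRings z₀ m (T * m) K₀ (nScale p.lam) (blockSize m p)
          (((A * m - 1) * blockSize m p : ℕ) : ℤ) (ringsOf R 0 ω) (ringsOf R 1 ω)
          (ringsOf R 2 ω)} ≤ 4 * A * T / m ^ 2 + ε ∧
        ∀ i, P.real {ω | ¬LateSites m K₀ (blockSize m p) (ringsOf R 0 ω) i} ≤ ε := by
  have hm' : (0 : ℝ) < m := by exact_mod_cast hm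
  have hA' : (0 : ℝ) < A := by exact_mod_cast hA
  set J : ℕ := T * m with hJ
  -- The mean number of matches in a time cell is eventually at most `2 * A + 1`, so the misbehaving
  -- matches cost at most `2 * J * J * (2 * A + 1) * δ ≤ ε / 2`.
  set δ : ℝ := ε / (4 * J * J * (2 * A + 1) + 1) with hδ
  have hδ0 : 0 < δ := by positivity
  have hl : ∀ᶠ p in slowRegime z₀, ∀ k ∈ Finset.range J, ∀ j ∈ Finset.range J, Active z₀ m k j →
      LastingBound (aScale p.lam / m) p.pi (blockSize m p) k j δ := by
    refine (Filter.eventually_all_finset _).2 fun k _ => (Filter.eventually_all_finset _).2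
      fun j _ => ?_
    by_cases h : Active z₀ m k j
    · filter_upwards [eventually_lastingBound hz hm h hδ0] with p hp _ using hp
    · exact Eventually.of_forall fun p hp => absurd hp h
  have hb : ∀ᶠ p in slowRegime z₀, ∀ k ∈ Finset.range J, ∀ j ∈ Finset.range J,
      2 * (j + 1) < k → (j : ℝ) + 1 < z₀ * m → ∀ K₀ : ℕ, 0 < K₀ →
      aScale p.lam / m / K₀ ≤ p.lam → p.pi * (aScale p.lam / m / K₀) ≤ 1 →
      BriefBound (aScale p.lam / m) p.pi (blockSize m p) K₀ k j δ := by
    refine (Filter.eventually_all_finset _).2 fun k _ => (Filter.eventually_all_finset _).2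
      fun j _ => ?_
    by_cases h : 2 * (j + 1) < k ∧ (j : ℝ) + 1 < z₀ * m
    · filter_upwards [eventually_briefBound hz hm h.1 h.2 hδ0] with p hp _ _ using hp
    · exact Eventually.of_forall fun p h1 h2 => absurd ⟨h1, h2⟩ h
  have hD := tendsto_blockSize_mul (z₀ := z₀) hm
  have hla := tendsto_lam_mul_aScale (z₀ := z₀)
  have hlim1 : Tendsto (fun p : Params =>
      4 * (A * m) * J / m * (aScale p.lam * p.pi / blockSize m p) +
      (2 * A * (blockSize m p * (p.lam * aScale p.lam)) + p.lam * aScale p.lam / m) *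
      (2 * (blockSize m p * (p.lam * aScale p.lam)) / m + 3 * (p.lam * aScale p.lam) / m) * J +
      (2 * (A * m) * (blockSize m p * p.lam) + p.lam)) (slowRegime z₀)
      (𝓝 (4 * (A * m) * J / m * 0 + (2 * A * (1 / m) + 0 / m) * (2 * (1 / m) / m + 3 * 0 / m) * J +
      (2 * (A * m) * 0 + 0))) :=
    ((((tendsto_front_div_blockSize hm).const_mul _)).add ((((hD.const_mul _).add
      (hla.div_const _)).mul (((hD.const_mul _).div_const _).add
        ((hla.const_mul _).div_const _))).mul_const _)).add
      (((tendsto_blockSize_mul_lam hm).const_mul _).add tendsto_lam)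
  -- One term survives: the probability of two matches in the same cell has a positive limit for
  -- fixed `m`. It is only of order `1 / m ^ 2` and disappears when `m` is chosen large.
  have hval : 4 * (A * m) * J / m * 0 + (2 * A * (1 / m) + 0 / m) *
      (2 * (1 / m) / m + 3 * 0 / m) * J + (2 * (A * m) * 0 + 0) = 4 * A * T / (m : ℝ) ^ 2 := by
    rw [hJ]
    push_cast
    field_simp
    ring
  rw [hval] at hlim1
  have hlim2 : Tendsto (fun p : Params =>
      2 * A * (blockSize m p * (p.lam * aScale p.lam)) + p.lam * aScale p.lam / m)
      (slowRegime z₀) (𝓝 (2 * A * (1 / m) + 0 / m)) :=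
    (hD.const_mul _).add (hla.div_const _)
  have hval2 : 2 * A * (1 / m) + 0 / m < 2 * (A : ℝ) + 1 := by
    have : (1 : ℝ) ≤ m := by exact_mod_cast hm
    rw [zero_div, add_zero, mul_one_div, div_lt_iff₀ hm']
    nlinarith
  -- At rescaled time `γ` a site is unseeded with probability `λ ^ γ`. A block has more than `λ ^
  -- (-(1 + γ) / 2)` sites, hence many unseeded ones on each side.
  set γ : ℝ := (m - 1) / m with hγ
  have hγ1 : γ < 1 := by rw [hγ, div_lt_one hm']; linarith
  have hlim3 : Tendsto (fun p : Params =>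
      2 * Real.exp (-Real.exp (((1 - γ) / 2) * aScale p.lam))) (slowRegime z₀) (𝓝 (2 * 0)) :=
    (Real.tendsto_exp_neg_atTop_nhds_zero.comp
      (tendsto_exp_mul_aScale (by linarith))).const_mul 2
  rw [mul_zero] at hlim3
  filter_upwards [hl, hb, hlim1.eventually_le_const (show 4 * A * T / (m : ℝ) ^ 2 <
    4 * A * T / m ^ 2 + ε / 2 by linarith), hlim2.eventually_le_const hval2,
    hlim3.eventually_le_const hε, eventually_blockSize_pos hm, eventually_nScale_pos,
    eventually_exp_le_blockSize hm (show (1 + γ) / 2 < 1 by linarith)]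
    with p hl hb h1 h2 h3 hD0 hn hDe K₀ hK hh1 hh2 Ω _ P _ R hR
  have ha := aScale_pos p
  have hlam := p.lam_pos
  have hK' : (0 : ℝ) < K₀ := by exact_mod_cast hK
  have hD0' : (0 : ℝ) < blockSize m p := by exact_mod_cast hD0
  have hAm : 1 ≤ A * m := Nat.mul_pos hA hm
  set N : ℕ := (A * m - 1) * blockSize m p with hN
  constructor
  · refine (hR.real_not_typicalRings_le (z₀ := z₀) (J := J) (N := N) (B := A * m) (δ := δ) hm hK hD0
      (by positivity) hn (blockSize_spec hm p).2 ?_ hδ0.le (by positivity) ?_ ?_).trans ?_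
    · rw [hN]
      push_cast [Nat.cast_sub hAm]
      ring
    · intro k hk j hA
      exact hl k (Finset.mem_range.2 hk) j (Finset.mem_range.2 (by have := hA.1; omega)) hA
    · intro k hk j h4 h5
      exact hb k (Finset.mem_range.2 hk) j (Finset.mem_range.2 (by omega)) h4 h5 K₀ hK hh1 hh2
    · have hNle : (N : ℝ) ≤ A * m * blockSize m p := by
        have : N ≤ A * m * blockSize m p := Nat.mul_le_mul_right _ (Nat.sub_le _ _)
        exact_mod_cast this
      have e1 : 4 * ((A * m : ℕ) : ℝ) * (J * (aScale p.lam / m * p.pi) / blockSize m p) =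
          4 * (A * m) * J / m * (aScale p.lam * p.pi / blockSize m p) := by
        push_cast
        field_simp
      have e3 : Real.exp (-(m * (aScale p.lam / m))) = p.lam := by
        rw [mul_div_cancel₀ _ hm'.ne', ← lam_eq_exp]
      have e4 : (2 * N + 1 : ℝ) * (p.lam * (aScale p.lam / m)) ≤
          2 * A * (blockSize m p * (p.lam * aScale p.lam)) + p.lam * aScale p.lam / m := by
        calc (2 * N + 1 : ℝ) * (p.lam * (aScale p.lam / m)) ≤
            (2 * (A * m * blockSize m p) + 1) * (p.lam * (aScale p.lam / m)) := by gcongr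
          _ = _ := by field_simp
      have e2 : (2 * N + 1 : ℝ) * (2 * blockSize m p + 3) * J *
          (p.lam * (aScale p.lam / m)) ^ 2 ≤
          (2 * A * (blockSize m p * (p.lam * aScale p.lam)) + p.lam * aScale p.lam / m) *
          (2 * (blockSize m p * (p.lam * aScale p.lam)) / m + 3 * (p.lam * aScale p.lam) / m) *
          J := by
        calc (2 * N + 1 : ℝ) * (2 * blockSize m p + 3) * J * (p.lam * (aScale p.lam / m)) ^ 2 =
            ((2 * N + 1 : ℝ) * (p.lam * (aScale p.lam / m))) *
            (2 * (blockSize m p * (p.lam * aScale p.lam)) / m +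
              3 * (p.lam * aScale p.lam) / m) * J := by ring
          _ ≤ _ := by gcongr
      have e5 : (2 * N + 1 : ℝ) * p.lam ≤ 2 * (A * m) * (blockSize m p * p.lam) + p.lam := by
        calc (2 * N + 1 : ℝ) * p.lam ≤ (2 * (A * m * blockSize m p) + 1) * p.lam := by gcongr
          _ = _ := by ring
      have e6 : 2 * (J * J * ((2 * N + 1 : ℝ) * (p.lam * (aScale p.lam / m)) * δ)) ≤ ε / 2 := by
        calc 2 * (J * J * ((2 * N + 1 : ℝ) * (p.lam * (aScale p.lam / m)) * δ)) ≤
            2 * (J * J * ((2 * A + 1) * δ)) := by gcongr; exact e4.trans h2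
          _ ≤ ε / 2 := by
            rw [hδ]
            rw [show 2 * ((J : ℝ) * J * ((2 * A + 1) * (ε / (4 * J * J * (2 * A + 1) + 1)))) =
              ε / 2 * ((4 * J * J * (2 * A + 1)) / (4 * J * J * (2 * A + 1) + 1)) by ring]
            refine mul_le_of_le_one_right (by positivity) ?_
            rw [div_le_one (by positivity)]
            linarith
      rw [e1, e3]
      linarith
  · intro i
    refine (hR.real_not_lateSites_le m K₀ (blockSize m p) i).trans (le_trans ?_ h3)
    simp only [Matrix.cons_val_zero]
    gcongr
    have e : (((m - 1) * K₀ : ℕ) : ℝ) * (aScale p.lam / m / K₀) = γ * aScale p.lam := by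
      rw [hγ]
      push_cast [Nat.cast_sub (show 1 ≤ m from hm)]
      field_simp
    rw [e]
    calc Real.exp ((1 - γ) / 2 * aScale p.lam) =
        Real.exp ((1 + γ) / 2 * aScale p.lam) * Real.exp (-(γ * aScale p.lam)) := by
          rw [← Real.exp_add]; congr 1; ring
      _ ≤ _ := by gcongr

/-! ### The driving Poisson processes -/

/-- The rates of the seeds, matches and fronts. -/
def fireRate (lam pi : ℝ) : Fin 3 → ℝ≥0 := ![1, lam.toNNReal, pi.toNNReal]

/-- `η` is a forest fire process driven by the independent Poisson processes `n k i`. -/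
structure IsDriven {Ω : Type*} [MeasurableSpace Ω] (lam pi : ℝ) (η : ℝ≥0 → ℤ → Ω → Fin 3)
    (n : Fin 3 → ℤ → ℝ≥0 → Ω → ℕ) (P : Measure Ω) : Prop where
  measurable : ∀ t i, Measurable (η t i)
  poisson : ∀ k i, IsPoissonProcess (n k i) (fireRate lam pi k) P
  indep : iIndepFun (fun (k : Fin 3 × ℤ) (ω : Ω) (t : ℝ≥0) => n k.1 k.2 t ω) P
  regular : ∀ᵐ ω ∂P, IsRegularFire (fun t i => η t i ω) (fun i t => n 0 i t ω)
    (fun i t => n 1 i t ω) (fun i t => n 2 i t ω)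

lemma IsForestFireProcess.exists_isDriven {Ω : Type*} [MeasurableSpace Ω] {lam pi : ℝ}
    {η : ℝ≥0 → ℤ → Ω → Fin 3} {P : Measure Ω} (h : IsForestFireProcess lam pi η P) :
    ∃ n, IsDriven lam pi η n P := by
  obtain ⟨hm, NS, NM, NP, hS, hM, hP, hi, hae⟩ := h
  refine ⟨![NS, NM, NP], hm, fun k i => ?_, hi, ?_⟩
  · fin_cases k
    exacts [hS i, hM i, hP i]
  · have a1 := ae_all_iff.2 fun i => (hS i).path
    have a2 := ae_all_iff.2 fun i => (hM i).path
    have a3 := ae_all_iff.2 fun i => (hP i).path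
    filter_upwards [hae, a1, a2, a3] with ω h0 h1 h2 h3
    exact ⟨h0.1, h0.2, fun i => (h1 i).2.1, fun i => (h2 i).2.1, fun i => (h3 i).2.1,
      fun i => (h1 i).2.2, fun i => (h2 i).2.2, fun i => (h3 i).2.2⟩

/-- The event that the process `n k i` has a jump in the time cell `(c h, (c + 1) h]`. -/
def ringEvents {Ω : Type*} (n : Fin 3 → ℤ → ℝ≥0 → Ω → ℕ) (h : ℝ≥0) (p : Fin 3 × ℕ × ℤ) : Set Ω :=
  {ω | rings (fun i t => n p.1 i t ω) h p.2.1 p.2.2}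

namespace IsDriven

variable {Ω : Type*} [MeasurableSpace Ω] {lam pi : ℝ} {η : ℝ≥0 → ℤ → Ω → Fin 3}
  {n : Fin 3 → ℤ → ℝ≥0 → Ω → ℕ} {P : Measure Ω}

/-- Independence of the processes and independence of the increments of each of them combine into
joint independence over processes and cells. -/
lemma iIndepFun_increments (h : IsDriven lam pi η n P) (u : ℝ≥0) :
    iIndepFun (fun (p : Fin 3 × ℕ × ℤ) ω =>
      n p.1 p.2.2 (((p.2.1 + 1 : ℕ) : ℝ≥0) * u) ω - n p.1 p.2.2 ((p.2.1 : ℝ≥0) * u) ω) P := by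
  have := h.indep.isProbabilityMeasure
  have key := iIndepFun_uncurry' (P := P)
    (X := fun (k : Fin 3 × ℤ) (c : ℕ) ω =>
      n k.1 k.2 (((c + 1 : ℕ) : ℝ≥0) * u) ω - n k.1 k.2 ((c : ℝ≥0) * u) ω)
    (fun k c => ((h.poisson k.1 k.2).measurable _).sub ((h.poisson k.1 k.2).measurable _))
    (h.indep.comp (fun _ f c => f (((c + 1 : ℕ) : ℝ≥0) * u) - f ((c : ℝ≥0) * u)) fun _ =>
      measurable_pi_lambda _ fun c => (measurable_pi_apply _).sub (measurable_pi_apply _))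
    (fun k => (h.poisson k.1 k.2).indep.nat (t := fun c : ℕ => (c : ℝ≥0) * u)
      (fun a b hab => by
        simp only
        gcongr))
  refine key.precomp (g := fun p : Fin 3 × ℕ × ℤ => ((p.1, p.2.2), p.2.1)) ?_
  rintro ⟨a, b, c⟩ ⟨a', b', c'⟩ h
  simp only [Prod.mk.injEq] at h ⊢
  tauto

lemma hasLaw_increment (h : IsDriven lam pi η n P) (u : ℝ≥0) (k : Fin 3) (c : ℕ) (i : ℤ) :
    HasLaw (fun ω => n k i (((c + 1 : ℕ) : ℝ≥0) * u) ω - n k i ((c : ℝ≥0) * u) ω)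
      (poissonMeasure (fireRate lam pi k * u)) P := by
  have h1 := (h.poisson k i).law ((c : ℝ≥0) * u) (((c + 1 : ℕ) : ℝ≥0) * u) (by
    gcongr
    exact Nat.le_succ c)
  have : ((c + 1 : ℕ) : ℝ≥0) * u - (c : ℝ≥0) * u = u := by
    push_cast
    rw [add_mul, one_mul, add_tsub_cancel_left]
  rwa [this] at h1

lemma measure_increment (h : IsDriven lam pi η n P) (u : ℝ≥0) (k : Fin 3) (c : ℕ) (i : ℤ)
    (q : ℕ → Prop) :
    P {ω | q (n k i (((c + 1 : ℕ) : ℝ≥0) * u) ω - n k i ((c : ℝ≥0) * u) ω)} =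
      poissonMeasure (fireRate lam pi k * u) {v | q v} := by
  have h1 := h.hasLaw_increment u k c i
  rw [← h1.map_eq, Measure.map_apply_of_aemeasurable h1.aemeasurable .of_discrete]
  rfl

/-- The jumps of the driving processes. -/
lemma ringModel (h : IsDriven lam pi η n P) (u : ℝ≥0) :
    RingModel P (ringEvents n u) (fun k => fireRate lam pi k * u) := by
  have hm : ∀ p, MeasurableSet (ringEvents n u p) := fun p =>
    ((((h.poisson p.1 p.2.2).measurable _).sub ((h.poisson p.1 p.2.2).measurable _))
      (measurableSet_singleton 0)).compl
  refine ⟨hm, ?_, fun p => ?_⟩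
  · rw [iIndepSet_iff_meas_biInter hm]
    intro s
    exact (h.iIndepFun_increments u).measure_inter_preimage_eq_mul s
      (sets := fun _ => {v | v ≠ 0}) fun _ _ => .of_discrete
  · have h1 := h.measure_increment u p.1 p.2.1 p.2.2 (fun v => v = 0)
    have h2 : (ringEvents n u p)ᶜ = {ω | n p.1 p.2.2 (((p.2.1 + 1 : ℕ) : ℝ≥0) * u) ω -
        n p.1 p.2.2 ((p.2.1 : ℝ≥0) * u) ω = 0} := by
      ext ω
      simp [ringEvents, rings]
    rw [measureReal_def, h2, h1, ofPred_eq_eq_singleton, poissonMeasure_zero,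
      ENNReal.toReal_ofReal (Real.exp_pos _).le]
    push_cast
    rfl

/-- In each of the `K` cells, two jumps of one process, or one jump of each of two processes, have
probability at most `(ρ * u) ^ 2`. As `K` will be proportional to `1 / u`, the bound vanishes with
`u`. -/
lemma real_not_simpleCells_le (h : IsDriven lam pi η n P) (u : ℝ≥0) (N K : ℕ) {ρ : ℝ≥0}
    (hρ : ∀ k, fireRate lam pi k ≤ ρ) :
    P.real {ω | ¬SimpleCells N K ![fun i t => n 0 i t ω, fun i t => n 1 i t ω,
      fun i t => n 2 i t ω] u} ≤ K * (3 * (2 * N + 1)) ^ 2 * (ρ * u) ^ 2 := by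
  have := h.indep.isProbabilityMeasure
  have hR := h.ringModel u
  set I : Finset (Fin 3 × ℤ) := Finset.univ ×ˢ Finset.Icc (-N : ℤ) N with hI
  set Bad : ℕ × (Fin 3 × ℤ) × (Fin 3 × ℤ) → Set Ω := fun p =>
    if p.2.1 = p.2.2 then {ω | 2 ≤ n p.2.1.1 p.2.1.2 (((p.1 + 1 : ℕ) : ℝ≥0) * u) ω -
      n p.2.1.1 p.2.1.2 ((p.1 : ℝ≥0) * u) ω}
    else ringEvents n u (p.2.1.1, p.1, p.2.1.2) ∩ ringEvents n u (p.2.2.1, p.1, p.2.2.2) with hBad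
  have hn : ∀ ω (k : Fin 3), (![fun i t => n 0 i t ω, fun i t => n 1 i t ω,
      fun i t => n 2 i t ω] : Fin 3 → ℤ → ℝ≥0 → ℕ) k = fun i t => n k i t ω := by
    intro ω k
    fin_cases k <;> rfl
  have hsub : {ω | ¬SimpleCells N K ![fun i t => n 0 i t ω, fun i t => n 1 i t ω,
      fun i t => n 2 i t ω] u} ⊆ ⋃ p ∈ Finset.range K ×ˢ (I ×ˢ I), Bad p := by
    intro ω hω
    simp only [SimpleCells, mem_ofPred_eq, hn, not_and_or] at hω
    simp only [mem_iUnion, Finset.mem_product, Finset.mem_range, hI, Finset.mem_univ, true_and,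
      Finset.mem_Icc]
    rcases hω with hω | hω
    · simp only [not_forall, not_le] at hω
      obtain ⟨c, hc, k, i, hi, h2⟩ := hω
      rw [abs_le] at hi
      refine ⟨(c, (k, i), (k, i)), ⟨hc, hi, hi⟩, ?_⟩
      simp only [hBad, if_true]
      exact h2
    · simp only [not_forall] at hω
      obtain ⟨c, hc, k, k', i, i', hi, hi', h1, h2, h3⟩ := hω
      rw [abs_le] at hi hi'
      refine ⟨(c, (k, i), (k', i')), ⟨hc, hi, hi'⟩, ?_⟩
      have hne : ¬((k, i) = (k', i')) := fun he => h3 ⟨(Prod.mk.inj he).1, (Prod.mk.inj he).2⟩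
      simp only [hBad, if_neg hne]
      exact ⟨h1, h2⟩
  have hle : ∀ k, (fireRate lam pi k * u : ℝ) ≤ ρ * u := fun k => by
    have : (fireRate lam pi k : ℝ) ≤ ρ := hρ k
    gcongr
  have hbound : ∀ p, P.real (Bad p) ≤ (ρ * u : ℝ) ^ 2 := by
    rintro ⟨c, ⟨k, i⟩, ⟨k', i'⟩⟩
    by_cases he : ((k, i) : Fin 3 × ℤ) = (k', i')
    · simp only [hBad, if_pos he]
      rw [measureReal_def, h.measure_increment u k c i (fun v => 2 ≤ v)]
      calc _ ≤ (((fireRate lam pi k * u : ℝ≥0) : ℝ≥0∞) ^ 2).toReal :=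
            ENNReal.toReal_mono (by finiteness) (poissonMeasure_two_le _)
        _ = (fireRate lam pi k * u : ℝ) ^ 2 := by simp
        _ ≤ _ := pow_le_pow_left₀ (by positivity) (hle k) 2
    · simp only [hBad, if_neg he]
      rw [hR.measureReal_inter (A := {(k, c, i)}) (A' := {(k', c, i')}) ?_
        (measurableSet_ringAlgebra rfl) (measurableSet_ringAlgebra rfl), sq]
      · exact mul_le_mul ((hR.real_le _).trans (hle k)) ((hR.real_le _).trans (hle k'))
          measureReal_nonneg (by positivity)
      · rw [disjoint_singleton]
        intro heq
        simp only [Prod.mk.injEq, true_and] at heq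
        exact he (Prod.ext heq.1 heq.2)
  refine (measureReal_mono hsub (measure_ne_top _ _)).trans ((measureReal_biUnion_finset_le _ _).trans
    ((Finset.sum_le_sum fun p _ => hbound p).trans (le_of_eq ?_)))
  rw [Finset.sum_const, nsmul_eq_mul]
  have e1 : (((N : ℤ) + 1 - -N).toNat : ℕ) = 2 * N + 1 := by omega
  simp only [Finset.card_product, Finset.card_range, hI, Finset.card_univ, Fintype.card_fin,
    Int.card_Icc, e1]
  push_cast
  ring

end IsDriven

/-- A jump in a long time cell is a jump in one of its parts. -/
lemma rings_iff {n : ℤ → ℝ≥0 → ℕ} (hn : ∀ i, Monotone (n i)) {K₀ : ℕ} {h : ℝ≥0} (j : ℕ) (i : ℤ) :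
    rings n (K₀ * h) j i ↔ ∃ c, j * K₀ ≤ c ∧ c < (j + 1) * K₀ ∧ rings n h c i := by
  have e : ∀ l : ℕ, (l : ℝ≥0) * (K₀ * h) = ((l * K₀ : ℕ) : ℝ≥0) * h := fun l => by
    push_cast
    ring
  have hmono : Monotone fun c : ℕ => n i ((c : ℝ≥0) * h) := fun a b hab =>
    hn i (by gcongr)
  unfold rings
  rw [e, e]
  have hle : j * K₀ ≤ (j + 1) * K₀ := Nat.mul_le_mul_right _ (Nat.le_succ j)
  constructor
  · intro h1
    by_contra hcon
    push Not at hcon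
    have : ∀ c, j * K₀ ≤ c → c ≤ (j + 1) * K₀ → n i ((c : ℝ≥0) * h) =
        n i (((j * K₀ : ℕ) : ℝ≥0) * h) := by
      intro c hc
      induction c, hc using Nat.le_induction with
      | base => exact fun _ => rfl
      | succ c hc ih =>
        intro hc'
        rw [← ih (by omega)]
        have h2 := hcon c hc (by omega)
        have h3 := hmono (Nat.le_succ c)
        simp only [Nat.succ_eq_add_one] at h3
        omega
    exact h1 (by rw [this _ hle le_rfl, Nat.sub_self])
  · rintro ⟨c, h1, h2, h3⟩
    have h4 := hmono h1
    have h5 := hmono (show c + 1 ≤ (j + 1) * K₀ by omega)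
    simp only at h4 h5
    omega

/-! ### Convergence of the marked cells -/

/-- The probability of a pattern of independent events. -/
lemma real_pattern {Ω ι : Type*} [MeasurableSpace Ω] [Fintype ι] {P : Measure Ω} {E : ι → Set Ω}
    (hE : iIndepSet E P) (v : ι → Prop) [DecidablePred v] :
    P.real {ω | (fun s => ω ∈ E s) = v} = ∏ s, if v s then P.real (E s) else P.real (E s)ᶜ := by
  have h := (iIndepSet_iff E P).1 hE Finset.univ (f := fun s => if v s then E s else (E s)ᶜ)
    (fun s _ => by
      have h1 : MeasurableSet[MeasurableSpace.generateFrom {E s}] (E s) :=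
        MeasurableSpace.measurableSet_generateFrom rfl
      split_ifs
      exacts [h1, h1.compl])
  have e : {ω | (fun s => ω ∈ E s) = v} = ⋂ s ∈ Finset.univ, if v s then E s else (E s)ᶜ := by
    ext ω
    simp only [mem_ofPred_eq, funext_iff, eq_iff_iff, Finset.mem_univ, iInter_true, mem_iInter]
    refine forall_congr' fun s => ?_
    split_ifs with hs <;> simp [hs]
  rw [measureReal_def, e, h, ENNReal.toReal_prod]
  refine Finset.prod_congr rfl fun s _ => ?_
  split_ifs <;> rfl

lemma iIndepSet_of_iIndepFun {Ω ι β : Type*} [MeasurableSpace Ω] [MeasurableSpace β]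
    {P : Measure Ω} {X : ι → Ω → β} (h : iIndepFun X P) (hX : ∀ i, Measurable (X i)) {s : Set β}
    (hs : MeasurableSet s) : iIndepSet (fun i => X i ⁻¹' s) P := by
  rw [iIndepSet_iff_meas_biInter fun i => hX i hs]
  exact fun S => h.measure_inter_preimage_eq_mul S fun _ _ => hs

/-- The cells of the grid `[-B, B) × [0, J)`. -/
abbrev GridIndex (B J : ℕ) : Type := ↥(Finset.Ico (-B : ℤ) B ×ˢ Finset.range J)

/-- A set of cells of the grid, as a predicate. -/
def cellsOf {B J : ℕ} (v : GridIndex B J → Prop) (b : ℤ) (j : ℕ) : Prop :=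
  ∃ h : (b, j) ∈ Finset.Ico (-B : ℤ) B ×ˢ Finset.range J, v ⟨(b, j), h⟩

lemma cellsOf_iff {B J : ℕ} {v : GridIndex B J → Prop} {w : ℤ → ℕ → Prop}
    (h : ∀ s, v s ↔ w s.1.1 s.1.2) (b : ℤ) (j : ℕ) :
    cellsOf v b j ↔ -B ≤ b ∧ b < B ∧ j < J ∧ w b j := by
  constructor
  · rintro ⟨h1, h2⟩
    have h3 := Finset.mem_product.1 h1
    simp only [Finset.mem_Ico, Finset.mem_range] at h3
    exact ⟨h3.1.1, h3.1.2, h3.2, (h _).1 h2⟩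
  · rintro ⟨h1, h2, h3, h4⟩
    exact ⟨Finset.mem_product.2 ⟨Finset.mem_Ico.2 ⟨h1, h2⟩, Finset.mem_range.2 h3⟩, (h _).2 h4⟩

section Limit

variable {Ω : Type*} [MeasurableSpace Ω] {P : Measure Ω} [IsProbabilityMeasure P]
  {M : Ω → Measure (ℝ × ℝ)}

/-- The marked cells of the Poisson measure. -/
def markPattern (m B J : ℕ) (M : Ω → Measure (ℝ × ℝ)) (ω : Ω) (s : GridIndex B J) : Prop :=
  M ω (cell m s.1.1 s.1.2) ≠ 0

omit [MeasurableSpace Ω] in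
lemma cellsOf_markPattern (m B J : ℕ) (ω : Ω) :
    cellsOf (markPattern m B J M ω) = markedCells m B J (M ω) := by
  ext b j
  exact cellsOf_iff (w := fun b j => M ω (cell m b j) ≠ 0) (fun s => Iff.rfl) b j

lemma disjoint_cell {m : ℕ} (hm : 0 < m) {b b' : ℤ} {j j' : ℕ} (h : ¬(b = b' ∧ j = j')) :
    Disjoint (cell m b j) (cell m b' j') := by
  have hm' : (0 : ℝ) < m := by exact_mod_cast hm
  rw [Set.disjoint_left]
  rintro ⟨u, s⟩ ⟨⟨h1, h2⟩, h3, h4⟩ ⟨⟨h5, h6⟩, h7, h8⟩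
  simp only [div_le_iff₀ hm', lt_div_iff₀ hm', div_lt_iff₀ hm', le_div_iff₀ hm'] at h1 h2 h3 h4 h5 h6 h7 h8
  have e1 : b < b' + 1 := by exact_mod_cast h1.trans_lt h6
  have e2 : b' < b + 1 := by exact_mod_cast h5.trans_lt h2
  have e3 : j < j' + 1 := by exact_mod_cast h3.trans_le h8
  have e4 : j' < j + 1 := by exact_mod_cast h7.trans_le h4
  exact h ⟨by omega, by omega⟩

lemma intensity_cell {m : ℕ} (hm : 0 < m) (b : ℤ) (j : ℕ) :
    (volume.restrict (univ ×ˢ Ici (0 : ℝ))) (cell m b j) = ENNReal.ofReal (1 / m ^ 2) := by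
  rw [cell_eq_cellRect, intensity_cellRect hm, ← ENNReal.ofReal_mul]
  · congr 1
    push_cast
    ring
  · push_cast
    simp

omit [IsProbabilityMeasure P] in
lemma measurableSet_markPattern (hM : IsPoissonMeasure M (volume.restrict (univ ×ˢ Ici (0 : ℝ))) P)
    (m B J : ℕ) (v : GridIndex B J → Prop) : MeasurableSet (markPattern m B J M ⁻¹' {v}) := by
  have : markPattern m B J M ⁻¹' {v} = ⋂ s, {ω | markPattern m B J M ω s ↔ v s} := by
    ext ω
    simp [funext_iff]
  rw [this]
  refine MeasurableSet.iInter fun s => ?_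
  have h1 : MeasurableSet {ω | markPattern m B J M ω s} :=
    ((hM.measurable _ (measurableSet_cell m s.1.1 s.1.2)) (measurableSet_singleton 0)).compl
  by_cases hv : v s
  · simpa only [hv, iff_true] using h1
  · simp only [hv, iff_false]
    exact h1.compl

open Classical in
lemma real_markPattern (hM : IsPoissonMeasure M (volume.restrict (univ ×ˢ Ici (0 : ℝ))) P)
    {m : ℕ} (hm : 0 < m) (B J : ℕ) (v : GridIndex B J → Prop) :
    P.real (markPattern m B J M ⁻¹' {v}) =
      ∏ s, if v s then 1 - Real.exp (-(1 / m ^ 2)) else Real.exp (-(1 / m ^ 2)) := by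
  set e := Fintype.equivFin (GridIndex B J)
  have h1 := hM.indep (Fintype.card (GridIndex B J))
    (fun a => cell m (e.symm a).1.1 (e.symm a).1.2) (fun _ => measurableSet_cell _ _ _)
    (fun a b hab => disjoint_cell hm fun h => hab (e.symm.injective (Subtype.ext
      (Prod.ext h.1 h.2))))
  have h2 := h1.precomp (g := e) e.injective
  simp only [Equiv.symm_apply_apply] at h2
  have h3 := iIndepSet_of_iIndepFun h2
    (fun s => hM.measurable _ (measurableSet_cell _ _ _)) (measurableSet_singleton 0).compl
  have h4 := real_pattern h3 v
  have h5 : ∀ s : GridIndex B J, P.real ((fun ω => M ω (cell m s.1.1 s.1.2)) ⁻¹' {0}ᶜ)ᶜ =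
      Real.exp (-(1 / m ^ 2)) := by
    intro s
    have h6 := hM.measure_zero (measurableSet_cell m s.1.1 s.1.2) (by
      rw [intensity_cell hm]; exact ENNReal.ofReal_ne_top)
    rw [intensity_cell hm, ENNReal.toReal_ofReal (by positivity)] at h6
    have h7 : ((fun ω => M ω (cell m s.1.1 s.1.2)) ⁻¹' {0}ᶜ)ᶜ =
        {ω | M ω (cell m s.1.1 s.1.2) = 0} := by
      ext ω; simp
    rw [h7, measureReal_def, h6, ENNReal.toReal_ofReal (Real.exp_pos _).le]
  have h8 : ∀ s : GridIndex B J, P.real ((fun ω => M ω (cell m s.1.1 s.1.2)) ⁻¹' {0}ᶜ) =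
      1 - Real.exp (-(1 / m ^ 2)) := by
    intro s
    have := probReal_compl_eq_one_sub (μ := P)
      (hM.measurable _ (measurableSet_cell m s.1.1 s.1.2) (measurableSet_singleton 0).compl)
    rw [h5] at this
    linarith
  simp only [h5, h8] at h4
  exact h4

end Limit

section Rings

variable {Ω : Type*} [MeasurableSpace Ω] {P : Measure Ω} {R : Fin 3 × ℕ × ℤ → Set Ω}
  {r : Fin 3 → ℝ}

/-- The first site of the block `b`. -/
def firstSite (n : ℤ) (m : ℕ) (b : ℤ) : ℤ := -(-(b * n) / m)

/-- The first site is the ceiling of `b * n / m`, written as a negated floor division; the sites of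
a block form an interval. -/
lemma block_eq_iff {n : ℤ} (hn : 0 < n) {m : ℕ} (hm : 0 < m) (i b : ℤ) :
    block n m i = b ↔ firstSite n m b ≤ i ∧ i < firstSite n m (b + 1) := by
  have hm' : (0 : ℤ) < m := by exact_mod_cast hm
  have h1 : ∀ b, firstSite n m b ≤ i ↔ b * n ≤ i * m := fun b => by
    unfold firstSite
    rw [neg_le, Int.le_ediv_iff_mul_le hm', neg_mul, neg_le_neg_iff]
  rw [← not_le, h1, h1, not_le]
  obtain ⟨h2, h3⟩ := block_spec hn m i
  constructor
  · rintro rfl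
    exact ⟨h2, h3⟩
  · rintro ⟨h4, h5⟩
    have e1 := lt_of_mul_lt_mul_right (h2.trans_lt h5) hn.le
    have e2 := lt_of_mul_lt_mul_right (h4.trans_lt h3) hn.le
    omega

lemma firstSite_spec (n : ℤ) {m : ℕ} (hm : 0 < m) (b : ℤ) :
    b * n ≤ firstSite n m b * m ∧ firstSite n m b * m < b * n + m := by
  have hm' : (0 : ℤ) < m := by exact_mod_cast hm
  have h1 := Int.ediv_mul_le (-(b * n)) hm'.ne'
  have h2 := Int.lt_ediv_add_one_mul_self (-(b * n)) hm'
  unfold firstSite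
  constructor
  · linarith
  · linarith

/-- The blocks and times that contain matches. -/
def matchPattern (n : ℤ) (m B J : ℕ) (R : Fin 3 × ℕ × ℤ → Set Ω) (ω : Ω) (s : GridIndex B J) :
    Prop := ∃ i, block n m i = s.1.1 ∧ ω ∈ R (1, s.1.2, i)

lemma measurableSet_matchPattern (hR : RingModel P R r) (n : ℤ) (m B J : ℕ)
    (v : GridIndex B J → Prop) : MeasurableSet (matchPattern n m B J R ⁻¹' {v}) := by
  have : matchPattern n m B J R ⁻¹' {v} = ⋂ s, {ω | matchPattern n m B J R ω s ↔ v s} := by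
    ext ω
    simp [funext_iff]
  rw [this]
  refine MeasurableSet.iInter fun s => ?_
  have h1 : MeasurableSet {ω | matchPattern n m B J R ω s} := by
    have : {ω | matchPattern n m B J R ω s} =
        ⋃ i, ⋃ _ : block n m i = s.1.1, R (1, s.1.2, i) := by
      ext ω
      simp [matchPattern]
    rw [this]
    exact MeasurableSet.iUnion fun i => MeasurableSet.iUnion fun _ => hR.measurable _
  by_cases hv : v s
  · simpa only [hv, iff_true] using h1
  · simp only [hv, iff_false]
    exact h1.compl

/-- Induction on the finite family. The intersection of the events treated so far depends only on
the union of their ring sets, which is disjoint from the next one. -/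
lemma RingModel.iIndepSet_of_disjoint [IsProbabilityMeasure P] {ι : Type*} (hR : RingModel P R r)
    {A : ι → Set (Fin 3 × ℕ × ℤ)} (hA : Pairwise (Function.onFun Disjoint A)) {E : ι → Set Ω}
    (hE : ∀ s, MeasurableSet[ringAlgebra R (A s)] (E s)) : iIndepSet E P := by
  classical
  rw [iIndepSet_iff_meas_biInter fun s => hR.ringAlgebra_le _ _ (hE s)]
  intro S
  have key : MeasurableSet[ringAlgebra R (⋃ s ∈ S, A s)] (⋂ s ∈ S, E s) ∧
      P (⋂ s ∈ S, E s) = ∏ s ∈ S, P (E s) := by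
    induction S using Finset.induction_on with
    | empty => simp
    | insert a S ha ih =>
      have mono : ∀ {B B' : Set (Fin 3 × ℕ × ℤ)}, B ⊆ B' → ringAlgebra R B ≤ ringAlgebra R B' :=
        fun h => biSup_mono h
      have e : ⋂ s ∈ insert a S, E s = E a ∩ ⋂ s ∈ S, E s := by
        rw [Finset.set_biInter_insert]
      rw [e, Finset.prod_insert ha]
      constructor
      · refine @MeasurableSet.inter _ (ringAlgebra R _) _ _ (mono ?_ _ (hE a)) (mono ?_ _ ih.1)
        · exact fun p hp => by simp only [mem_iUnion]; exact ⟨a, Finset.mem_insert_self a S, hp⟩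
        · intro p hp
          simp only [mem_iUnion] at hp ⊢
          obtain ⟨s, hs, hp⟩ := hp
          exact ⟨s, Finset.mem_insert_of_mem hs, hp⟩
      · have hd : Disjoint (A a) (⋃ s ∈ S, A s) := by
          simp only [Set.disjoint_iUnion_right]
          intro s hs
          exact hA fun h => ha (h ▸ hs)
        have h1 := hR.measureReal_inter hd (hE a) ih.1
        rw [← ih.2]
        rw [measureReal_def, measureReal_def, measureReal_def, ← ENNReal.toReal_mul] at h1
        exact (ENNReal.toReal_eq_toReal_iff' (measure_ne_top _ _)
          (ENNReal.mul_ne_top (measure_ne_top _ _) (measure_ne_top _ _))).1 h1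
  exact key.2

lemma RingModel.real_no_match [IsProbabilityMeasure P] (hR : RingModel P R r) {n : ℤ} (hn : 0 < n)
    {m : ℕ} (hm : 0 < m) (j : ℕ) (b : ℤ) :
    P.real {ω | ∃ i, block n m i = b ∧ ω ∈ R (1, j, i)}ᶜ =
      Real.exp (-(((firstSite n m (b + 1) - firstSite n m b : ℤ) : ℝ) * r 1)) := by
  have hle : firstSite n m b ≤ firstSite n m (b + 1) := by
    have hm' : (0 : ℤ) < m := by exact_mod_cast hm
    unfold firstSite
    refine neg_le_neg (Int.ediv_le_ediv hm' ?_)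
    linarith
  obtain ⟨l, hl⟩ := Int.le.dest hle
  rw [← hl, add_sub_cancel_left]
  have e : {ω | ∃ i, block n m i = b ∧ ω ∈ R (1, j, i)}ᶜ =
      {ω | ∃ a : Fin l, ω ∈ R (1, j, firstSite n m b + (a : ℕ))}ᶜ := by
    ext ω
    simp only [mem_compl_iff, mem_ofPred_eq, not_iff_not, block_eq_iff hn hm, ← hl]
    constructor
    · rintro ⟨i, ⟨h1, h2⟩, h3⟩
      refine ⟨⟨(i - firstSite n m b).toNat, by omega⟩, ?_⟩
      have : firstSite n m b + ((i - firstSite n m b).toNat : ℕ) = i := by omega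
      rw [this]
      exact h3
    · rintro ⟨a, ha⟩
      exact ⟨_, by have := a.2; omega, ha⟩
  have h1 : iIndepSet (fun a : Fin l => R (1, j, firstSite n m b + (a : ℕ))) P :=
    hR.iIndepSet_of_disjoint (A := fun a : Fin l => {(1, j, firstSite n m b + (a : ℕ))})
      (fun a a' haa => by
        simp only [Function.onFun, disjoint_singleton]
        intro h
        simp only [Prod.mk.injEq, add_right_inj, true_and, Nat.cast_inj] at h
        exact haa (Fin.ext h)) fun a => measurableSet_ringAlgebra rfl
  have h2 := real_pattern h1 (fun _ => False)
  have e2 : {ω | ∃ a : Fin l, ω ∈ R (1, j, firstSite n m b + (a : ℕ))}ᶜ =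
      {ω | (fun a : Fin l => ω ∈ R (1, j, firstSite n m b + (a : ℕ))) = fun _ => False} := by
    ext ω
    simp [funext_iff]
  rw [e, e2, h2]
  simp only [if_false, hR.law, Finset.prod_const, Finset.card_univ, Fintype.card_fin]
  rw [← Real.exp_nat_mul]
  congr 1
  push_cast
  ring

open Classical in
lemma RingModel.real_matchPattern [IsProbabilityMeasure P] (hR : RingModel P R r) {n : ℤ}
    (hn : 0 < n) {m : ℕ} (hm : 0 < m) (B J : ℕ) (v : GridIndex B J → Prop) :
    P.real (matchPattern n m B J R ⁻¹' {v}) =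
      ∏ s : GridIndex B J, if v s then
        1 - Real.exp (-(((firstSite n m (s.1.1 + 1) - firstSite n m s.1.1 : ℤ) : ℝ) * r 1))
      else Real.exp (-(((firstSite n m (s.1.1 + 1) - firstSite n m s.1.1 : ℤ) : ℝ) * r 1)) := by
  have hE : ∀ s : GridIndex B J,
      MeasurableSet[ringAlgebra R {p | p.2.1 = s.1.2 ∧ block n m p.2.2 = s.1.1}]
      {ω | ∃ i, block n m i = s.1.1 ∧ ω ∈ R (1, s.1.2, i)} := by
    intro s
    have : {ω | ∃ i, block n m i = s.1.1 ∧ ω ∈ R (1, s.1.2, i)} =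
        ⋃ i, ⋃ _ : block n m i = s.1.1, R (1, s.1.2, i) := by
      ext ω
      simp
    rw [this]
    exact @MeasurableSet.iUnion _ _ (ringAlgebra R _) _ _ fun i =>
      @MeasurableSet.iUnion _ _ (ringAlgebra R _) _ _ fun hi =>
        measurableSet_ringAlgebra ⟨rfl, hi⟩
  have h1 := hR.iIndepSet_of_disjoint
    (A := fun s : GridIndex B J => {p | p.2.1 = s.1.2 ∧ block n m p.2.2 = s.1.1})
    (fun s s' hs => Set.disjoint_left.2 fun p hp hp' => hs (Subtype.ext (Prod.ext
      (hp.2.symm.trans hp'.2) (hp.1.symm.trans hp'.1)))) hE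
  have h2 := real_pattern h1 v
  have h3 : ∀ s : GridIndex B J, P.real {ω | ∃ i, block n m i = s.1.1 ∧ ω ∈ R (1, s.1.2, i)} =
      1 - Real.exp (-(((firstSite n m (s.1.1 + 1) - firstSite n m s.1.1 : ℤ) : ℝ) * r 1)) := by
    intro s
    have := probReal_compl_eq_one_sub (μ := P) (hR.ringAlgebra_le _ _ (hE s))
    rw [hR.real_no_match hn hm] at this
    linarith
  simp only [h3, hR.real_no_match hn hm] at h2
  exact h2

end Rings

/-- The mean number of matches in a block converges. -/
lemma tendsto_matches {z₀ : ℝ} {m : ℕ} (hm : 0 < m) (b : ℤ) :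
    Tendsto (fun p : Params => ((firstSite (nScale p.lam) m (b + 1) -
      firstSite (nScale p.lam) m b : ℤ) : ℝ) * (p.lam * (aScale p.lam / m))) (slowRegime z₀)
      (𝓝 (1 / m ^ 2)) := by
  have hm' : (0 : ℝ) < m := by exact_mod_cast hm
  have h1 := tendsto_nScale_mul (z₀ := z₀)
  have h2 := (tendsto_lam_mul_aScale (z₀ := z₀)).const_mul (m : ℝ)
  rw [mul_zero] at h2
  have h3 := (h1.sub h2).div_const ((m : ℝ) ^ 2)
  have h4 := (h1.add h2).div_const ((m : ℝ) ^ 2)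
  rw [sub_zero] at h3
  rw [add_zero] at h4
  have key : ∀ p : Params, (nScale p.lam : ℝ) - m ≤ ((firstSite (nScale p.lam) m (b + 1) -
      firstSite (nScale p.lam) m b : ℤ) : ℝ) * m ∧ ((firstSite (nScale p.lam) m (b + 1) -
      firstSite (nScale p.lam) m b : ℤ) : ℝ) * m ≤ nScale p.lam + m := by
    intro p
    obtain ⟨a1, a2⟩ := firstSite_spec (nScale p.lam) hm b
    obtain ⟨a3, a4⟩ := firstSite_spec (nScale p.lam) hm (b + 1)
    constructor
    · have : nScale p.lam - m ≤ (firstSite (nScale p.lam) m (b + 1) -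
        firstSite (nScale p.lam) m b) * m := by linarith
      exact_mod_cast this
    · have : (firstSite (nScale p.lam) m (b + 1) -
        firstSite (nScale p.lam) m b) * m ≤ nScale p.lam + m := by linarith
      exact_mod_cast this
  refine tendsto_of_tendsto_of_tendsto_of_le_of_le h3 h4 (fun p => ?_) fun p => ?_
  · have h0 : 0 ≤ p.lam * aScale p.lam := (mul_pos p.lam_pos (aScale_pos p)).le
    have := mul_le_mul_of_nonneg_right (key p).1 h0
    simp only
    rw [div_le_iff₀ (by positivity)]
    field_simp
    linarith
  · have h0 : 0 ≤ p.lam * aScale p.lam := (mul_pos p.lam_pos (aScale_pos p)).le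
    have := mul_le_mul_of_nonneg_right (key p).2 h0
    simp only
    rw [le_div_iff₀ (by positivity)]
    field_simp
    linarith

/-! ### Measurability of the clusters of the forest fire process -/

lemma rightEnd_le {ξ ξ' : ℤ → Fin 3} {i f : ℤ} (hf : i < f) (h1 : ξ f ≠ 1)
    (h : ∀ j, i ≤ j → j ≤ f → ξ j = ξ' j) : rightEnd ξ i ≤ rightEnd ξ' i := by
  have h2 := (rightEnd_spec hf h1).2.1
  refine (rightEnd_spec hf (by rwa [← h f hf.le le_rfl])).2.2 _ fun g hg1 hg2 => ?_
  rw [← h g hg1.le (by omega)]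
  by_contra hcon
  have := (rightEnd_spec hg1 hcon).2.1
  omega

lemma le_leftEnd {ξ ξ' : ℤ → Fin 3} {i f : ℤ} (hf : f < i) (h1 : ξ f ≠ 1)
    (h : ∀ j, f ≤ j → j ≤ i → ξ j = ξ' j) : leftEnd ξ' i ≤ leftEnd ξ i := by
  have h2 := (leftEnd_spec hf h1).2.1
  refine (leftEnd_spec hf (by rwa [← h f le_rfl hf.le])).2.2 _ fun g hg1 hg2 => ?_
  rw [← h g (by omega) hg2.le]
  by_contra hcon
  have := (leftEnd_spec hg2 hcon).2.1
  omega

/-- The cluster only depends on the configuration between two unoccupied sites. -/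
lemma scaledComponent_congr (n : ℤ) {ξ ξ' : ℤ → Fin 3} {g i f : ℤ} (hg : g < i) (hf : i < f)
    (h1 : ξ g ≠ 1) (h2 : ξ f ≠ 1) (h : ∀ j, g ≤ j → j ≤ f → ξ j = ξ' j) :
    scaledComponent n ξ i = scaledComponent n ξ' i := by
  have e1 : rightEnd ξ i = rightEnd ξ' i := le_antisymm
    (rightEnd_le hf h2 fun j a b => h j (by omega) b)
    (rightEnd_le hf (by rwa [← h f (by omega) le_rfl]) fun j a b => (h j (by omega) b).symm)
  have e2 : leftEnd ξ i = leftEnd ξ' i := le_antisymm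
    (le_leftEnd hg (by rwa [← h g le_rfl (by omega)]) fun j a b => (h j a (by omega)).symm)
    (le_leftEnd hg h1 fun j a b => h j a (by omega))
  unfold scaledComponent
  rw [h i hg.le hf.le, e1, e2]

/-- Two sites that stay vacant confine the cluster, which then depends on finitely many coordinates.
These take discrete values, so they are constant just after and just before each time. Strict
monotonicity of `φ` carries left neighbourhoods to left neighbourhoods. -/
lemma isCadlag_scaledComponent {ξ : ℝ≥0 → ℤ → Fin 3} (hξ : ∀ i, IsCadlag fun t => ξ t i)
    {α : Type*} [LinearOrder α] [TopologicalSpace α] {φ : α → ℝ≥0} (hφ : Continuous φ)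
    (hφ' : StrictMono φ) (n : ℤ) (x : ℝ) {g i f : ℤ} (hg : g < i) (hf : i < f)
    (h0 : ∀ t, ξ (φ t) g = 0 ∧ ξ (φ t) f = 0) :
    IsCadlag (E := Cluster x) fun t => scaledComponent n (ξ (φ t)) i := by
  intro t
  have n01 : (0 : Fin 3) ≠ 1 := by decide
  constructor
  · have h1 : Tendsto φ (𝓝[≥] t) (𝓝[≥] (φ t)) :=
      tendsto_nhdsWithin_iff.2 ⟨hφ.continuousAt.continuousWithinAt,
        eventually_mem_nhdsWithin.mono fun s hs => hφ'.monotone hs⟩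
    have h2 : ∀ᶠ s in 𝓝[≥] t, ∀ j ∈ Finset.Icc g f, ξ (φ s) j = ξ (φ t) j := by
      refine (Filter.eventually_all_finset _).2 fun j _ => h1.eventually
        ((hξ j (φ t)).1.eventually (p := fun y => y = ξ (φ t) j) ?_)
      rw [nhds_discrete]
      exact Filter.eventually_pure.2 rfl
    refine tendsto_nhds_of_eventually_eq ?_
    filter_upwards [h2] with s hs
    exact scaledComponent_congr n hg hf (by rw [(h0 s).1]; exact n01) (by rw [(h0 s).2]; exact n01)
      fun j a b => hs j (Finset.mem_Icc.2 ⟨a, b⟩)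
  · have h1 : Tendsto φ (𝓝[<] t) (𝓝[<] (φ t)) :=
      tendsto_nhdsWithin_iff.2 ⟨hφ.continuousAt.continuousWithinAt,
        eventually_mem_nhdsWithin.mono fun s hs => hφ' hs⟩
    choose l hl using fun j => (hξ j (φ t)).2
    have h2 : ∀ᶠ s in 𝓝[<] t, ∀ j ∈ Finset.Icc g f, ξ (φ s) j = l j := by
      refine (Filter.eventually_all_finset _).2 fun j _ => h1.eventually
        ((hl j).eventually (p := fun y => y = l j) ?_)
      rw [nhds_discrete]
      exact Filter.eventually_pure.2 rfl
    refine ⟨(scaledComponent n l i : Cluster x), tendsto_nhds_of_eventually_eq ?_⟩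
    filter_upwards [h2] with s hs
    exact scaledComponent_congr n hg hf (by rw [(h0 s).1]; exact n01) (by rw [(h0 s).2]; exact n01)
      fun j a b => hs j (Finset.mem_Icc.2 ⟨a, b⟩)

lemma norm_clusterDist_le {x C₁ C₂ : ℝ} {I J : Interval ℝ} (h1 : |(ends x I).1| ≤ C₁)
    (h2 : |(ends x J).1| ≤ C₁) (h3 : |(ends x I).2| ≤ C₂) (h4 : |(ends x J).2| ≤ C₂) :
    ‖clusterDist x I J‖ ≤ 2 * C₁ + 2 * C₂ := by
  rw [Real.norm_of_nonneg (clusterDist_nonneg _ _ _)]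
  unfold clusterDist
  linarith [abs_sub (ends x I).1 (ends x J).1, abs_sub (ends x I).2 (ends x J).2]

/-- Càdlàg paths are limits of their discretisations. -/
lemma IsCadlag.tendsto_pathDist {T x : ℝ} (hT : 0 ≤ T) {f : Icc (0 : ℝ) T → Cluster x}
    (hf : IsCadlag f) :
    Tendsto (fun k : ℕ => pathDist T x
      (fun t => f (projIcc 0 T hT ((⌊(t : ℝ) * (k + 1)⌋₊ + 1) / (k + 1)))) f) atTop (𝓝 0) := by
  have hfin : IsFiniteMeasure ((volume : Measure ℝ).comap ((↑) : Icc (0 : ℝ) T → ℝ)) := by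
    refine ⟨?_⟩
    rw [comap_subtype_coe_apply measurableSet_Icc]
    exact (measure_mono (Subtype.coe_image_subset _ _)).trans_lt measure_Icc_lt_top
  obtain ⟨C₁, hC₁⟩ := (hf.comp (continuous_ends_fst x)).bounded
  obtain ⟨C₂, hC₂⟩ := (hf.comp (continuous_ends_snd x)).bounded
  have hcad : ∀ k : ℕ, IsCadlag fun t : Icc (0 : ℝ) T =>
      f (projIcc 0 T hT ((⌊(t : ℝ) * (k + 1)⌋₊ + 1) / (k + 1))) := fun k =>
    (isCadlag_step (E := Cluster x) (fun l => f (projIcc 0 T hT ((l + 1) / (k + 1))))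
      (r := (k : ℝ) + 1) (by positivity)).comp_subtype _
  have aux : ∀ s s', ‖clusterDist x (f s) (f s')‖ ≤ 2 * C₁ + 2 * C₂ := fun s s' =>
    norm_clusterDist_le (hC₁ s) (hC₁ s') (hC₂ s) (hC₂ s')
  suffices h : Tendsto (fun k : ℕ => pathDist T x
      (fun t => f (projIcc 0 T hT ((⌊(t : ℝ) * (k + 1)⌋₊ + 1) / (k + 1)))) f) atTop
      (𝓝 (∫ _ : Icc (0 : ℝ) T, (0 : ℝ) ∂(volume.comap ((↑) : Icc (0 : ℝ) T → ℝ)))) by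
    rwa [integral_zero] at h
  refine tendsto_integral_of_dominated_convergence (fun _ => 2 * C₁ + 2 * C₂)
    (fun k => (integrable_clusterDist (hcad k) hf).aestronglyMeasurable) (integrable_const _)
    (fun k => Eventually.of_forall fun t => ?_) (Eventually.of_forall fun t => ?_)
  · exact aux _ _
  · have hs1 : ∀ k : ℕ, (t : ℝ) ≤ (⌊(t : ℝ) * (k + 1)⌋₊ + 1) / (k + 1) := fun k => by
      rw [le_div_iff₀ (by positivity)]
      exact (Nat.lt_floor_add_one _).le
    have hs2 : ∀ k : ℕ, ((⌊(t : ℝ) * (k + 1)⌋₊ : ℝ) + 1) / (k + 1) ≤ t + 1 / ((k : ℝ) + 1) := by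
      intro k
      rw [div_le_iff₀ (by positivity), add_mul, one_div_mul_cancel (by positivity)]
      linarith [Nat.floor_le (show 0 ≤ (t : ℝ) * (k + 1) from mul_nonneg t.2.1 (by positivity))]
    have h1 : Tendsto (fun k : ℕ => ((⌊(t : ℝ) * (k + 1)⌋₊ : ℝ) + 1) / (k + 1)) atTop
        (𝓝 (t : ℝ)) := by
      refine tendsto_of_tendsto_of_tendsto_of_le_of_le tendsto_const_nhds
        (h := fun k : ℕ => (t : ℝ) + 1 / ((k : ℝ) + 1)) ?_ hs1 hs2
      simpa using (tendsto_const_nhds (x := (t : ℝ))).add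
        (tendsto_one_div_add_atTop_nhds_zero_nat (𝕜 := ℝ))
    have h2 : Tendsto (fun k : ℕ =>
        projIcc 0 T hT (((⌊(t : ℝ) * (k + 1)⌋₊ : ℝ) + 1) / (k + 1))) atTop (𝓝[≥] t) := by
      refine tendsto_nhdsWithin_iff.2 ⟨?_, Eventually.of_forall fun k => ?_⟩
      · have := ((continuous_projIcc (h := hT)).tendsto (t : ℝ)).comp h1
        rwa [projIcc_val] at this
      · have := monotone_projIcc hT (hs1 k)
        rwa [projIcc_val] at this
    exact tendsto_iff_dist_tendsto_zero.1 ((hf t).1.tendsto.comp h2)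

namespace IsDriven

variable {Ω : Type*} [MeasurableSpace Ω] {lam pi : ℝ} {η : ℝ≥0 → ℤ → Ω → Fin 3}
  {n : Fin 3 → ℤ → ℝ≥0 → Ω → ℕ} {P : Measure Ω}

/-- There are unseeded sites on both sides of `i`. -/
lemma exists_vacant (h : IsDriven lam pi η n P) (T : ℝ≥0) (i : ℤ) :
    ∀ᵐ ω ∂P, ∃ g f, g < i ∧ i < f ∧ ∀ t ≤ T, η t g ω = 0 ∧ η t f ω = 0 := by
  have := h.indep.isProbabilityMeasure
  have hR := h.ringModel T
  -- The interval `(0, T]` is treated as a single cell, and `c` is the probability that a site has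
  -- no seed in it. Then `l` consecutive sites are all seeded with probability at most `exp (-(l *
  -- c))`.
  set c := Real.exp (-((1 : ℕ) - (0 : ℕ) : ℝ) * (fireRate lam pi 0 * T)) with hc
  have hlim : Tendsto (fun l : ℕ => Real.exp (-(l * c))) atTop (𝓝 0) :=
    Real.tendsto_exp_neg_atTop_nhds_zero.comp
      (tendsto_natCast_atTop_atTop.atTop_mul_const (Real.exp_pos _))
  have key : ∀ s : ℕ → Set Ω, (∀ l, P.real (s l) ≤ Real.exp (-(l * c))) → P (⋂ l, s l) = 0 := by
    intro s hs
    have h1 : P.real (⋂ l, s l) ≤ 0 := ge_of_tendsto' hlim fun l =>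
      (measureReal_mono (iInter_subset s l) (measure_ne_top _ _)).trans (hs l)
    have h2 := le_antisymm h1 measureReal_nonneg
    rwa [measureReal_def, ENNReal.toReal_eq_zero_iff, or_iff_left (measure_ne_top _ _)] at h2
  have bound : ∀ (i : ℤ) (l : ℕ), P.real {ω | ∀ g, i ≤ g → g < i + l → ∃ c, 0 ≤ c ∧ c < 1 ∧
      ringsOf (ringEvents n T) 0 ω c g} ≤ Real.exp (-(l * c)) := by
    intro i l
    refine (hR.real_all_ring_le 0 i l zero_le_one).trans (le_of_eq ?_)
    rw [hc]
    congr 4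
    ring
  have h1 := key (fun l => _) fun l => bound (i + 1) l
  have h2 := key (fun l => _) fun l => bound (i - l) l
  have h1' := measure_eq_zero_iff_ae_notMem.1 h1
  have h2' := measure_eq_zero_iff_ae_notMem.1 h2
  filter_upwards [h1', h2', h.regular] with ω a1 a2 hr
  simp only [mem_iInter, mem_ofPred_eq, not_forall, not_exists, not_and] at a1 a2
  obtain ⟨l, f, hf1, hf2, hf3⟩ := a1
  obtain ⟨l', g, hg1, hg2, hg3⟩ := a2
  have vac : ∀ g, (∀ c, 0 ≤ c → c < 1 → ¬ringsOf (ringEvents n T) 0 ω c g) →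
      ∀ t ≤ T, η t g ω = 0 := by
    intro g hg
    have h3 := hg 0 le_rfl one_pos
    simp only [ringsOf, ringEvents, rings, mem_ofPred_eq, not_not, zero_add, Nat.cast_one,
      one_mul, Nat.cast_zero, zero_mul] at h3
    have h4 : n 0 g 0 ω ≤ n 0 g T ω := hr.monoS g zero_le
    exact hr.vacant_of_no_seed (i := g) (T := T) (show n 0 g T ω = n 0 g 0 ω by omega)
  exact ⟨g, f, by omega, by omega, fun t ht => ⟨vac g hg3 t ht, vac f hf3 t ht⟩⟩

variable {q : ℕ} (x : Fin q → ℝ)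

lemma time_continuous (a T : ℝ) : Continuous fun t : Icc (0 : ℝ) T => (a * t).toNNReal :=
  continuous_real_toNNReal.comp (continuous_const.mul continuous_subtype_val)

lemma time_strictMono {a : ℝ} (ha : 0 < a) (T : ℝ) :
    StrictMono fun t : Icc (0 : ℝ) T => (a * t).toNNReal := by
  intro s t hst
  have h1 : (s : ℝ) < t := hst
  exact (Real.toNNReal_lt_toNNReal_iff_of_nonneg (mul_nonneg ha.le s.2.1)).2
    (mul_lt_mul_of_pos_left h1 ha)

lemma exists_vacant_path (h : IsDriven lam pi η n P) (T : ℝ) :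
    ∀ᵐ ω ∂P, ∀ i : Fin q, ∃ g f, g < ⌊(nScale lam : ℝ) * x i⌋ ∧ ⌊(nScale lam : ℝ) * x i⌋ < f ∧
      ∀ t ≤ (aScale lam * T).toNNReal, η t g ω = 0 ∧ η t f ω = 0 :=
  ae_all_iff.2 fun _ => h.exists_vacant _ _

lemma isCadlag_rescaledCluster (h : IsDriven lam pi η n P) (ha : 0 < aScale lam) (T : ℝ) :
    ∀ᵐ ω ∂P, ∀ i, IsCadlag (fun t : Icc (0 : ℝ) T =>
      rescaledCluster lam (fun s k => η s k ω) t (x i)) := by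
  filter_upwards [h.exists_vacant_path x T, h.regular] with ω h1 hr i
  obtain ⟨g, f, hg, hf, h0⟩ := h1 i
  refine isCadlag_scaledComponent (ξ := fun s k => η s k ω) hr.cadlag (time_continuous _ T)
    (time_strictMono ha T) _ _ hg hf fun t => h0 _ ?_
  exact Real.toNNReal_le_toNNReal (mul_le_mul_of_nonneg_left t.2.2 ha.le)

/-- The states of the sites of a window at the times `s l`, as a finite vector. -/
def states (η : ℝ≥0 → ℤ → Ω → Fin 3) (K L : ℕ) (s : ℕ → ℝ≥0) (ω : Ω)
    (c : Fin K × Finset.Icc (-L : ℤ) L) : Fin 3 := η (s c.1) c.2 ω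

omit [MeasurableSpace Ω] in
/-- The configuration that is described by a finite vector. -/
def ofStates {K L : ℕ} (v : Fin K × Finset.Icc (-L : ℤ) L → Fin 3) (l : ℕ) (g : ℤ) : Fin 3 :=
  if h : l < K ∧ g ∈ Finset.Icc (-L : ℤ) L then v (⟨l, h.1⟩, ⟨g, h.2⟩) else 0

omit [MeasurableSpace Ω] in
lemma ofStates_states {K L : ℕ} {s : ℕ → ℝ≥0} {ω : Ω} {l : ℕ} (hl : l < K) {g : ℤ}
    (hg : g ∈ Finset.Icc (-L : ℤ) L) : ofStates (states η K L s ω) l g = η (s l) g ω :=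
  dif_pos ⟨hl, hg⟩

lemma measurableSet_states (h : IsDriven lam pi η n P) (K L : ℕ) (s : ℕ → ℝ≥0)
    (v : Fin K × Finset.Icc (-L : ℤ) L → Fin 3) :
    MeasurableSet (states η K L s ⁻¹' {v}) := by
  have : states η K L s ⁻¹' {v} = ⋂ c : Fin K × Finset.Icc (-L : ℤ) L,
      η (s c.1) c.2 ⁻¹' {v c} := by
    ext ω
    simp [states, funext_iff]
  rw [this]
  exact MeasurableSet.iInter fun c => h.measurable _ _ (measurableSet_singleton _)

omit [MeasurableSpace Ω] in
lemma scaledComponent_ofStates {K L : ℕ} {s : ℕ → ℝ≥0} {ω : Ω} {l : ℕ} (hl : l < K) (N : ℤ)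
    {g i f : ℤ} (hg : g < i) (hf : i < f) (h0 : η (s l) g ω = 0 ∧ η (s l) f ω = 0)
    (h1 : -(L : ℤ) ≤ g) (h2 : f ≤ L) :
    scaledComponent N (fun k => η (s l) k ω) i =
      scaledComponent N (ofStates (states η K L s ω) l) i := by
  have n01 : (0 : Fin 3) ≠ 1 := by decide
  refine scaledComponent_congr N hg hf (by rw [h0.1]; exact n01) (by rw [h0.2]; exact n01)
    fun j a b => (ofStates_states hl ?_).symm
  exact Finset.mem_Icc.2 ⟨by omega, by omega⟩

/-- Almost surely vacant sites confine each cluster, so it eventually equals the cluster computed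
from the states in the window `[-L, L]`, a function of a finite variable. -/
lemma aemeasurable_clusterTuple (h : IsDriven lam pi η n P) (t : Fin q → ℝ) :
    AEMeasurable (β := ClusterTuple x)
      (fun ω i => rescaledCluster lam (fun s k => η s k ω) (t i) (x i)) P := by
  classical
  set s : ℕ → ℝ≥0 := fun l => if hl : l < q then (aScale lam * t ⟨l, hl⟩).toNNReal else 0 with hs
  have hsi : ∀ i : Fin q, s i = (aScale lam * t i).toNNReal := fun i => dif_pos i.2
  let H : ∀ L : ℕ, (Fin q × Finset.Icc (-L : ℤ) L → Fin 3) → ClusterTuple x := fun L v i =>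
    scaledComponent (nScale lam) (ofStates v i) ⌊(nScale lam : ℝ) * x i⌋
  refine aemeasurable_of_tendsto_metrizable_ae' (β := ClusterTuple x)
    (f := fun L ω => H L (states η q L s ω))
    (fun L => aemeasurable_comp_finite (h.measurableSet_states q L s) (H L)) ?_
  have hv : ∀ᵐ ω ∂P, ∀ i : Fin q, ∃ g f, g < ⌊(nScale lam : ℝ) * x i⌋ ∧
      ⌊(nScale lam : ℝ) * x i⌋ < f ∧ ∀ u ≤ s i, η u g ω = 0 ∧ η u f ω = 0 :=
    ae_all_iff.2 fun i => h.exists_vacant _ _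
  filter_upwards [hv] with ω hω
  refine tendsto_nhds_of_eventually_eq ?_
  choose g f hg hf h0 using hω
  have hL : ∀ᶠ L : ℕ in atTop, ∀ i, -(L : ℤ) ≤ g i ∧ f i ≤ L := by
    refine eventually_all.2 fun i => ?_
    filter_upwards [eventually_ge_atTop ((-g i).toNat + (f i).toNat)] with L hL
    omega
  filter_upwards [hL] with L hL
  funext i
  unfold rescaledCluster
  rw [← hsi]
  exact (scaledComponent_ofStates (η := η) i.2 _ (hg i) (hf i) (h0 i _ le_rfl) (hL i).1
    (hL i).2).symm

/-- The path is the almost sure limit of step paths with mesh `1 / (k + 1)`, computed from the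
states in the window `[-k, k]` at finitely many times. Once the window contains the confining vacant
sites, these are exactly the discretisations of the path. -/
lemma aemeasurable_pathTuple (h : IsDriven lam pi η n P) (ha : 0 < aScale lam) {T : ℝ}
    (hT : 0 ≤ T) :
    AEMeasurable (fun ω => toPathTuple T x (fun i t =>
      rescaledCluster lam (fun s k => η s k ω) t (x i))) P := by
  set s : ℕ → ℕ → ℝ≥0 := fun k l =>
    (aScale lam * projIcc 0 T hT (((l : ℝ) + 1) / (k + 1))).toNNReal with hs
  set K : ℕ → ℕ := fun k => ⌊T * (k + 1)⌋₊ + 1 with hK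
  have hcad : ∀ (k : ℕ) (F : ℕ → ∀ i, Cluster (x i)) i, IsCadlag
      fun t : Icc (0 : ℝ) T => F ⌊(t : ℝ) * (k + 1)⌋₊ i := fun k F i =>
    (isCadlag_step (E := Cluster (x i)) (fun l => F l i)
      (r := (k : ℝ) + 1) (by positivity)).comp_subtype _
  let H : ∀ k : ℕ, (Fin (K k) × Finset.Icc (-k : ℤ) k → Fin 3) → PathTuple T x := fun k v =>
    toPathTuple T x (fun i t => scaledComponent (nScale lam) (ofStates v ⌊(t : ℝ) * (k + 1)⌋₊)
      ⌊(nScale lam : ℝ) * x i⌋)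
  refine aemeasurable_of_tendsto_metrizable_ae' (f := fun k ω => H k (states η (K k) k (s k) ω))
    (fun k => aemeasurable_comp_finite (h.measurableSet_states (K k) k (s k)) (H k)) ?_
  filter_upwards [h.exists_vacant_path x T, h.isCadlag_rescaledCluster x ha T] with ω hω hcω
  choose g f hg hf h0 using hω
  have hL : ∀ᶠ L : ℕ in atTop, ∀ i, -(L : ℤ) ≤ g i ∧ f i ≤ L := by
    refine eventually_all.2 fun i => ?_
    filter_upwards [eventually_ge_atTop ((-g i).toNat + (f i).toNat)] with L hL
    omega
  rw [tendsto_iff_dist_tendsto_zero]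
  have hlim : Tendsto (fun k : ℕ => ∑ i, pathDist T (x i)
      (fun t => rescaledCluster lam (fun s k => η s k ω)
        (projIcc 0 T hT ((⌊(t : ℝ) * (k + 1)⌋₊ + 1) / (k + 1)) : Icc (0 : ℝ) T) (x i))
      (fun t => rescaledCluster lam (fun s k => η s k ω) t (x i))) atTop (𝓝 (∑ i : Fin q, 0)) :=
    tendsto_finsetSum _ fun i _ => (hcω i).tendsto_pathDist hT
  rw [Finset.sum_const_zero] at hlim
  refine hlim.congr' ?_
  filter_upwards [hL] with k hk
  refine Finset.sum_congr rfl fun i _ => ?_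
  simp only [H]
  rw [toPathTuple_val (hcad k (fun l i => scaledComponent (nScale lam)
    (ofStates (states η (K k) k (s k) ω) l) ⌊(nScale lam : ℝ) * x i⌋)),
    toPathTuple_val hcω]
  congr 1
  funext t
  have hl : ⌊(t : ℝ) * (k + 1)⌋₊ < K k := by
    rw [hK]
    exact Nat.lt_succ_of_le (Nat.floor_le_floor (by gcongr; exact t.2.2))
  refine scaledComponent_ofStates (η := η) (s := s k) hl _ (hg i) (hf i) (h0 i _ ?_) (hk i).1
    (hk i).2
  exact Real.toNNReal_le_toNNReal (mul_le_mul_of_nonneg_left (projIcc 0 T hT _).2.2 ha.le)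

end IsDriven

/-! ### The discrete process is close to its grid path -/

/-- Translation from steps to real times. As `u * K₀ * m` is the time scale, the rescaled time `t`
falls in the step `⌊t * m * K₀⌋`, and the configuration at that time is the one at an end of the
step. -/
lemma IsRegularFire.closeToGrid {z₀ lam : ℝ} {ξ : ℝ≥0 → ℤ → Fin 3} {nS nM nP : ℤ → ℝ≥0 → ℕ}
    (hr : IsRegularFire ξ nS nM nP) {m A T K₀ D : ℕ} {u : ℝ≥0} (hu : 0 < u) (hm : 0 < m)
    (hK : 0 < K₀) (huK : (u : ℝ) * K₀ * m = aScale lam)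
    (hs : SimpleCells (((A * m - 1) * D : ℕ) + 2) (T * m * K₀) ![nS, nM, nP] u)
    (hR : TypicalRings z₀ m (T * m) K₀ (nScale lam) D (((A * m - 1) * D : ℕ) : ℤ) (rings nS u)
      (rings nM u) (rings nP u)) (hn : 0 < nScale lam) (hdm : (D : ℤ) * m ≤ nScale lam)
    (hnd : nScale lam < ((D : ℤ) + 1) * m) (hA : 20 ≤ A * m) (hAD : A * m ≤ D) (hT : 0 < T)
    {V : ℤ → ℕ → Prop}
    (hV : ∀ b j, V b j ↔ -((A * m : ℕ) : ℤ) ≤ b ∧ b < (A * m : ℕ) ∧ j < T * m ∧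
      ∃ i, block (nScale lam) m i = b ∧ rings nM (K₀ * u) j i)
    (hIV : ∀ b j b' j', V b j → V b' j' → |b - b'| ≤ 10 → b = b' ∧ j = j') {x : ℝ}
    (hG : GoodCells z₀ m (A * m : ℕ) (T * m) V x)
    (hlate : LateSites m K₀ D (rings nS u) ⌊(nScale lam : ℝ) * x⌋) :
    CloseToGrid z₀ m (A * m : ℕ) (T * m) V x (fun t => rescaledCluster lam ξ t x) := by
  obtain ⟨hev, hcell⟩ := hr.isEvolution hu hs
  have hm' : (0 : ℝ) < m := by exact_mod_cast hm
  have hK' : (0 : ℝ) < K₀ := by exact_mod_cast hK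
  have hu' : (0 : ℝ) < u := hu
  refine hR.closeToGrid hev hn hm hK hdm hnd (by exact_mod_cast hA) (by exact_mod_cast hAD) ?_
    (Nat.le_mul_of_pos_left _ hT) (fun b j => ?_) hIV hG hlate
    (ξ := fun t => ξ (aScale lam * t).toNNReal) fun t k h1 h2 hk => ?_
  · rw [Nat.cast_mul, Nat.cast_sub (by omega)]
    rfl
  · rw [hV]
    refine and_congr_right fun _ => and_congr_right fun _ => and_congr_right fun _ => ?_
    refine exists_congr fun i => ?_
    rw [rings_iff hr.monoM, ← exists_and_left]
  · have ht : 0 ≤ t * m := (Nat.cast_nonneg k).trans h1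
    have hc1 : (⌊t * m * K₀⌋₊ : ℝ) ≤ t * m * K₀ := Nat.floor_le (by positivity)
    have hc2 : t * m * K₀ < ⌊t * m * K₀⌋₊ + 1 := Nat.lt_floor_add_one _
    set c := ⌊t * m * K₀⌋₊ with hc
    have h3 : k * K₀ ≤ c := Nat.le_floor (by push_cast; gcongr)
    have h4 : c < (k + 1) * K₀ := by
      have : (c : ℝ) < ((k + 1) * K₀ : ℕ) := by
        push_cast
        exact hc1.trans_lt (by gcongr)
      exact_mod_cast this
    have h5 : c < T * m * K₀ := h4.trans_le (Nat.mul_le_mul_right _ hk)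
    have e : aScale lam * t = t * m * K₀ * u := by rw [← huK]; ring
    have hat : 0 ≤ aScale lam * t := by rw [e]; positivity
    rcases hcell c h5 (aScale lam * t).toNNReal (by
        rw [← NNReal.coe_le_coe, Real.coe_toNNReal _ hat, e]
        push_cast
        gcongr) (by
        rw [← NNReal.coe_le_coe, Real.coe_toNNReal _ hat, e]
        push_cast
        gcongr) with h6 | h6
    · exact ⟨c, h3, h4.le, h6⟩
    · exact ⟨c + 1, h3.trans (Nat.le_succ c), h4, h6⟩

/-- With high probability the clusters of the discrete process are close to the clusters of the
grid, on the event that the pattern of the matches is good. -/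
theorem eventually_closeToGrid {z₀ : ℝ} (hz : z₀ ∈ Icc (0 : ℝ) 1)
    {Ω : Params → Type u} [∀ p, MeasurableSpace (Ω p)]
    (P : ∀ p, Measure (Ω p)) [∀ p, IsProbabilityMeasure (P p)]
    {η : ∀ p, ℝ≥0 → ℤ → Ω p → Fin 3} {n : ∀ p, Fin 3 → ℤ → ℝ≥0 → Ω p → ℕ}
    (hη : ∀ p, IsDriven p.lam p.pi (η p) (n p) (P p)) {m A T : ℕ} (hm : 0 < m) (hA : 20 ≤ A * m)
    (hT : 0 < T) {q : ℕ} (x : Fin q → ℝ) (n₀ : ℕ) (κ : Fin q → ℕ) {ε : ℝ} (hε : 0 < ε) :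
    ∀ᶠ p in slowRegime z₀, (P p).real {ω |
      GoodState z₀ m (A * m : ℕ) (T * m) (cellsOf (matchPattern (nScale p.lam) m (A * m) (T * m)
        (ringEvents (n p) (aScale p.lam / m).toNNReal) ω)) x n₀ κ ∧
      ¬∀ i, CloseToGrid z₀ m (A * m : ℕ) (T * m) (cellsOf (matchPattern (nScale p.lam) m (A * m)
        (T * m) (ringEvents (n p) (aScale p.lam / m).toNNReal) ω)) (x i)
        (fun t => rescaledCluster p.lam (fun s k => η p s k ω) t (x i))} ≤
      4 * A * T / m ^ 2 + ε := by
  have hA0 : 0 < A := Nat.pos_of_ne_zero fun h => by simp [h] at hA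
  have hm' : (0 : ℝ) < m := by exact_mod_cast hm
  set δ : ℝ := ε / (q + 2) with hδ
  have hδ0 : 0 < δ := by positivity
  filter_upwards [eventually_typicalRings (T := T) hz hm hA0 hδ0, eventually_nScale_pos,
    (tendsto_blockSize hm).eventually_ge_atTop ((A * m : ℕ) : ℝ)] with p htyp hn hAD
  have hAD' : A * m ≤ blockSize m p := by exact_mod_cast hAD
  set a := aScale p.lam with ha
  have ha0 : 0 < a := aScale_pos p
  set D := blockSize m p with hD
  set τ : ℝ≥0 := (a / m).toNNReal with hτ
  have hτR : (τ : ℝ) = a / m := Real.coe_toNNReal _ (by positivity)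
  have hτ0 : 0 < τ := Real.toNNReal_pos.2 (by positivity)
  set ρ : ℝ≥0 := 1 + p.lam.toNNReal + p.pi.toNNReal with hρ
  have hρk : ∀ k, fireRate p.lam p.pi k ≤ ρ := by
    intro k
    fin_cases k
    · exact (le_add_of_nonneg_right zero_le).trans (le_add_of_nonneg_right zero_le)
    · exact (le_add_of_nonneg_left zero_le).trans (le_add_of_nonneg_right zero_le)
    · exact le_add_of_nonneg_left zero_le
  set C : ℝ := T * m * (3 * (2 * ((A * m - 1) * D + 2 : ℕ) + 1)) ^ 2 * (ρ * τ) ^ 2 with hC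
  -- The number of steps is chosen last, depending on `p`; this is possible because the estimate on
  -- typical rings holds for all `K₀` at once. The third condition makes the steps simple with
  -- probability at least `1 - δ`.
  obtain ⟨K₀, hK1, hK2, hK3, hK⟩ :
      ∃ K₀ : ℕ, a / m / K₀ ≤ p.lam ∧ p.pi * (a / m) / K₀ ≤ 1 ∧ C / K₀ ≤ δ ∧ 0 < K₀ :=
    (((tendsto_const_div_atTop_nhds_zero_nat (a / m)).eventually_le_const p.lam_pos).and
      (((tendsto_const_div_atTop_nhds_zero_nat (p.pi * (a / m))).eventually_le_const one_pos).and
      (((tendsto_const_div_atTop_nhds_zero_nat C).eventually_le_const hδ0).and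
        (eventually_gt_atTop 0)))).exists
  have hK' : (0 : ℝ) < K₀ := by exact_mod_cast hK
  set u : ℝ≥0 := τ / K₀ with hu
  have huR : (u : ℝ) = a / m / K₀ := by rw [hu, NNReal.coe_div, hτR]; rfl
  have hu0 : 0 < u := div_pos hτ0 (by exact_mod_cast hK)
  have hKu : (K₀ : ℝ≥0) * u = τ := mul_div_cancel₀ _ (by exact_mod_cast hK.ne')
  have hmodel : RingModel (P p) (ringEvents (n p) u) ![a / m / K₀, p.lam * (a / m / K₀),
      p.pi * (a / m / K₀)] := by
    have h1 := (hη p).ringModel u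
    refine ⟨h1.measurable, h1.indep, fun s => ?_⟩
    rw [h1.law, huR]
    congr 2
    obtain ⟨k, s⟩ := s
    fin_cases k
    · simp [fireRate]
    · simp [fireRate, p.lam_pos.le]
    · simp [fireRate, zero_le_one.trans p.one_le_pi]
  obtain ⟨ht1, ht2⟩ := htyp K₀ hK hK1 (by rwa [← mul_div_assoc]) (P p) _ hmodel
  have hsimple := (hη p).real_not_simpleCells_le u ((A * m - 1) * D + 2) (T * m * K₀) hρk
  have hsimple' : ((T * m * K₀ : ℕ) : ℝ) * (3 * (2 * (((A * m - 1) * D + 2 : ℕ) : ℝ) + 1)) ^ 2 *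
      (ρ * u) ^ 2 ≤ δ := by
    refine le_trans (le_of_eq ?_) hK3
    rw [hC, hu]
    push_cast
    field_simp
  set Bad : Set (Ω p) := ({ω | ¬SimpleCells (((A * m - 1) * D + 2 : ℕ) : ℤ) (T * m * K₀)
      ![fun i t => n p 0 i t ω, fun i t => n p 1 i t ω, fun i t => n p 2 i t ω] u} ∪
    {ω | ¬TypicalRings z₀ m (T * m) K₀ (nScale p.lam) D (((A * m - 1) * D : ℕ) : ℤ)
      (ringsOf (ringEvents (n p) u) 0 ω) (ringsOf (ringEvents (n p) u) 1 ω)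
      (ringsOf (ringEvents (n p) u) 2 ω)}) ∪
    ⋃ i ∈ (Finset.univ : Finset (Fin q)), {ω | ¬LateSites m K₀ D (ringsOf (ringEvents (n p) u) 0 ω)
      ⌊(nScale p.lam : ℝ) * x i⌋} with hBad
  have hle : (P p).real Bad ≤ 4 * A * T / m ^ 2 + ε := by
    have h1 : (P p).real (⋃ i ∈ (Finset.univ : Finset (Fin q)), {ω | ¬LateSites m K₀ D
        (ringsOf (ringEvents (n p) u) 0 ω) ⌊(nScale p.lam : ℝ) * x i⌋}) ≤ q * δ := by
      refine (measureReal_biUnion_finset_le _ _).trans ((Finset.sum_le_sum fun i _ => ht2 _).trans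
        (le_of_eq ?_))
      simp
    have h2 : ε = q * δ + δ + δ := by rw [hδ]; field_simp; ring
    refine (measureReal_union_le _ _).trans ?_
    have h3 := measureReal_union_le (μ := P p) {ω | ¬SimpleCells (((A * m - 1) * D + 2 : ℕ) : ℤ)
      (T * m * K₀) ![fun i t => n p 0 i t ω, fun i t => n p 1 i t ω, fun i t => n p 2 i t ω] u}
      {ω | ¬TypicalRings z₀ m (T * m) K₀ (nScale p.lam) D (((A * m - 1) * D : ℕ) : ℤ)
      (ringsOf (ringEvents (n p) u) 0 ω) (ringsOf (ringEvents (n p) u) 1 ω)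
      (ringsOf (ringEvents (n p) u) 2 ω)}
    linarith [hsimple.trans hsimple']
  refine le_trans ?_ hle
  refine ENNReal.toReal_mono (measure_ne_top _ _) (measure_mono_ae ?_)
  filter_upwards [(hη p).regular] with ω hreg hω
  by_contra hcon
  replace hcon : ω ∉ Bad := hcon
  simp only [hBad, mem_union, mem_ofPred_eq, mem_iUnion, Finset.mem_univ, exists_const,
    not_or, not_not, not_exists] at hcon
  obtain ⟨hgood, hnc⟩ := hω
  obtain ⟨⟨c1, c2⟩, c3⟩ := hcon
  refine hnc fun i => ?_
  refine hreg.closeToGrid hu0 hm hK ?_ (by exact_mod_cast c1) c2 hn (blockSize_spec hm p).1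
    (blockSize_spec hm p).2 hA hAD' hT (fun b j => ?_) hgood.isolated (hgood.cells i) (c3 i)
  · rw [huR]
    field_simp
    rfl
  · rw [hKu]
    exact cellsOf_iff (w := fun b j => ∃ i, block (nScale p.lam) m i = b ∧
      rings (fun i t => n p 1 i t ω) τ j i) (fun s => Iff.rfl) b j

/-! ### Convergence in law through the grid -/

lemma measureReal_preimage_finite {Ω S : Type*} [MeasurableSpace Ω] [Fintype S] {P : Measure Ω}
    [IsFiniteMeasure P] {U : Ω → S} (hU : ∀ s, MeasurableSet (U ⁻¹' {s})) (c : S → Prop)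
    [DecidablePred c] :
    P.real {ω | c (U ω)} = ∑ s with c s, P.real (U ⁻¹' {s}) := by
  have : {ω | c (U ω)} = ⋃ s ∈ Finset.univ.filter c, U ⁻¹' {s} := by
    ext ω
    simp
  rw [this, measureReal_biUnion_finset
    (fun s _ s' _ h => (disjoint_singleton.2 h).preimage U) fun s _ => hU s]

instance (z₀ : ℝ) : (slowRegime z₀).IsCountablyGenerated := by
  unfold slowRegime
  infer_instance

/-- Both probabilities are products over the finite grid, with the same choice of factors `exp (-c)`
or `1 - exp (-c)`. The mean number `c` of matches in a cell tends to `1 / m ^ 2`. -/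
lemma tendsto_real_matchPattern {z₀ : ℝ} {Ω : Params → Type*} [∀ p, MeasurableSpace (Ω p)]
    {P : ∀ p, Measure (Ω p)} [∀ p, IsProbabilityMeasure (P p)]
    {η : ∀ p, ℝ≥0 → ℤ → Ω p → Fin 3} {n : ∀ p, Fin 3 → ℤ → ℝ≥0 → Ω p → ℕ}
    (hη : ∀ p, IsDriven p.lam p.pi (η p) (n p) (P p))
    {Ω' : Type*} [MeasurableSpace Ω'] {P' : Measure Ω'} [IsProbabilityMeasure P']
    {M : Ω' → Measure (ℝ × ℝ)}
    (hM : IsPoissonMeasure M (volume.restrict (univ ×ˢ Ici (0 : ℝ))) P') {m : ℕ} (hm : 0 < m)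
    (B J : ℕ) (v : GridIndex B J → Prop) :
    Tendsto (fun p => (P p).real (matchPattern (nScale p.lam) m B J
      (ringEvents (n p) (aScale p.lam / m).toNNReal) ⁻¹' {v})) (slowRegime z₀)
      (𝓝 (P'.real (markPattern m B J M ⁻¹' {v}))) := by
  classical
  rw [real_markPattern hM hm]
  refine Tendsto.congr' (f₁ := fun p : Params => ∏ s : GridIndex B J, if v s then
      1 - Real.exp (-(((firstSite (nScale p.lam) m (s.1.1 + 1) -
        firstSite (nScale p.lam) m s.1.1 : ℤ) : ℝ) * (p.lam * (aScale p.lam / m))))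
      else Real.exp (-(((firstSite (nScale p.lam) m (s.1.1 + 1) -
        firstSite (nScale p.lam) m s.1.1 : ℤ) : ℝ) * (p.lam * (aScale p.lam / m))))) ?_
    (tendsto_finsetProd _ fun s _ => ?_)
  · filter_upwards [eventually_nScale_pos] with p hn
    rw [((hη p).ringModel _).real_matchPattern hn hm]
    have h0 := aScale_pos p
    simp only [fireRate, Matrix.cons_val_one, Matrix.cons_val_zero, Real.coe_toNNReal _ p.lam_pos.le,
      Real.coe_toNNReal (aScale p.lam / m) (by positivity)]
  · have h := (Real.continuous_exp.tendsto _).comp (tendsto_matches (z₀ := z₀) hm s.1.1).neg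
    split_ifs
    · exact h.const_sub 1
    · exact h

/-- The common end of both convergence statements. `g m V` is the deterministic object attached to
the pattern `V`, and `e A m` its distance to the two random objects when the pattern is good. The
choices of `κ` (cells not to be hit) and `n₀` (allowed number of hit cells) differ between the
applications. -/
theorem tendstoInDistribution_of_grid {z₀ : ℝ} (hz : z₀ ∈ Icc (0 : ℝ) 1)
    {Ω : Params → Type u} [∀ p, MeasurableSpace (Ω p)]
    {P : ∀ p, Measure (Ω p)} [∀ p, IsProbabilityMeasure (P p)]
    {η : ∀ p, ℝ≥0 → ℤ → Ω p → Fin 3} {n : ∀ p, Fin 3 → ℤ → ℝ≥0 → Ω p → ℕ}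
    (hη : ∀ p, IsDriven p.lam p.pi (η p) (n p) (P p))
    {Ω' : Type*} [MeasurableSpace Ω'] {P' : Measure Ω'} [IsProbabilityMeasure P']
    {M : Ω' → Measure (ℝ × ℝ)} {Y : ℝ≥0 → ℝ → Ω' → ℝ} (hY : IsLFFP z₀ M Y P')
    {E : Type*} [PseudoMetricSpace E] [MeasurableSpace E] [BorelSpace E]
    {X : ∀ p, Ω p → E} {Z : Ω' → E} (hX : ∀ p, AEMeasurable (X p) (P p)) {q : ℕ} (x : Fin q → ℝ)
    (κ : ℕ → Fin q → ℕ) {n₀ : ℕ → ℕ} (hn : Tendsto n₀ atTop atTop) {T : ℕ} (hT : 2 ≤ T)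
    (g : ℕ → (ℤ → ℕ → Prop) → E) {e : ℕ → ℕ → ℝ} (he : ∀ A, Tendsto (e A) atTop (𝓝 0))
    (hclose : ∀ A, ∀ᶠ m : ℕ in atTop,
      (∀ p, ∀ᵐ ω ∂(P p), ∀ V, GoodState z₀ m (A * m : ℕ) (T * m) V x (n₀ m) (κ m) →
        (∀ i, CloseToGrid z₀ m (A * m : ℕ) (T * m) V (x i)
          (fun t => rescaledCluster p.lam (fun s k => η p s k ω) t (x i))) →
        dist (X p ω) (g m V) ≤ e A m) ∧
      (∀ᵐ ω ∂P', ∀ V, GoodState z₀ m (A * m : ℕ) (T * m) V x (n₀ m) (κ m) →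
        (∀ i, CloseToGrid z₀ m (A * m : ℕ) (T * m) V (x i)
          (fun t => limitCluster (fun s u => Y s u ω) t (x i))) →
        dist (Z ω) (g m V) ≤ e A m)) :
    TendstoInDistribution X (slowRegime z₀) Z P P' := by
  classical
  obtain ⟨hM, -, hYae⟩ := hY
  refine tendstoInDistribution_of_approx hX fun ε hε => ?_
  -- First the width `A`, from `ε` alone; then a single `m`, large enough for all errors; only then
  -- the parameters move along the regime.
  obtain ⟨A, hA, hgood⟩ := exists_goodState hM hz x κ hn hT (show 0 < ε / 4 by positivity)
  have hsq : Tendsto (fun m : ℕ => 4 * A * T / (m : ℝ) ^ 2) atTop (𝓝 0) :=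
    tendsto_const_nhds.div_atTop
      ((tendsto_pow_atTop two_ne_zero).comp tendsto_natCast_atTop_atTop)
  obtain ⟨m, hm, hm20, hme, hmA, hmX, hmZ⟩ := (hgood.and ((eventually_ge_atTop 20).and
    (((he A).eventually_le_const hε).and ((hsq.eventually_le_const
      (show 0 < ε / 8 by positivity)).and (hclose A))))).exists
  have hm0 : 0 < m := by omega
  have hAm : 20 ≤ A * m := hm20.trans (Nat.le_mul_of_pos_left _ hA)
  have hUm : ∀ p s, MeasurableSet ((fun ω => matchPattern (nScale p.lam) m (A * m) (T * m)
      (ringEvents (n p) (aScale p.lam / m).toNNReal) ω) ⁻¹' {s}) := fun p s =>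
    measurableSet_matchPattern ((hη p).ringModel _) _ _ _ _ s
  have hVm := measurableSet_markPattern hM m (A * m) (T * m)
  have hlim := tendsto_real_matchPattern (z₀ := z₀) hη hM hm0 (A * m) (T * m)
  refine ⟨GridIndex (A * m) (T * m) → Prop, Fintype.ofFinite _, fun p ω =>
    matchPattern (nScale p.lam) m (A * m) (T * m) (ringEvents (n p) (aScale p.lam / m).toNNReal) ω,
    markPattern m (A * m) (T * m) M, fun v => g m (cellsOf v), hUm, hVm, hlim, ?_, ?_⟩
  · set c : (GridIndex (A * m) (T * m) → Prop) → Prop := fun v =>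
      ¬GoodState z₀ m (A * m : ℕ) (T * m) (cellsOf v) x (n₀ m) (κ m) with hc
    -- Being good is a property of the pattern, so its probability for the discrete process is
    -- controlled by the limit through the convergence of the finite laws.
    have h1 : Tendsto (fun p => (P p).real {ω | c (matchPattern (nScale p.lam) m (A * m) (T * m)
        (ringEvents (n p) (aScale p.lam / m).toNNReal) ω)}) (slowRegime z₀)
        (𝓝 (P'.real {ω | c (markPattern m (A * m) (T * m) M ω)})) := by
      have := Fintype.ofFinite (GridIndex (A * m) (T * m) → Prop)
      simp only [measureReal_preimage_finite (hUm _) c, measureReal_preimage_finite hVm c]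
      exact tendsto_finsetSum _ fun s _ => hlim s
    have h2 : P'.real {ω | c (markPattern m (A * m) (T * m) M ω)} ≤ ε / 4 := by
      simp only [hc, cellsOf_markPattern]
      exact ENNReal.toReal_le_of_le_ofReal (by positivity) hm
    filter_upwards [h1.eventually_lt_const (show _ < ε / 2 by linarith),
      eventually_closeToGrid hz P hη (T := T) hm0 hAm (by omega) x (n₀ m) (κ m)
        (show 0 < ε / 8 by positivity)] with p h3 h4
    rw [← ENNReal.ofReal_toReal (measure_ne_top (P p) _)]
    refine ENNReal.ofReal_le_ofReal ?_
    have h5 := (measureReal_union_le (μ := P p) _ _).trans (add_le_add h3.le h4)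
    refine le_trans (ENNReal.toReal_mono (measure_ne_top _ _) (measure_mono_ae ?_))
      (h5.trans (by linarith))
    filter_upwards [hmX p] with ω hω hlt
    by_contra hcon
    refine absurd (lt_of_lt_of_le hlt ?_) (lt_irrefl ε)
    replace hcon := not_or.1 hcon
    simp only [hc, mem_ofPred_eq, not_and, not_not] at hcon
    exact (hω _ hcon.1 (hcon.2 hcon.1)).trans hme
  · refine le_trans (le_trans (measure_mono_ae ?_) hm) (ENNReal.ofReal_le_ofReal (by linarith))
    filter_upwards [hmZ, hYae, goodMarks_ae hM z₀] with ω hω hy hμ hlt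
    by_contra hcon
    refine absurd (lt_of_lt_of_le hlt ?_) (lt_irrefl ε)
    have hG := not_not.1 hcon
    rw [cellsOf_markPattern]
    exact (hω _ hG fun i => limit_closeToGrid hz hμ hy hm0 (Nat.cast_nonneg _)
      (hG.cells i)).trans hme

/-- For every `ε` the grid can be chosen good up to probability `ε`, and on a good grid the paths
are càdlàg by `limitCluster_isCadlag`. Only the `cells` part of `GoodState` is used, so `κ` and `n₀`
are arbitrary here. -/
lemma IsLFFP.isCadlag_limitCluster {z₀ : ℝ} (hz : z₀ ∈ Icc (0 : ℝ) 1)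
    {Ω' : Type*} [MeasurableSpace Ω'] {P' : Measure Ω'} [IsProbabilityMeasure P']
    {M : Ω' → Measure (ℝ × ℝ)} {Y : ℝ≥0 → ℝ → Ω' → ℝ} (hY : IsLFFP z₀ M Y P') (T : ℝ) {q : ℕ}
    (x : Fin q → ℝ) :
    ∀ᵐ ω ∂P', ∀ i, IsCadlag (fun t : Icc (0 : ℝ) T =>
      limitCluster (fun s u => Y s u ω) t (x i)) := by
  obtain ⟨hM, -, hYae⟩ := hY
  obtain ⟨T', hT'⟩ := exists_nat_gt (max T 2)
  have hT2 : 2 ≤ T' := by exact_mod_cast (le_max_right T 2).trans hT'.le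
  rw [ae_iff, ← nonpos_iff_eq_zero]
  refine ENNReal.le_of_forall_pos_le_add fun ε hε _ => ?_
  obtain ⟨A, -, hgood⟩ := exists_goodState hM hz x (fun _ _ => 0) tendsto_id hT2
    (NNReal.coe_pos.2 hε)
  obtain ⟨m, hm, hm0⟩ := (hgood.and (eventually_gt_atTop 0)).exists
  rw [ENNReal.ofReal_coe_nnreal] at hm
  rw [zero_add]
  refine (measure_mono_ae ?_).trans hm
  filter_upwards [hYae, goodMarks_ae hM z₀] with ω hy hμ hlt hG
  have hm' : (0 : ℝ) < m := by exact_mod_cast hm0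
  refine hlt fun i => limitCluster_isCadlag hz hμ hy hm0 (J := T' * m) ?_ (hG.cells i)
  push_cast
  exact mul_lt_mul_of_pos_right ((le_max_left T 2).trans_lt hT') hm'

end ForestFire

end

/-! ### The three assertions -/

theorem mainTheorem2
    (z₀ : ℝ) (hz₀ : z₀ ∈ Set.Icc (0 : ℝ) 1)
    {Ω : ForestFire.Params → Type*} [∀ p, MeasurableSpace (Ω p)]
    (P : ∀ p, Measure (Ω p)) [∀ p, IsProbabilityMeasure (P p)]
    (η : ∀ p, ℝ≥0 → ℤ → Ω p → Fin 3)
    (hη : ∀ p, ForestFire.IsForestFireProcess p.lam p.pi (η p) (P p))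
    {Ω' : Type*} [MeasurableSpace Ω'] (P' : Measure Ω') [IsProbabilityMeasure P']
    (M : Ω' → Measure (ℝ × ℝ)) (Y : ℝ≥0 → ℝ → Ω' → ℝ)
    (hY : ForestFire.IsLFFP z₀ M Y P') :
    (∀ (T : ℝ), 0 < T → ∀ (q : ℕ) (x : Fin q → ℝ),
      (∀ p, ∀ᵐ ω ∂(P p), ∀ i, ForestFire.IsCadlag (fun t : Set.Icc (0 : ℝ) T =>
        ForestFire.rescaledCluster p.lam (fun s k => η p s k ω) t (x i))) ∧
      (∀ᵐ ω ∂P', ∀ i, ForestFire.IsCadlag (fun t : Set.Icc (0 : ℝ) T =>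
        ForestFire.limitCluster (fun s u => Y s u ω) t (x i))) ∧
      TendstoInDistribution
        (fun p ω => ForestFire.toPathTuple T x (fun i t =>
          ForestFire.rescaledCluster p.lam (fun s k => η p s k ω) t (x i)))
        (ForestFire.slowRegime z₀)
        (fun ω => ForestFire.toPathTuple T x (fun i t =>
          ForestFire.limitCluster (fun s u => Y s u ω) t (x i)))
        P P') ∧
    (∀ (q : ℕ) (x t : Fin q → ℝ), (∀ i, 0 ≤ t i) →
      TendstoInDistribution
        (E := ForestFire.ClusterTuple x)
        (fun p ω i => ForestFire.rescaledCluster p.lam (fun s k => η p s k ω) (t i) (x i))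
        (ForestFire.slowRegime z₀)
        (fun ω i => ForestFire.limitCluster (fun s u => Y s u ω) (t i) (x i))
        P P') ∧
    (∀ᵐ ω ∂P', ∀ (x : ℝ) (s : ℝ≥0), M ω {(x, (s : ℝ))} ≠ 0 →
      ((s : ℝ) < z₀ → ∀ t, 0 < Y t x ω ↔ s ≤ t ∧ t < 2 * s) ∧
      (z₀ < s → ∀ t, 0 < Y t x ω ↔ s ≤ t)) := by
  choose n hn using fun p => (hη p).exists_isDriven
  refine ⟨fun T hT q x => ?_, fun q x t ht => ?_, ?_⟩
  · have hX := fun p => (hn p).isCadlag_rescaledCluster x (ForestFire.aScale_pos p) T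
    have hZ := hY.isCadlag_limitCluster hz₀ T x
    refine ⟨hX, hZ, ?_⟩
    obtain ⟨T', hT'⟩ := exists_nat_gt (max T 2)
    have hT2 : 2 ≤ T' := by exact_mod_cast (le_max_right T 2).trans hT'.le
    -- The allowed number `√m` of hit cells tends to infinity, so that exceeding it is unlikely,
    -- while these cells occupy a total time of order `√m / m → 0`.
    have hsqrt : Tendsto Nat.sqrt atTop atTop := tendsto_atTop.2 fun b => by
      filter_upwards [eventually_ge_atTop (b * b)] with m hm using Nat.le_sqrt.2 hm
    refine ForestFire.tendstoInDistribution_of_grid hz₀ hn hY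
      (fun p => (hn p).aemeasurable_pathTuple x (ForestFire.aScale_pos p) hT.le) x (fun _ _ => 0)
      hsqrt hT2
      (fun m V => ForestFire.toPathTuple T x fun i t => ForestFire.gridPath z₀ m V (x i) t)
      (e := fun A m => q * (20 / m * T + 4 * ((A * m : ℕ) : ℤ) / m * ((Nat.sqrt m + 1) / m)))
      (fun A => ?_) fun A => ?_
    · have h1 := tendsto_const_div_atTop_nhds_zero_nat (20 : ℝ)
      have h2 := tendsto_const_div_atTop_nhds_zero_nat (1 : ℝ)
      have h3 : Tendsto (fun m : ℕ => (Nat.sqrt m : ℝ) / m) atTop (𝓝 0) := by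
        refine squeeze_zero' (Eventually.of_forall fun m => by positivity) ?_
          (h2.comp hsqrt)
        filter_upwards [eventually_gt_atTop 0] with m hm
        have h4 : (0 : ℝ) < Nat.sqrt m := by exact_mod_cast Nat.sqrt_pos.2 hm
        have h5 : (Nat.sqrt m : ℝ) * Nat.sqrt m ≤ m := by exact_mod_cast Nat.sqrt_le m
        rw [Function.comp_apply, div_le_div_iff₀ (by exact_mod_cast hm) h4, one_mul]
        exact h5
      have h4 := ((h1.mul_const T).add ((h3.add h2).const_mul (4 * (A : ℝ)))).const_mul (q : ℝ)
      simp only [zero_mul, add_zero, mul_zero] at h4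
      refine h4.congr' ?_
      filter_upwards [eventually_gt_atTop 0] with m hm
      have hm' : (m : ℝ) ≠ 0 := by exact_mod_cast hm.ne'
      push_cast
      field_simp
    · filter_upwards [eventually_gt_atTop 0] with m hm
      have hJ : T * m < (T' * m : ℕ) := by
        push_cast
        exact mul_lt_mul_of_pos_right ((le_max_left T 2).trans_lt hT') (by exact_mod_cast hm)
      constructor
      · intro p
        filter_upwards [hX p] with ω hω V hG hV
        exact ForestFire.dist_toPathTuple_gridPath_le hT.le hV hG.cells hm (Nat.cast_nonneg _) hJ
          hω hG.few
      · filter_upwards [hZ] with ω hω V hG hV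
        exact ForestFire.dist_toPathTuple_gridPath_le hT.le hV hG.cells hm (Nat.cast_nonneg _) hJ
          hω hG.few
  · obtain ⟨T', hT'⟩ := exists_nat_gt (max (∑ i, t i) 2)
    have hT2 : 2 ≤ T' := by exact_mod_cast (le_max_right (∑ i, t i) 2).trans hT'.le
    have htT : ∀ i, t i < T' := fun i =>
      (Finset.single_le_sum (fun j _ => ht j) (Finset.mem_univ i)).trans_lt
        ((le_max_left _ _).trans_lt hT')
    -- At fixed times only the cells of the `t i` must not be hit; the number of hit cells is
    -- irrelevant, so `n₀` is the identity.
    refine ForestFire.tendstoInDistribution_of_grid (E := ForestFire.ClusterTuple x) hz₀ hn hY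
      (fun p => (hn p).aemeasurable_clusterTuple x t) x (fun m i => ⌊t i * m⌋₊)
      tendsto_id hT2 (fun m V i => ForestFire.gridPath z₀ m V (x i) (t i))
      (e := fun _ m => q * (20 / m)) (fun A => ?_) fun A => ?_
    · have := (tendsto_const_div_atTop_nhds_zero_nat (20 : ℝ)).const_mul (q : ℝ)
      rwa [mul_zero] at this
    -- The uncertain cell just before time `1` is avoided: for `t i < 1` it lies after `t i` once `m
    -- > 1 / (1 - t i)`, and for `t i ≥ 1` it is already past.
    · have h1 : ∀ᶠ m : ℕ in atTop, ∀ i, ⌊t i * m⌋₊ + 1 ≠ m := by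
        refine eventually_all.2 fun i => ?_
        rcases lt_or_ge (t i) 1 with h | h
        · filter_upwards [(tendsto_natCast_atTop_atTop (R := ℝ)).eventually_gt_atTop
            (1 / (1 - t i))] with m hm he
          have h2 : (⌊t i * m⌋₊ : ℝ) ≤ t i * m :=
            Nat.floor_le (mul_nonneg (ht i) (Nat.cast_nonneg m))
          have h3 : (⌊t i * m⌋₊ : ℝ) + 1 = m := by exact_mod_cast he
          rw [div_lt_iff₀ (by linarith)] at hm
          linarith
        · refine Eventually.of_forall fun m he => ?_
          have h2 : m ≤ ⌊t i * m⌋₊ := Nat.le_floor (le_mul_of_one_le_left (Nat.cast_nonneg m) h)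
          omega
      filter_upwards [eventually_gt_atTop 0, h1] with m hm h1
      have hJ : ∀ i, ⌊t i * m⌋₊ < T' * m := fun i => by
        rw [Nat.floor_lt (mul_nonneg (ht i) (Nat.cast_nonneg m))]
        push_cast
        exact mul_lt_mul_of_pos_right (htT i) (by exact_mod_cast hm)
      exact ⟨fun p => Eventually.of_forall fun ω V hG hV =>
          ForestFire.dist_clusterTuple_gridPath_le (X := fun i s =>
            ForestFire.rescaledCluster p.lam (fun s k => η p s k ω) s (x i)) hV hm ht hJ h1
            hG.not_hit,
        Eventually.of_forall fun ω V hG hV =>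
          ForestFire.dist_clusterTuple_gridPath_le (X := fun i s =>
            ForestFire.limitCluster (fun s u => Y s u ω) s (x i)) hV hm ht hJ h1 hG.not_hit⟩
  · obtain ⟨hM, -, hYae⟩ := hY
    filter_upwards [hYae, ForestFire.goodMarks_ae hM z₀] with ω hy hμ x s hs
    exact ForestFire.LimitEquation.pos_iff_of_mark hz₀ hμ hy hs
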